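/- Let $\mathcal F$ be a proper minor-closed family of finite simple graphs: every minor of a member of $\mathcal F$ is in $\mathcal F$, and some finite graph is not in $\mathcal F$. There is a constant $\Delta$, depending only on $\mathcal F$, such that the following holds for every graph $G\in\mathcal F$ with $n\ge 1$ vertices. **The hierarchy.** Let $G_0=G$. Given $G_{i-1}$, let $Q_i$ be the set of its vertices of degree at least $\Delta$, and call $u,v\in V(G_{i-1})\setminus Q_i$ equivalent if $N(u)\cap Q_i=N(v)\cap Q_i$ (neighborhoods in $G_{i-1}$). The vertices of $G_i$ are the members of $Q_i$ and one supervertex for each equivalence class; its edges are the edges of $G_{i-1}$ inside $Q_i$, and an edge from a supervertex to $h\in Q_i$ whenever some vertex of its class is adjacent to $h$ in $G_{i-1}$. A supervertex of $G_i$ whose class contains a supervertex of $G_{i-1}$ of the same degree is identified with it. The sequence ends with the first $G_i$ that consists of a single supervertex $z$ of degree zero (and such an $i$ exists). The level of a vertex or supervertex $x$ is the largest $i$ with $x\in V(G_i)$. **The data structure.** For a set $S\subseteq V(G)$, the data structure stores $G$, $S$, a record for each vertex and supervertex of the graphs $G_i$, and: * for each vertex or supervertex $x\ne z$ of level $i$,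 a pointer $\mathrm{sv}(x)$ to the supervertex of $G_{i+1}$ that corresponds to the equivalence class of $x$; * for each vertex or supervertex $x$ of level $i$, the number $\mathrm{nadj}(x)$ of adjacent original vertices of $G$ that belong to $S$ and have level at most $i$; * for each vertex $v$ of $G$, of level $i$, a list $\mathrm{nbr}(v)$ of the vertices and supervertices adjacent to $v$ in $G_i$; * for each vertex or supervertex a number $\mathrm{undom}$: for a vertex $v$ of $G$ it is $0$ if $v\in S$ and $1$ if $v\notin S$, and for a supervertex $x$ it is $$\mathrm{undom}(x)=\sum_{w:\ \mathrm{sv}(w)=x,\ \mathrm{nadj}(w)=0}\mathrm{undom}(w).$$ **Claim.** On a unit-cost random access machine whose words hold $O(\log n)$ bits (numbers less than $Cn$, for a constant $C$), with programs that depend only on $\mathcal F$, this data structure takes $O(n)$ words of space; it can be constructed in $O(n)$ time and space from the adjacency lists of $G$ and the indicator array of an initial set $S$; a vertex can be inserted into $S$ or deleted from $S$ in $O(1)$ time, after which the memory holds the data structure for the new set; and the number of vertices of $G$ that are not dominated by $S$ (neither in $S$ nor adjacent to a vertex of $S$) can be queried in $O(1)$ time. These bounds hold throughout every sequence of updates and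 queries, and all constants depend only on $\mathcal F$, not on $G$. -/

import Mathlib

namespace DynDom

/-! ### Minors and minor-closed families -/

/-- `H` is a minor of `G`: there are pairwise disjoint connected (hence nonempty) branch sets
`β w ⊆ V(G)`, one for each vertex `w` of `H`, such that adjacent vertices of `H` have branch sets
joined by an edge of `G`. -/
def IsMinor {W V : Type*} (H : SimpleGraph W) (G : SimpleGraph V) : Prop :=
  ∃ β : W → Set V,
    (∀ w, (G.induce (β w)).Connected) ∧
    (∀ w w', w ≠ w' → Disjoint (β w) (β w')) ∧
    (∀ w w', H.Adj w w' → ∃ x ∈ β w, ∃ y ∈ β w', G.Adj x y)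

/-- A family of finite graphs: for every `n`, a set of graphs with vertex set `{0, …, n - 1}`. -/
abbrev GraphFamily : Type := (n : ℕ) → Set (SimpleGraph (Fin n))

/-- Every minor of a member is a member (in particular the family is closed under
isomorphism). -/
def MinorClosed (F : GraphFamily) : Prop :=
  ∀ (m n : ℕ) (H : SimpleGraph (Fin m)) (G : SimpleGraph (Fin n)),
    G ∈ F n → IsMinor H G → H ∈ F m

/-- Some finite graph is not in the family. -/
def Proper (F : GraphFamily) : Prop :=
  ∃ (n : ℕ) (G : SimpleGraph (Fin n)), G ∉ F n

/-- The vertices not dominated by `S`: those neither in `S` nor adjacent to a vertex of `S`. -/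
noncomputable def undominated {n : ℕ} (G : SimpleGraph (Fin n)) (S : Finset (Fin n)) :
    Finset (Fin n) := by
  classical exact Finset.univ.filter fun v => v ∉ S ∧ ∀ u ∈ S, ¬ G.Adj v u

/-! ### The hierarchy of graphs `G₀ = G, G₁, G₂, …` -/

/-- A vertex of one of the graphs `Gᵢ`: `Sum.inl v` is the original vertex `v` of `G`, and
`Sum.inr A` is the supervertex whose set of neighbours is `A`.

Distinct supervertices of the same `Gᵢ` have distinct sets of neighbours, and these consist of
original vertices (`adj_super_iff` and `high_original` below). A supervertex of `Gᵢ₊₁` that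
contains a supervertex of `Gᵢ` and has the same degree has the same set of neighbours, and then the
two count as the same supervertex. Hence a supervertex is named by its set of neighbours. -/
abbrev Node (n : ℕ) : Type := Fin n ⊕ Finset (Fin n)

/-- The supervertex of degree zero. -/
def zeroNode (n : ℕ) : Node n := Sum.inr ∅

/-- One graph of the hierarchy: a finite vertex set and the adjacency relation. -/
structure Layer (n : ℕ) where
  verts : Finset (Node n)
  graph : SimpleGraph (Node n)

namespace Layer

variable {n : ℕ}

/-- The neighbours of `x`. -/
noncomputable def nbrs (L : Layer n) (x : Node n) : Finset (Node n) := by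
  classical exact L.verts.filter fun y => L.graph.Adj x y

/-- The set `Q` of the vertices of degree at least `Δ`. -/
noncomputable def high (Δ : ℕ) (L : Layer n) : Finset (Node n) :=
  L.verts.filter fun x => Δ ≤ (L.nbrs x).card

/-- `N(x) ∩ Q`, as a set of original vertices. Two vertices `x, y` outside `Q` are equivalent when
`trace Δ L x = trace Δ L y`. -/
noncomputable def trace (Δ : ℕ) (L : Layer n) (x : Node n) : Finset (Fin n) := by
  classical exact Finset.univ.filter fun h => Sum.inl h ∈ L.high Δ ∧ L.graph.Adj x (Sum.inl h)

/-- The next graph: its vertices are the members of `Q` and one supervertex for every equivalence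
class of vertices outside `Q`. Its edges are the edges inside `Q`, and an edge from a supervertex
to `y ∈ Q` whenever some vertex of the corresponding class is adjacent to `y`. -/
noncomputable def next (Δ : ℕ) (L : Layer n) : Layer n where
  verts := L.high Δ ∪ (L.verts \ L.high Δ).image fun u => Sum.inr (L.trace Δ u)
  graph := SimpleGraph.fromRel fun x y =>
    (x ∈ L.high Δ ∧ y ∈ L.high Δ ∧ L.graph.Adj x y) ∨
    (y ∈ L.high Δ ∧ ∃ u ∈ L.verts \ L.high Δ, x = Sum.inr (L.trace Δ u) ∧ L.graph.Adj u y)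

end Layer

section Hierarchy

variable {n : ℕ} (Δ : ℕ) (G : SimpleGraph (Fin n))

/-- The graph `Gᵢ`. -/
noncomputable def layer : ℕ → Layer n
  | 0 => ⟨Finset.univ.map Function.Embedding.inl, G.map Function.Embedding.inl⟩
  | i + 1 => (layer i).next Δ

/-- The index of the last graph: the first one that consists of the supervertex of degree zero
alone. (The value is junk if there is none.) -/
noncomputable def height : ℕ :=
  sInf {i | (layer Δ G i).verts = {zeroNode n}}

/-- All vertices and supervertices of all the graphs `G₀, …, G_height`. -/
noncomputable def nodes : Finset (Node n) :=
  (Finset.range (height Δ G + 1)).biUnion fun i => (layer Δ G i).verts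

/-- The level of `x`: the largest `i` with `x ∈ V(Gᵢ)`. -/
noncomputable def level (x : Node n) : ℕ := by
  classical exact Nat.findGreatest (fun i => x ∈ (layer Δ G i).verts) (height Δ G)

/-- For `x` of level `i`, the supervertex corresponding to the equivalence class of `x` in
`Gᵢ₊₁`. It is used for `x` other than the supervertex of degree zero only. -/
noncomputable def sv (x : Node n) : Node n :=
  Sum.inr ((layer Δ G (level Δ G x)).trace Δ x)

/-- For `x` of level `i`, the number of original vertices that are adjacent to `x` (in one of the
graphs of the hierarchy), belong to `S`, and have level at most `i`. -/
noncomputable def nadj (S : Finset (Fin n)) (x : Node n) : ℕ := by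
  classical exact (S.filter fun u =>
    level Δ G (Sum.inl u) ≤ level Δ G x ∧
      ∃ j ≤ height Δ G, (layer Δ G j).graph.Adj x (Sum.inl u)).card

/-- For an original vertex `v` of level `i`, the vertices and supervertices adjacent to `v` in
`Gᵢ`. -/
noncomputable def nbr (v : Fin n) : Finset (Node n) :=
  (layer Δ G (level Δ G (Sum.inl v))).nbrs (Sum.inl v)

/-- The equations that define the numbers `undom(x)`. -/
def IsUndom (S : Finset (Fin n)) (undom : Node n → ℕ) : Prop :=
  (∀ v : Fin n, undom (Sum.inl v) = if v ∈ S then 0 else 1) ∧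
  (∀ A : Finset (Fin n), Sum.inr A ∈ nodes Δ G →
    undom (Sum.inr A) =
      ∑ w ∈ (nodes Δ G).filter
        (fun w => w ≠ zeroNode n ∧ sv Δ G w = Sum.inr A ∧ nadj Δ G S w = 0), undom w)

/-! Two facts that justify naming supervertices by their sets of neighbours. -/

theorem layer_aux (i : ℕ) (A : Finset (Fin n)) (hA : Sum.inr A ∈ (layer Δ G i).verts) :
    (∀ y, (layer Δ G i).graph.Adj (Sum.inr A) y ↔ ∃ h ∈ A, y = Sum.inl h) ∧ A.card < Δ := by
  classical
  induction i generalizing A with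
  | zero => simp [layer] at hA
  | succ i ih =>
    have hQ : ∀ B : Finset (Fin n), Sum.inr B ∉ (layer Δ G i).high Δ := by
      intro B hB
      simp only [Layer.high, Finset.mem_filter] at hB
      obtain ⟨h1, h2⟩ := ih B hB.1
      have h3 : (layer Δ G i).nbrs (Sum.inr B) ⊆ B.image Sum.inl := by
        intro y hy
        simp only [Layer.nbrs, Finset.mem_filter] at hy
        obtain ⟨h, hh, rfl⟩ := (h1 y).1 hy.2
        exact Finset.mem_image_of_mem _ hh
      have h4 := (Finset.card_le_card h3).trans Finset.card_image_le
      omega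
    simp only [layer, Layer.next, Finset.mem_union, hQ, false_or, Finset.mem_image] at hA
    obtain ⟨u, hu, hA⟩ := hA
    have hA' : (layer Δ G i).trace Δ u = A := Sum.inr_injective hA
    constructor
    · intro y
      simp only [layer, Layer.next, SimpleGraph.fromRel_adj, hQ, false_and, and_false, false_or,
        or_false, Sum.inr.injEq]
      constructor
      · rintro ⟨-, hy, w, -, rfl, hadj⟩
        rcases y with h | B
        · exact ⟨h, by simp [Layer.trace, hy, hadj], rfl⟩
        · exact absurd hy (hQ B)
      · rintro ⟨h, hh, rfl⟩
        have hh' := hh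
        rw [← hA'] at hh'
        simp only [Layer.trace, Finset.mem_filter, Finset.mem_univ, true_and] at hh'
        exact ⟨by simp, hh'.1, u, hu, hA'.symm, hh'.2⟩
    · have h1 : A.image Sum.inl ⊆ (layer Δ G i).nbrs u := by
        intro y hy
        obtain ⟨h, hh, rfl⟩ := Finset.mem_image.1 hy
        rw [← hA'] at hh
        simp only [Layer.trace, Finset.mem_filter, Finset.mem_univ, true_and] at hh
        simp only [Layer.nbrs, Finset.mem_filter]
        exact ⟨(Finset.mem_filter.1 hh.1).1, hh.2⟩
      have h2 := Finset.card_le_card h1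
      rw [Finset.card_image_of_injective _ Sum.inl_injective] at h2
      simp only [Layer.high, Finset.mem_sdiff, Finset.mem_filter, not_and, not_le] at hu
      exact h2.trans_lt (hu.2 hu.1)

/-- The neighbours of the supervertex named `A` are exactly the members of `A`. -/
theorem adj_super_iff (i : ℕ) (A : Finset (Fin n)) (hA : Sum.inr A ∈ (layer Δ G i).verts)
    (y : Node n) :
    (layer Δ G i).graph.Adj (Sum.inr A) y ↔ ∃ h ∈ A, y = Sum.inl h :=
  (layer_aux Δ G i A hA).1 y

/-- Vertices of degree at least `Δ` are original vertices. -/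
theorem high_original (i : ℕ) (x : Node n) (hx : x ∈ (layer Δ G i).high Δ) :
    ∃ v : Fin n, x = Sum.inl v := by
  classical
  rcases x with v | A
  · exact ⟨v, rfl⟩
  · exfalso
    simp only [Layer.high, Finset.mem_filter] at hx
    obtain ⟨h1, h2⟩ := layer_aux Δ G i A hx.1
    have h3 : (layer Δ G i).nbrs (Sum.inr A) ⊆ A.image Sum.inl := by
      intro y hy
      simp only [Layer.nbrs, Finset.mem_filter] at hy
      obtain ⟨h, hh, rfl⟩ := (h1 y).1 hy.2
      exact Finset.mem_image_of_mem _ hh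
    have h4 := (Finset.card_le_card h3).trans Finset.card_image_le
    omega

end Hierarchy

/-! ### A random access machine with unit costs and bounded words -/

/-- The state of the machine: registers and memory cells, all holding natural numbers. A program
mentions finitely many registers. -/
structure State where
  reg : ℕ → ℕ
  mem : ℕ → ℕ

/-- Write `x` to register `d`. -/
def State.setReg (s : State) (d x : ℕ) : State :=
  { s with reg := Function.update s.reg d x }

/-- Write `x` to memory cell `a`. -/
def State.setMem (s : State) (a x : ℕ) : State :=
  { s with mem := Function.update s.mem a x }

/-- Programs. The arguments `d, a, b` are numbers of registers, and `c` is a constant.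
* `const d c`: put `c` into register `d`;
* `move d a`: copy register `a` to register `d`;
* `add d a b`, `sub d a b`: put the sum (the truncated difference) of registers `a` and `b` into
  register `d`;
* `load d a`: put the memory cell whose address is in register `a` into register `d`;
* `store a b`: put register `b` into the memory cell whose address is in register `a`;
* `ite a b p q`, `loop a b p`: branch, resp. repeat while, register `a` is less than
  register `b`. -/
inductive Prog : Type
  | skip : Prog
  | const (d c : ℕ) : Prog
  | move (d a : ℕ) : Prog
  | add (d a b : ℕ) : Prog
  | sub (d a b : ℕ) : Prog
  | load (d a : ℕ) : Prog
  | store (a b : ℕ) : Prog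
  | seq (p q : Prog) : Prog
  | ite (a b : ℕ) (p q : Prog) : Prog
  | loop (a b : ℕ) (p : Prog) : Prog

/-- `Exec B p s t s'`: on the machine that has `B` memory cells (with addresses `0, …, B - 1`) and
whose words are the numbers less than `B`, the program `p`, started in the state `s`, halts after
exactly `t` steps in the state `s'`. Every elementary instruction and every test of a condition is
one step. There is no execution that accesses an address, or writes a number, that is not less
than `B`. -/
inductive Exec (B : ℕ) : Prog → State → ℕ → State → Prop
  | skip (s : State) : Exec B .skip s 1 s
  | const (s : State) (d c : ℕ) (h : c < B) : Exec B (.const d c) s 1 (s.setReg d c)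
  | move (s : State) (d a : ℕ) (h : s.reg a < B) :
      Exec B (.move d a) s 1 (s.setReg d (s.reg a))
  | add (s : State) (d a b : ℕ) (h : s.reg a + s.reg b < B) :
      Exec B (.add d a b) s 1 (s.setReg d (s.reg a + s.reg b))
  | sub (s : State) (d a b : ℕ) (h : s.reg a - s.reg b < B) :
      Exec B (.sub d a b) s 1 (s.setReg d (s.reg a - s.reg b))
  | load (s : State) (d a : ℕ) (h : s.reg a < B) (h' : s.mem (s.reg a) < B) :
      Exec B (.load d a) s 1 (s.setReg d (s.mem (s.reg a)))
  | store (s : State) (a b : ℕ) (h : s.reg a < B) (h' : s.reg b < B) :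
      Exec B (.store a b) s 1 (s.setMem (s.reg a) (s.reg b))
  | seq {p q : Prog} {s s' s'' : State} {t t' : ℕ} (h : Exec B p s t s')
      (h' : Exec B q s' t' s'') : Exec B (.seq p q) s (t + t') s''
  | ite_true {a b : ℕ} {p q : Prog} {s s' : State} {t : ℕ} (hc : s.reg a < s.reg b)
      (h : Exec B p s t s') : Exec B (.ite a b p q) s (t + 1) s'
  | ite_false {a b : ℕ} {p q : Prog} {s s' : State} {t : ℕ} (hc : ¬ s.reg a < s.reg b)
      (h : Exec B q s t s') : Exec B (.ite a b p q) s (t + 1) s'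
  | loop_true {a b : ℕ} {p : Prog} {s s' s'' : State} {t t' : ℕ} (hc : s.reg a < s.reg b)
      (h : Exec B p s t s') (h' : Exec B (.loop a b p) s' t' s'') :
      Exec B (.loop a b p) s (t + t' + 1) s''
  | loop_false {a b : ℕ} {p : Prog} {s : State} (hc : ¬ s.reg a < s.reg b) :
      Exec B (.loop a b p) s 1 s

/-- From the state `s`, the program `p` halts within `T` steps in a state that satisfies `P`. -/
def RunsTo (B : ℕ) (p : Prog) (s : State) (T : ℕ) (P : State → Prop) : Prop :=
  ∃ (t : ℕ) (s' : State), t ≤ T ∧ Exec B p s t s' ∧ P s'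

/-! ### The contents of the memory -/

/-- The memory holds the graph `G` (as arrays of neighbours) and the set `S`:
* cell `0` holds `n`;
* cells `1, …, n` hold the indicator function of `S`;
* cells `n + 1, …, 2 * n + 1` hold offsets, the first of which is `2 * n + 2`; the cells from the
  offset of `v` up to the following offset hold the neighbours of `v`, each once, in any order.

Nothing is required of the other cells. -/
def Encodes {n : ℕ} (G : SimpleGraph (Fin n)) (S : Finset (Fin n)) (mem : ℕ → ℕ) : Prop :=
  mem 0 = n ∧
  (∀ v : Fin n, mem (1 + v) = if v ∈ S then 1 else 0) ∧
  mem (n + 1) = 2 * n + 2 ∧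
  ∃ adj : Fin n → List (Fin n),
    (∀ v, (adj v).Nodup ∧ ∀ u, u ∈ adj v ↔ G.Adj v u) ∧
    (∀ v : Fin n, mem (n + 2 + v) = mem (n + 1 + v) + (adj v).length) ∧
    (∀ (v : Fin n) (k : ℕ) (hk : k < (adj v).length),
      mem (mem (n + 1 + v) + k) = ((adj v)[k] : Fin n))

/-- The first `B` cells of the memory hold the supervertex data structure for the graph `G` and the
set `S`. Every vertex and every supervertex `x` has a record of five cells at address `ptr x`:
the pointer to the record of `sv x` (not for the supervertex of degree zero), the number `nadj x`,
the number `undom x` and, for original vertices, the address and the length of an array of pointers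
to the records of the members of `nbr x`. The records, the arrays and the cells that hold `G` and
`S` are disjoint. -/
def Stores {n : ℕ} (Δ : ℕ) (G : SimpleGraph (Fin n)) (S : Finset (Fin n)) (B : ℕ)
    (mem : ℕ → ℕ) : Prop :=
  Encodes G S mem ∧
  ∃ (ptr : Node n → ℕ) (start : Fin n → ℕ) (list : Fin n → List (Node n)),
    (∀ x ∈ nodes Δ G, x ≠ zeroNode n → mem (ptr x) = ptr (sv Δ G x)) ∧
    (∀ x ∈ nodes Δ G, mem (ptr x + 1) = nadj Δ G S x) ∧
    IsUndom Δ G S (fun x => mem (ptr x + 2)) ∧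
    (∀ v : Fin n, (list v).Nodup ∧ (∀ y, y ∈ list v ↔ y ∈ nbr Δ G v) ∧
      mem (ptr (Sum.inl v) + 3) = start v ∧
      mem (ptr (Sum.inl v) + 4) = (list v).length ∧
      ∀ (k : ℕ) (hk : k < (list v).length), mem (start v + k) = ptr ((list v)[k])) ∧
    -- the records and the arrays lie behind the encoding of `G` and `S`, within the `B` cells
    (∀ x ∈ nodes Δ G, mem (2 * n + 1) ≤ ptr x ∧ ptr x + 5 ≤ B) ∧
    (∀ v : Fin n, mem (2 * n + 1) ≤ start v ∧ start v + (list v).length ≤ B) ∧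
    -- they do not overlap
    (∀ x ∈ nodes Δ G, ∀ y ∈ nodes Δ G, x ≠ y →
      Disjoint (Finset.Ico (ptr x) (ptr x + 5)) (Finset.Ico (ptr y) (ptr y + 5))) ∧
    (∀ u v : Fin n, u ≠ v →
      Disjoint (Finset.Ico (start u) (start u + (list u).length))
        (Finset.Ico (start v) (start v + (list v).length))) ∧
    (∀ x ∈ nodes Δ G, ∀ v : Fin n,
      Disjoint (Finset.Ico (ptr x) (ptr x + 5))
        (Finset.Ico (start v) (start v + (list v).length)))

end DynDom

open DynDom

/-!
# A dynamic data structure for dominated vertices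

**The hierarchy.** Write `Oᵢ = orig Δ G i` for the set of the original vertices in `Gᵢ`. The
hierarchy has a closed form: the supervertices of `Gᵢ` are the sets `N(w) ∩ Oᵢ` for the vertices
`w ∉ Oᵢ` (`inr_mem_verts`), and adjacency to a vertex of `Oᵢ` is adjacency in `G`, resp. membership
(`adj_inl_iff`). In a graph without a complete minor `K_t`, every graph on a set `O` that arises by
contractions has linearly many edges (`adjPairs_le_of_not_isMinor_top`), and there are only linearly
many distinct neighbourhoods in `O` of vertices outside `O`: contract as many of these vertices as
possible so that each of them adds a new edge on `O`; the neighbourhoods of the remaining ones are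
cliques of the resulting sparse graph, which has linearly many cliques (`card_neighborhoods_le`).
Hence the degrees of the original vertices of `Gᵢ` add up to at most `D * |Oᵢ|`, where `D` depends
on the family only (`sum_card_nbrs_le`). With `Δ = 2 * D + 1`, the sets `Oᵢ` shrink by a factor of
two (`Sparse.two_mul_card_orig_succ_le`): the hierarchy ends, and it has linear total size.

**Updates and queries.** The pointer of a supervertex leads to one of smaller degree
(`Sparse.rank_sv_lt`), so a path along pointers has at most `Δ` steps. The equations of `undom` say
that `undom x` counts the vertices outside `S` that reach `x` along pointers from nodes with
`nadj = 0` (`Undom.eq_card`), and a vertex outside `S` reaches the supervertex of degree zero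
exactly if none of its neighbours is in `S` (`reach_zeroNode_iff`). So a query reads one number. To
insert or delete a vertex, one changes its own number `undom` and the numbers `nadj` of the fewer
than `Δ` nodes in its list; each of these changes breaks the equations of `undom` at a single node,
and `UndomUpTo.step` moves the defect along the pointers until it disappears.

**Construction.** The graph `Gᵢ₊₁` is made from `Gᵢ` in time proportional to `|Oᵢ|`
(`levelStep_spec`). The vertices of low degree are divided into classes by partition refinement:
for each vertex `h` of high degree in turn, every class that meets `N(h)` is split (`refine_spec`).
A new class gets a new record; if it turns out that it contains a supervertex of the same degree,
it is forwarded to the record of this supervertex (`matchSupers_spec`). Then the pointers are set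
and the lists of neighbours of the vertices of high degree are overwritten in place
(`linkSupers_spec`, `rebuild_spec`). When the hierarchy is complete, the numbers are those for the
set of all vertices at first, which is easy as all numbers `undom` of vertices vanish, and the
vertices outside the given set are deleted one by one (`finish_spec`).

Running times are bounded by means of weakest preconditions for programs without loops (`Prog.wp`)
and a rule for counted loops (`RunsTo.for`).
-/

namespace DynDom

/-! ### Minors -/

section Minors

universe u

theorem induce_connected_of_star {V : Type*} {G : SimpleGraph V} {s : Set V} (q : V) (hq : q ∈ s)
    (h : ∀ x ∈ s, x = q ∨ G.Adj q x) : (G.induce s).Connected := by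
  rw [SimpleGraph.connected_iff_exists_forall_reachable]
  refine ⟨⟨q, hq⟩, fun ⟨x, hx⟩ => ?_⟩
  rcases h x hx with rfl | h
  · exact SimpleGraph.Reachable.refl _
  · exact SimpleGraph.Adj.reachable (by simpa using h)

/-- A walk in `G` between members of `s` lifts to the union of the branch sets in `K`. -/
theorem reachable_induce_biUnion {W V : Type*} {G : SimpleGraph W} {K : SimpleGraph V}
    {γ : W → Set V} (hγ : ∀ w, (K.induce (γ w)).Connected)
    (hadj : ∀ w w', G.Adj w w' → ∃ x ∈ γ w, ∃ y ∈ γ w', K.Adj x y) {s : Set W} {x y : s}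
    (p : (G.induce s).Walk x y) :
    ∀ a (ha : a ∈ ⋃ w ∈ s, γ w) b (hb : b ∈ ⋃ w ∈ s, γ w), a ∈ γ x → b ∈ γ y →
      (K.induce (⋃ w ∈ s, γ w)).Reachable ⟨a, ha⟩ ⟨b, hb⟩ := by
  have key : ∀ (x : s) a (ha : a ∈ ⋃ w ∈ s, γ w) b (hb : b ∈ ⋃ w ∈ s, γ w),
      a ∈ γ x → b ∈ γ x → (K.induce (⋃ w ∈ s, γ w)).Reachable ⟨a, ha⟩ ⟨b, hb⟩ := by
    intro x a ha b hb hax hbx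
    have h1 := (hγ x).preconnected ⟨a, hax⟩ ⟨b, hbx⟩
    have hsub : γ x ≤ ⋃ w ∈ s, γ w := Set.subset_biUnion_of_mem (u := γ) x.2
    exact h1.map (SimpleGraph.induceHomOfLE K hsub).toHom
  induction p with
  | nil => exact fun a ha b hb hax hbx => key _ a ha b hb hax hbx
  | @cons x z y h p ih =>
    intro a ha b hb hax hby
    obtain ⟨c, hc, d, hd, hcd⟩ := hadj _ _ (show G.Adj x z by simpa using h)
    have hc' : c ∈ ⋃ w ∈ s, γ w := Set.mem_biUnion x.2 hc
    have hd' : d ∈ ⋃ w ∈ s, γ w := Set.mem_biUnion z.2 hd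
    have h1 := key x a ha c hc' hax hc
    have h2 := ih d hd' b hb hd hby
    have h3 : (K.induce (⋃ w ∈ s, γ w)).Adj ⟨c, hc'⟩ ⟨d, hd'⟩ := by simpa using hcd
    exact (h1.trans h3.reachable).trans h2

theorem IsMinor.trans {U W V : Type*} {H : SimpleGraph U} {G : SimpleGraph W} {K : SimpleGraph V}
    (h₁ : IsMinor H G) (h₂ : IsMinor G K) : IsMinor H K := by
  obtain ⟨β, hβ, hβd, hβa⟩ := h₁
  obtain ⟨γ, hγ, hγd, hγa⟩ := h₂
  refine ⟨fun w => ⋃ x ∈ β w, γ x, ?_, ?_, ?_⟩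
  · intro w
    obtain ⟨⟨x, hx⟩⟩ := (hβ w).nonempty
    obtain ⟨⟨a, ha⟩⟩ := (hγ x).nonempty
    rw [SimpleGraph.connected_iff_exists_forall_reachable]
    refine ⟨⟨a, Set.mem_biUnion hx ha⟩, fun ⟨b, hb⟩ => ?_⟩
    obtain ⟨y, hy, hby⟩ := Set.mem_iUnion₂.1 hb
    obtain ⟨p⟩ := (hβ w).preconnected ⟨x, hx⟩ ⟨y, hy⟩
    exact reachable_induce_biUnion hγ hγa p _ _ _ _ ha hby
  · intro w w' hne
    simp only [Set.disjoint_iUnion_left, Set.disjoint_iUnion_right]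
    intro x hx y hy
    refine hγd _ _ ?_
    rintro rfl
    exact Set.disjoint_left.1 (hβd w w' hne) hy hx
  · intro w w' h
    obtain ⟨x, hx, y, hy, hxy⟩ := hβa w w' h
    obtain ⟨a, ha, b, hb, hab⟩ := hγa x y hxy
    exact ⟨a, Set.mem_biUnion hx ha, b, Set.mem_biUnion hy hb, hab⟩

theorem IsMinor.of_injective {W V : Type*} {H : SimpleGraph W} {G : SimpleGraph V} (f : W → V)
    (hf : Function.Injective f) (h : ∀ w w', H.Adj w w' → G.Adj (f w) (f w')) : IsMinor H G := by
  refine ⟨fun w => {f w}, fun w => induce_connected_of_star (f w) rfl (by simp), ?_, ?_⟩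
  · intro w w' hne
    simpa using hf.ne hne
  · intro w w' hadj
    exact ⟨f w, rfl, f w', rfl, h w w' hadj⟩

/-- The number of ordered pairs of adjacent vertices, that is, twice the number of edges. -/
noncomputable def adjPairs {V : Type*} [Fintype V] (G : SimpleGraph V) : ℕ := by
  classical exact (Finset.univ.filter fun p : V × V => G.Adj p.1 p.2).card

open Classical in
theorem adjPairs_eq_sum {V : Type*} [Fintype V] (G : SimpleGraph V) :
    adjPairs G = ∑ x, (Finset.univ.filter fun y => G.Adj x y).card := by
  rw [adjPairs, Finset.card_filter, ← Finset.univ_product_univ, Finset.sum_product]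
  simp only [Finset.card_filter]

/-- The graph obtained by contracting the edge `uv` to the vertex `u`. -/
def contract {V : Type*} (G : SimpleGraph V) (u v : V) : SimpleGraph {x // x ≠ v} :=
  SimpleGraph.fromRel fun x y => G.Adj x y ∨ (x.1 = u ∧ G.Adj v y)

theorem isMinor_contract {V : Type*} (G : SimpleGraph V) {u v : V} (huv : G.Adj u v) :
    IsMinor (contract G u v) G := by
  refine ⟨fun x => {y | y = x.1 ∨ (x.1 = u ∧ y = v)}, ?_, ?_, ?_⟩
  · intro x
    refine induce_connected_of_star x.1 (Or.inl rfl) ?_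
    rintro y (rfl | ⟨hx, rfl⟩)
    · exact Or.inl rfl
    · right; rw [hx]; exact huv
  · intro x y hne
    rw [Set.disjoint_left]
    rintro a (rfl | ⟨hx, rfl⟩) (h | ⟨hy, h⟩)
    · exact hne (Subtype.ext h)
    · exact x.2 h
    · exact y.2 h.symm
    · exact hne (Subtype.ext (hx.trans hy.symm))
  · intro x y h
    simp only [contract, SimpleGraph.fromRel_adj] at h
    rcases h with ⟨-, (h | ⟨hx, h⟩) | (h | ⟨hy, h⟩)⟩
    · exact ⟨x, Or.inl rfl, y, Or.inl rfl, h⟩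
    · exact ⟨v, Or.inr ⟨hx, rfl⟩, y, Or.inl rfl, h⟩
    · exact ⟨x, Or.inl rfl, y, Or.inl rfl, h.symm⟩
    · exact ⟨x, Or.inl rfl, v, Or.inr ⟨hy, rfl⟩, h.symm⟩

open Classical in
/-- The contraction of `uv` loses the edge `uv` and, for every common neighbour of `u` and `v`, one
of two parallel edges. -/
theorem adjPairs_le_contract {V : Type*} [Fintype V] (G : SimpleGraph V) {u v : V}
    (huv : G.Adj u v) :
    adjPairs G ≤ adjPairs (contract G u v) + 2 +
      2 * (Finset.univ.filter fun y => G.Adj u y ∧ G.Adj v y).card := by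
  set R := Finset.univ.filter fun y => G.Adj v y ∧ ¬ G.Adj u y ∧ y ≠ u
  set A := Finset.univ.filter fun p : V × V => G.Adj p.1 p.2 ∧ p.1 ≠ v ∧ p.2 ≠ v
  set N := Finset.univ.filter fun y => G.Adj v y
  set CN := Finset.univ.filter fun y => G.Adj u y ∧ G.Adj v y
  have hN : N.card ≤ 1 + CN.card + R.card := by
    have : N ⊆ ({u} ∪ CN) ∪ R := by
      intro y hy
      simp only [N, CN, R, Finset.mem_filter, Finset.mem_univ, true_and, Finset.mem_union,
        Finset.mem_singleton] at hy ⊢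
      tauto
    refine (Finset.card_le_card this).trans ((Finset.card_union_le _ _).trans ?_)
    gcongr
    exact (Finset.card_union_le _ _).trans (by simp)
  have hG : adjPairs G ≤ A.card + N.card + N.card := by
    have : (Finset.univ.filter fun p : V × V => G.Adj p.1 p.2) ⊆
        A ∪ N.image (fun y => (v, y)) ∪ N.image (fun y => (y, v)) := by
      rintro ⟨x, y⟩ h
      simp only [Finset.mem_filter, Finset.mem_univ, true_and, A, N, Finset.mem_union,
        Finset.mem_image, Prod.mk.injEq] at h ⊢
      by_cases hx : x = v
      · subst hx; exact Or.inl (Or.inr ⟨y, h, rfl, rfl⟩)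
      · by_cases hy : y = v
        · subst hy; exact Or.inr ⟨x, h.symm, rfl, rfl⟩
        · exact Or.inl (Or.inl ⟨h, hx, hy⟩)
    unfold adjPairs
    refine (Finset.card_le_card this).trans ((Finset.card_union_le _ _).trans ?_)
    gcongr
    · exact (Finset.card_union_le _ _).trans (Nat.add_le_add_left Finset.card_image_le _)
    · exact Finset.card_image_le
  have hC : A.card + R.card + R.card ≤ adjPairs (contract G u v) := by
    have hsub : A ∪ R.image (fun y => (u, y)) ∪ R.image (fun y => (y, u)) ⊆
        (Finset.univ.filter fun p : {x // x ≠ v} × {x // x ≠ v} =>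
          (contract G u v).Adj p.1 p.2).image (fun p => (p.1.1, p.2.1)) := by
      rintro ⟨x, y⟩ h
      simp only [Finset.mem_filter, Finset.mem_univ, true_and, A, R, Finset.mem_union,
        Finset.mem_image, Prod.mk.injEq] at h
      simp only [Finset.mem_image, Finset.mem_filter, Finset.mem_univ, true_and, Prod.mk.injEq]
      rcases h with (⟨h, hx, hy⟩ | ⟨z, ⟨h1, h2, h3⟩, rfl, rfl⟩) | ⟨z, ⟨h1, h2, h3⟩, rfl, rfl⟩
      · refine ⟨(⟨x, hx⟩, ⟨y, hy⟩), ?_, rfl, rfl⟩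
        simp only [contract, SimpleGraph.fromRel_adj]
        exact ⟨fun e => h.ne (Subtype.ext_iff.1 e), Or.inl (Or.inl h)⟩
      · refine ⟨(⟨u, huv.ne⟩, ⟨z, h1.ne'⟩), ?_, rfl, rfl⟩
        simp only [contract, SimpleGraph.fromRel_adj]
        exact ⟨fun e => h3 (Subtype.ext_iff.1 e).symm, by simp [h1]⟩
      · refine ⟨(⟨z, h1.ne'⟩, ⟨u, huv.ne⟩), ?_, rfl, rfl⟩
        simp only [contract, SimpleGraph.fromRel_adj]
        exact ⟨fun e => h3 (Subtype.ext_iff.1 e), by simp [h1]⟩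
    have h1 := (Finset.card_le_card hsub).trans Finset.card_image_le
    rw [Finset.card_union_of_disjoint, Finset.card_union_of_disjoint,
      Finset.card_image_of_injective, Finset.card_image_of_injective] at h1
    · exact h1
    · intro a b h; simpa using h
    · intro a b h; simpa using h
    · rw [Finset.disjoint_left]
      rintro ⟨x, y⟩ h h'
      simp only [Finset.mem_filter, Finset.mem_univ, true_and, A, R,
        Finset.mem_image, Prod.mk.injEq] at h h'
      obtain ⟨z, ⟨h1, h2, h3⟩, rfl, rfl⟩ := h'
      exact h2 h.1
    · rw [Finset.disjoint_left]
      rintro ⟨x, y⟩ h h'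
      simp only [Finset.mem_filter, Finset.mem_univ, true_and, A, R, Finset.mem_union,
        Finset.mem_image, Prod.mk.injEq] at h h'
      obtain ⟨z, ⟨h1, h2, h3⟩, rfl, rfl⟩ := h'
      rcases h with h | ⟨w, ⟨h1', h2', h3'⟩, rfl, rfl⟩
      · exact h2 h.1.symm
      · exact h3 rfl
  omega

/-- The bound of `adjPairs_le_of_not_isMinor_top`. -/
def minorBound : ℕ → ℕ
  | 0 => 0
  | t + 1 => 2 * minorBound t + 2

/-- Mader's theorem: a graph without a complete minor on `t` vertices has linearly many edges. If
every edge lies in many triangles, the neighbourhood of a vertex is dense and the claim follows by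
induction on `t`; otherwise an edge in few triangles is contracted. -/
theorem adjPairs_le_of_not_isMinor_top (t : ℕ) {V : Type u} [Fintype V] (G : SimpleGraph V)
    (hG : ¬ IsMinor (⊤ : SimpleGraph (Fin t)) G) :
    adjPairs G ≤ minorBound t * Fintype.card V := by
  classical
  induction t generalizing V with
  | zero => exact absurd ⟨fun w => w.elim0, fun w => w.elim0, fun w => w.elim0,
      fun w => w.elim0⟩ hG
  | succ t ih =>
    obtain ⟨m, hm⟩ : ∃ m, Fintype.card V = m := ⟨_, rfl⟩
    induction m generalizing V with
    | zero =>
      have := Fintype.card_eq_zero_iff.1 hm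
      simp [adjPairs]
    | succ m ihm =>
      by_cases hedge : ∃ u v, G.Adj u v ∧
          (Finset.univ.filter fun y => G.Adj u y ∧ G.Adj v y).card ≤ minorBound t
      · obtain ⟨u, v, huv, hcn⟩ := hedge
        -- An edge in few triangles: contracting it loses few edges.
        have h1 := adjPairs_le_contract G huv
        have hcard : Fintype.card {x // x ≠ v} = m := by
          simp [Fintype.card_subtype_compl, hm]
        have h2 := ihm (contract G u v) (fun h => hG (h.trans (isMinor_contract G huv))) hcard
        rw [hcard] at h2
        rw [hm]
        simp only [minorBound] at h2 ⊢
        nlinarith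
      · push Not at hedge
        by_cases hne : ∃ u v, G.Adj u v
        · exfalso
          obtain ⟨u, v, huv⟩ := hne
          -- Otherwise the neighbourhood of `u` has too many edges for a graph without `K_t`
          -- minor, while `u` would complete such a minor to a `K_{t+1}` minor of `G`.
          have hN : ¬ IsMinor (⊤ : SimpleGraph (Fin t)) (G.induce {x | G.Adj u x}) := by
            rintro ⟨β, h1, h2, h3⟩
            apply hG
            refine ⟨Fin.cases {u} fun w => Subtype.val '' (β w), ?_, ?_, ?_⟩
            · intro w
              refine Fin.cases ?_ (fun w => ?_) w
              · exact induce_connected_of_star u rfl (by simp)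
              · obtain ⟨⟨⟨x, hx⟩, hxβ⟩, hr⟩ :=
                  (SimpleGraph.connected_iff_exists_forall_reachable _).1 (h1 w)
                rw [SimpleGraph.connected_iff_exists_forall_reachable]
                refine ⟨⟨x, ⟨x, hx⟩, hxβ, rfl⟩, ?_⟩
                rintro ⟨_, ⟨y, hy⟩, hyβ, rfl⟩
                let f : (G.induce {x | G.Adj u x}).induce (β w) →g
                    G.induce (Subtype.val '' (β w)) :=
                  ⟨fun z => ⟨z.1.1, z.1, z.2, rfl⟩, fun h => by simpa using h⟩
                exact (hr ⟨⟨y, hy⟩, hyβ⟩).map f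
            · intro w w'
              refine Fin.cases ?_ (fun w => ?_) w <;> refine Fin.cases ?_ (fun w' => ?_) w'
              · simp
              · intro _
                simp only [Fin.cases_zero, Fin.cases_succ, Set.disjoint_singleton_left]
                rintro ⟨⟨y, hy⟩, -, e⟩
                exact (show G.Adj u y from hy).ne e.symm
              · intro _
                simp only [Fin.cases_zero, Fin.cases_succ, Set.disjoint_singleton_right]
                rintro ⟨⟨y, hy⟩, -, e⟩
                exact (show G.Adj u y from hy).ne e.symm
              · intro hne
                simp only [Fin.cases_succ]
                exact (Set.disjoint_image_iff Subtype.val_injective).2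
                  (h2 w w' fun e => hne (by rw [e]))
            · intro w w'
              refine Fin.cases ?_ (fun w => ?_) w <;> refine Fin.cases ?_ (fun w' => ?_) w'
              · simp
              · intro _
                obtain ⟨⟨⟨y, hy⟩, hyβ⟩⟩ := (h1 w').nonempty
                exact ⟨u, rfl, y, ⟨⟨y, hy⟩, hyβ, rfl⟩, hy⟩
              · intro _
                obtain ⟨⟨⟨y, hy⟩, hyβ⟩⟩ := (h1 w).nonempty
                exact ⟨y, ⟨⟨y, hy⟩, hyβ, rfl⟩, u, rfl, G.adj_symm hy⟩
              · intro hadj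
                obtain ⟨x, hx, y, hy, hxy⟩ := h3 w w'
                  (by simpa using fun e => hadj.ne (by rw [e]))
                exact ⟨x, ⟨x, hx, rfl⟩, y, ⟨y, hy, rfl⟩, by simpa using hxy⟩
          have h1 := ih (G.induce {x | G.Adj u x}) hN
          rw [adjPairs_eq_sum] at h1
          -- The degree of `x` in the neighbourhood of `u` is the number of triangles on `ux`.
          have h2 : ∀ x : {x | G.Adj u x}, minorBound t + 1 ≤
              (Finset.univ.filter fun y => (G.induce {x | G.Adj u x}).Adj x y).card := by
            intro x
            refine (hedge u x x.2).trans_le ?_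
            rw [← Finset.card_image_of_injective _
              (Subtype.val_injective (p := fun y => y ∈ {x | G.Adj u x}))]
            refine Finset.card_le_card fun y hy => ?_
            simp only [Finset.mem_filter, Finset.mem_univ, true_and] at hy
            simp only [Finset.mem_image, Finset.mem_filter, Finset.mem_univ, true_and]
            exact ⟨⟨y, hy.1⟩, by simpa using hy.2, rfl⟩
          have h3 := Finset.sum_le_sum fun x (_ : x ∈ Finset.univ) => h2 x
          have h4 : 0 < Fintype.card {x | G.Adj u x} := Fintype.card_pos_iff.2 ⟨⟨v, huv⟩⟩
          rw [Finset.sum_const, Finset.card_univ, smul_eq_mul] at h3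
          have h5 : Fintype.card {x | G.Adj u x} * (minorBound t + 1) ≤
              minorBound t * Fintype.card {x | G.Adj u x} := by
            refine h3.trans (le_trans (le_of_eq ?_) h1)
            congr!
          nlinarith
        · push Not at hne
          simp [adjPairs, hne]

end Minors

/-! ### The number of distinct neighbourhoods -/

section Neighborhoods

variable {V : Type*}

open Classical in
theorem adjPairs_induce [Fintype V] (H : SimpleGraph V) (U : Finset V) :
    adjPairs (H.induce (U : Set V)) = ((U ×ˢ U).filter fun p => H.Adj p.1 p.2).card := by
  rw [adjPairs]
  refine Finset.card_bij (fun p _ => (p.1.1, p.2.1)) ?_ ?_ ?_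
  · rintro ⟨⟨x, hx⟩, ⟨y, hy⟩⟩ h
    simpa using ⟨⟨hx, hy⟩, by simpa using h⟩
  · rintro ⟨⟨x, hx⟩, ⟨y, hy⟩⟩ _ ⟨⟨x', hx'⟩, ⟨y', hy'⟩⟩ _ h
    simpa using h
  · rintro ⟨x, y⟩ h
    simp only [Finset.mem_filter, Finset.mem_product] at h
    exact ⟨(⟨x, h.1.1⟩, ⟨y, h.1.2⟩), by simpa using h.2, rfl⟩

open Classical in
/-- If all induced subgraphs are sparse, there is a vertex of small degree. Every clique avoids it
or consists of it and some of its neighbours, so the number of cliques is linear. -/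
theorem card_cliques_le (H : SimpleGraph V) (d : ℕ) (U : Finset V)
    (h : ∀ U' ⊆ U, ((U' ×ˢ U').filter fun p => H.Adj p.1 p.2).card ≤ d * U'.card) :
    (U.powerset.filter fun A : Finset V => (A : Set V).Pairwise H.Adj).card ≤
      2 ^ d * U.card + 1 := by
  obtain ⟨m, hm⟩ : ∃ m, U.card = m := ⟨_, rfl⟩
  induction m generalizing U with
  | zero =>
    rw [Finset.card_eq_zero] at hm
    subst hm
    exact (Finset.card_filter_le _ _).trans (by simp)
  | succ m ih =>
    -- The average degree is at most `d`.
    obtain ⟨x, hx, hdeg⟩ : ∃ x ∈ U, (U.filter fun y => H.Adj x y).card ≤ d := by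
      by_contra! hcon
      have h1 := h U subset_rfl
      rw [Finset.card_filter, Finset.sum_product] at h1
      simp only [← Finset.card_filter] at h1
      have h2 := Finset.sum_le_sum fun x hx => Nat.succ_le_of_lt (hcon x hx)
      rw [Finset.sum_const, smul_eq_mul] at h2
      have h3 : 0 < U.card := by omega
      nlinarith
    -- A clique that contains `x` is determined by the at most `d` neighbours of `x`.
    have hsub : (U.powerset.filter fun A : Finset V => (A : Set V).Pairwise H.Adj) ⊆
        ((U.erase x).powerset.filter fun A : Finset V => (A : Set V).Pairwise H.Adj) ∪
          (U.filter fun y => H.Adj x y).powerset.image (insert x) := by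
      intro A hA
      simp only [Finset.mem_filter, Finset.mem_powerset, Finset.mem_union, Finset.mem_image]
        at hA ⊢
      by_cases hxA : x ∈ A
      · right
        refine ⟨A.erase x, fun y hy => ?_, Finset.insert_erase hxA⟩
        rw [Finset.mem_erase] at hy
        exact Finset.mem_filter.2 ⟨hA.1 hy.2, hA.2 hxA hy.2 (Ne.symm hy.1)⟩
      · left
        exact ⟨fun y hy => Finset.mem_erase.2 ⟨fun e => hxA (e ▸ hy), hA.1 hy⟩, hA.2⟩
    have h1 := ih (U.erase x) (fun U' hU' => h U' (hU'.trans (Finset.erase_subset _ _)))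
      (by rw [Finset.card_erase_of_mem hx]; omega)
    have h2 : ((U.filter fun y => H.Adj x y).powerset.image (insert x)).card ≤ 2 ^ d := by
      refine Finset.card_image_le.trans ?_
      rw [Finset.card_powerset]
      exact Nat.pow_le_pow_right (by norm_num) hdeg
    have h3 := (Finset.card_le_card hsub).trans (Finset.card_union_le _ _)
    rw [Finset.card_erase_of_mem hx] at h1
    rw [hm] at h1 ⊢
    simp only [Nat.add_sub_cancel] at h1
    rw [Nat.mul_succ]
    omega

/-- The graph whose edges join `f w` to `g w` for the members `w` of `M`. -/
def shortcut (M : Finset V) (f g : V → V) : SimpleGraph V :=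
  SimpleGraph.fromRel fun a b => ∃ w ∈ M, f w = a ∧ g w = b

open Classical in
/-- A maximal set `M` of vertices outside `O` such that each of them can be contracted to give a
new edge between two of its neighbours in `O`. -/
theorem exists_shortcut (G : SimpleGraph V) (O X : Finset V) :
    ∃ M ⊆ X, ∃ f g : V → V,
      (∀ w ∈ M, f w ∈ O ∧ g w ∈ O ∧ G.Adj w (f w) ∧ G.Adj w (g w) ∧ f w ≠ g w) ∧
      (∀ w ∈ M, ∀ w' ∈ M, w ≠ w' → ¬ (f w = f w' ∧ g w = g w')) ∧
      (∀ w ∈ M, ∀ w' ∈ M, ¬ (f w = g w' ∧ g w = f w')) ∧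
      ∀ w ∈ X, w ∉ M → ((O.filter fun v => G.Adj w v : Finset V) : Set V).Pairwise
        (shortcut M f g).Adj := by
  induction X using Finset.induction_on with
  | empty => exact ⟨∅, subset_rfl, id, id, by simp⟩
  | insert w X hw ih =>
    obtain ⟨M, hM, f, g, h1, h2, h3, h4⟩ := ih
    by_cases hcl : ((O.filter fun v => G.Adj w v : Finset V) : Set V).Pairwise
        (shortcut M f g).Adj
    · refine ⟨M, hM.trans (Finset.subset_insert _ _), f, g, h1, h2, h3, ?_⟩
      intro x hx hxM
      rcases Finset.mem_insert.1 hx with rfl | hx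
      · exact hcl
      · exact h4 x hx hxM
    -- Two neighbours `a`, `b` of `w` are not joined yet: let `w` join them.
    · have hwM : w ∉ M := fun h => hw (hM h)
      have hne : ∀ x ∈ M, x ≠ w := fun x hx e => hwM (e ▸ hx)
      rw [Set.Pairwise] at hcl
      push Not at hcl
      obtain ⟨a, ha, b, hb, hab, hadj⟩ := hcl
      simp only [Finset.coe_filter, Set.mem_ofPred_eq] at ha hb
      have hnot : ∀ x ∈ M, ¬ (f x = a ∧ g x = b) ∧ ¬ (f x = b ∧ g x = a) := by
        intro x hx
        simp only [shortcut, SimpleGraph.fromRel_adj, not_and, not_or, not_exists] at hadj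
        exact ⟨fun h => (hadj hab).1 x hx h.1 h.2, fun h => (hadj hab).2 x hx h.1 h.2⟩
      have hf : ∀ x ∈ M, Function.update f w a x = f x := fun x hx =>
        Function.update_of_ne (hne x hx) _ _
      have hg : ∀ x ∈ M, Function.update g w b x = g x := fun x hx =>
        Function.update_of_ne (hne x hx) _ _
      refine ⟨insert w M, Finset.insert_subset_insert _ hM, Function.update f w a,
        Function.update g w b, ?_, ?_, ?_, ?_⟩
      · intro x hx
        rcases Finset.mem_insert.1 hx with rfl | hx
        · simp [ha, hb, hab]
        · rw [hf x hx, hg x hx]; exact h1 x hx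
      · intro x hx y hy hxy
        rcases Finset.mem_insert.1 hx with ex | hx <;> rcases Finset.mem_insert.1 hy with ey | hy
        · exact absurd (ex.trans ey.symm) hxy
        · simp only [ex, Function.update_self, hf y hy, hg y hy]
          exact fun h => (hnot y hy).1 ⟨h.1.symm, h.2.symm⟩
        · simp only [ey, Function.update_self, hf x hx, hg x hx]
          exact (hnot x hx).1
        · rw [hf x hx, hg x hx, hf y hy, hg y hy]; exact h2 x hx y hy hxy
      · intro x hx y hy
        rcases Finset.mem_insert.1 hx with ex | hx <;> rcases Finset.mem_insert.1 hy with ey | hy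
        · simp only [ex, ey, Function.update_self]
          exact fun h => hab h.1
        · simp only [ex, Function.update_self, hf y hy, hg y hy]
          exact fun h => (hnot y hy).2 ⟨h.2.symm, h.1.symm⟩
        · simp only [ey, Function.update_self, hf x hx, hg x hx]
          exact (hnot x hx).2
        · rw [hf x hx, hg x hx, hf y hy, hg y hy]; exact h3 x hx y hy
      · intro x hx hxM
        rw [Finset.mem_insert, not_or] at hxM
        refine (h4 x ((Finset.mem_insert.1 hx).resolve_left hxM.1) hxM.2).mono' ?_
        intro p q hpq
        simp only [shortcut, SimpleGraph.fromRel_adj] at hpq ⊢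
        refine ⟨hpq.1, hpq.2.imp ?_ ?_⟩
        · rintro ⟨y, hy, e⟩
          exact ⟨y, Finset.mem_insert_of_mem hy, by rwa [hf y hy, hg y hy]⟩
        · rintro ⟨y, hy, e⟩
          exact ⟨y, Finset.mem_insert_of_mem hy, by rwa [hf y hy, hg y hy]⟩

/-- Contract each `w ∈ M` to `f w`: the edge from `w` to `g w` becomes the edge from `f w` to `g w`.
As `f w` and `g w` belong to `O`, the other vertices of `M` are not affected. -/
theorem isMinor_shortcut (G : SimpleGraph V) (O M U : Finset V) (f g : V → V)
    (hMO : Disjoint M O) (hU : U ⊆ O)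
    (h : ∀ w ∈ M, G.Adj w (f w) ∧ G.Adj w (g w)) :
    IsMinor ((shortcut M f g).induce (U : Set V)) G := by
  have hUM : ∀ (x : (U : Set V)), x.1 ∉ M := fun x hx =>
    Finset.disjoint_left.1 hMO hx (hU x.2)
  refine ⟨fun q => {x | x = q.1 ∨ (x ∈ M ∧ f x = q.1)}, ?_, ?_, ?_⟩
  · intro q
    refine induce_connected_of_star q.1 (Or.inl rfl) ?_
    rintro x (rfl | ⟨hx, hq⟩)
    · exact Or.inl rfl
    · exact Or.inr (hq ▸ (h x hx).1.symm)
  · intro p q hpq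
    rw [Set.disjoint_left]
    rintro x (rfl | ⟨hx, hxp⟩) (hx' | ⟨hx', hxq⟩)
    · exact hpq (Subtype.ext hx')
    · exact hUM _ hx'
    · exact hUM q (hx' ▸ hx)
    · exact hpq (Subtype.ext (hxp.symm.trans hxq))
  · intro p q hpq
    simp only [SimpleGraph.comap_adj, shortcut, SimpleGraph.fromRel_adj,
      Function.Embedding.subtype_apply] at hpq
    rcases hpq with ⟨-, ⟨w, hw, hf, hg⟩ | ⟨w, hw, hf, hg⟩⟩
    · exact ⟨w, Or.inr ⟨hw, hf⟩, q.1, Or.inl rfl, hg ▸ (h w hw).2⟩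
    · exact ⟨p.1, Or.inl rfl, w, Or.inr ⟨hw, hf⟩, hg ▸ (h w hw).2.symm⟩

open Classical in
/-- In a graph without a complete minor on `t` vertices, the vertices outside `O` have linearly many
distinct neighbourhoods in `O`. -/
theorem card_neighborhoods_le [Fintype V] (t : ℕ) (G : SimpleGraph V)
    (hG : ¬ IsMinor (⊤ : SimpleGraph (Fin t)) G) (O : Finset V) :
    (Oᶜ.image fun w => O.filter fun v => G.Adj w v).card ≤
      (minorBound t + 2 ^ minorBound t) * O.card + 1 := by
  obtain ⟨M, hM, f, g, h1, h2, h3, h4⟩ := exists_shortcut G O Oᶜ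
  have hMO : Disjoint M O := Finset.disjoint_left.2 fun x hx =>
    Finset.mem_compl.1 (hM hx)
  have hU : ∀ U ⊆ O, ((U ×ˢ U).filter fun p => (shortcut M f g).Adj p.1 p.2).card ≤
      minorBound t * U.card := by
    intro U hU
    rw [← adjPairs_induce]
    refine (adjPairs_le_of_not_isMinor_top t _ fun h => hG (h.trans (isMinor_shortcut G O M U f g
      hMO hU fun w hw => ⟨(h1 w hw).2.2.1, (h1 w hw).2.2.2.1⟩))).trans ?_
    simp
  -- Each member of `M` contributes an edge of its own to a minor of `G` on the vertex set `O`.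
  have hMc : M.card ≤ minorBound t * O.card := by
    refine le_trans ?_ (hU O subset_rfl)
    refine Finset.card_le_card_of_injOn (fun w => (f w, g w)) ?_ ?_
    · intro w hw
      obtain ⟨a, b, -, -, c⟩ := h1 w hw
      simp only [Finset.coe_filter, Finset.mem_product, Set.mem_ofPred_eq, shortcut,
        SimpleGraph.fromRel_adj]
      exact ⟨⟨a, b⟩, c, Or.inl ⟨w, hw, rfl, rfl⟩⟩
    · intro w hw w' hw' e
      by_contra hne
      exact h2 w hw w' hw' hne (by simpa using e)
  -- The neighbourhoods of the other vertices are cliques of this minor.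
  have hsub : (Oᶜ.image fun w => O.filter fun v => G.Adj w v) ⊆
      (M.image fun w => O.filter fun v => G.Adj w v) ∪
        O.powerset.filter fun A : Finset V => (A : Set V).Pairwise (shortcut M f g).Adj := by
    intro A hA
    obtain ⟨w, hw, rfl⟩ := Finset.mem_image.1 hA
    rw [Finset.mem_union]
    by_cases hwM : w ∈ M
    · exact Or.inl (Finset.mem_image_of_mem _ hwM)
    · right
      rw [Finset.mem_filter, Finset.mem_powerset]
      exact ⟨Finset.filter_subset _ _, h4 w hw hwM⟩
  have h5 := (Finset.card_le_card hsub).trans (Finset.card_union_le _ _)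
  have h6 := card_cliques_le (shortcut M f g) (minorBound t) O hU
  have h7 : (M.image fun w => O.filter fun v => G.Adj w v).card ≤ M.card := Finset.card_image_le
  rw [Nat.add_mul]
  omega

/-- The bound of `sum_degrees_le`. -/
def degreeBound (t : ℕ) : ℕ :=
  minorBound t + minorBound t * (1 + (minorBound t + 2 ^ minorBound t + 1))

open Classical in
/-- The graph on `O` and one supervertex for every neighbourhood in `O` of a vertex outside `O`
has linearly many edges in terms of `O`, because it is isomorphic to a subgraph of `G`. -/
theorem sum_degrees_le [Fintype V] (t : ℕ) (G : SimpleGraph V)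
    (hG : ¬ IsMinor (⊤ : SimpleGraph (Fin t)) G) (O : Finset V) :
    ((O ×ˢ O).filter fun p => G.Adj p.1 p.2).card +
      ∑ A ∈ Oᶜ.image fun w => O.filter fun v => G.Adj w v, A.card ≤ degreeBound t * O.card := by
  have hU : ∀ U : Finset V, ((U ×ˢ U).filter fun p => G.Adj p.1 p.2).card ≤
      minorBound t * U.card := by
    intro U
    rw [← adjPairs_induce]
    refine (adjPairs_le_of_not_isMinor_top t _ fun h => hG (h.trans
      (IsMinor.of_injective Subtype.val Subtype.val_injective ?_))).trans ?_
    · intro x y hxy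
      simpa using hxy
    · simp
  rcases O.eq_empty_or_nonempty with rfl | hne
  · simp
  set T := Oᶜ.image fun w => O.filter fun v => G.Adj w v with hT
  have hTc := card_neighborhoods_le t G hG O
  rw [← hT] at hTc
  -- A representative `r A` for each neighbourhood; the subgraph induced by `O` and the
  -- representatives is sparse.
  have hrep : ∀ A : Finset V, ∃ w, A ∈ T → w ∉ O ∧ O.filter (fun v => G.Adj w v) = A := by
    intro A
    by_cases hA : A ∈ T
    · obtain ⟨w, hw, e⟩ := Finset.mem_image.1 hA
      exact ⟨w, fun _ => ⟨Finset.mem_compl.1 hw, e⟩⟩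
    · obtain ⟨w, -⟩ := hne
      exact ⟨w, fun h => absurd h hA⟩
  choose r hr using hrep
  have hsum : ∑ A ∈ T, A.card ≤
      (((O ∪ T.image r) ×ˢ (O ∪ T.image r)).filter fun p => G.Adj p.1 p.2).card := by
    rw [← Finset.card_sigma]
    refine Finset.card_le_card_of_injOn (fun p => (r p.1, p.2)) ?_ ?_
    · rintro ⟨A, v⟩ h
      simp only [Finset.coe_sigma, Set.mem_sigma_iff, SetLike.mem_coe] at h
      have h1 := h.2
      rw [← (hr A h.1).2, Finset.mem_filter] at h1
      simp only [Finset.coe_filter, Finset.mem_product, Finset.mem_union, Set.mem_ofPred_eq]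
      exact ⟨⟨Or.inr (Finset.mem_image_of_mem _ h.1), Or.inl h1.1⟩, h1.2⟩
    · rintro ⟨A, v⟩ h ⟨A', v'⟩ h' e
      simp only [Finset.coe_sigma, Set.mem_sigma_iff, SetLike.mem_coe] at h h'
      simp only [Prod.mk.injEq] at e
      have : A = A' := by rw [← (hr A h.1).2, ← (hr A' h'.1).2, e.1]
      subst this
      rw [e.2]
  have h1 := hU O
  have h2 := hU (O ∪ T.image r)
  have h3 : (O ∪ T.image r).card ≤ O.card + T.card :=
    (Finset.card_union_le _ _).trans (Nat.add_le_add_left Finset.card_image_le _)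
  have h4 : 1 ≤ O.card := hne.card_pos
  have h5 : (O ∪ T.image r).card ≤
      (1 + (minorBound t + 2 ^ minorBound t + 1)) * O.card := by nlinarith
  have h6 := Nat.mul_le_mul_left (minorBound t) h5
  rw [degreeBound, Nat.add_mul, Nat.mul_assoc]
  omega

end Neighborhoods

/-! ### The hierarchy in closed form -/

section ClosedForm

variable {n : ℕ} {Δ : ℕ} {G : SimpleGraph (Fin n)}

/-- The original vertices of the graph `Gᵢ`. -/
noncomputable def orig (Δ : ℕ) (G : SimpleGraph (Fin n)) (i : ℕ) : Finset (Fin n) :=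
  Finset.univ.filter fun v => Sum.inl v ∈ (layer Δ G i).verts

/-- The original neighbours of a node: in `G` for an original vertex, and the set that names it for
a supervertex. -/
noncomputable def onb (G : SimpleGraph (Fin n)) : Node n → Finset (Fin n)
  | Sum.inl v => by classical exact Finset.univ.filter fun u => G.Adj v u
  | Sum.inr A => A

@[simp] theorem mem_onb_inl {u v : Fin n} : u ∈ onb G (Sum.inl v) ↔ G.Adj v u := by simp [onb]

@[simp] theorem onb_inr {A : Finset (Fin n)} : onb G (Sum.inr A) = A := rfl

@[simp] theorem mem_orig {i : ℕ} {v : Fin n} :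
    v ∈ orig Δ G i ↔ Sum.inl v ∈ (layer Δ G i).verts := by simp [orig]

theorem orig_zero : orig Δ G 0 = Finset.univ := by
  ext v; simp [layer]

theorem inr_notMem_verts_zero (A : Finset (Fin n)) : Sum.inr A ∉ (layer Δ G 0).verts := by
  simp [layer]

theorem inr_notMem_high (i : ℕ) (A : Finset (Fin n)) : Sum.inr A ∉ (layer Δ G i).high Δ := by
  intro h
  obtain ⟨v, hv⟩ := high_original Δ G i _ h
  cases hv

theorem mem_high {i : ℕ} {x : Node n} : x ∈ (layer Δ G i).high Δ ↔
    x ∈ (layer Δ G i).verts ∧ Δ ≤ ((layer Δ G i).nbrs x).card := by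
  simp [Layer.high]

theorem inl_mem_high_iff {i : ℕ} {v : Fin n} :
    Sum.inl v ∈ (layer Δ G i).high Δ ↔ v ∈ orig Δ G (i + 1) := by
  simp [layer, Layer.next]

theorem mem_orig_succ {i : ℕ} {v : Fin n} :
    v ∈ orig Δ G (i + 1) ↔ v ∈ orig Δ G i ∧ Δ ≤ ((layer Δ G i).nbrs (Sum.inl v)).card := by
  rw [← inl_mem_high_iff, mem_high, mem_orig]

theorem mem_high_iff {i : ℕ} {x : Node n} : x ∈ (layer Δ G i).high Δ ↔
    ∃ v ∈ orig Δ G (i + 1), x = Sum.inl v := by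
  constructor
  · intro h
    obtain ⟨v, rfl⟩ := high_original Δ G i _ h
    exact ⟨v, inl_mem_high_iff.1 h, rfl⟩
  · rintro ⟨v, hv, rfl⟩
    exact inl_mem_high_iff.2 hv

theorem orig_succ_subset (i : ℕ) : orig Δ G (i + 1) ⊆ orig Δ G i := fun _ hv =>
  (mem_orig_succ.1 hv).1

theorem orig_antitone : Antitone (orig Δ G) := antitone_nat_of_succ_le orig_succ_subset

theorem adj_mem_verts {i : ℕ} {x y : Node n} (h : (layer Δ G i).graph.Adj x y) :
    x ∈ (layer Δ G i).verts := by
  classical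
  cases i with
  | zero =>
    simp only [layer, SimpleGraph.map_adj] at h ⊢
    obtain ⟨u, v, -, rfl, rfl⟩ := h
    simp
  | succ i =>
    simp only [layer, Layer.next, SimpleGraph.fromRel_adj, Finset.mem_union,
      Finset.mem_image] at h ⊢
    rcases h with ⟨-, (⟨h, -, -⟩ | ⟨-, u, hu, rfl, -⟩) | (⟨-, h, -⟩ | ⟨h, -⟩)⟩
    · exact Or.inl h
    · exact Or.inr ⟨u, hu, rfl⟩
    · exact Or.inl h
    · exact Or.inl h

theorem adj_inl_inl {i : ℕ} {u v : Fin n} (hu : u ∈ orig Δ G i) (hv : v ∈ orig Δ G i) :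
    (layer Δ G i).graph.Adj (Sum.inl u) (Sum.inl v) ↔ G.Adj u v := by
  induction i with
  | zero => simp [layer]
  | succ i ih =>
    have ih' := ih (orig_succ_subset i hu) (orig_succ_subset i hv)
    have hu' := inl_mem_high_iff.2 hu
    have hv' := inl_mem_high_iff.2 hv
    simp only [layer, Layer.next, SimpleGraph.fromRel_adj, hu', hv', true_and, ih',
      reduceCtorEq, false_and, and_false, exists_false, or_false, ne_eq, Sum.inl.injEq]
    constructor
    · rintro ⟨-, h | h⟩
      · exact h
      · exact ih'.1 h.symm
    · exact fun h => ⟨h.ne, Or.inl h⟩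

/-- Adjacency of a node of `Gᵢ` to an original vertex is the same in all graphs of the hierarchy. -/
theorem adj_inl_iff {i : ℕ} {x : Node n} (hx : x ∈ (layer Δ G i).verts) {v : Fin n}
    (hv : v ∈ orig Δ G i) :
    (layer Δ G i).graph.Adj x (Sum.inl v) ↔ v ∈ onb G x := by
  rcases x with u | A
  · rw [adj_inl_inl (mem_orig.2 hx) hv, mem_onb_inl]
  · rw [adj_super_iff Δ G i A hx]
    simp

/-- The supervertex that a vertex of `Gᵢ` of low degree is replaced by. -/
theorem trace_eq {i : ℕ} {x : Node n} (hx : x ∈ (layer Δ G i).verts) :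
    (layer Δ G i).trace Δ x = onb G x ∩ orig Δ G (i + 1) := by
  ext v
  simp only [Layer.trace, Finset.mem_filter, Finset.mem_univ, true_and, Finset.mem_inter,
    inl_mem_high_iff]
  rw [and_comm]
  exact and_congr_left fun hv => adj_inl_iff hx (orig_succ_subset i hv)

theorem inr_mem_verts_succ {i : ℕ} {A : Finset (Fin n)} :
    Sum.inr A ∈ (layer Δ G (i + 1)).verts ↔
      ∃ x ∈ (layer Δ G i).verts, x ∉ (layer Δ G i).high Δ ∧ A = onb G x ∩ orig Δ G (i + 1) := by
  have : (layer Δ G (i + 1)).verts = (layer Δ G i).high Δ ∪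
    ((layer Δ G i).verts \ (layer Δ G i).high Δ).image
      fun u => Sum.inr ((layer Δ G i).trace Δ u) := rfl
  rw [this, Finset.mem_union, or_iff_right (inr_notMem_high i A), Finset.mem_image]
  constructor
  · rintro ⟨x, hx, e⟩
    rw [Finset.mem_sdiff] at hx
    exact ⟨x, hx.1, hx.2, by rw [← trace_eq hx.1]; exact (Sum.inr_injective e).symm⟩
  · rintro ⟨x, hx, hx', rfl⟩
    exact ⟨x, Finset.mem_sdiff.2 ⟨hx, hx'⟩, by rw [trace_eq hx]⟩

/-- The supervertices of `Gᵢ` are given by the neighbourhoods, within the original vertices of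
`Gᵢ`, of the other vertices of `G`. -/
theorem inr_mem_verts {i : ℕ} {A : Finset (Fin n)} :
    Sum.inr A ∈ (layer Δ G i).verts ↔
      ∃ w, w ∉ orig Δ G i ∧ A = onb G (Sum.inl w) ∩ orig Δ G i := by
  induction i generalizing A with
  | zero => simp [inr_notMem_verts_zero, orig_zero]
  | succ i ih =>
    have hsub := orig_succ_subset (Δ := Δ) (G := G) i
    rw [inr_mem_verts_succ]
    constructor
    · rintro ⟨u | B, hx, hx', rfl⟩
      · exact ⟨u, fun h => hx' (inl_mem_high_iff.2 h), rfl⟩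
      · obtain ⟨w, hw, rfl⟩ := ih.1 hx
        refine ⟨w, fun h => hw (hsub h), ?_⟩
        rw [onb_inr, Finset.inter_assoc, Finset.inter_eq_right.2 hsub]
    · rintro ⟨w, hw, rfl⟩
      by_cases hwi : w ∈ orig Δ G i
      · exact ⟨Sum.inl w, mem_orig.1 hwi, fun h => hw (inl_mem_high_iff.1 h), rfl⟩
      · refine ⟨Sum.inr (onb G (Sum.inl w) ∩ orig Δ G i), ih.2 ⟨w, hwi, rfl⟩,
          inr_notMem_high _ _, ?_⟩
        rw [onb_inr, Finset.inter_assoc, Finset.inter_eq_right.2 hsub]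

theorem subset_orig {i : ℕ} {A : Finset (Fin n)} (hA : Sum.inr A ∈ (layer Δ G i).verts) :
    A ⊆ orig Δ G i := by
  obtain ⟨w, -, rfl⟩ := inr_mem_verts.1 hA
  exact Finset.inter_subset_right

theorem mem_nbrs {i : ℕ} {v : Fin n} (hv : v ∈ orig Δ G i) {y : Node n} :
    y ∈ (layer Δ G i).nbrs (Sum.inl v) ↔ y ∈ (layer Δ G i).verts ∧ v ∈ onb G y := by
  simp only [Layer.nbrs, Finset.mem_filter]
  refine and_congr_right fun hy => ?_
  rw [SimpleGraph.adj_comm, adj_inl_iff hy hv]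

/-- A supervertex persists as long as its neighbours do. -/
theorem mem_verts_of_le {x : Node n} {i j : ℕ} (hij : i ≤ j) (hi : x ∈ (layer Δ G i).verts)
    (hx : (∃ v, x = Sum.inl v ∧ v ∈ orig Δ G j) ∨ ∃ A, x = Sum.inr A ∧ A ⊆ orig Δ G j) :
    x ∈ (layer Δ G j).verts := by
  rcases hx with ⟨v, rfl, hv⟩ | ⟨A, rfl, hA⟩
  · exact mem_orig.1 hv
  · obtain ⟨w, hw, rfl⟩ := inr_mem_verts.1 hi
    refine inr_mem_verts.2 ⟨w, fun h => hw (orig_antitone hij h), ?_⟩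
    ext u
    constructor
    · intro hu
      exact Finset.mem_inter.2 ⟨(Finset.mem_inter.1 hu).1, hA hu⟩
    · intro hu
      rw [Finset.mem_inter] at hu ⊢
      exact ⟨hu.1, orig_antitone hij hu.2⟩

theorem mem_verts_of_between {x : Node n} {i j k : ℕ} (hij : i ≤ j) (hjk : j ≤ k)
    (hi : x ∈ (layer Δ G i).verts) (hk : x ∈ (layer Δ G k).verts) :
    x ∈ (layer Δ G j).verts := by
  refine mem_verts_of_le hij hi ?_
  rcases x with v | A
  · exact Or.inl ⟨v, rfl, orig_antitone hjk (mem_orig.2 hk)⟩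
  · exact Or.inr ⟨A, rfl, (subset_orig hk).trans (orig_antitone hjk)⟩

/-- The degrees of the original vertices of `Gᵢ` add up to a constant multiple of their number. -/
theorem sum_card_nbrs_le {t : ℕ} (hG : ¬ IsMinor (⊤ : SimpleGraph (Fin t)) G) (i : ℕ) :
    ∑ v ∈ orig Δ G i, ((layer Δ G i).nbrs (Sum.inl v)).card ≤
      degreeBound t * (orig Δ G i).card := by
  classical
  refine le_trans ?_ (sum_degrees_le t G hG (orig Δ G i))
  set O := orig Δ G i with hO
  set T := Oᶜ.image fun w => O.filter fun v => G.Adj w v with hT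
  have h1 : ∀ v ∈ O, ((layer Δ G i).nbrs (Sum.inl v)).card ≤
      (O.filter fun u => G.Adj v u).card + (T.filter fun A => v ∈ A).card := by
    intro v hv
    have hsub : (layer Δ G i).nbrs (Sum.inl v) ⊆ (O.filter fun u => G.Adj v u).image Sum.inl ∪
        (T.filter fun A => v ∈ A).image Sum.inr := by
      intro y hy
      rw [mem_nbrs hv] at hy
      rw [Finset.mem_union, Finset.mem_image, Finset.mem_image]
      rcases y with u | A
      · left
        exact ⟨u, Finset.mem_filter.2 ⟨mem_orig.2 hy.1, (mem_onb_inl.1 hy.2).symm⟩, rfl⟩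
      · right
        obtain ⟨w, hw, e⟩ := inr_mem_verts.1 hy.1
        refine ⟨A, Finset.mem_filter.2 ⟨?_, hy.2⟩, rfl⟩
        refine Finset.mem_image.2 ⟨w, Finset.mem_compl.2 hw, ?_⟩
        rw [e]
        ext u
        simp [hO, and_comm]
    refine (Finset.card_le_card hsub).trans ((Finset.card_union_le _ _).trans ?_)
    exact Nat.add_le_add Finset.card_image_le Finset.card_image_le
  refine (Finset.sum_le_sum h1).trans ?_
  rw [Finset.sum_add_distrib]
  refine Nat.add_le_add (le_of_eq ?_) ?_
  · rw [Finset.card_filter, Finset.sum_product]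
    simp only [Finset.card_filter]
  · have h2 : ∑ v ∈ O, (T.filter fun A => v ∈ A).card ≤ ∑ A ∈ T, A.card := by
      simp only [Finset.card_filter]
      rw [Finset.sum_comm]
      refine Finset.sum_le_sum fun A _ => ?_
      rw [← Finset.card_filter]
      exact Finset.card_le_card fun v hv => (Finset.mem_filter.1 hv).2
    refine h2.trans (le_of_eq (Finset.sum_congr ?_ fun _ _ => rfl))
    rw [hT]
    congr!

end ClosedForm

/-! ### Sparse hierarchies -/

/-- The sum of the degrees of the original vertices of each `Gᵢ` is at most `D` times their number,
and `Δ` is more than twice `D`. -/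
structure Sparse {n : ℕ} (Δ D : ℕ) (G : SimpleGraph (Fin n)) : Prop where
  pos : 1 ≤ n
  lt : 2 * D + 1 ≤ Δ
  sum_le : ∀ i, ∑ v ∈ orig Δ G i, ((layer Δ G i).nbrs (Sum.inl v)).card ≤
    D * (orig Δ G i).card

namespace Sparse

variable {n Δ D : ℕ} {G : SimpleGraph (Fin n)} (h : Sparse Δ D G)

include h

/-- Each original vertex of `Gᵢ₊₁` has degree at least `Δ > 2 * D` in `Gᵢ`. -/
theorem two_mul_card_orig_succ_le (i : ℕ) :
    2 * (orig Δ G (i + 1)).card ≤ (orig Δ G i).card := by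
  have h1 : Δ * (orig Δ G (i + 1)).card ≤
      ∑ v ∈ orig Δ G (i + 1), ((layer Δ G i).nbrs (Sum.inl v)).card := by
    rw [mul_comm, ← smul_eq_mul]
    exact Finset.card_nsmul_le_sum _ _ _ fun v hv => (mem_orig_succ.1 hv).2
  have h2 := h1.trans ((Finset.sum_le_sum_of_subset (orig_succ_subset i)).trans (h.sum_le i))
  have h3 := Nat.mul_le_mul_right (orig Δ G (i + 1)).card h.lt
  have h4 : D * (2 * (orig Δ G (i + 1)).card) ≤ D * (orig Δ G i).card := by nlinarith
  rcases Nat.eq_zero_or_pos D with hD | hD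
  · subst hD
    nlinarith
  · exact Nat.le_of_mul_le_mul_left h4 hD

theorem sum_card_orig_le (i : ℕ) :
    ∑ j ∈ Finset.range i, (orig Δ G j).card + 2 * (orig Δ G i).card ≤ 2 * n := by
  induction i with
  | zero => simp [orig_zero]
  | succ i ih =>
    have := h.two_mul_card_orig_succ_le i
    rw [Finset.sum_range_succ]
    omega

theorem verts_eq_iff {i : ℕ} : (layer Δ G i).verts = {zeroNode n} ↔ orig Δ G i = ∅ := by
  constructor
  · intro e
    ext v
    simp [e, zeroNode]
  · intro e
    ext x
    rcases x with v | A
    · rw [← mem_orig, e]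
      simp [zeroNode]
    · rw [inr_mem_verts, e]
      simp only [Finset.notMem_empty, not_false_eq_true, Finset.inter_empty, true_and, zeroNode,
        Finset.mem_singleton, Sum.inr.injEq]
      exact ⟨fun ⟨_, h⟩ => h, fun e => ⟨⟨0, h.pos⟩, e⟩⟩

theorem exists_orig_eq_empty : ∃ i, orig Δ G i = ∅ := by
  by_contra! hne
  have h1 := h.sum_card_orig_le (2 * n + 1)
  have h2 : ∑ _j ∈ Finset.range (2 * n + 1), 1 ≤
      ∑ j ∈ Finset.range (2 * n + 1), (orig Δ G j).card :=
    Finset.sum_le_sum fun j _ => Finset.card_pos.2 (hne j)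
  simp at h2
  omega

theorem orig_height : orig Δ G (height Δ G) = ∅ := by
  obtain ⟨i, hi⟩ := h.exists_orig_eq_empty
  have : height Δ G ∈ {i | (layer Δ G i).verts = {zeroNode n}} :=
    Nat.sInf_mem ⟨i, h.verts_eq_iff.2 hi⟩
  exact h.verts_eq_iff.1 this

theorem verts_height : (layer Δ G (height Δ G)).verts = {zeroNode n} :=
  h.verts_eq_iff.2 h.orig_height

theorem orig_nonempty {i : ℕ} (hi : i < height Δ G) : (orig Δ G i).Nonempty := by
  rw [Finset.nonempty_iff_ne_empty]
  intro e
  exact Nat.notMem_of_lt_sInf hi (h.verts_eq_iff.2 e)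

omit h in
theorem mem_nodes {x : Node n} : x ∈ nodes Δ G ↔ ∃ i ≤ height Δ G, x ∈ (layer Δ G i).verts := by
  simp [nodes]

theorem zeroNode_mem_nodes : zeroNode n ∈ nodes Δ G := by
  rw [mem_nodes]
  exact ⟨_, le_rfl, by simp [h.verts_height]⟩

omit h in
theorem inl_mem_nodes (v : Fin n) : Sum.inl v ∈ nodes Δ G := by
  rw [mem_nodes]
  exact ⟨0, Nat.zero_le _, by rw [← mem_orig, orig_zero]; simp⟩

omit h in
theorem le_level {x : Node n} {i : ℕ} (hi : i ≤ height Δ G) (hx : x ∈ (layer Δ G i).verts) :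
    i ≤ level Δ G x := by
  classical
  rw [level]
  exact Nat.le_findGreatest hi hx

omit h in
theorem level_le (x : Node n) : level Δ G x ≤ height Δ G := by
  classical
  rw [level]
  exact Nat.findGreatest_le _

omit h in
theorem mem_verts_level {x : Node n} (hx : x ∈ nodes Δ G) :
    x ∈ (layer Δ G (level Δ G x)).verts := by
  classical
  obtain ⟨i, hi, hxi⟩ := mem_nodes.1 hx
  rw [level]
  exact Nat.findGreatest_spec (P := fun i => x ∈ (layer Δ G i).verts) hi hxi

omit h in
theorem level_eq {x : Node n} {i : ℕ} (hi : i < height Δ G) (hx : x ∈ (layer Δ G i).verts)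
    (hx' : x ∉ (layer Δ G (i + 1)).verts) : level Δ G x = i := by
  refine le_antisymm ?_ (le_level hi.le hx)
  by_contra! hlt
  refine hx' (mem_verts_of_between (Nat.le_succ i) hlt hx (mem_verts_level ?_))
  exact mem_nodes.2 ⟨i, hi.le, hx⟩

theorem level_lt {x : Node n} (hx : x ∈ nodes Δ G) (hne : x ≠ zeroNode n) :
    level Δ G x < height Δ G := by
  refine lt_of_le_of_ne (level_le x) fun e => hne ?_
  have := mem_verts_level hx
  rwa [e, h.verts_height, Finset.mem_singleton] at this

theorem notMem_verts_level_succ {x : Node n} (hx : x ∈ nodes Δ G) (hne : x ≠ zeroNode n) :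
    x ∉ (layer Δ G (level Δ G x + 1)).verts := fun hx' =>
  absurd (le_level (h.level_lt hx hne) hx') (by omega)

theorem notMem_high_level {x : Node n} (hx : x ∈ nodes Δ G) (hne : x ≠ zeroNode n) :
    x ∉ (layer Δ G (level Δ G x)).high Δ := by
  intro hh
  obtain ⟨v, hv, rfl⟩ := mem_high_iff.1 hh
  exact h.notMem_verts_level_succ hx hne (mem_orig.1 hv)

omit h in
theorem mem_orig_iff {v : Fin n} {i : ℕ} (hi : i ≤ height Δ G) :
    v ∈ orig Δ G i ↔ i ≤ level Δ G (Sum.inl v) := by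
  constructor
  · exact fun hv => le_level hi (mem_orig.1 hv)
  · exact fun hle => orig_antitone hle (mem_orig.2 (mem_verts_level (inl_mem_nodes v)))

omit h in
theorem sv_eq {x : Node n} (hx : x ∈ nodes Δ G) :
    sv Δ G x = Sum.inr (onb G x ∩ orig Δ G (level Δ G x + 1)) := by
  rw [sv, trace_eq (mem_verts_level hx)]

theorem sv_mem_verts {x : Node n} (hx : x ∈ nodes Δ G) (hne : x ≠ zeroNode n) :
    sv Δ G x ∈ (layer Δ G (level Δ G x + 1)).verts := by
  rw [sv_eq hx, inr_mem_verts_succ]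
  exact ⟨x, mem_verts_level hx, h.notMem_high_level hx hne, rfl⟩

theorem sv_mem_nodes {x : Node n} (hx : x ∈ nodes Δ G) (hne : x ≠ zeroNode n) :
    sv Δ G x ∈ nodes Δ G :=
  mem_nodes.2 ⟨_, h.level_lt hx hne, h.sv_mem_verts hx hne⟩

omit h in
theorem inr_card_lt {A : Finset (Fin n)} (hA : Sum.inr A ∈ nodes Δ G) : A.card < Δ := by
  simp only [nodes, Finset.mem_biUnion, Finset.mem_range] at hA
  obtain ⟨i, -, hi⟩ := hA
  exact (layer_aux Δ G i A hi).2

end Sparse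

/-- A measure that decreases from each node to the supervertex that it points to. -/
def rank {n : ℕ} (Δ : ℕ) : Node n → ℕ
  | Sum.inl _ => Δ
  | Sum.inr A => A.card

namespace Sparse

variable {n Δ D : ℕ} {G : SimpleGraph (Fin n)} (h : Sparse Δ D G)

include h

/-- A supervertex with the same set of neighbours as `sv x` would persist, so that the level of `x`
would be higher. -/
theorem rank_sv_lt {x : Node n} (hx : x ∈ nodes Δ G) (hne : x ≠ zeroNode n) :
    rank Δ (sv Δ G x) < rank Δ x := by
  have h1 := h.sv_mem_nodes hx hne
  have h2 := h.sv_mem_verts hx hne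
  have h3 := h.notMem_verts_level_succ hx hne
  rw [sv_eq hx] at h1 h2 ⊢
  rcases x with v | A
  · exact inr_card_lt h1
  · refine Finset.card_lt_card (Finset.ssubset_iff_subset_ne.2 ⟨Finset.inter_subset_left, ?_⟩)
    intro e
    rw [e] at h2
    exact h3 h2

omit h in
theorem mem_nbr {v : Fin n} {y : Node n} :
    y ∈ nbr Δ G v ↔
      y ∈ (layer Δ G (level Δ G (Sum.inl v))).verts ∧ v ∈ onb G y := by
  rw [nbr, mem_nbrs (mem_orig.2 (mem_verts_level (inl_mem_nodes v)))]

omit h in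
theorem nbr_subset_nodes {v : Fin n} {y : Node n} (hy : y ∈ nbr Δ G v) : y ∈ nodes Δ G :=
  mem_nodes.2 ⟨_, level_le _, (mem_nbr.1 hy).1⟩

/-- In the last graph that contains it, a vertex has low degree. -/
theorem card_nbr_lt (v : Fin n) : (nbr Δ G v).card < Δ := by
  have h1 := h.notMem_high_level (inl_mem_nodes v) (by simp [zeroNode])
  rw [mem_high, not_and, not_le] at h1
  exact h1 (mem_verts_level (inl_mem_nodes v))

omit h in
/-- The lists `nbr` are the inverses of the sets that are counted by `nadj`. -/
theorem mem_nbr_iff {v : Fin n} {y : Node n} (hy : y ∈ nodes Δ G) :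
    y ∈ nbr Δ G v ↔ level Δ G (Sum.inl v) ≤ level Δ G y ∧
      ∃ j ≤ height Δ G, (layer Δ G j).graph.Adj y (Sum.inl v) := by
  rw [mem_nbr]
  have hv := mem_orig.2 (mem_verts_level (inl_mem_nodes (Δ := Δ) (G := G) v))
  constructor
  · intro hyv
    exact ⟨le_level (level_le _) hyv.1, _, level_le _, (adj_inl_iff hyv.1 hv).2 hyv.2⟩
  · rintro ⟨hle, j, hj, hadj⟩
    have hyj := adj_mem_verts hadj
    have hvj := mem_orig.2 (adj_mem_verts hadj.symm)
    refine ⟨mem_verts_of_between ((mem_orig_iff hj).1 hvj) hle hyj (mem_verts_level hy), ?_⟩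
    exact (adj_inl_iff hyj hvj).1 hadj

omit h in
open Classical in
/-- The number `nadj y` changes with the membership of `u` in `S` exactly for the nodes `y` in the
list of `u`. -/
theorem nadj_eq (S : Finset (Fin n)) {y : Node n} (hy : y ∈ nodes Δ G) :
    nadj Δ G S y = (S.filter fun u => y ∈ nbr Δ G u).card := by
  rw [nadj]
  congr 1
  ext u
  simp only [Finset.mem_filter, mem_nbr_iff hy]

end Sparse

/-! ### Counting undominated vertices along the pointers -/

section Undom

variable {n : ℕ} (Δ : ℕ) (G : SimpleGraph (Fin n))

/-- The nodes that contribute to the number `undom x` when the numbers `nadj` are given by `N`. -/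
noncomputable def children (N : Node n → ℕ) (x : Node n) : Finset (Node n) := by
  classical exact (nodes Δ G).filter fun w => w ≠ zeroNode n ∧ sv Δ G w = x ∧ N w = 0

/-- The node `x` contributes to the supervertex that it points to. -/
def Active (N : Node n → ℕ) (x : Node n) : Prop := x ≠ zeroNode n ∧ N x = 0

open Classical in
/-- The supervertex to which `x` contributes, if there is one. -/
noncomputable def target (N : Node n → ℕ) (x : Node n) : Option (Node n) :=
  if Active N x then some (sv Δ G x) else none

open Classical in
/-- The numbers `U` satisfy the equations of `undom` for the vertices `T` outside the dominating
set and the numbers `N` of adjacent dominating vertices, except that the equation at the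
supervertex `t`, if there is one, has the defect `q - p`. -/
structure UndomUpTo (T : Finset (Fin n)) (N U : Node n → ℕ) (t : Option (Node n)) (p q : ℕ) :
    Prop where
  inl : ∀ v : Fin n, U (Sum.inl v) = if v ∈ T then 1 else 0
  inr : ∀ A : Finset (Fin n), Sum.inr A ∈ nodes Δ G →
    U (Sum.inr A) + (if t = some (Sum.inr A) then p else 0) =
      ∑ w ∈ children Δ G N (Sum.inr A), U w + (if t = some (Sum.inr A) then q else 0)

/-- The numbers `U` satisfy the equations of `undom` for the vertices `T` outside the dominating
set and the numbers `N` of adjacent dominating vertices. -/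
structure Undom (T : Finset (Fin n)) (N U : Node n → ℕ) : Prop where
  inl : ∀ v : Fin n, U (Sum.inl v) = if v ∈ T then 1 else 0
  inr : ∀ A : Finset (Fin n), Sum.inr A ∈ nodes Δ G →
    U (Sum.inr A) = ∑ w ∈ children Δ G N (Sum.inr A), U w

variable {Δ G}

theorem isUndom_iff (S : Finset (Fin n)) (U : Node n → ℕ) :
    IsUndom Δ G S U ↔ Undom Δ G Sᶜ (nadj Δ G S) U := by
  constructor
  · rintro ⟨h1, h2⟩
    exact ⟨fun v => by rw [h1]; simp, fun A hA => by rw [h2 A hA, children]⟩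
  · rintro ⟨h1, h2⟩
    exact ⟨fun v => by rw [h1]; simp, fun A hA => by rw [h2 A hA, children]⟩

theorem mem_children {N : Node n → ℕ} {x w : Node n} :
    w ∈ children Δ G N x ↔ w ∈ nodes Δ G ∧ Active N w ∧ sv Δ G w = x := by
  simp only [children, Finset.mem_filter, Active]
  tauto

theorem mem_children_iff_target {N : Node n → ℕ} {x w : Node n} :
    w ∈ children Δ G N x ↔ w ∈ nodes Δ G ∧ target Δ G N w = some x := by
  rw [mem_children, target]
  refine and_congr_right fun _ => ?_
  split_ifs with hw <;> simp [hw]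

theorem UndomUpTo.undom {T : Finset (Fin n)} {N U : Node n → ℕ} {p q : ℕ}
    (hU : UndomUpTo Δ G T N U none p q) : Undom Δ G T N U :=
  ⟨hU.inl, fun A hA => by simpa using hU.inr A hA⟩

theorem Undom.upTo {T : Finset (Fin n)} {N U : Node n → ℕ} (hU : Undom Δ G T N U) :
    UndomUpTo Δ G T N U none 0 0 :=
  ⟨hU.inl, fun A hA => by rw [hU.inr A hA]⟩

theorem Undom.congr {T : Finset (Fin n)} {N N' U U' : Node n → ℕ} (hU : Undom Δ G T N U)
    (hN' : ∀ x ∈ nodes Δ G, N' x = N x) (hU' : ∀ x ∈ nodes Δ G, U' x = U x) :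
    Undom Δ G T N' U' := by
  refine ⟨fun v => by rw [hU' _ (Sparse.inl_mem_nodes v), hU.inl], fun A hA => ?_⟩
  rw [hU' _ hA, hU.inr A hA]
  refine Finset.sum_congr ?_ fun w hw => (hU' w (mem_children.1 hw).1).symm
  ext w
  rw [mem_children, mem_children]
  refine and_congr_right fun hw => ?_
  rw [Active, Active, hN' w hw]

open Classical in
/-- A change of the number at `t` affects the sum at the target of `t` only. -/
theorem sum_children_update {N U : Node n → ℕ} {t : Node n} (ht : t ∈ nodes Δ G) {b p q : ℕ}
    (hb : b + q = U t + p) (x : Node n) :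
    ∑ w ∈ children Δ G N x, Function.update U t b w +
        (if target Δ G N t = some x then q else 0) =
      ∑ w ∈ children Δ G N x, U w + (if target Δ G N t = some x then p else 0) := by
  by_cases hx : target Δ G N t = some x
  · have hm : t ∈ children Δ G N x := mem_children_iff_target.2 ⟨ht, hx⟩
    rw [if_pos hx, if_pos hx, ← Finset.add_sum_erase _ _ hm, ← Finset.add_sum_erase _ _ hm,
      Function.update_self]
    have : ∑ w ∈ (children Δ G N x).erase t, Function.update U t b w =
        ∑ w ∈ (children Δ G N x).erase t, U w :=
      Finset.sum_congr rfl fun w hw => Function.update_of_ne (Finset.ne_of_mem_erase hw) _ _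
    omega
  · rw [if_neg hx, if_neg hx]
    congr 1
    refine Finset.sum_congr rfl fun w hw => Function.update_of_ne ?_ _ _
    rintro rfl
    exact hx (mem_children_iff_target.1 hw).2

/-- One step of the propagation of a change along the pointers. -/
theorem UndomUpTo.step {D : ℕ} (h : Sparse Δ D G) {T : Finset (Fin n)} {N U : Node n → ℕ}
    {A : Finset (Fin n)} {p q b : ℕ} (hU : UndomUpTo Δ G T N U (some (Sum.inr A)) p q)
    (ht : Sum.inr A ∈ nodes Δ G) (hb : b + q = U (Sum.inr A) + p) :
    UndomUpTo Δ G T N (Function.update U (Sum.inr A) b) (target Δ G N (Sum.inr A)) p q := by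
  classical
  constructor
  · intro v
    rw [Function.update_of_ne (by simp), hU.inl]
  · intro A' hA'
    have h1 := sum_children_update (N := N) ht hb (Sum.inr A')
    have h2 := hU.inr A' hA'
    by_cases e : A = A'
    · subst e
      have h3 : ¬ target Δ G N (Sum.inr A) = some (Sum.inr A) := by
        intro e
        have hc := mem_children.1 (mem_children_iff_target.2 ⟨ht, e⟩)
        have := h.rank_sv_lt ht hc.2.1.1
        rw [hc.2.2] at this
        exact lt_irrefl _ this
      rw [if_neg h3, if_neg h3] at h1 ⊢
      rw [if_pos rfl, if_pos rfl] at h2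
      rw [Function.update_self]
      omega
    · have e' : ¬ (some (Sum.inr A : Node n) = some (Sum.inr A')) := by simpa using e
      rw [if_neg e', if_neg e'] at h2
      rw [Function.update_of_ne (by simpa using Ne.symm e)]
      split_ifs at h1 ⊢ <;> omega

/-- A change at an original vertex is a defect at the supervertex to which it contributes. -/
theorem Undom.update_inl {T T' : Finset (Fin n)} {N U : Node n → ℕ} (hU : Undom Δ G T N U)
    {v : Fin n} {b p q : ℕ} (hT : ∀ u, u ≠ v → (u ∈ T' ↔ u ∈ T))
    (hb : b = if v ∈ T' then 1 else 0) (hpq : b + q = U (Sum.inl v) + p) :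
    UndomUpTo Δ G T' N (Function.update U (Sum.inl v) b) (target Δ G N (Sum.inl v)) p q := by
  classical
  constructor
  · intro u
    by_cases hu : u = v
    · subst hu; rw [Function.update_self, hb]
    · rw [Function.update_of_ne (by simpa using hu), hU.inl]
      simp [hT u hu]
  · intro A hA
    have h1 := sum_children_update (Δ := Δ) (G := G) (N := N) (Sparse.inl_mem_nodes v) hpq
      (Sum.inr A)
    rw [Function.update_of_ne (by simp), hU.inr A hA]
    exact h1.symm

open Classical in
/-- If `y` is not active for `N'`, its contribution is missing from the sum at its target. -/
theorem sum_children_eq_add {N N' U : Node n → ℕ} {y : Node n} (hy : y ∈ nodes Δ G)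
    (hN : ∀ x, x ≠ y → N' x = N x) (hNy' : N' y ≠ 0) (x : Node n) :
    ∑ w ∈ children Δ G N x, U w =
      ∑ w ∈ children Δ G N' x, U w + (if target Δ G N y = some x then U y else 0) := by
  have hsub : children Δ G N' x = (children Δ G N x).erase y := by
    ext w
    rw [mem_children, Finset.mem_erase, mem_children, Active, Active]
    by_cases hw : w = y
    · subst hw; simp [hNy']
    · simp [hw, hN w hw]
  rw [hsub]
  by_cases hx : target Δ G N y = some x
  · rw [if_pos hx, Finset.sum_erase_add _ _ (mem_children_iff_target.2 ⟨hy, hx⟩)]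
  · rw [if_neg hx, Finset.erase_eq_of_notMem fun hm => hx (mem_children_iff_target.1 hm).2,
      add_zero]

/-- When a node stops being active, its contribution becomes a defect. -/
theorem Undom.deactivate {T : Finset (Fin n)} {N N' U : Node n → ℕ} (hU : Undom Δ G T N U)
    {y : Node n} (hy : y ∈ nodes Δ G) (hN : ∀ x, x ≠ y → N' x = N x) (hNy' : N' y ≠ 0) :
    UndomUpTo Δ G T N' U (target Δ G N y) 0 (U y) := by
  refine ⟨hU.inl, fun A hA => ?_⟩
  rw [hU.inr A hA, ite_self, add_zero, sum_children_eq_add hy hN hNy']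

/-- When a node becomes active, its contribution is missing. -/
theorem Undom.activate {T : Finset (Fin n)} {N N' U : Node n → ℕ} (hU : Undom Δ G T N U)
    {y : Node n} (hy : y ∈ nodes Δ G) (hN : ∀ x, x ≠ y → N' x = N x) (hNy : N y ≠ 0) :
    UndomUpTo Δ G T N' U (target Δ G N' y) (U y) 0 := by
  refine ⟨hU.inl, fun A hA => ?_⟩
  rw [hU.inr A hA, ite_self, add_zero,
    sum_children_eq_add hy (fun x hx => (hN x hx).symm) hNy]

/-- `Reach N v x`: the pointers lead from `v` to `x` through active nodes. -/
inductive Reach (Δ : ℕ) (G : SimpleGraph (Fin n)) (N : Node n → ℕ) (v : Fin n) : Node n → Prop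
  | refl : Reach Δ G N v (Sum.inl v)
  | step {w : Node n} : Reach Δ G N v w → Active N w → Reach Δ G N v (sv Δ G w)

section Reach

variable {D : ℕ} (h : Sparse Δ D G) {N : Node n → ℕ}

include h

theorem Reach.mem_nodes {v : Fin n} {x : Node n} (hr : Reach Δ G N v x) : x ∈ nodes Δ G := by
  induction hr with
  | refl => exact Sparse.inl_mem_nodes v
  | step _ ha ih => exact h.sv_mem_nodes ih ha.1

/-- Along the path of `v`, the rank decreases: the path does not return to a node. -/
theorem rank_iterate_lt {v : Fin n} {k m : ℕ} (hk : ∀ j < k + m + 1,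
    Reach Δ G N v ((sv Δ G)^[j] (Sum.inl v)) ∧ Active N ((sv Δ G)^[j] (Sum.inl v))) :
    rank Δ ((sv Δ G)^[k + m + 1] (Sum.inl v)) < rank Δ ((sv Δ G)^[k] (Sum.inl v)) := by
  have hstep : ∀ j < k + m + 1, rank Δ ((sv Δ G)^[j + 1] (Sum.inl v)) <
      rank Δ ((sv Δ G)^[j] (Sum.inl v)) := by
    intro j hj
    rw [Function.iterate_succ_apply']
    exact h.rank_sv_lt ((hk j hj).1.mem_nodes h) (hk j hj).2.1
  induction m with
  | zero => exact hstep k (by omega)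
  | succ m ih =>
    exact (hstep (k + m + 1) (by omega)).trans
      (ih (fun j hj => hk j (by omega)) fun j hj => hstep j (by omega))

omit h in
theorem Reach.exists_iterate {v : Fin n} {x : Node n} (hr : Reach Δ G N v x) :
    ∃ k, (sv Δ G)^[k] (Sum.inl v) = x ∧ ∀ j < k,
      Reach Δ G N v ((sv Δ G)^[j] (Sum.inl v)) ∧ Active N ((sv Δ G)^[j] (Sum.inl v)) := by
  induction hr with
  | refl => exact ⟨0, rfl, by simp⟩
  | @step w hw ha ih =>
    obtain ⟨k, rfl, hk⟩ := ih
    refine ⟨k + 1, Function.iterate_succ_apply' _ _ _, fun j hj => ?_⟩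
    rcases Nat.lt_succ_iff_lt_or_eq.1 hj with hj | rfl
    · exact hk j hj
    · exact ⟨hw, ha⟩

/-- Each vertex reaches a supervertex through at most one of its children. -/
theorem Reach.eq_of_sv_eq {v : Fin n} {x y : Node n} (hx : Reach Δ G N v x)
    (hy : Reach Δ G N v y) (hax : Active N x) (hay : Active N y) (e : sv Δ G x = sv Δ G y) :
    x = y := by
  obtain ⟨k, rfl, hk⟩ := hx.exists_iterate
  obtain ⟨l, rfl, hl⟩ := hy.exists_iterate
  rw [← Function.iterate_succ_apply' (sv Δ G), ← Function.iterate_succ_apply' (sv Δ G)] at e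
  rcases lt_trichotomy k l with hkl | rfl | hkl
  · exfalso
    obtain ⟨m, rfl⟩ := Nat.exists_eq_add_of_lt hkl
    have := rank_iterate_lt h (N := N) (v := v) (k := k + 1) (m := m) fun j hj => by
      rcases Nat.lt_succ_iff_lt_or_eq.1 (show j < (k + m + 1).succ by omega) with hj | rfl
      · exact hl j hj
      · exact ⟨hy, hay⟩
    rw [e, show k + 1 + m + 1 = (k + m + 1).succ by omega] at this
    exact lt_irrefl _ this
  · rfl
  · exfalso
    obtain ⟨m, rfl⟩ := Nat.exists_eq_add_of_lt hkl
    have := rank_iterate_lt h (N := N) (v := v) (k := l + 1) (m := m) fun j hj => by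
      rcases Nat.lt_succ_iff_lt_or_eq.1 (show j < (l + m + 1).succ by omega) with hj | rfl
      · exact hk j hj
      · exact ⟨hx, hax⟩
    rw [← e, show l + 1 + m + 1 = (l + m + 1).succ by omega] at this
    exact lt_irrefl _ this

open Classical in
/-- The vertices that reach `A` are divided by the last step of their paths. -/
theorem sum_card_reach (T : Finset (Fin n)) {A : Finset (Fin n)} :
    ∑ w ∈ children Δ G N (Sum.inr A), (T.filter fun v => Reach Δ G N v w).card =
      (T.filter fun v => Reach Δ G N v (Sum.inr A)).card := by
  rw [← Finset.card_biUnion]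
  · congr 1
    ext v
    simp only [Finset.mem_biUnion, Finset.mem_filter]
    constructor
    · rintro ⟨w, hw, hv, hr⟩
      rw [mem_children] at hw
      exact ⟨hv, hw.2.2 ▸ hr.step hw.2.1⟩
    · rintro ⟨hv, hr⟩
      obtain ⟨x, hx⟩ : ∃ x : Node n, x = Sum.inr A := ⟨_, rfl⟩
      rw [← hx] at hr
      cases hr with
      | refl => cases hx
      | @step w hw ha => exact ⟨w, mem_children.2 ⟨hw.mem_nodes h, ha, hx⟩, hv, hw⟩
  · intro x hx y hy hxy
    rw [Finset.mem_coe, mem_children] at hx hy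
    rw [Function.onFun, Finset.disjoint_left]
    intro v hvx hvy
    rw [Finset.mem_filter] at hvx hvy
    exact hxy (hvx.2.eq_of_sv_eq h hvy.2 hx.2.1 hy.2.1 (hx.2.2.trans hy.2.2.symm))

omit h in
theorem reach_inl_iff {u v : Fin n} : Reach Δ G N v (Sum.inl u) ↔ v = u := by
  constructor
  · intro hr
    obtain ⟨x, hx⟩ : ∃ x : Node n, x = Sum.inl u := ⟨_, rfl⟩
    rw [← hx] at hr
    cases hr with
    | refl => exact Sum.inl_injective hx
    | step _ _ => cases hx
  · rintro rfl
    exact Reach.refl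

/-- Induction along the pointers: the claim for a supervertex may be derived from the claim for its
children. -/
theorem rank_induction {P : Node n → Prop} (hinl : ∀ v, P (Sum.inl v))
    (hinr : ∀ A, Sum.inr A ∈ nodes Δ G → (∀ w ∈ children Δ G N (Sum.inr A), P w) →
      P (Sum.inr A)) {x : Node n} (hx : x ∈ nodes Δ G) : P x := by
  obtain ⟨m, hm⟩ : ∃ m, Δ - rank Δ x = m := ⟨_, rfl⟩
  induction m using Nat.strong_induction_on generalizing x with
  | _ m ih =>
    rcases x with v | A
    · exact hinl v
    · refine hinr A hx fun w hw => ?_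
      rw [mem_children] at hw
      have h1 := h.rank_sv_lt hw.1 hw.2.1.1
      have h2 := Sparse.inr_card_lt hx
      rw [hw.2.2] at h1
      have h3 : rank Δ (Sum.inr A : Node n) = A.card := rfl
      exact ih (Δ - rank Δ w) (by omega) hw.1 rfl

/-- While a number `p` is still to be added along the pointers, the numbers are at most those that
solve the equations, and fit into a word. -/
theorem UndomUpTo.le {T : Finset (Fin n)} {U : Node n → ℕ} {t : Option (Node n)}
    {p : ℕ} (hU : UndomUpTo Δ G T N U t p 0) {x : Node n} (hx : x ∈ nodes Δ G) : U x ≤ n := by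
  classical
  have key : U x ≤ (T.filter fun v => Reach Δ G N v x).card := by
    refine rank_induction h (N := N)
      (P := fun x => U x ≤ (T.filter fun v => Reach Δ G N v x).card) ?_ ?_ hx
    · intro v
      rw [hU.inl]
      split_ifs with hv
      · exact Finset.card_pos.2 ⟨v, Finset.mem_filter.2 ⟨hv, Reach.refl⟩⟩
      · exact Nat.zero_le _
    · intro A hA ih
      have := hU.inr A hA
      rw [ite_self, add_zero] at this
      rw [← sum_card_reach h]
      exact (Nat.le.intro this).trans (Finset.sum_le_sum ih)
  refine key.trans ((Finset.card_le_univ _).trans ?_)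
  simp

open Classical in
/-- The equations have a unique solution, which counts the vertices of `T` that reach `x`. -/
theorem Undom.eq_card {T : Finset (Fin n)} {U : Node n → ℕ} (hU : Undom Δ G T N U) {x : Node n}
    (hx : x ∈ nodes Δ G) : U x = (T.filter fun v => Reach Δ G N v x).card := by
  refine rank_induction h (N := N)
    (P := fun x => U x = (T.filter fun v => Reach Δ G N v x).card) ?_ ?_ hx
  · intro v
    rw [hU.inl]
    have : (T.filter fun u => Reach Δ G N u (Sum.inl v)) = T.filter fun u => u = v := by
      ext u
      rw [Finset.mem_filter, Finset.mem_filter, reach_inl_iff]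
    rw [this, Finset.filter_eq']
    split_ifs <;> simp
  · intro A hA ih
    rw [hU.inr A hA, ← sum_card_reach h]
    exact Finset.sum_congr rfl ih

theorem Undom.le {T : Finset (Fin n)} {U : Node n → ℕ} (hU : Undom Δ G T N U) {x : Node n}
    (hx : x ∈ nodes Δ G) : U x ≤ n :=
  hU.upTo.le h hx

/-- A vertex outside `S` is undominated if and only if no node on its path to the supervertex of
degree zero is adjacent to a vertex of `S` of at most its level: a neighbour of higher level is
also a neighbour of the next supervertex on the path. -/
theorem reach_zeroNode_iff (S : Finset (Fin n)) (v : Fin n) :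
    Reach Δ G (nadj Δ G S) v (zeroNode n) ↔ ∀ u ∈ S, ¬ G.Adj v u := by
  classical
  constructor
  · intro hr u hu hvu
    -- A neighbour `u` of `v` that belongs to `S` stays adjacent to the nodes on the path, up to the
    -- supervertex of degree zero, which is impossible.
    have key : ∀ w, Reach Δ G (nadj Δ G S) v w → u ∈ onb G w := by
      intro w hw
      induction hw with
      | refl => exact mem_onb_inl.2 hvu
      | @step w hw ha ih =>
        have hwn := hw.mem_nodes h
        rw [Sparse.sv_eq hwn, onb_inr, Finset.mem_inter]
        refine ⟨ih, (Sparse.mem_orig_iff (h.level_lt hwn ha.1)).2 ?_⟩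
        -- Otherwise `u` has at most the level of `w`, and is counted by `nadj w`.
        by_contra! hlt
        have h0 := ha.2
        rw [Sparse.nadj_eq S hwn, Finset.card_eq_zero, Finset.filter_eq_empty_iff] at h0
        refine h0 hu (Sparse.mem_nbr.2 ⟨?_, ih⟩)
        have hw1 := Sparse.mem_verts_level hwn
        rcases w with a | A
        · exact mem_orig.1 (orig_antitone (by omega) (mem_orig.2 hw1))
        · have h1 := (Sparse.mem_orig_iff (Sparse.level_le _)).1 (subset_orig hw1 ih)
          rwa [show level Δ G (Sum.inl u) = level Δ G (Sum.inr A) by omega]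
    have := key _ hr
    simp [zeroNode] at this
  · intro hv
    -- Conversely, the nodes on the path have no neighbours but those of `v`, so they are active.
    have h1 : ∀ w, Reach Δ G (nadj Δ G S) v w → onb G w ⊆ onb G (Sum.inl v) := by
      intro w hw
      induction hw with
      | refl => exact subset_rfl
      | @step w hw ha ih =>
        rw [Sparse.sv_eq (hw.mem_nodes h), onb_inr]
        exact Finset.inter_subset_left.trans ih
    have h2 : ∀ m w, rank Δ w = m → Reach Δ G (nadj Δ G S) v w →
        Reach Δ G (nadj Δ G S) v (zeroNode n) := by
      intro m
      induction m using Nat.strong_induction_on with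
      | _ m ih =>
        intro w hm hw
        by_cases hwz : w = zeroNode n
        · exact hwz ▸ hw
        have hwn := hw.mem_nodes h
        refine ih _ (hm ▸ h.rank_sv_lt hwn hwz) _ rfl (hw.step ⟨hwz, ?_⟩)
        rw [Sparse.nadj_eq S hwn, Finset.card_eq_zero, Finset.filter_eq_empty_iff]
        intro u hu hmem
        exact hv u hu (mem_onb_inl.1 (h1 w hw (Sparse.mem_nbr.1 hmem).2))
    exact h2 _ _ rfl Reach.refl

theorem Undom.zeroNode_eq {S : Finset (Fin n)} {U : Node n → ℕ}
    (hU : Undom Δ G Sᶜ (nadj Δ G S) U) : U (zeroNode n) = (undominated G S).card := by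
  classical
  rw [hU.eq_card h h.zeroNode_mem_nodes, undominated]
  congr 1
  ext v
  rw [Finset.mem_filter, Finset.mem_filter, reach_zeroNode_iff h]
  simp

end Reach
end Undom

/-! ### A program logic with time bounds -/

/-! Registers are used as follows: `0` holds the argument or the result, `1` the address of the
records, `2` the address of the record of the supervertex of degree zero, `3` the first free address,
`4` and `5` the length and the address of the list of the original vertices of the current graph, and
`6`, …, `11` are used by loops over this list and over arrays of neighbours. Register `12` is a
running address or counter of the loops that need one. The loop construct uses register `29`, and
access to a field of a record uses register `31`. The other registers are scratch. -/

section ProgramLogic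

namespace State

@[simp] theorem setReg_reg (s : State) (d x r : ℕ) :
    (s.setReg d x).reg r = if r = d then x else s.reg r := by
  simp [setReg, Function.update_apply]

@[simp] theorem setReg_mem (s : State) (d x : ℕ) : (s.setReg d x).mem = s.mem := rfl

@[simp] theorem setMem_reg (s : State) (a x : ℕ) : (s.setMem a x).reg = s.reg := rfl

@[simp] theorem setMem_mem (s : State) (a x : ℕ) :
    (s.setMem a x).mem = Function.update s.mem a x := rfl

end State

namespace Prog

/-- A condition on the state `s` that ensures that a program without loops halts in a state that
satisfies `P`. -/
def wp (B : ℕ) : Prog → State → (State → Prop) → Prop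
  | skip, s, P => P s
  | const d c, s, P => c < B ∧ P (s.setReg d c)
  | move d a, s, P => s.reg a < B ∧ P (s.setReg d (s.reg a))
  | add d a b, s, P => s.reg a + s.reg b < B ∧ P (s.setReg d (s.reg a + s.reg b))
  | sub d a b, s, P => s.reg a - s.reg b < B ∧ P (s.setReg d (s.reg a - s.reg b))
  | load d a, s, P => s.reg a < B ∧ s.mem (s.reg a) < B ∧ P (s.setReg d (s.mem (s.reg a)))
  | store a b, s, P => s.reg a < B ∧ s.reg b < B ∧ P (s.setMem (s.reg a) (s.reg b))
  | seq p q, s, P => p.wp B s fun s' => q.wp B s' P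
  | ite a b p q, s, P =>
    (s.reg a < s.reg b → p.wp B s P) ∧ (¬ s.reg a < s.reg b → q.wp B s P)
  | loop _ _ _, _, _ => False

/-- A bound on the number of steps of a program without loops. -/
def cost : Prog → ℕ
  | seq p q => p.cost + q.cost
  | ite _ _ p q => max p.cost q.cost + 1
  | _ => 1

/-- The program has no instruction that writes to register `r`. -/
def keeps : Prog → ℕ → Bool
  | skip, _ => true
  | const d _, r => r != d
  | move d _, r => r != d
  | add d _ _, r => r != d
  | sub d _ _, r => r != d
  | load d _, r => r != d
  | store _ _, _ => true
  | seq p q, r => p.keeps r && q.keeps r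
  | ite _ _ p q, r => p.keeps r && q.keeps r
  | loop _ _ p, r => p.keeps r

end Prog

theorem Exec.reg_eq {B : ℕ} {p : Prog} {s s' : State} {t : ℕ} (h : Exec B p s t s') {r : ℕ}
    (hr : p.keeps r = true) : s'.reg r = s.reg r := by
  induction h with
  | skip => rfl
  | store => rfl
  | seq _ _ ih1 ih2 =>
    simp only [Prog.keeps, Bool.and_eq_true] at hr
    rw [ih2 hr.2, ih1 hr.1]
  | ite_true _ _ ih =>
    simp only [Prog.keeps, Bool.and_eq_true] at hr
    exact ih hr.1
  | ite_false _ _ ih =>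
    simp only [Prog.keeps, Bool.and_eq_true] at hr
    exact ih hr.2
  | loop_true _ _ _ ih1 ih2 => rw [ih2 hr, ih1 hr]
  | loop_false => rfl
  | _ =>
    simp only [Prog.keeps, bne_iff_ne, ne_eq] at hr
    simp [hr]

theorem RunsTo.mono {B : ℕ} {p : Prog} {s : State} {T T' : ℕ} {P P' : State → Prop}
    (h : RunsTo B p s T P) (hT : T ≤ T') (hP : ∀ s', P s' → P' s') : RunsTo B p s T' P' := by
  obtain ⟨t, s', ht, he, hs⟩ := h
  exact ⟨t, s', ht.trans hT, he, hP s' hs⟩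

theorem RunsTo.frame {B : ℕ} {p : Prog} {s : State} {T : ℕ} {P : State → Prop}
    (h : RunsTo B p s T P) :
    RunsTo B p s T fun s' => P s' ∧ ∀ r, p.keeps r = true → s'.reg r = s.reg r := by
  obtain ⟨t, s', ht, he, hs⟩ := h
  exact ⟨t, s', ht, he, hs, fun r hr => he.reg_eq hr⟩

theorem RunsTo.seq {B : ℕ} {p q : Prog} {s : State} {T T' : ℕ} {P Q : State → Prop}
    (h : RunsTo B p s T Q) (h' : ∀ s', Q s' → RunsTo B q s' T' P) :
    RunsTo B (.seq p q) s (T + T') P := by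
  obtain ⟨t, s', ht, he, hs⟩ := h
  obtain ⟨t', s'', ht', he', hs'⟩ := h' s' hs
  exact ⟨t + t', s'', by omega, he.seq he', hs'⟩

theorem RunsTo.of_wp {B : ℕ} {p : Prog} {s : State} {P : State → Prop} (h : p.wp B s P) :
    RunsTo B p s p.cost P := by
  induction p generalizing s P with
  | skip => exact ⟨1, s, le_rfl, .skip s, h⟩
  | const d c => exact ⟨1, _, le_rfl, .const s d c h.1, h.2⟩
  | move d a => exact ⟨1, _, le_rfl, .move s d a h.1, h.2⟩
  | add d a b => exact ⟨1, _, le_rfl, .add s d a b h.1, h.2⟩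
  | sub d a b => exact ⟨1, _, le_rfl, .sub s d a b h.1, h.2⟩
  | load d a => exact ⟨1, _, le_rfl, .load s d a h.1 h.2.1, h.2.2⟩
  | store a b => exact ⟨1, _, le_rfl, .store s a b h.1 h.2.1, h.2.2⟩
  | seq p q ihp ihq => exact (ihp h).seq fun s' hs' => ihq hs'
  | ite a b p q ihp ihq =>
    by_cases hc : s.reg a < s.reg b
    · obtain ⟨t, s', ht, he, hs⟩ := ihp (h.1 hc)
      exact ⟨t + 1, s', by simp only [Prog.cost]; omega, .ite_true hc he, hs⟩
    · obtain ⟨t, s', ht, he, hs⟩ := ihq (h.2 hc)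
      exact ⟨t + 1, s', by simp only [Prog.cost]; omega, .ite_false hc he, hs⟩
  | loop => exact h.elim

/-- A loop with a variant: if each iteration decreases the index of the invariant `I`, the loop
ends. -/
theorem RunsTo.while {B a b : ℕ} {p : Prog} {P : State → Prop} {T : ℕ} (I : ℕ → State → Prop)
    (hstep : ∀ k s, I k s → s.reg a < s.reg b →
      RunsTo B p s T fun s' => ∃ k' < k, I k' s')
    (hend : ∀ k s, I k s → ¬ s.reg a < s.reg b → P s) {k : ℕ} {s : State} (h : I k s) :
    RunsTo B (.loop a b p) s (k * (T + 1) + 1) P := by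
  induction k using Nat.strong_induction_on generalizing s with
  | _ k ih =>
    by_cases hc : s.reg a < s.reg b
    · obtain ⟨t, s', ht, he, k', hk', hs'⟩ := hstep k s h hc
      obtain ⟨t', s'', ht', he', hs''⟩ := ih k' hk' hs'
      refine ⟨t + t' + 1, s'', ?_, .loop_true hc he he', hs''⟩
      have : (k' + 1) * (T + 1) ≤ k * (T + 1) := Nat.mul_le_mul_right _ hk'
      rw [Nat.add_mul] at this
      omega
    · exact ⟨1, s, by omega, .loop_false hc, hend k s h hc⟩

/-- A loop whose number of iterations is known in advance. -/
theorem RunsTo.loop {B a b : ℕ} {p : Prog} {N : ℕ} {c : ℕ → ℕ} (I : ℕ → State → Prop)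
    (hlt : ∀ k ≤ N, ∀ s, I k s → (s.reg a < s.reg b ↔ k < N))
    (hstep : ∀ k < N, ∀ s, I k s → RunsTo B p s (c k) (I (k + 1))) {s : State} (h : I 0 s) :
    RunsTo B (.loop a b p) s (∑ k ∈ Finset.range N, (c k + 1) + 1) (I N) := by
  have key : ∀ m ≤ N, ∀ s, I (N - m) s →
      RunsTo B (.loop a b p) s (∑ k ∈ Finset.Ico (N - m) N, (c k + 1) + 1) (I N) := by
    intro m
    induction m with
    | zero =>
      intro _ s hs
      rw [Nat.sub_zero] at hs
      refine ⟨1, s, by simp, .loop_false ?_, hs⟩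
      rw [hlt N le_rfl s hs]
      exact lt_irrefl N
    | succ m ih =>
      intro hm s hs
      have hk : N - (m + 1) < N := by omega
      obtain ⟨t, s', ht, he, hs'⟩ := hstep _ hk s hs
      have e : N - (m + 1) + 1 = N - m := by omega
      rw [e] at hs'
      obtain ⟨t', s'', ht', he', hs''⟩ := ih (by omega) s' hs'
      refine ⟨t + t' + 1, s'', ?_, .loop_true ((hlt _ hk.le s hs).2 hk) he he', hs''⟩
      rw [Finset.sum_eq_sum_Ico_succ_bot hk, e]
      omega
  have := key N le_rfl s (by simpa using h)
  simpa using this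

/-- `for i < n do p`, for registers `i` and `n`. -/
def Prog.for (i n : ℕ) (p : Prog) : Prog :=
  .seq (.const i 0) (.loop i n (.seq p (.seq (.const 29 1) (.add i i 29))))

/-- The rule for counted loops. The invariant may refer to the memory and to the registers `3` and
`12`, which the bodies of loops may advance. -/
theorem RunsTo.for {B i n : ℕ} {p : Prog} {s : State} {N : ℕ} {c : ℕ → ℕ}
    (I : ℕ → (ℕ → ℕ) → ℕ → ℕ → Prop)
    (hi : i ≠ 29 ∧ i ≠ 3 ∧ i ≠ 12 ∧ n ≠ i ∧ n ≠ 29 ∧ p.keeps i = true ∧ p.keeps n = true)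
    (hn : s.reg n = N) (hB : N < B) (h1 : 1 < B)
    (h0 : I 0 s.mem (s.reg 3) (s.reg 12))
    (hstep : ∀ k < N, ∀ s' : State, (∀ r, (Prog.for i n p).keeps r = true → s'.reg r = s.reg r) →
      s'.reg i = k → I k s'.mem (s'.reg 3) (s'.reg 12) →
      RunsTo B p s' (c k) fun s'' => I (k + 1) s''.mem (s''.reg 3) (s''.reg 12)) :
    RunsTo B (.for i n p) s (∑ k ∈ Finset.range N, (c k + 3) + 2)
      fun s' => I N s'.mem (s'.reg 3) (s'.reg 12) := by
  obtain ⟨hi29, hi3, hi12, hni, hn29, hpi, hpn⟩ := hi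
  have h3 : (3 : ℕ) ≠ i := Ne.symm hi3
  have h12 : (12 : ℕ) ≠ i := Ne.symm hi12
  have hinit : RunsTo B (.const i 0) s 1 fun s' => s' = s.setReg i 0 :=
    RunsTo.of_wp (p := .const i 0) ⟨by omega, rfl⟩
  refine (hinit.seq (T' := ∑ k ∈ Finset.range N, (c k + 3) + 1) fun s1 hs1 => ?_).mono
    (by omega) fun s' h => h
  subst hs1
  have hloop := RunsTo.loop (B := B) (a := i) (b := n)
    (p := .seq p (.seq (.const 29 1) (.add i i 29))) (N := N) (c := fun k => c k + 2)
    (fun k s' => s'.reg i = k ∧ (∀ r, (Prog.for i n p).keeps r = true → s'.reg r = s.reg r) ∧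
      s'.reg n = N ∧ I k s'.mem (s'.reg 3) (s'.reg 12)) ?_ ?_ (s := s.setReg i 0) ?_
  · exact hloop.mono le_rfl fun s' h => h.2.2.2
  · rintro k - s' ⟨h1, -, h2, -⟩
    rw [h1, h2]
  · rintro k hk s' ⟨hk1, hk2, hk3, hk4⟩
    refine ((hstep k hk s' hk2 hk1 hk4).frame.seq (T' := 2)
      (Q := fun s'' => I (k + 1) s''.mem (s''.reg 3) (s''.reg 12) ∧
        ∀ r, p.keeps r = true → s''.reg r = s'.reg r) fun s'' hs'' => ?_)
    refine RunsTo.of_wp (p := .seq (.const 29 1) (.add i i 29)) ?_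
    have e := hs''.2 i hpi
    have e' := hs''.2 n hpn
    simp only [Prog.wp, State.setReg_reg, State.setReg_mem, hi29, if_false, if_true, e, hk1, h3,
      h12, hni, hn29, e', hk3, true_and]
    refine ⟨h1, by omega, ?_, by simpa using hs''.1⟩
    intro r hr
    have hr' := hr
    simp only [Prog.for, Prog.keeps, Bool.and_eq_true, bne_iff_ne, ne_eq] at hr'
    rw [if_neg hr'.1, if_neg hr'.2.2.1, hs''.2 r hr'.2.1, hk2 r hr]
  · refine ⟨by simp, ?_, by simp [hni, hn], by simpa [h3, h12] using h0⟩
    intro r hr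
    simp only [Prog.for, Prog.keeps, Bool.and_eq_true, bne_iff_ne, ne_eq] at hr
    simp [hr.1]

/-- Put the field `i` of the record at the address in register `a` into register `d`. -/
def Prog.getF (d a i : ℕ) : Prog := .seq (.const 31 i) (.seq (.add 31 a 31) (.load d 31))

/-- Put register `b` into the field `i` of the record at the address in register `a`. -/
def Prog.setF (a i b : ℕ) : Prog := .seq (.const 31 i) (.seq (.add 31 a 31) (.store 31 b))

/-- Branch on the equality of two registers. -/
def Prog.ifEq (a b : ℕ) (p q : Prog) : Prog := .ite a b q (.ite b a q p)

theorem wp_ifEq {B a b : ℕ} {p q : Prog} {s : State} {P : State → Prop} :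
    (Prog.ifEq a b p q).wp B s P ↔
      (s.reg a = s.reg b → p.wp B s P) ∧ (s.reg a ≠ s.reg b → q.wp B s P) := by
  simp only [Prog.ifEq, Prog.wp]
  constructor
  · rintro ⟨h1, h2⟩
    refine ⟨fun e => (h2 (by omega)).2 (by omega), fun e => ?_⟩
    rcases Nat.lt_or_gt_of_ne e with h | h
    · exact h1 h
    · exact (h2 (by omega)).1 h
  · rintro ⟨h1, h2⟩
    exact ⟨fun e => h2 (by omega), fun e => ⟨fun e' => h2 (by omega), fun e' => h1 (by omega)⟩⟩

end ProgramLogic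

/-! ### Records -/

section Records

/-- The field `i` of the record with number `j`, as a function of `j`. Records have 16 cells and
the first one is at address `b`. The fields hold
* `0`: the pointer to the record of `sv x`;
* `1`, `2`: the numbers `nadj x` and `undom x`;
* `3`, `4`: for vertices, the address and the length of the array of neighbours;

and, for the construction of the hierarchy only,
* `5`: the pointer from a node of low degree to the record of its class;
* `6`: the degree of a supervertex, and `Δ` for a vertex;
* `7`, `8`: for a class, the vertex by which it was split last, and the part that was split off;
* `9`: for a class, the record of the supervertex that it becomes;
* `10`: a mark that prevents double entries in an array;
* `11`: the indicator of high degree;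
* `12`: for vertices, the indicator of the given set. -/
def fld (b : ℕ) (m : ℕ → ℕ) (i j : ℕ) : ℕ := m (b + 16 * j + i)

theorem fld_update_self (b : ℕ) (m : ℕ → ℕ) (i j x : ℕ) :
    fld b (Function.update m (b + 16 * j + i) x) i = Function.update (fld b m i) j x := by
  funext k
  simp only [fld, Function.update_apply]
  congr 1
  simp

theorem fld_update_of_ne {b i i' : ℕ} (m : ℕ → ℕ) (j x : ℕ) (h : i' ≠ i) (hi : i < 16)
    (hi' : i' < 16) :
    fld b (Function.update m (b + 16 * j + i) x) i' = fld b m i' := by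
  funext k
  simp only [fld]
  exact Function.update_of_ne (by omega) _ _

theorem fld_update_raw {b a : ℕ} (m : ℕ → ℕ) (i x : ℕ) (h : a < b) :
    fld b (Function.update m a x) i = fld b m i := by
  funext k
  simp only [fld]
  exact Function.update_of_ne (by omega) _ _

theorem update_fld_raw {b a : ℕ} (m : ℕ → ℕ) (i j x : ℕ) (h : a < b) :
    Function.update m (b + 16 * j + i) x a = m a :=
  Function.update_of_ne (by omega) _ _

variable {B b : ℕ} {s : State} {P : State → Prop}

theorem wp_getF {d a i j : ℕ} (ha : s.reg a = b + 16 * j) (ha' : a ≠ 31)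
    (hb : b + 16 * j + 16 ≤ B) (hi : i < 16) (hv : fld b s.mem i j < B)
    (hP : P ((s.setReg 31 (b + 16 * j + i)).setReg d (fld b s.mem i j))) :
    (Prog.getF d a i).wp B s P := by
  simp only [Prog.getF, Prog.wp, State.setReg_reg, State.setReg_mem, if_true, ha', if_false, ha]
  have e : fld b s.mem i j = s.mem (b + 16 * j + i) := rfl
  rw [e] at hv hP
  refine ⟨by omega, by omega, by omega, hv, ?_⟩
  convert hP using 2
  simp only [State.setReg, State.mk.injEq, and_true]
  exact Function.update_idem _ _ _

theorem wp_setF {a i c j : ℕ} (ha : s.reg a = b + 16 * j) (ha' : a ≠ 31) (hc : c ≠ 31)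
    (hb : b + 16 * j + 16 ≤ B) (hi : i < 16) (hv : s.reg c < B)
    (hP : P ((s.setReg 31 (b + 16 * j + i)).setMem (b + 16 * j + i) (s.reg c))) :
    (Prog.setF a i c).wp B s P := by
  simp only [Prog.setF, Prog.wp, State.setReg_reg, if_true, ha', if_false, ha, hc]
  refine ⟨by omega, by omega, by omega, hv, ?_⟩
  convert hP using 2
  simp only [State.setReg, State.mk.injEq, and_true]
  exact Function.update_idem _ _ _

end Records

/-! ### Updates and queries -/

section Dynamic

variable {n : ℕ} (Δ : ℕ) (G : SimpleGraph (Fin n))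

/-- The part of the memory `m` that does not depend on the dominating set: the pointers and the
lists of neighbours. The record of `x` has number `id x`, and the array for `v` starts at
address `start v`. -/
structure Static (B b : ℕ) (id : Node n → ℕ) (start : Fin n → ℕ) (L : Fin n → List (Node n))
    (m : ℕ → ℕ) : Prop where
  lt_b : n < b
  id_inl : ∀ v : Fin n, id (Sum.inl v) = v
  id_zero : id (zeroNode n) = n
  id_inj : ∀ x ∈ nodes Δ G, ∀ y ∈ nodes Δ G, id x = id y → x = y
  id_le : ∀ x ∈ nodes Δ G, b + 16 * id x + 16 ≤ B
  sv : ∀ x ∈ nodes Δ G, x ≠ zeroNode n → fld b m 0 (id x) = b + 16 * id (sv Δ G x)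
  sv_zero : fld b m 0 n = 0
  start_eq : ∀ v : Fin n, fld b m 3 v = start v
  length_eq : ∀ v : Fin n, fld b m 4 v = (L v).length
  nodup : ∀ v, (L v).Nodup
  mem_list : ∀ v y, y ∈ L v ↔ y ∈ nbr Δ G v
  array : ∀ v (k : ℕ) (hk : k < (L v).length), m (start v + k) = b + 16 * id ((L v)[k])
  lt_start : ∀ v, n < start v
  start_le : ∀ v, start v + (L v).length ≤ b

/-- The memory `m` agrees with `m₀`, up to the indicator array of the dominating set and the fields
for `nadj` and `undom`, which hold the numbers `N` and `U`. -/
structure Holds (b : ℕ) (id : Node n → ℕ) (m₀ m : ℕ → ℕ) (N U : Node n → ℕ) : Prop where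
  nadj : ∀ x ∈ nodes Δ G, fld b m 1 (id x) = N x
  undom : ∀ x ∈ nodes Δ G, fld b m 2 (id x) = U x
  other : ∀ i < 16, i ≠ 1 → i ≠ 2 → fld b m i = fld b m₀ i
  raw : ∀ a < b, a = 0 ∨ n < a → m a = m₀ a

/-- The indicator array of `S`. -/
def Indicates (S : Finset (Fin n)) (m : ℕ → ℕ) : Prop :=
  ∀ v : Fin n, m (1 + v) = if v ∈ S then 1 else 0

variable {Δ G} {B b : ℕ} {id : Node n → ℕ} {start : Fin n → ℕ} {L : Fin n → List (Node n)}
  {m₀ m : ℕ → ℕ} {N U : Node n → ℕ}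

theorem Holds.setU (hs : Static Δ G B b id start L m₀) (h : Holds Δ G b id m₀ m N U)
    {t : Node n} (ht : t ∈ nodes Δ G) (x : ℕ) :
    Holds Δ G b id m₀ (Function.update m (b + 16 * id t + 2) x) N (Function.update U t x) := by
  refine ⟨fun y hy => ?_, fun y hy => ?_, fun i hi h1 h2 => ?_, fun a ha h0 => ?_⟩
  · rw [fld_update_of_ne _ _ _ (by norm_num) (by norm_num) (by norm_num), h.nadj y hy]
  · rw [fld_update_self]
    by_cases e : y = t
    · rw [e, Function.update_self, Function.update_self]
    · rw [Function.update_of_ne e, Function.update_of_ne fun e' => e (hs.id_inj y hy t ht e'),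
        h.undom y hy]
  · rw [fld_update_of_ne _ _ _ h2 (by norm_num) hi, h.other i hi h1 h2]
  · rw [update_fld_raw _ _ _ _ ha, h.raw a ha h0]

theorem Holds.setN (hs : Static Δ G B b id start L m₀) (h : Holds Δ G b id m₀ m N U)
    {t : Node n} (ht : t ∈ nodes Δ G) (x : ℕ) :
    Holds Δ G b id m₀ (Function.update m (b + 16 * id t + 1) x) (Function.update N t x) U := by
  refine ⟨fun y hy => ?_, fun y hy => ?_, fun i hi h1 h2 => ?_, fun a ha h0 => ?_⟩
  · rw [fld_update_self]
    by_cases e : y = t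
    · rw [e, Function.update_self, Function.update_self]
    · rw [Function.update_of_ne e, Function.update_of_ne fun e' => e (hs.id_inj y hy t ht e'),
        h.nadj y hy]
  · rw [fld_update_of_ne _ _ _ (by norm_num) (by norm_num) (by norm_num), h.undom y hy]
  · rw [fld_update_of_ne _ _ _ h1 (by norm_num) hi, h.other i hi h1 h2]
  · rw [update_fld_raw _ _ _ _ ha, h.raw a ha h0]

theorem Holds.setBit (hs : Static Δ G B b id start L m₀) (h : Holds Δ G b id m₀ m N U)
    (v : Fin n) (x : ℕ) :
    Holds Δ G b id m₀ (Function.update m (1 + v) x) N U := by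
  have hv : 1 + (v : ℕ) < b := by have := hs.lt_b; omega
  refine ⟨fun y hy => ?_, fun y hy => ?_, fun i hi h1 h2 => ?_, fun a ha h0 => ?_⟩
  · rw [fld_update_raw _ _ _ hv, h.nadj y hy]
  · rw [fld_update_raw _ _ _ hv, h.undom y hy]
  · rw [fld_update_raw _ _ _ hv, h.other i hi h1 h2]
  · rw [Function.update_of_ne (by omega), h.raw a ha h0]

theorem Indicates.update_fld {S : Finset (Fin n)} (h : Indicates S m) (hb : n < b)
    (i j x : ℕ) : Indicates S (Function.update m (b + 16 * j + i) x) := fun v => by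
  rw [update_fld_raw _ _ _ _ (by omega), h v]

/-- Put into register `16` the address of the supervertex to which the node at the address in
register `14` contributes, or `0` if there is none. -/
def findTarget : Prog :=
  .seq (.getF 16 14 1) (.seq (.const 30 0) (.ite 30 16 (.const 16 0) (.getF 16 14 0)))

/-- Change the numbers `undom` along the active path that starts at the node at the address in
register `16`; `op` is addition or subtraction of the number in register `15`. -/
def propagate (op : Prog) : Prog :=
  .seq (.const 30 0) (.loop 30 16 (.seq (.getF 17 16 2) (.seq op (.seq (.setF 16 2 17)
    (.seq (.move 14 16) findTarget)))))

/-- The address of a node, or `0`. -/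
def optAddr (b : ℕ) (id : Node n → ℕ) : Option (Node n) → ℕ
  | none => 0
  | some x => b + 16 * id x

/-- The address that `findTarget` leaves in register `16`. -/
theorem findTarget_wp (hs : Static Δ G B b id start L m₀) (h : Holds Δ G b id m₀ m N U)
    (hN : ∀ x ∈ nodes Δ G, N x < B) {D : ℕ} (hG : Sparse Δ D G) {s : State} (hm : s.mem = m)
    {x : Node n} (hx : x ∈ nodes Δ G) (h14 : s.reg 14 = b + 16 * id x) {P : State → Prop}
    (hP : ∀ s', s'.mem = m → s'.reg 16 = optAddr b id (target Δ G N x) → s'.reg 30 = 0 →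
      (∀ r, r ≠ 16 → r ≠ 30 → r ≠ 31 → s'.reg r = s.reg r) → P s') :
    findTarget.wp B s P := by
  subst hm
  have hBx := hs.id_le x hx
  have hb : 0 < b := by have := hs.lt_b; omega
  have h1 : fld b s.mem 1 (id x) = N x := h.nadj x hx
  have h0 := h.other 0 (by norm_num) (by norm_num) (by norm_num)
  refine wp_getF h14 (by norm_num) hBx (by norm_num) (by rw [h1]; exact hN x hx) ?_
  simp only [Prog.wp, State.setReg_reg, h1]
  norm_num
  refine ⟨by omega, fun hpos => ⟨by omega, ?_⟩, fun hz => ?_⟩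
  · refine hP _ (by simp) ?_ (by simp) ?_
    · rw [target, if_neg fun ha => by have := ha.2; omega]
      simp [optAddr]
    · intro r h16 h30 h31; simp [h16, h30, h31]
  · by_cases hxz : x = zeroNode n
    · have hv : fld b s.mem 0 (id x) = 0 := by rw [h0, hxz, hs.id_zero, hs.sv_zero]
      refine wp_getF (j := id x) (b := b) (by simp [h14]) (by norm_num) hBx (by norm_num)
        (by simp only [State.setReg_mem, hv]; omega) ?_
      refine hP _ (by simp) ?_ (by simp) ?_
      · rw [target, if_neg fun ha => ha.1 hxz]
        simp [optAddr, hv]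
      · intro r h16 h30 h31; simp [h16, h30, h31]
    · have hv : fld b s.mem 0 (id x) = b + 16 * id (sv Δ G x) := by rw [h0, hs.sv x hx hxz]
      have := hs.id_le _ (hG.sv_mem_nodes hx hxz)
      refine wp_getF (j := id x) (b := b) (by simp [h14]) (by norm_num) hBx (by norm_num)
        (by simp only [State.setReg_mem, hv]; omega) ?_
      refine hP _ (by simp) ?_ (by simp) ?_
      · rw [target, if_pos ⟨hxz, hz⟩]
        simp [optAddr, hv]
      · intro r h16 h30 h31; simp [h16, h30, h31]

/-- A bound for the time of `propagate`. -/
def propagateTime (Δ : ℕ) : ℕ := (Δ + 1) * 30 + 2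

/-- The walk along the pointers repairs the counts `U`. It starts at the node `t`, where the change
of size `a` has to be applied, and takes at most `Δ + 1` steps, since every pointer leads to a
supervertex of smaller degree. -/
theorem propagate_spec (hs : Static Δ G B b id start L m₀) {D : ℕ} (hG : Sparse Δ D G)
    (hN : ∀ x ∈ nodes Δ G, N x < B) {op : Prog} {T : Finset (Fin n)} {p q a : ℕ}
    (hop : (op = .add 17 17 15 ∧ p = a ∧ q = 0) ∨ (op = .sub 17 17 15 ∧ p = 0 ∧ q = a))
    (hU : ∀ x ∈ nodes Δ G, U x ≤ n) {t : Option (Node n)}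
    (ht : ∀ x ∈ t, ∃ A, x = Sum.inr A ∧ x ∈ nodes Δ G)
    {S : Finset (Fin n)} {s : State} (h : Holds Δ G b id m₀ s.mem N U) (hS : Indicates S s.mem)
    (hu : UndomUpTo Δ G T N U t p q) (h16 : s.reg 16 = optAddr b id t) (h15 : s.reg 15 = a) :
    RunsTo B (propagate op) s (propagateTime Δ) fun s' => ∃ U',
      Holds Δ G b id m₀ s'.mem N U' ∧ Indicates S s'.mem ∧ Undom Δ G T N U' := by
  have hb := hs.lt_b
  have hBb : b + 16 ≤ B := by
    have := hs.id_le _ hG.zeroNode_mem_nodes; omega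
  -- The variant of the loop: it is zero once there is no node left to repair.
  let rk : Option (Node n) → ℕ := fun t => t.elim 0 fun x => rank Δ x + 1
  let I : ℕ → State → Prop := fun k s => ∃ t U, k = rk t ∧
    (∀ x ∈ nodes Δ G, U x ≤ n) ∧ (∀ x ∈ t, ∃ A, x = Sum.inr A ∧ x ∈ nodes Δ G) ∧
    Holds Δ G b id m₀ s.mem N U ∧ Indicates S s.mem ∧ UndomUpTo Δ G T N U t p q ∧
    s.reg 16 = optAddr b id t ∧ s.reg 15 = a ∧ s.reg 30 = 0
  have hstart : RunsTo B (.const 30 0) s 1 (I (rk t)) := by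
    refine RunsTo.of_wp (p := .const 30 0) ⟨by omega, t, U, rfl, hU, ht, h, hS, hu, ?_, ?_, ?_⟩
    · simpa using h16
    · simpa using h15
    · simp
  have hrk : rk t ≤ Δ + 1 := by
    rcases t with _ | x
    · exact Nat.zero_le _
    · obtain ⟨A, rfl, hA⟩ := ht x rfl
      exact Nat.succ_le_succ (Sparse.inr_card_lt hA).le
  refine (hstart.seq fun s1 hs1 => RunsTo.while (T := 29) I ?_ ?_ hs1).mono ?_ fun s' h => h
  · rintro k s ⟨t, U, rfl, hU, ht, h, hS, hu, h16, h15, h30⟩ hlt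
    rw [h30, h16] at hlt
    rcases t with _ | x
    · exact absurd hlt (lt_irrefl 0)
    obtain ⟨A, rfl, hA⟩ := ht x rfl
    have hBA := hs.id_le _ hA
    have hUA := hU _ hA
    have h2 : fld b s.mem 2 (id (Sum.inr A)) = U (Sum.inr A) := h.undom _ hA
    simp only [optAddr] at h16
    obtain ⟨c, hc, hcn, hopc⟩ : ∃ c, c + q = U (Sum.inr A) + p ∧ c ≤ n ∧
        ∀ (s : State) (P : State → Prop), s.reg 17 = U (Sum.inr A) → s.reg 15 = a →
          P (s.setReg 17 c) → op.wp B s P := by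
      rcases hop with ⟨rfl, rfl, rfl⟩ | ⟨rfl, rfl, rfl⟩
      · have hle := (hu.step hG hA (b := U (Sum.inr A) + p) rfl).le hG hA
        rw [Function.update_self] at hle
        refine ⟨U (Sum.inr A) + p, rfl, hle, fun s P e1 e2 hP => ?_⟩
        simp only [Prog.wp, e1, e2]
        exact ⟨by omega, hP⟩
      · have hq := hu.inr A hA
        rw [if_pos rfl, if_pos rfl] at hq
        refine ⟨U (Sum.inr A) - q, by omega, by omega, fun s P e1 e2 hP => ?_⟩
        simp only [Prog.wp, e1, e2]
        exact ⟨by omega, hP⟩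
    have hT : (Prog.seq (.getF 17 16 2) (.seq op (.seq (.setF 16 2 17)
        (.seq (.move 14 16) findTarget)))).cost ≤ 29 := by
      rcases hop with ⟨rfl, -⟩ | ⟨rfl, -⟩ <;> decide
    refine (RunsTo.of_wp ?_).mono hT fun s' h => h
    refine wp_getF h16 (by norm_num) hBA (by norm_num) (by rw [h2]; omega) ?_
    refine hopc _ _ (by simp [h2]) (by simp [h15]) ?_
    refine wp_setF (b := b) (j := id (Sum.inr A)) (by simp [h16]) (by norm_num) (by norm_num) hBA
      (by norm_num) (by simp; omega) ?_
    simp only [Prog.wp, State.setMem_reg, State.setReg_reg]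
    norm_num
    refine ⟨by rw [h16]; omega, ?_⟩
    have h' := h.setU hs hA c
    refine findTarget_wp hs h' hN hG (by simp) hA (by simp [h16]) fun s' hm' hr16 hr30 hr => ?_
    refine ⟨_, ?_, target Δ G N (Sum.inr A), Function.update U (Sum.inr A) c, rfl, ?_, ?_,
      by rw [hm']; exact h', by rw [hm']; exact hS.update_fld hb _ _ _, hu.step hG hA hc, hr16,
      ?_, hr30⟩
    · simp only [rk, target]
      split_ifs with hact
      · exact Nat.succ_lt_succ (hG.rank_sv_lt hA hact.1)
      · exact Nat.succ_pos _
    · intro y hy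
      by_cases e : y = Sum.inr A
      · rw [e, Function.update_self]; exact hcn
      · rw [Function.update_of_ne e]; exact hU y hy
    · intro y hy
      simp only [target] at hy
      split_ifs at hy with hact
      · simp only [Option.mem_def, Option.some.injEq] at hy
        subst hy
        exact ⟨_, rfl, hG.sv_mem_nodes hA hact.1⟩
      · cases hy
    · rw [hr 15 (by norm_num) (by norm_num) (by norm_num)]
      simpa using h15
  · rintro k s ⟨t, U, rfl, hU, ht, h, hS, hu, h16, h15, h30⟩ hlt
    rcases t with _ | x
    · exact ⟨U, h, hS, hu.undom⟩
    · rw [h30, h16] at hlt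
      exfalso
      simp only [optAddr] at hlt
      omega
  · have := Nat.mul_le_mul_right 30 hrk
    simp only [propagateTime]
    omega

end Dynamic

section Updates

variable {n Δ : ℕ} {G : SimpleGraph (Fin n)} {B b : ℕ} {id : Node n → ℕ} {start : Fin n → ℕ}
  {L : Fin n → List (Node n)} {m₀ : ℕ → ℕ} {N U : Node n → ℕ}

/-- Increase `nadj` at the node at the address in register `26` and correct `undom`. -/
def incNadj : Prog :=
  .seq (.seq (.getF 27 26 1) (.seq (.move 14 26) (.seq (.getF 15 26 2) (.seq findTarget
    (.seq (.const 22 1) (.seq (.add 27 27 22) (.setF 26 1 27)))))))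
    (propagate (.sub 17 17 15))

/-- Decrease `nadj` at the node at the address in register `26` and correct `undom`. -/
def decNadj : Prog :=
  .seq (.seq (.getF 27 26 1) (.seq (.const 22 1) (.seq (.sub 27 27 22) (.seq (.setF 26 1 27)
    (.seq (.move 14 26) (.seq (.getF 15 26 2) findTarget))))))
    (propagate (.add 17 17 15))

theorem target_mem {D : ℕ} (hG : Sparse Δ D G) {x : Node n} (hx : x ∈ nodes Δ G)
    (N : Node n → ℕ) : ∀ y ∈ target Δ G N x, ∃ A, y = Sum.inr A ∧ y ∈ nodes Δ G := by
  intro y hy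
  simp only [target] at hy
  split_ifs at hy with hact
  · simp only [Option.mem_def, Option.some.injEq] at hy
    subst hy
    exact ⟨_, rfl, hG.sv_mem_nodes hx hact.1⟩
  · cases hy

theorem incNadj_spec (hs : Static Δ G B b id start L m₀) {D : ℕ} (hG : Sparse Δ D G)
    (hN : ∀ x ∈ nodes Δ G, N x ≤ n) {T S : Finset (Fin n)} {s : State}
    (h : Holds Δ G b id m₀ s.mem N U) (hS : Indicates S s.mem) (hu : Undom Δ G T N U)
    {y : Node n} (hy : y ∈ nodes Δ G) (h26 : s.reg 26 = b + 16 * id y) :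
    RunsTo B incNadj s (30 + propagateTime Δ) fun s' => ∃ U',
      Holds Δ G b id m₀ s'.mem (Function.update N y (N y + 1)) U' ∧ Indicates S s'.mem ∧
      Undom Δ G T (Function.update N y (N y + 1)) U' := by
  have hb := hs.lt_b
  have hBy := hs.id_le y hy
  have h1 : fld b s.mem 1 (id y) = N y := h.nadj y hy
  have h2 : fld b s.mem 2 (id y) = U y := h.undom y hy
  have hNy := hN y hy
  have hUy := hu.le hG hy
  refine (RunsTo.seq (RunsTo.of_wp (P := fun s' => s'.reg 15 = U y ∧
    s'.reg 16 = optAddr b id (target Δ G N y) ∧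
    s'.mem = Function.update s.mem (b + 16 * id y + 1) (N y + 1)) ?_) (T' := propagateTime Δ)
      ?_).mono (Nat.add_le_add_right (by decide) _) fun _ h => h
  · refine wp_getF h26 (by norm_num) hBy (by norm_num) (by omega) ?_
    simp only [Prog.wp, State.setReg_reg]
    norm_num
    refine ⟨by omega, ?_⟩
    refine wp_getF (b := b) (j := id y) (by simp [h26]) (by norm_num) hBy (by norm_num)
      (by simp only [State.setReg_mem]; omega) ?_
    refine findTarget_wp hs h (fun x hx => by have := hN x hx; omega) hG (by simp) hy
      (by simp [h26]) ?_
    intro s' hm' hr16 hr30 hr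
    have h27 : s'.reg 27 = N y := by
      rw [hr 27 (by norm_num) (by norm_num) (by norm_num)]; simp [h1]
    refine ⟨by omega, by omega, ?_⟩
    refine wp_setF (b := b) (j := id y) ?_ (by norm_num) (by norm_num) hBy (by norm_num) ?_ ?_
    · simp [hr 26, h26]
    · simp [h27]; omega
    · refine ⟨?_, ?_, ?_⟩
      · simp [hr 15, h2]
      · simp [hr16]
      · simp [hm', h27]
  · rintro s' ⟨h15, h16, hm⟩
    have h' := h.setN hs hy (N y + 1)
    rw [← hm] at h'
    refine propagate_spec hs hG ?_ (Or.inr ⟨rfl, rfl, rfl⟩) (fun x hx => hu.le hG hx)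
      (target_mem hG hy N) h' (hm ▸ hS.update_fld hb _ _ _) ?_ h16 h15
    · intro x hx
      by_cases e : x = y
      · rw [e, Function.update_self]; omega
      · rw [Function.update_of_ne e]; have := hN x hx; omega
    · exact hu.deactivate hy (fun x hx => Function.update_of_ne hx _ _) (by simp)

theorem decNadj_spec (hs : Static Δ G B b id start L m₀) {D : ℕ} (hG : Sparse Δ D G)
    (hN : ∀ x ∈ nodes Δ G, N x ≤ n) {T S : Finset (Fin n)} {s : State}
    (h : Holds Δ G b id m₀ s.mem N U) (hS : Indicates S s.mem) (hu : Undom Δ G T N U)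
    {y : Node n} (hy : y ∈ nodes Δ G) (hNy0 : N y ≠ 0) (h26 : s.reg 26 = b + 16 * id y) :
    RunsTo B decNadj s (30 + propagateTime Δ) fun s' => ∃ U',
      Holds Δ G b id m₀ s'.mem (Function.update N y (N y - 1)) U' ∧ Indicates S s'.mem ∧
      Undom Δ G T (Function.update N y (N y - 1)) U' := by
  have hb := hs.lt_b
  have hBy := hs.id_le y hy
  have h1 : fld b s.mem 1 (id y) = N y := h.nadj y hy
  have hNy := hN y hy
  have hUy := hu.le hG hy
  have h' := h.setN hs hy (N y - 1)
  have h2 := h'.undom y hy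
  have hN' : ∀ x ∈ nodes Δ G, Function.update N y (N y - 1) x < B := by
    intro x hx
    by_cases e : x = y
    · rw [e, Function.update_self]; omega
    · rw [Function.update_of_ne e]; have := hN x hx; omega
  refine (RunsTo.seq (RunsTo.of_wp (P := fun s' => s'.reg 15 = U y ∧
    s'.reg 16 = optAddr b id (target Δ G (Function.update N y (N y - 1)) y) ∧
    s'.mem = Function.update s.mem (b + 16 * id y + 1) (N y - 1)) ?_) (T' := propagateTime Δ)
      ?_).mono (Nat.add_le_add_right (by decide) _) fun _ h => h
  · refine wp_getF h26 (by norm_num) hBy (by norm_num) (by omega) ?_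
    simp only [Prog.wp, State.setReg_reg]
    norm_num
    refine ⟨by omega, by omega, ?_⟩
    refine wp_setF (b := b) (j := id y) (by simp [h26]) (by norm_num) (by norm_num) hBy
      (by norm_num) (by simp; omega) ?_
    simp only [State.setReg_reg, State.setMem_reg]
    norm_num
    refine ⟨by omega, ?_⟩
    refine wp_getF (b := b) (j := id y) (by simp [h26]) (by norm_num) hBy (by norm_num)
      (by simp only [State.setReg_mem, State.setMem_mem, h1, h2]; omega) ?_
    refine findTarget_wp hs h' hN' hG (by simp [h1]) hy (by simp [h26]) ?_
    intro s' hm' hr16 hr30 hr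
    refine ⟨?_, hr16, hm'⟩
    simp [hr 15, h1, h2]
  · rintro s' ⟨h15, h16, hm⟩
    rw [← hm] at h'
    refine propagate_spec hs hG hN' (Or.inl ⟨rfl, rfl, rfl⟩) (fun x hx => hu.le hG hx)
      (target_mem hG hy _) h' (hm ▸ hS.update_fld hb _ _ _) ?_ h16 h15
    exact hu.activate hy (fun x hx => Function.update_of_ne hx _ _) hNy0

/-- For the vertex in register `0`, put the address of its record into register `18`, the address
of its bit in the indicator array into register `19`, and the bit into register `21`. Register `1`
is supposed to hold the address of the first record, and `1` is put into register `20`. -/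
def locate : Prog :=
  .seq (.add 18 0 0) (.seq (.add 18 18 18) (.seq (.add 18 18 18) (.seq (.add 18 18 18)
    (.seq (.add 18 1 18) (.seq (.const 20 1) (.seq (.add 19 0 20) (.load 21 19)))))))

/-- Set the bit of the located vertex to `β`, correct the numbers `undom`, and execute `p` with the
address of each member of the list of neighbours in register `26`. -/
def flip (β : ℕ) (op p : Prog) : Prog :=
  .seq (.seq (.const 21 β) (.seq (.store 19 21) (.seq (.const 22 (1 - β)) (.seq (.setF 18 2 22)
    (.seq (.move 14 18) (.seq (.const 15 1) findTarget))))))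
    (.seq (propagate op) (.seq (.seq (.getF 23 18 3) (.getF 24 18 4))
      (.for 25 24 (.seq (.seq (.add 26 23 25) (.load 26 26)) p))))

/-- The program for insertion. -/
def insertProg : Prog := .seq locate (.ite 21 20 (flip 1 (.sub 17 17 15) incNadj) .skip)

/-- The program for deletion. -/
def deleteProg : Prog := .seq locate (.ite 21 20 .skip (flip 0 (.add 17 17 15) decNadj))

/-- A bound for the time of `flip`. -/
def flipTime (Δ : ℕ) : ℕ := 40 + propagateTime Δ + Δ * (35 + propagateTime Δ)

/-- The memory holds the numbers for `S`. -/
def Current (Δ : ℕ) (G : SimpleGraph (Fin n)) (b : ℕ) (id : Node n → ℕ) (m₀ : ℕ → ℕ)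
    (S : Finset (Fin n)) (m : ℕ → ℕ) : Prop :=
  ∃ N U, (∀ x ∈ nodes Δ G, N x = nadj Δ G S x) ∧ Holds Δ G b id m₀ m N U ∧ Indicates S m ∧
    Undom Δ G Sᶜ N U

theorem nadj_le (S : Finset (Fin n)) (x : Node n) : nadj Δ G S x ≤ n := by
  rw [nadj]
  exact (Finset.card_le_univ _).trans (by simp)

open Classical in
theorem nadj_insert {v : Fin n} {S : Finset (Fin n)} (hv : v ∉ S) {x : Node n}
    (hx : x ∈ nodes Δ G) :
    nadj Δ G (insert v S) x = nadj Δ G S x + if x ∈ nbr Δ G v then 1 else 0 := by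
  rw [Sparse.nadj_eq _ hx, Sparse.nadj_eq _ hx, Finset.filter_insert]
  split_ifs with h
  · rw [Finset.card_insert_of_notMem (by simp [hv])]
  · rfl

/-- The update repairs the count of `v` first and then handles the nodes of its list one at a time.
After each of these, the counts `undom` are correct for the current numbers `N`, which are those of
`S'` for the part of the list already treated and those of `S` for the rest. -/
theorem flip_spec (hs : Static Δ G B b id start L m₀) {D : ℕ} (hG : Sparse Δ D G)
    {S S' : Finset (Fin n)} {v : Fin n} {β : ℕ} {op p : Prog}
    (hS' : ∀ u, u ≠ v → (u ∈ S' ↔ u ∈ S))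
    (hv : (v ∈ S ∧ v ∉ S' ∧ β = 0 ∧ op = .add 17 17 15 ∧ p = decNadj) ∨
      (v ∉ S ∧ v ∈ S' ∧ β = 1 ∧ op = .sub 17 17 15 ∧ p = incNadj))
    {s : State} (h : Current Δ G b id m₀ S s.mem) (h18 : s.reg 18 = b + 16 * v)
    (h19 : s.reg 19 = 1 + v) :
    RunsTo B (flip β op p) s (flipTime Δ) fun s' => Current Δ G b id m₀ S' s'.mem := by
  classical
  obtain ⟨N, U, hN, hH, hI, hu⟩ := h
  have hb := hs.lt_b
  have hvn : (Sum.inl v : Node n) ∈ nodes Δ G := Sparse.inl_mem_nodes v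
  have hBv := hs.id_le _ hvn
  rw [hs.id_inl] at hBv
  have hv2 := v.2
  have hNn : ∀ x ∈ nodes Δ G, N x ≤ n := fun x hx => hN x hx ▸ nadj_le _ _
  set U₁ := Function.update U (Sum.inl v) (1 - β) with hU₁
  have hβ : β = if v ∈ S' then 1 else 0 := by
    rcases hv with ⟨-, h, rfl, -⟩ | ⟨-, h, rfl, -⟩ <;> simp [h]
  have hβ1 : β ≤ 1 := by rw [hβ]; split_ifs <;> omega
  set m₁ := Function.update (Function.update s.mem (1 + v) β) (b + 16 * v + 2) (1 - β) with hm₁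
  have hH₁ : Holds Δ G b id m₀ m₁ N U₁ := by
    have := (hH.setBit hs v β).setU hs hvn (1 - β)
    rwa [hs.id_inl] at this
  have hI₁ : Indicates S' m₁ := by
    refine Indicates.update_fld (fun u => ?_) hb _ _ _
    by_cases e : u = v
    · rw [e, Function.update_self, hβ]
    · rw [Function.update_of_ne (by
        intro e'; exact e (Fin.ext (by omega))), hI u]
      simp [hS' u e]
  obtain ⟨P, Q, hPQ, hu₁⟩ : ∃ P Q, ((op = .add 17 17 15 ∧ P = 1 ∧ Q = 0) ∨
      (op = .sub 17 17 15 ∧ P = 0 ∧ Q = 1)) ∧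
      UndomUpTo Δ G S'ᶜ N U₁ (target Δ G N (Sum.inl v)) P Q := by
    have hT : ∀ u, u ≠ v → (u ∈ S'ᶜ ↔ u ∈ Sᶜ) := fun u hu => by simp [hS' u hu]
    rcases hv with ⟨h1, h2, rfl, h3, -⟩ | ⟨h1, h2, rfl, h3, -⟩
    · exact ⟨1, 0, Or.inl ⟨h3, rfl, rfl⟩, hu.update_inl hT (by simp [h2])
        (by rw [hu.inl]; simp [h1])⟩
    · exact ⟨0, 1, Or.inr ⟨h3, rfl, rfl⟩, hu.update_inl hT (by simp [h2])
        (by rw [hu.inl]; simp [h1])⟩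
  have hU₁n : ∀ x ∈ nodes Δ G, U₁ x ≤ n := by
    intro x hx
    rw [hU₁]
    by_cases e : x = Sum.inl v
    · rw [e, Function.update_self]; omega
    · rw [Function.update_of_ne e]; exact hu.le hG hx
  have step1 : RunsTo B (.seq (.const 21 β) (.seq (.store 19 21) (.seq (.const 22 (1 - β))
      (.seq (.setF 18 2 22) (.seq (.move 14 18) (.seq (.const 15 1) findTarget)))))) s 20
      fun s' => s'.mem = m₁ ∧ s'.reg 16 = optAddr b id (target Δ G N (Sum.inl v)) ∧
        s'.reg 15 = 1 ∧ s'.reg 18 = b + 16 * v := by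
    refine (RunsTo.of_wp ?_).mono (by simp [Prog.cost, Prog.setF, Prog.getF, findTarget])
      fun _ h => h
    simp only [Prog.wp, State.setReg_reg]
    norm_num
    refine ⟨by omega, by omega, by omega, by omega, ?_⟩
    refine wp_setF (b := b) (j := v) (by simp [h18]) (by norm_num) (by norm_num) hBv
      (by norm_num) (by simp; omega) ?_
    simp only [State.setReg_reg, State.setMem_reg]
    norm_num
    refine ⟨by omega, by omega, ?_⟩
    refine findTarget_wp hs hH₁ (fun x hx => by have := hNn x hx; omega) hG
      (by simp [hm₁, h19]) hvn (by simp [h18, hs.id_inl]) ?_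
    intro s' hm' hr16 hr30 hr
    exact ⟨hm', hr16, by simp [hr 15], by simp [hr 18, h18]⟩
  have step2 : ∀ s₁ : State, (s₁.mem = m₁ ∧ s₁.reg 16 = optAddr b id (target Δ G N (Sum.inl v)) ∧
      s₁.reg 15 = 1 ∧ s₁.reg 18 = b + 16 * v) → RunsTo B (propagate op) s₁ (propagateTime Δ)
      fun s' => (∃ U', Holds Δ G b id m₀ s'.mem N U' ∧ Indicates S' s'.mem ∧
        Undom Δ G S'ᶜ N U') ∧ s'.reg 18 = b + 16 * v := by
    rintro s₁ ⟨hm, h16, h15, h18⟩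
    rw [← hm] at hH₁ hI₁
    refine (propagate_spec hs hG (fun x hx => by have := hNn x hx; omega) hPQ hU₁n
      (target_mem hG hvn N) hH₁ hI₁ hu₁ h16 h15).frame.mono le_rfl ?_
    rintro s' ⟨h, hk⟩
    refine ⟨h, ?_⟩
    rw [hk 18, h18]
    rcases hPQ with ⟨rfl, -⟩ | ⟨rfl, -⟩ <;> rfl
  have step3 : ∀ s₂ : State, ((∃ U', Holds Δ G b id m₀ s₂.mem N U' ∧ Indicates S' s₂.mem ∧
        Undom Δ G S'ᶜ N U') ∧ s₂.reg 18 = b + 16 * v) →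
      RunsTo B (.seq (.getF 23 18 3) (.getF 24 18 4)) s₂ 6
      fun s' => (∃ U', Holds Δ G b id m₀ s'.mem N U' ∧ Indicates S' s'.mem ∧
        Undom Δ G S'ᶜ N U') ∧ s'.reg 23 = start v ∧ s'.reg 24 = (L v).length := by
    rintro s₂ ⟨⟨U', hH', hI', hu'⟩, h18⟩
    have h3 := congrFun (hH'.other 3 (by norm_num) (by norm_num) (by norm_num)) v
    have h4 := congrFun (hH'.other 4 (by norm_num) (by norm_num) (by norm_num)) v
    rw [hs.start_eq] at h3
    rw [hs.length_eq] at h4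
    have h5 := hs.start_le v
    refine RunsTo.of_wp (p := .seq (.getF 23 18 3) (.getF 24 18 4)) ?_
    refine wp_getF h18 (by norm_num) hBv (by norm_num) (by omega) ?_
    refine wp_getF (b := b) (j := v) (by simp [h18]) (by norm_num) hBv (by norm_num)
      (by simp only [State.setReg_mem]; omega) ?_
    exact ⟨⟨U', by simpa using hH', by simpa using hI', hu'⟩, by simp [h3], by simp [h4]⟩
  have hlen : (L v).length ≤ Δ := by
    rw [← List.toFinset_card_of_nodup (hs.nodup v)]
    refine le_trans (Finset.card_le_card fun y hy => ?_) (hG.card_nbr_lt v).le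
    exact (hs.mem_list v y).1 (List.mem_toFinset.1 hy)
  -- the numbers `nadj` when `k` members of the list have been processed
  let Rel : ℕ → (Node n → ℕ) → Prop := fun k N' => ∀ x ∈ nodes Δ G,
    (if β = 1 then N' x = N x + (if x ∈ (L v).take k then 1 else 0)
      else N' x + (if x ∈ (L v).take k then 1 else 0) = N x)
  have step4 : ∀ s₃ : State, ((∃ U', Holds Δ G b id m₀ s₃.mem N U' ∧ Indicates S' s₃.mem ∧
        Undom Δ G S'ᶜ N U') ∧ s₃.reg 23 = start v ∧ s₃.reg 24 = (L v).length) →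
      RunsTo B (.for 25 24 (.seq (.seq (.add 26 23 25) (.load 26 26)) p)) s₃
        (Δ * (35 + propagateTime Δ) + 2) fun s' => ∃ N' U', Rel (L v).length N' ∧
          Holds Δ G b id m₀ s'.mem N' U' ∧ Indicates S' s'.mem ∧ Undom Δ G S'ᶜ N' U' := by
    rintro s₃ ⟨⟨U', hH', hI', hu'⟩, h23, h24⟩
    have h5 := hs.start_le v
    refine (RunsTo.for (N := (L v).length) (c := fun _ => 2 + (30 + propagateTime Δ))
      (fun k m _ _ => ∃ N' U', Rel k N' ∧ Holds Δ G b id m₀ m N' U' ∧ Indicates S' m ∧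
        Undom Δ G S'ᶜ N' U') ?_ h24 (by omega) (by omega) ?_ ?_).mono ?_ fun _ h => h
    · rcases hv with ⟨-, -, -, -, rfl⟩ | ⟨-, -, -, -, rfl⟩ <;> decide
    · exact ⟨N, U', fun x hx => by simp, hH', hI', hu'⟩
    · rintro k hk s' hreg h25 ⟨N', U'', hrel, hH'', hI'', hu''⟩
      have h23' : s'.reg 23 = start v := by
        rw [hreg 23, h23]
        rcases hv with ⟨-, -, -, -, rfl⟩ | ⟨-, -, -, -, rfl⟩ <;> decide
      have hy : (L v)[k] ∈ nodes Δ G :=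
        Sparse.nbr_subset_nodes ((hs.mem_list v _).1 (List.getElem_mem hk))
      have hBy := hs.id_le _ hy
      have hr : s'.mem (start v + k) = b + 16 * id ((L v)[k]) := by
        rw [hH''.raw _ (by omega) (Or.inr (by have := hs.lt_start v; omega)), hs.array v k hk]
      have htake : ∀ x, x ∈ (L v).take (k + 1) ↔ x ∈ (L v).take k ∨ x = (L v)[k] := by
        intro x
        rw [List.take_succ_eq_append_getElem hk, List.mem_append, List.mem_singleton]
      have hnot : (L v)[k] ∉ (L v).take k := by
        intro hmem
        obtain ⟨j, hj, e⟩ := List.mem_take_iff_getElem.1 hmem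
        have := (hs.nodup v).getElem_inj_iff.1 e
        omega
      have hN'n : ∀ x ∈ nodes Δ G, N' x ≤ n := by
        intro x hx
        have h1 := hrel x hx
        have h2 := nadj_le (Δ := Δ) (G := G) S' x
        have h3 := hN x hx
        have h4 := hNn x hx
        split_ifs at h1 with hb1 hxt
        · rcases hv with ⟨-, -, h, -⟩ | ⟨hv1, hv2, -⟩
          · omega
          · have e : S' = insert v S := by
              ext u
              by_cases e : u = v
              · simp [e, hv2]
              · simp [hS' u e, e]
            rw [e, nadj_insert hv1 hx,
              if_pos ((hs.mem_list v x).1 (List.mem_of_mem_take hxt))] at h2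
            omega
        all_goals omega
      refine RunsTo.seq (T := 2) (Q := fun s'' => s''.mem = s'.mem ∧
        s''.reg 26 = b + 16 * id ((L v)[k])) ?_ ?_
      · refine RunsTo.of_wp (p := .seq (.add 26 23 25) (.load 26 26)) ?_
        simp only [Prog.wp, State.setReg_reg, h23', h25, State.setReg_mem, if_true, hr]
        exact ⟨by omega, by omega, by omega, trivial, trivial⟩
      · rintro s'' ⟨hm'', h26⟩
        rw [← hm''] at hH'' hI''
        rcases hv with ⟨hvS, -, hβ0, -, rfl⟩ | ⟨-, -, hβ0, -, rfl⟩
        · have hNy : N' (L v)[k] ≠ 0 := by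
            have h1 := hrel _ hy
            rw [if_neg (by omega), if_neg hnot, hN _ hy, Sparse.nadj_eq _ hy] at h1
            have : 0 < (S.filter fun u => (L v)[k] ∈ nbr Δ G u).card :=
              Finset.card_pos.2 ⟨v, Finset.mem_filter.2 ⟨hvS,
                (hs.mem_list v _).1 (List.getElem_mem hk)⟩⟩
            omega
          refine (decNadj_spec hs hG hN'n hH'' hI'' hu'' hy hNy h26).mono le_rfl ?_
          rintro s₄ ⟨U₄, h1, h2, h3⟩
          refine ⟨_, U₄, fun x hx => ?_, h1, h2, h3⟩
          have h4 := hrel x hx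
          rw [if_neg (by omega)] at h4 ⊢
          simp only [htake]
          by_cases e : x = (L v)[k]
          · rw [e, if_neg hnot] at h4
            rw [e, Function.update_self, if_pos (Or.inr rfl)]
            omega
          · rw [Function.update_of_ne e]
            simpa [e] using h4
        · refine (incNadj_spec hs hG hN'n hH'' hI'' hu'' hy h26).mono le_rfl ?_
          rintro s₄ ⟨U₄, h1, h2, h3⟩
          refine ⟨_, U₄, fun x hx => ?_, h1, h2, h3⟩
          have h4 := hrel x hx
          rw [if_pos hβ0] at h4 ⊢
          simp only [htake]
          by_cases e : x = (L v)[k]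
          · rw [e, if_neg hnot] at h4
            rw [e, Function.update_self, if_pos (Or.inr rfl)]
            omega
          · rw [Function.update_of_ne e]
            simpa [e] using h4
    · rw [Finset.sum_const, Finset.card_range, smul_eq_mul]
      have := Nat.mul_le_mul_right (35 + propagateTime Δ) hlen
      have e : 2 + (30 + propagateTime Δ) + 3 = 35 + propagateTime Δ := by omega
      rw [e]
      omega
  refine (step1.seq fun s₁ hs₁ => (step2 s₁ hs₁).seq fun s₂ hs₂ => (step3 s₂ hs₂).seq
    fun s₃ hs₃ => step4 s₃ hs₃).mono ?_ ?_
  · simp only [flipTime]; omega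
  · rintro s' ⟨N', U', hrel, hH', hI', hu'⟩
    refine ⟨N', U', fun x hx => ?_, hH', hI', hu'⟩
    have h1 := hrel x hx
    simp only [List.take_length, hs.mem_list] at h1
    rcases hv with ⟨hv1, hv2, hβ0, -⟩ | ⟨hv1, hv2, hβ0, -⟩
    · have e : S = insert v S' := by
        ext u
        by_cases e : u = v
        · simp [e, hv1]
        · simp [hS' u e, e]
      rw [if_neg (by omega), hN x hx, e, nadj_insert hv2 hx] at h1
      omega
    · have e : S' = insert v S := by
        ext u
        by_cases e : u = v
        · simp [e, hv2]
        · simp [hS' u e, e]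
      rw [if_pos hβ0, hN x hx] at h1
      rw [h1, e, nadj_insert hv1 hx]

theorem locate_spec (hs : Static Δ G B b id start L m₀) {S : Finset (Fin n)} {v : Fin n}
    {s : State} (h : Current Δ G b id m₀ S s.mem) (h0 : s.reg 0 = v) (h1 : s.reg 1 = b) :
    RunsTo B locate s 8 fun s' => s'.mem = s.mem ∧ s'.reg 18 = b + 16 * v ∧
      s'.reg 19 = 1 + v ∧ s'.reg 20 = 1 ∧ s'.reg 21 = if v ∈ S then 1 else 0 := by
  obtain ⟨N, U, hN, hH, hI, hu⟩ := h
  have hb := hs.lt_b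
  have hBv := hs.id_le _ (Sparse.inl_mem_nodes v)
  rw [hs.id_inl] at hBv
  have hIv := hI v
  have hle : (if v ∈ S then 1 else 0) ≤ 1 := by split_ifs <;> omega
  refine RunsTo.of_wp (p := locate) ?_
  simp only [locate, Prog.wp, State.setReg_reg, State.setReg_mem]
  norm_num
  rw [h0, h1, add_comm (v : ℕ) 1, hIv]
  and_intros <;> omega

theorem insertProg_spec (hs : Static Δ G B b id start L m₀) {D : ℕ} (hG : Sparse Δ D G)
    {S : Finset (Fin n)} {v : Fin n} {s : State} (h : Current Δ G b id m₀ S s.mem)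
    (h0 : s.reg 0 = v) (h1 : s.reg 1 = b) :
    RunsTo B insertProg s (9 + flipTime Δ) fun s' => Current Δ G b id m₀ (insert v S) s'.mem := by
  refine ((locate_spec hs h h0 h1).seq (T' := flipTime Δ + 1) ?_).mono (by omega) fun _ h => h
  rintro s' ⟨hm, h18, h19, h20, h21⟩
  rw [← hm] at h
  by_cases hv : v ∈ S
  · rw [if_pos hv] at h21
    rw [Finset.insert_eq_of_mem hv]
    exact ⟨2, s', by simp only [flipTime]; omega, .ite_false (by omega) (.skip s'), h⟩
  · rw [if_neg hv] at h21
    obtain ⟨t, s'', ht, he, hs''⟩ := flip_spec hs hG (S := S) (S' := insert v S) (v := v)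
      (fun u hu => by simp [hu]) (Or.inr ⟨hv, by simp, rfl, rfl, rfl⟩) h h18 h19
    exact ⟨t + 1, s'', by omega, .ite_true (by omega) he, hs''⟩

theorem deleteProg_spec (hs : Static Δ G B b id start L m₀) {D : ℕ} (hG : Sparse Δ D G)
    {S : Finset (Fin n)} {v : Fin n} {s : State} (h : Current Δ G b id m₀ S s.mem)
    (h0 : s.reg 0 = v) (h1 : s.reg 1 = b) :
    RunsTo B deleteProg s (9 + flipTime Δ) fun s' => Current Δ G b id m₀ (S.erase v) s'.mem := by
  refine ((locate_spec hs h h0 h1).seq (T' := flipTime Δ + 1) ?_).mono (by omega) fun _ h => h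
  rintro s' ⟨hm, h18, h19, h20, h21⟩
  rw [← hm] at h
  by_cases hv : v ∈ S
  · rw [if_pos hv] at h21
    obtain ⟨t, s'', ht, he, hs''⟩ := flip_spec hs hG (S := S) (S' := S.erase v) (v := v)
      (fun u hu => by simp [hu]) (Or.inl ⟨hv, by simp, rfl, rfl, rfl⟩) h h18 h19
    exact ⟨t + 1, s'', by omega, .ite_false (by omega) he, hs''⟩
  · rw [if_neg hv] at h21
    rw [Finset.erase_eq_of_notMem hv]
    exact ⟨2, s', by simp only [flipTime]; omega, .ite_true (by omega) (.skip s'), h⟩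

/-- The program for queries. Register `2` is supposed to hold the address of the supervertex of
degree zero. -/
def queryProg : Prog := .getF 0 2 2

theorem queryProg_spec (hs : Static Δ G B b id start L m₀) {D : ℕ} (hG : Sparse Δ D G)
    {S : Finset (Fin n)} {s : State} (h : Current Δ G b id m₀ S s.mem)
    (h2 : s.reg 2 = b + 16 * n) :
    RunsTo B queryProg s 3 fun s' => s'.reg 0 = (undominated G S).card ∧ s'.mem = s.mem := by
  obtain ⟨N, U, hN, hH, hI, hu⟩ := h
  have hz := hG.zeroNode_mem_nodes
  have h3 := hH.undom _ hz
  have h4 := hs.id_le _ hz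
  have h5 := hu.le hG hz
  have hb := hs.lt_b
  rw [hs.id_zero] at h3 h4
  refine RunsTo.of_wp (p := queryProg) (wp_getF h2 (by norm_num) h4 (by norm_num) (by omega) ?_)
  refine ⟨?_, rfl⟩
  rw [State.setReg_reg, if_pos rfl, h3]
  exact (hu.congr (fun x hx => (hN x hx).symm) (fun _ _ => rfl)).zeroNode_eq hG

end Updates

/-! ### Loops over the edges of a level -/

section Edges

/-- The division of the memory: the input in the cells below `M`, an array of `cap v` cells at
`st v` for each vertex `v`, a list of vertices at `la`, and records from address `b` on. -/
structure Layout (n : ℕ) where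
  (B b M la : ℕ)
  (st cap : Fin n → ℕ)
  le_M : 2 * n + 2 ≤ M
  M_le_st : ∀ v, M ≤ st v
  st_le : ∀ v, st v + cap v ≤ la
  disj : ∀ u v, u ≠ v → st u + cap u ≤ st v ∨ st v + cap v ≤ st u
  M_le_la : M ≤ la
  la_le : la + n ≤ b
  le_B : b + 16 * (n + 1) ≤ B

variable {n : ℕ}

/-- A loop over the vertices in the list at the address in register `5`, of length in register `4`,
and, for each of them, over its array of neighbours. In `pre`, `body` and `post`, the vertex is in
register `7`, the address and the length of its array in registers `11` and `9`, and, in `body`,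
the neighbour in register `10`. -/
def forEdges (pre body post : Prog) : Prog :=
  .for 6 4 (.seq (.seq (.seq (.add 28 5 6) (.seq (.load 7 28) (.seq (.getF 11 7 3)
    (.getF 9 7 4)))) pre)
    (.seq (.for 8 9 (.seq (.seq (.add 28 11 8) (.load 10 28)) body)) post))

/-- A bound for the time of `forEdges`, where `l` is the list of the vertices and `L` the lists of
their neighbours. -/
def edgesTime (c : ℕ) (l : List (Fin n)) (L : Fin n → List (Node n)) : ℕ :=
  (c + 30) * (l.length + (l.map fun v => (L v).length).sum) + 2

theorem sum_range_getElem {α : Type*} (l : List α) (f : α → ℕ) :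
    ∑ k ∈ Finset.range l.length, (if hk : k < l.length then f l[k] else 0) = (l.map f).sum := by
  induction l with
  | nil => simp
  | cons a l ih => simp [Finset.sum_range_succ', ← ih, add_comm]

theorem forEdges_spec (Y : Layout n) {id : Node n → ℕ} {l : List (Fin n)}
    {L : Fin n → List (Node n)} {pre body post : Prog} {s : State}
    (I : ℕ → (ℕ → ℕ) → ℕ → ℕ → Prop) (K : ℕ → ℕ → (ℕ → ℕ) → ℕ → ℕ → Prop)
    (hkeep : ([1, 2, 4, 5, 6, 7, 8, 9, 11].all fun r =>
      pre.keeps r && body.keeps r && post.keeps r) = true)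
    (hl : l.length ≤ n) (hcap : ∀ v, (L v).length ≤ Y.cap v)
    (hid : ∀ v ∈ l, ∀ u ∈ L v, Y.b + 16 * id u + 16 ≤ Y.B)
    (h4 : s.reg 4 = l.length) (h5 : s.reg 5 = Y.la)
    (hI : ∀ k (hk : k < l.length) m a w, I k m a w → m (Y.la + k) = Y.b + 16 * l[k] ∧
      fld Y.b m 3 l[k] = Y.st l[k] ∧ fld Y.b m 4 l[k] = (L l[k]).length)
    (hK : ∀ k (hk : k < l.length) j (hj : j < (L l[k]).length) m a w, K k j m a w →
      m (Y.st l[k] + j) = Y.b + 16 * id ((L l[k])[j]))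
    (hpre : ∀ k (hk : k < l.length) (s' : State), s'.reg 1 = s.reg 1 → s'.reg 2 = s.reg 2 →
      s'.reg 7 = Y.b + 16 * l[k] → s'.reg 9 = (L l[k]).length → s'.reg 11 = Y.st l[k] →
      I k s'.mem (s'.reg 3) (s'.reg 12) →
      pre.wp Y.B s' fun s'' => K k 0 s''.mem (s''.reg 3) (s''.reg 12))
    (hbody : ∀ k (hk : k < l.length) j (hj : j < (L l[k]).length) (s' : State),
      s'.reg 1 = s.reg 1 → s'.reg 2 = s.reg 2 →
      s'.reg 7 = Y.b + 16 * l[k] → s'.reg 10 = Y.b + 16 * id ((L l[k])[j]) →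
      K k j s'.mem (s'.reg 3) (s'.reg 12) →
      body.wp Y.B s' fun s'' => K k (j + 1) s''.mem (s''.reg 3) (s''.reg 12))
    (hpost : ∀ k (hk : k < l.length) (s' : State), s'.reg 1 = s.reg 1 → s'.reg 2 = s.reg 2 →
      s'.reg 7 = Y.b + 16 * l[k] → s'.reg 11 = Y.st l[k] →
      K k (L l[k]).length s'.mem (s'.reg 3) (s'.reg 12) →
      post.wp Y.B s' fun s'' => I (k + 1) s''.mem (s''.reg 3) (s''.reg 12))
    (h0 : I 0 s.mem (s.reg 3) (s.reg 12)) :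
    RunsTo Y.B (forEdges pre body post) s
      (edgesTime (pre.cost + body.cost + post.cost) l L)
      fun s' => I l.length s'.mem (s'.reg 3) (s'.reg 12) := by
  have hlab := Y.la_le
  have hbB := Y.le_B
  simp only [List.all_cons, List.all_nil, Bool.and_eq_true, Bool.and_true] at hkeep
  obtain ⟨⟨⟨p1, b1⟩, q1⟩, ⟨⟨p2, b2⟩, q2⟩, ⟨⟨p4, b4⟩, q4⟩, ⟨⟨p5, b5⟩, q5⟩, ⟨⟨p6, b6⟩, q6⟩,
    ⟨⟨p7, b7⟩, q7⟩, ⟨⟨p8, b8⟩, q8⟩, ⟨⟨p9, b9⟩, q9⟩, ⟨⟨p11, b11⟩, q11⟩⟩ := hkeep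
  refine (RunsTo.for (N := l.length) (c := fun k => 8 + pre.cost +
    ((if hk : k < l.length then (L l[k]).length else 0) * (body.cost + 5) + 2 + post.cost)) I ?_ h4
    (by omega) (by omega) h0 ?_).mono ?_ fun _ h => h
  · refine ⟨by norm_num, by norm_num, by norm_num, by norm_num, by norm_num, ?_, ?_⟩
    · simp [Prog.keeps, Prog.for, Prog.getF, p6, b6, q6]
    · simp [Prog.keeps, Prog.for, Prog.getF, p4, b4, q4]
  · intro k hk s' hreg h6 hIk
    have r1 : s'.reg 1 = s.reg 1 := hreg 1 (by
      simp [Prog.keeps, Prog.for, Prog.getF, p1, b1, q1])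
    have r2 : s'.reg 2 = s.reg 2 := hreg 2 (by
      simp [Prog.keeps, Prog.for, Prog.getF, p2, b2, q2])
    have r5 : s'.reg 5 = Y.la := (hreg 5 (by
      simp [Prog.keeps, Prog.for, Prog.getF, p5, b5, q5])).trans h5
    obtain ⟨e1, e2, e3⟩ := hI k hk _ _ _ hIk
    rw [dif_pos hk]
    set v := l[k] with hv
    have hvn := v.2
    have hst := Y.st_le v
    have hcapv := hcap v
    have step1 : RunsTo Y.B (.seq (.add 28 5 6) (.seq (.load 7 28) (.seq (.getF 11 7 3)
        (.getF 9 7 4)))) s' 8 fun s1 => I k s1.mem (s1.reg 3) (s1.reg 12) ∧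
        s1.reg 7 = Y.b + 16 * v ∧ s1.reg 9 = (L v).length ∧ s1.reg 11 = Y.st v ∧
        s1.reg 1 = s.reg 1 ∧ s1.reg 2 = s.reg 2 := by
      refine RunsTo.of_wp (p := .seq (.add 28 5 6) (.seq (.load 7 28) (.seq (.getF 11 7 3)
        (.getF 9 7 4)))) ?_
      simp only [Prog.wp, State.setReg_reg, State.setReg_mem, r5, h6, if_true, e1]
      refine ⟨by omega, by omega, by omega, ?_⟩
      refine wp_getF (b := Y.b) (j := v) (by simp) (by norm_num) (by omega) (by norm_num)
        (by simp only [State.setReg_mem]; omega) ?_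
      refine wp_getF (b := Y.b) (j := v) (by simp) (by norm_num) (by omega) (by norm_num)
        (by simp only [State.setReg_mem]; omega) ?_
      simp only [State.setReg_reg, State.setReg_mem, e2, e3]
      norm_num
      exact ⟨hIk, r1, r2⟩
    refine ((step1.seq (T' := pre.cost) (P := fun s2 => K k 0 s2.mem (s2.reg 3) (s2.reg 12) ∧
        s2.reg 7 = Y.b + 16 * v ∧ s2.reg 9 = (L v).length ∧ s2.reg 11 = Y.st v ∧
        s2.reg 1 = s.reg 1 ∧ s2.reg 2 = s.reg 2) ?_).seq
        (T' := (L v).length * (body.cost + 5) + 2 + post.cost) fun s2 hs2 => ?_).mono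
        (by omega) fun _ h => h
    · rintro s1 ⟨hI1, h7, h9, h11, h1, h2⟩
      refine (RunsTo.of_wp (hpre k hk s1 h1 h2 h7 h9 h11 hI1)).frame.mono le_rfl ?_
      rintro s2 ⟨hs2, hr⟩
      exact ⟨hs2, (hr 7 p7).trans h7, (hr 9 p9).trans h9, (hr 11 p11).trans h11,
        (hr 1 p1).trans h1, (hr 2 p2).trans h2⟩
    · obtain ⟨hK0, h7, h9, h11, h1, h2⟩ := hs2
      have step3 : RunsTo Y.B (.for 8 9 (.seq (.seq (.add 28 11 8) (.load 10 28)) body)) s2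
          ((L v).length * (body.cost + 5) + 2) fun s3 =>
          K k (L v).length s3.mem (s3.reg 3) (s3.reg 12) ∧
          s3.reg 7 = Y.b + 16 * v ∧ s3.reg 11 = Y.st v ∧ s3.reg 1 = s.reg 1 ∧
          s3.reg 2 = s.reg 2 := by
        refine (RunsTo.for (N := (L v).length) (c := fun _ => 2 + body.cost) (K k) ?_ h9
          (by omega) (by omega) hK0 ?_).frame.mono ?_ ?_
        · refine ⟨by norm_num, by norm_num, by norm_num, by norm_num, by norm_num, ?_, ?_⟩
          · simp [Prog.keeps, b8]
          · simp [Prog.keeps, b9]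
        · intro j hj s3 hreg3 h8 hKj
          have hB := hid v (by simp [hv]) _ (List.getElem_mem hj)
          have ej := hK k hk j hj _ _ _ hKj
          have f1 : s3.reg 1 = s.reg 1 := (hreg3 1 (by simp [Prog.keeps, Prog.for, b1])).trans h1
          have f2 : s3.reg 2 = s.reg 2 := (hreg3 2 (by simp [Prog.keeps, Prog.for, b2])).trans h2
          have f7 := (hreg3 7 (by simp [Prog.keeps, Prog.for, b7])).trans h7
          have f11 := (hreg3 11 (by simp [Prog.keeps, Prog.for, b11])).trans h11
          have hload : RunsTo Y.B (.seq (.add 28 11 8) (.load 10 28)) s3 2 fun s4 =>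
              K k j s4.mem (s4.reg 3) (s4.reg 12) ∧ s4.reg 1 = s.reg 1 ∧ s4.reg 2 = s.reg 2 ∧
              s4.reg 7 = Y.b + 16 * v ∧ s4.reg 10 = Y.b + 16 * id ((L v)[j]) := by
            refine RunsTo.of_wp (p := .seq (.add 28 11 8) (.load 10 28)) ?_
            simp only [Prog.wp, State.setReg_reg, State.setReg_mem, f11, h8, if_true]
            have ej' : s3.mem (Y.st v + j) = Y.b + 16 * id ((L v)[j]) := ej
            rw [ej']
            norm_num
            exact ⟨by omega, by omega, hKj, f1, f2, f7⟩
          refine hload.seq fun s4 hs4 => ?_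
          obtain ⟨hK4, g1, g2, g7, g10⟩ := hs4
          exact RunsTo.of_wp (hbody k hk j hj s4 g1 g2 g7 g10 hK4)
        · rw [Finset.sum_const, Finset.card_range, smul_eq_mul]
          have : 2 + body.cost + 3 = body.cost + 5 := by omega
          rw [this]
        · rintro s3 ⟨hs3, hr⟩
          exact ⟨hs3, (hr 7 (by simp [Prog.keeps, Prog.for, b7])).trans h7,
            (hr 11 (by simp [Prog.keeps, Prog.for, b11])).trans h11,
            (hr 1 (by simp [Prog.keeps, Prog.for, b1])).trans h1,
            (hr 2 (by simp [Prog.keeps, Prog.for, b2])).trans h2⟩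
      refine step3.seq fun s3 hs3 => ?_
      obtain ⟨hK3, g7, g11, g1, g2⟩ := hs3
      exact RunsTo.of_wp (hpost k hk s3 g1 g2 g7 g11 hK3)
  · have hsum : ∀ c : ℕ, ∑ k ∈ Finset.range l.length,
        ((if hk : k < l.length then (L l[k]).length else 0) * c) =
        (l.map fun v => (L v).length).sum * c := by
      intro c
      rw [← Finset.sum_mul]
      congr 1
      exact sum_range_getElem l fun v => (L v).length
    simp only [Finset.sum_add_distrib, hsum, Finset.sum_const, Finset.card_range, smul_eq_mul,
      edgesTime]
    generalize (l.map fun v => (L v).length).sum = t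
    nlinarith [Nat.zero_le (l.length * body.cost), Nat.zero_le (t * pre.cost),
      Nat.zero_le (t * post.cost)]

end Edges

/-! ### The state of the construction between two levels -/

section Level

variable {n : ℕ} (Δ : ℕ) (G : SimpleGraph (Fin n))

/-- The nodes of the graphs `G₀, …, Gᵢ` and the supervertex of degree zero. -/
def Seen (i : ℕ) (x : Node n) : Prop :=
  x = zeroNode n ∨ ∃ j ≤ i, x ∈ (layer Δ G j).verts

/-- The contents of the memory when the graph `Gᵢ` has been constructed: the record of `x` has
number `id x`, `L v` is the list of neighbours of `v` in `Gᵢ` or, for vertices of lower level, in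
the last graph that contains `v`, and `l` lists the original vertices of `Gᵢ`. The first `al`
records are in use. The memory `m₀` is the one at the beginning, and `f` holds the bits of the given
set. -/
structure LevelInv (Y : Layout n) (m₀ f : ℕ → ℕ) (i : ℕ) (id : Node n → ℕ)
    (L : Fin n → List (Node n)) (l : List (Fin n)) (al : ℕ) (m : ℕ → ℕ) : Prop where
  id_inl : ∀ v : Fin n, id (Sum.inl v) = v
  id_zero : id (zeroNode n) = n
  id_inj : ∀ x, Seen Δ G i x → ∀ y, Seen Δ G i y → id x = id y → x = y
  id_lt : ∀ x, Seen Δ G i x → id x < al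
  lt_al : n < al
  sv : ∀ x, Seen Δ G i x → x ≠ zeroNode n → x ∉ (layer Δ G i).verts →
    fld Y.b m 0 (id x) = Y.b + 16 * id (sv Δ G x)
  start : ∀ v : Fin n, fld Y.b m 3 v = Y.st v
  length : ∀ v : Fin n, fld Y.b m 4 v = (L v).length
  nodup : ∀ v, (L v).Nodup
  mem_list : ∀ v y, y ∈ L v ↔
    y ∈ (layer Δ G (min i (level Δ G (Sum.inl v)))).nbrs (Sum.inl v)
  array : ∀ v (k : ℕ) (hk : k < (L v).length), m (Y.st v + k) = Y.b + 16 * id ((L v)[k])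
  cap : ∀ v, (L v).length ≤ Y.cap v
  l_nodup : l.Nodup
  mem_l : ∀ v, v ∈ l ↔ v ∈ orig Δ G i
  l_array : ∀ (k : ℕ) (hk : k < l.length), m (Y.la + k) = Y.b + 16 * l[k]
  deg_inl : ∀ v : Fin n, fld Y.b m 6 v = Δ
  deg_inr : ∀ A, Seen Δ G i (Sum.inr A) → fld Y.b m 6 (id (Sum.inr A)) = A.card
  high : ∀ A, Seen Δ G i (Sum.inr A) → fld Y.b m 11 (id (Sum.inr A)) = 0
  nadj : ∀ x, Seen Δ G i x → fld Y.b m 1 (id x) = 0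
  undom : ∀ x, Seen Δ G i x → fld Y.b m 2 (id x) = 0
  sv_zero : fld Y.b m 0 n = 0
  fwd_zero : fld Y.b m 9 n = Y.b + 16 * n
  bits : fld Y.b m 12 = f
  raw : ∀ a < Y.M, m a = m₀ a

variable {Δ G} {Y : Layout n} {m₀ f : ℕ → ℕ} {i : ℕ} {id : Node n → ℕ}
  {L : Fin n → List (Node n)} {l : List (Fin n)} {al : ℕ} {m : ℕ → ℕ}

theorem Seen.of_mem {i : ℕ} {x : Node n} (hx : x ∈ (layer Δ G i).verts) : Seen Δ G i x :=
  Or.inr ⟨i, le_rfl, hx⟩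

theorem Seen.inl (i : ℕ) (v : Fin n) : Seen Δ G i (Sum.inl v) :=
  Or.inr ⟨0, Nat.zero_le _, by rw [← mem_orig, orig_zero]; simp⟩

theorem Seen.zero (i : ℕ) : Seen Δ G i (zeroNode n) := Or.inl rfl

theorem Seen.succ_iff {i : ℕ} {x : Node n} :
    Seen Δ G (i + 1) x ↔ Seen Δ G i x ∨ x ∈ (layer Δ G (i + 1)).verts := by
  constructor
  · rintro (h | ⟨j, hj, h⟩)
    · exact Or.inl (Or.inl h)
    · rcases Nat.lt_succ_iff_lt_or_eq.1 (Nat.lt_succ_of_le hj) with hj | rfl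
      · exact Or.inl (Or.inr ⟨j, by omega, h⟩)
      · exact Or.inr h
  · rintro ((h | ⟨j, hj, h⟩) | h)
    · exact Or.inl h
    · exact Or.inr ⟨j, by omega, h⟩
    · exact Or.inr ⟨i + 1, le_rfl, h⟩

namespace LevelInv

variable (h : LevelInv Δ G Y m₀ f i id L l al m)

include h

theorem mem_L (hi : i ≤ height Δ G) {v : Fin n} (hv : v ∈ orig Δ G i) {y : Node n} :
    y ∈ L v ↔ y ∈ (layer Δ G i).verts ∧ v ∈ onb G y := by
  rw [h.mem_list, Nat.min_eq_left ((Sparse.mem_orig_iff hi).1 hv), mem_nbrs hv]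

theorem ne_zero_of_mem (hi : i ≤ height Δ G) {v : Fin n} (hv : v ∈ orig Δ G i) {y : Node n}
    (hy : y ∈ L v) : y ≠ zeroNode n := by
  rintro rfl
  have := ((h.mem_L hi hv).1 hy).2
  simp [zeroNode] at this

theorem length_le : l.length ≤ n := by
  have := h.l_nodup.length_le_card
  simpa using this

theorem id_le_of_le {B' : ℕ} (hB : Y.b + 16 * al ≤ B') {x : Node n} (hx : Seen Δ G i x) :
    Y.b + 16 * id x + 16 ≤ B' := by
  have := h.id_lt x hx
  omega

theorem length_eq_card (hi : i ≤ height Δ G) {v : Fin n} (hv : v ∈ orig Δ G i) :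
    (L v).length = ((layer Δ G i).nbrs (Sum.inl v)).card := by
  rw [← List.toFinset_card_of_nodup (h.nodup v)]
  congr 1
  ext y
  rw [List.mem_toFinset, h.mem_list, Nat.min_eq_left ((Sparse.mem_orig_iff hi).1 hv)]

/-- Each nonisolated node of the level is a vertex in the list or a neighbour of one. -/
theorem exists_mem_L (hi : i ≤ height Δ G) {A : Finset (Fin n)}
    (hA : Sum.inr A ∈ (layer Δ G i).verts) (hne : Sum.inr A ≠ zeroNode n) :
    ∃ v ∈ l, Sum.inr A ∈ L v := by
  have hne' : A ≠ ∅ := fun e => hne (by rw [e]; rfl)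
  obtain ⟨v, hv⟩ := Finset.nonempty_iff_ne_empty.2 hne'
  have hvo := subset_orig hA hv
  exact ⟨v, (h.mem_l v).2 hvo, (h.mem_L hi hvo).2 ⟨hA, hv⟩⟩

end LevelInv

/-! ### Marking the vertices of high degree -/

/-- Reset the classes, and mark the vertices of degree at least `Δ`. -/
def markHigh (Δ : ℕ) : Prog :=
  .seq (.seq (.const 14 0) (.setF 2 7 14)) (forEdges
    (.seq (.setF 7 5 2) (.seq (.const 14 Δ)
      (.seq (.ite 9 14 (.const 15 0) (.const 15 1)) (.setF 7 11 15))))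
    (.setF 10 5 2) .skip)

/-- The effect of `markHigh`. -/
structure Marked (Δ : ℕ) (G : SimpleGraph (Fin n)) (Y : Layout n) (i : ℕ) (id : Node n → ℕ)
    (m m' : ℕ → ℕ) : Prop where
  cls : ∀ x ∈ (layer Δ G i).verts, x ≠ zeroNode n → fld Y.b m' 5 (id x) = Y.b + 16 * n
  high : ∀ v ∈ orig Δ G i, fld Y.b m' 11 v = open Classical in
    if v ∈ orig Δ G (i + 1) then 1 else 0
  high_of_le : ∀ j, n ≤ j → fld Y.b m' 11 j = fld Y.b m 11 j
  stamp : fld Y.b m' 7 n = 0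
  other : ∀ c < 16, c ≠ 5 → c ≠ 7 → c ≠ 11 → fld Y.b m' c = fld Y.b m c
  raw : ∀ a < Y.b, m' a = m a

theorem update_eq_of_eq {f : ℕ → ℕ} {y c : ℕ} (x : ℕ) (h : f y = c) :
    Function.update f x c y = c := by
  by_cases e : y = x
  · rw [e, Function.update_self]
  · rw [Function.update_of_ne e, h]

/-- A bound for the cost of the bodies of the loops over edges. -/
def bodyTime : ℕ := 200

theorem markHigh_spec (h : LevelInv Δ G Y m₀ f i id L l al m) (hi : i ≤ height Δ G)
    (hB : Y.b + 16 * al ≤ Y.B) (hΔ : Δ < Y.B) {s : State} (hm : s.mem = m)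
    (h1 : s.reg 1 = Y.b) (h2 : s.reg 2 = Y.b + 16 * n) (h4 : s.reg 4 = l.length)
    (h5 : s.reg 5 = Y.la) :
    RunsTo Y.B (markHigh Δ) s (4 + edgesTime bodyTime l L) fun s' =>
      Marked Δ G Y i id m s'.mem ∧ s'.reg 3 = s.reg 3 := by
  classical
  have hlab := Y.la_le
  have hlaM := Y.M_le_la
  have hbB := Y.le_B
  have hMn := Y.le_M
  subst hm
  have hzB : Y.b + 16 * n + 16 ≤ Y.B := by omega
  have hstart : RunsTo Y.B (.seq (.const 14 0) (.setF 2 7 14)) s 4 fun s' =>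
      s'.mem = Function.update s.mem (Y.b + 16 * n + 7) 0 ∧
      ∀ r, r ≠ 14 → r ≠ 31 → s'.reg r = s.reg r := by
    refine RunsTo.of_wp (p := .seq (.const 14 0) (.setF 2 7 14)) ?_
    refine ⟨by omega, ?_⟩
    refine wp_setF (b := Y.b) (j := n) (by simp [h2]) (by norm_num) (by norm_num) hzB
      (by norm_num) (by simp; omega) ?_
    refine ⟨by simp, fun r hr hr' => by simp [hr, hr']⟩
  refine hstart.seq fun s₁ hs₁ => ?_
  obtain ⟨hm₁, hr₁⟩ := hs₁
  -- The vertices `V` and the neighbours `U` have been initialized.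
  let J : (Fin n → Prop) → (Node n → Prop) → (ℕ → ℕ) → ℕ → ℕ → Prop := fun V U m' a _ =>
    (∀ v, V v → fld Y.b m' 5 v = Y.b + 16 * n ∧ fld Y.b m' 11 v =
      if v ∈ orig Δ G (i + 1) then 1 else 0) ∧
    (∀ u, U u → fld Y.b m' 5 (id u) = Y.b + 16 * n) ∧
    (∀ j, n ≤ j → fld Y.b m' 11 j = fld Y.b s.mem 11 j) ∧ fld Y.b m' 7 n = 0 ∧
    (∀ c < 16, c ≠ 5 → c ≠ 7 → c ≠ 11 → fld Y.b m' c = fld Y.b s.mem c) ∧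
    (∀ a < Y.b, m' a = s.mem a) ∧ a = s.reg 3
  have hvB : ∀ v : Fin n, Y.b + 16 * (v : ℕ) + 16 ≤ Y.B := fun v => by have := v.2; omega
  have huB : ∀ v ∈ l, ∀ u ∈ L v, Y.b + 16 * id u + 16 ≤ Y.B := fun v hv u hu =>
    h.id_le_of_le hB (Seen.of_mem ((h.mem_L hi ((h.mem_l v).1 hv)).1 hu).1)
  refine (forEdges_spec Y (id := id) (l := l) (L := L) (s := s₁)
    (fun k => J (fun v => v ∈ l.take k) (fun u => ∃ v ∈ l.take k, u ∈ L v))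
    (fun k j => J (fun v => v ∈ l.take (k + 1))
      (fun u => (∃ v ∈ l.take k, u ∈ L v) ∨ ∃ hk : k < l.length, u ∈ (L l[k]).take j))
    (by rfl) h.length_le h.cap huB
    ((hr₁ 4 (by norm_num) (by norm_num)).trans h4) ((hr₁ 5 (by norm_num) (by norm_num)).trans h5)
    ?_ ?_ ?_ ?_ ?_ ?_).mono ?_ ?_
  · rintro k hk m' a w ⟨j1, j2, j3, j4, j5, j6, j7⟩
    have := h.length_le
    refine ⟨?_, ?_, ?_⟩
    · rw [j6 _ (by omega), h.l_array k hk]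
    · rw [j5 3 (by norm_num) (by norm_num) (by norm_num) (by norm_num), h.start]
    · rw [j5 4 (by norm_num) (by norm_num) (by norm_num) (by norm_num), h.length]
  · rintro k hk j hj m' a w ⟨j1, j2, j3, j4, j5, j6, j7⟩
    have e1 := Y.st_le l[k]
    have e2 := h.cap l[k]
    rw [j6 _ (by omega), h.array _ j hj]
  · rintro k hk s' g1 g2 g7 g9 g11 ⟨j1, j2, j3, j4, j5, j6, j7⟩
    have g2' : s'.reg 2 = Y.b + 16 * n := by
      rw [g2, hr₁ 2 (by norm_num) (by norm_num), h2]
    have hv := (h.mem_l l[k]).1 (List.getElem_mem hk)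
    have hhigh : l[k] ∈ orig Δ G (i + 1) ↔ Δ ≤ (L l[k]).length := by
      rw [mem_orig_succ, h.length_eq_card hi hv, and_iff_right hv]
    refine wp_setF g7 (by norm_num) (by norm_num) (hvB _) (by norm_num) (by omega) ?_
    simp only [Prog.wp, State.setReg_reg, State.setMem_reg]
    norm_num
    have fin : ∀ (s₂ : State) (x : ℕ), x ≤ 1 → (x = if l[k] ∈ orig Δ G (i + 1) then 1 else 0) →
        s₂.mem = Function.update s'.mem (Y.b + 16 * (l[k] : ℕ) + 5) (Y.b + 16 * n) →
        s₂.reg 3 = s'.reg 3 → s₂.reg 7 = s'.reg 7 → s₂.reg 15 = x →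
        (Prog.setF 7 11 15).wp Y.B s₂ fun s'' => J (fun v => v ∈ l.take (k + 1))
          (fun u => ∃ v ∈ l.take k, u ∈ L v) s''.mem (s''.reg 3) (s''.reg 12) := by
      intro s₂ x hx1 hx hm2 hr3 hr7 hr15
      refine wp_setF (b := Y.b) (j := l[k]) (hr7.trans g7) (by norm_num) (by norm_num) (hvB _)
        (by norm_num) (by omega) ?_
      simp only [State.setMem_mem, State.setReg_mem, hm2, hr15]
      refine ⟨?_, ?_, ?_, ?_, ?_, ?_, ?_⟩
      · intro v hv
        rw [List.take_succ_eq_append_getElem hk, List.mem_append, List.mem_singleton] at hv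
        rw [fld_update_of_ne _ _ _ (by norm_num) (by norm_num) (by norm_num), fld_update_self,
          fld_update_self, fld_update_of_ne _ _ _ (by norm_num) (by norm_num) (by norm_num)]
        rcases hv with hv | rfl
        · refine ⟨update_eq_of_eq _ (j1 v hv).1, ?_⟩
          by_cases e : v = l[k]
          · rw [e, Function.update_self, hx]
          · rw [Function.update_of_ne (fun e' => e (Fin.ext e')), (j1 v hv).2]
        · rw [Function.update_self, Function.update_self]
          exact ⟨rfl, hx⟩
      · intro u hu
        rw [fld_update_of_ne _ _ _ (by norm_num) (by norm_num) (by norm_num), fld_update_self]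
        exact update_eq_of_eq _ (j2 u hu)
      · intro j hj
        rw [fld_update_self, Function.update_of_ne (by have := (l[k]).2; omega),
          fld_update_of_ne _ _ _ (by norm_num) (by norm_num) (by norm_num), j3 j hj]
      · rw [fld_update_of_ne _ _ _ (by norm_num) (by norm_num) (by norm_num),
          fld_update_of_ne _ _ _ (by norm_num) (by norm_num) (by norm_num), j4]
      · intro c hc h5 h7 h11
        rw [fld_update_of_ne _ _ _ h11 (by norm_num) hc, fld_update_of_ne _ _ _ h5 (by norm_num) hc,
          j5 c hc h5 h7 h11]
      · intro a ha
        rw [update_fld_raw _ _ _ _ ha, update_fld_raw _ _ _ _ ha, j6 a ha]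
      · simpa [hr3] using j7
    refine ⟨hΔ, ?_, ?_⟩
    · intro hlt
      refine ⟨by omega, fin _ 0 (by omega) ?_ ?_ ?_ ?_ ?_⟩
      · rw [if_neg (by rw [hhigh]; omega)]
      all_goals simp [g2']
    · intro hge
      refine ⟨by omega, fin _ 1 (by omega) ?_ ?_ ?_ ?_ ?_⟩
      · rw [if_pos (by rw [hhigh]; omega)]
      all_goals simp [g2']
  · rintro k hk j hj s' g1 g2 g7 g10 ⟨j1, j2, j3, j4, j5, j6, j7⟩
    have g2' : s'.reg 2 = Y.b + 16 * n := by
      rw [g2, hr₁ 2 (by norm_num) (by norm_num), h2]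
    refine wp_setF g10 (by norm_num) (by norm_num) (huB _ (List.getElem_mem hk) _
      (List.getElem_mem hj)) (by norm_num) (by omega) ?_
    simp only [State.setMem_mem, State.setReg_mem, g2']
    refine ⟨?_, ?_, ?_, ?_, ?_, ?_, ?_⟩
    · intro v hv
      rw [fld_update_self, fld_update_of_ne _ _ _ (by norm_num) (by norm_num) (by norm_num)]
      exact ⟨update_eq_of_eq _ (j1 v hv).1, (j1 v hv).2⟩
    · rintro u hu
      rw [fld_update_self]
      by_cases e : u = (L l[k])[j]
      · rw [e, Function.update_self]
      · refine update_eq_of_eq _ (j2 u (hu.imp_right ?_))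
        rintro ⟨hk', hu⟩
        rw [List.take_succ_eq_append_getElem hj, List.mem_append, List.mem_singleton] at hu
        exact ⟨hk', hu.resolve_right e⟩
    · intro j hj
      rw [fld_update_of_ne _ _ _ (by norm_num) (by norm_num) (by norm_num), j3 j hj]
    · rw [fld_update_of_ne _ _ _ (by norm_num) (by norm_num) (by norm_num), j4]
    · intro c hc h5 h7 h11
      rw [fld_update_of_ne _ _ _ h5 (by norm_num) hc, j5 c hc h5 h7 h11]
    · intro a ha
      rw [update_fld_raw _ _ _ _ ha, j6 a ha]
    · simpa using j7
  · rintro k hk s' g1 g2 g7 g11 ⟨j1, j2, j3, j4, j5, j6, j7⟩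
    refine ⟨j1, ?_, j3, j4, j5, j6, j7⟩
    rintro u ⟨v, hv, hu⟩
    rw [List.take_succ_eq_append_getElem hk, List.mem_append, List.mem_singleton] at hv
    rcases hv with hv | rfl
    · exact j2 u (Or.inl ⟨v, hv, hu⟩)
    · exact j2 u (Or.inr ⟨hk, by simpa using hu⟩)
  · refine ⟨by simp, by simp, ?_, ?_, ?_, ?_, hr₁ 3 (by norm_num) (by norm_num)⟩
    · intro j hj
      rw [hm₁, fld_update_of_ne _ _ _ (by norm_num) (by norm_num) (by norm_num)]
    · rw [hm₁, fld_update_self, Function.update_self]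
    · intro c hc h5 h7 h11
      rw [hm₁, fld_update_of_ne _ _ _ h7 (by norm_num) hc]
    · intro a ha
      rw [hm₁, update_fld_raw _ _ _ _ ha]
  · simp only [edgesTime]
    gcongr
    simp [Prog.cost, Prog.setF, bodyTime]
  · rintro s' ⟨j1, j2, j3, j4, j5, j6, j7⟩
    rw [List.take_length] at j1 j2
    refine ⟨⟨?_, fun v hv => (j1 v ((h.mem_l v).2 hv)).2, j3, j4, j5, j6⟩, j7⟩
    rintro (v | A) hx hne
    · rw [h.id_inl]
      exact (j1 v ((h.mem_l v).2 (mem_orig.2 hx))).1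
    · exact j2 _ (h.exists_mem_L hi hx hne)

end Level

/-! ### Partition of the vertices of low degree -/

section Refine

variable {n : ℕ} (Δ : ℕ) (G : SimpleGraph (Fin n))

/-- The nodes of `Gᵢ` that are not kept in `Gᵢ₊₁` as original vertices, other than the supervertex
of degree zero. -/
def Low (i : ℕ) (x : Node n) : Prop :=
  x ∈ (layer Δ G i).verts ∧ x ∉ (layer Δ G i).high Δ ∧ x ≠ zeroNode n

open Classical in
/-- The nodes `x` of low degree are partitioned according to the sets `C x`. The class of `T ∈ TD`
has the record with number `tid T`, and this record has a pointer to the record with number `φ T`.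
The records of the classes are those with numbers from `al` up to `al'`, and the one of the
supervertex of degree zero for the empty set. Apart from that, the memory `m` agrees with `m₀`.

The sets `C x` are made of the vertices `P`, which have been dealt with, and of the vertices `H`,
which are being dealt with. The class of a set `T` that does not contain `h ∈ H` is stamped with `h`
if the class of `insert h T` exists, and then there is a pointer to the latter. -/
structure Classes (Y : Layout n) (m₀ : ℕ → ℕ) (i : ℕ) (id : Node n → ℕ) (al : ℕ)
    (P H : Finset (Fin n)) (C : Node n → Finset (Fin n)) (TD : Finset (Finset (Fin n)))
    (tid φ : Finset (Fin n) → ℕ) (al' : ℕ) (m : ℕ → ℕ) : Prop where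
  le_al : al ≤ al'
  empty_mem : ∅ ∈ TD
  tid_empty : tid ∅ = n
  inj : ∀ T ∈ TD, ∀ T' ∈ TD, tid T = tid T' → T = T'
  le_tid : ∀ T ∈ TD, T ≠ ∅ → al ≤ tid T
  tid_lt : ∀ T ∈ TD, tid T < al'
  subset : ∀ T ∈ TD, T ⊆ P ∪ H
  deg : ∀ T ∈ TD, fld Y.b m 6 (tid T) = T.card
  nadj : ∀ T ∈ TD, fld Y.b m 1 (tid T) = 0
  undom : ∀ T ∈ TD, fld Y.b m 2 (tid T) = 0
  high : ∀ T ∈ TD, fld Y.b m 11 (tid T) = 0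
  fwd : ∀ T ∈ TD, fld Y.b m 9 (tid T) = Y.b + 16 * φ T
  mark : ∀ T ∈ TD, T ≠ ∅ → fld Y.b m 10 (tid T) = 0
  stamp : ∀ T ∈ TD, fld Y.b m 7 (tid T) = 0 ∨ ∃ v ∈ P ∪ H, fld Y.b m 7 (tid T) = Y.b + 16 * v
  split : ∀ h ∈ H, ∀ T ∈ TD, h ∉ T →
    (fld Y.b m 7 (tid T) = Y.b + 16 * h ∧ insert h T ∈ TD ∧
      fld Y.b m 8 (tid T) = Y.b + 16 * tid (insert h T)) ∨
    (fld Y.b m 7 (tid T) ≠ Y.b + 16 * h ∧ insert h T ∉ TD)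
  mem : ∀ x, Low Δ G i x → C x ∈ TD
  cls : ∀ x, Low Δ G i x → fld Y.b m 5 (id x) = Y.b + 16 * tid (C x)
  node_high : ∀ x ∈ (layer Δ G i).verts,
    fld Y.b m 11 (id x) = if x ∈ (layer Δ G i).high Δ then 1 else 0
  high_of_le : ∀ j, n ≤ j → j < al → fld Y.b m 11 j = fld Y.b m₀ 11 j
  old : ∀ c < 16, c ≠ 5 → c ≠ 7 → c ≠ 8 → c ≠ 9 → c ≠ 11 → ∀ j < al,
    fld Y.b m c j = fld Y.b m₀ c j
  bits : fld Y.b m 12 = fld Y.b m₀ 12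
  raw : ∀ a < Y.b, m a = m₀ a

variable {Δ G} {Y : Layout n} {m₀ f : ℕ → ℕ} {i : ℕ} {id : Node n → ℕ}
  {L : Fin n → List (Node n)} {l : List (Fin n)} {al al' : ℕ} {m : ℕ → ℕ}
  {P H : Finset (Fin n)} {C : Node n → Finset (Fin n)} {TD : Finset (Finset (Fin n))}
  {tid φ : Finset (Fin n) → ℕ}

theorem Classes.congr (h : Classes Δ G Y m₀ i id al P H C TD tid φ al' m)
    {C' : Node n → Finset (Fin n)} (hC : ∀ x, Low Δ G i x → C' x = C x) :
    Classes Δ G Y m₀ i id al P H C' TD tid φ al' m :=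
  { h with
    mem := fun x hx => by rw [hC x hx]; exact h.mem x hx
    cls := fun x hx => by rw [hC x hx]; exact h.cls x hx }

/-- The partition before the first vertex of high degree has been dealt with. -/
theorem Classes.of_marked (h : LevelInv Δ G Y m₀ f i id L l al m) {m' : ℕ → ℕ}
    (hm : Marked Δ G Y i id m m') :
    Classes Δ G Y m i id al ∅ ∅ (fun _ => ∅) {∅} (fun _ => n) (fun _ => n) al m' := by
  classical
  have h0 : Seen Δ G i (Sum.inr ∅) := Seen.zero i
  have hid : id (Sum.inr ∅) = n := h.id_zero
  have d6 := h.deg_inr _ h0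
  have d1 := h.nadj _ h0
  have d2 := h.undom _ h0
  have d11 := h.high _ h0
  rw [hid] at d6 d1 d2 d11
  refine ⟨le_rfl, by simp, rfl, by simp, by simp, fun _ _ => h.lt_al, by simp, ?_, ?_, ?_, ?_, ?_,
    by simp, ?_, by simp, by simp, ?_, ?_, fun j hj _ => hm.high_of_le j hj, ?_,
    hm.other 12 (by norm_num) (by norm_num) (by norm_num) (by norm_num), hm.raw⟩
  · intro T hT
    rw [Finset.mem_singleton.1 hT, hm.other 6 (by norm_num) (by norm_num) (by norm_num)
      (by norm_num), d6]
  · intro T hT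
    rw [hm.other 1 (by norm_num) (by norm_num) (by norm_num) (by norm_num), d1]
  · intro T hT
    rw [hm.other 2 (by norm_num) (by norm_num) (by norm_num) (by norm_num), d2]
  · intro T hT
    rw [hm.high_of_le n le_rfl, d11]
  · intro T hT
    rw [hm.other 9 (by norm_num) (by norm_num) (by norm_num) (by norm_num), h.fwd_zero]
  · exact fun T _ => Or.inl hm.stamp
  · exact fun x hx => hm.cls x hx.1 hx.2.2
  · rintro (v | A) hx
    · rw [h.id_inl, hm.high v (mem_orig.2 hx)]
      simp only [inl_mem_high_iff]
    · have hA := Seen.of_mem hx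
      have hn : n ≤ id (Sum.inr A) := by
        by_contra! hlt
        have := h.id_inj _ hA _ (Seen.inl i ⟨_, hlt⟩) (h.id_inl ⟨_, hlt⟩).symm
        cases this
      rw [hm.high_of_le _ hn, h.high _ hA, if_neg (inr_notMem_high i A)]
  · intro c hc h5 h7 _ _ h11 j _
    rw [hm.other c hc h5 h7 h11]

/-- The node at the address in register `10` moves to the class that arises by the addition of the
vertex at the address in register `7`, where `16` has the address of the present class; that class
is to be made. -/
def newClass : Prog :=
  .seq (.getF 19 16 6) (.seq (.const 20 1) (.seq (.add 19 19 20) (.seq (.setF 3 6 19)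
    (.seq (.setF 3 1 14) (.seq (.setF 3 2 14) (.seq (.setF 3 7 14) (.seq (.setF 3 10 14)
    (.seq (.setF 3 11 14) (.seq (.setF 3 9 3) (.seq (.setF 16 7 7) (.seq (.setF 16 8 3)
    (.seq (.const 20 16) (.add 3 3 20)))))))))))))

/-- The part of `refine` that deals with one edge. -/
def splitBody : Prog :=
  .seq (.getF 13 7 11) (.seq (.const 14 0) (.ite 14 13
    (.seq (.getF 15 10 11) (.ite 14 15 .skip
      (.seq (.getF 16 10 5) (.seq (.getF 17 16 7) (.seq (.ifEq 17 7 .skip newClass)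
        (.seq (.getF 18 16 8) (.setF 10 5 18)))))))
    .skip))

/-- Partition the vertices of low degree according to their neighbours of high degree. -/
def refine : Prog := forEdges .skip splitBody .skip

theorem newClass_wp {B b : ℕ} {t a d : ℕ} {s : State} {Q : State → Prop} {v : ℕ}
    (h3 : s.reg 3 = b + 16 * a) (h7 : s.reg 7 = v) (h14 : s.reg 14 = 0)
    (h16 : s.reg 16 = b + 16 * t) (ha : b + 16 * a + 16 < B) (ht : t < a) (hv : v < B)
    (hd : fld b s.mem 6 t = d) (hdB : d + 1 < B)
    (hQ : ∀ s' : State, s'.reg 3 = b + 16 * (a + 1) → s'.reg 12 = s.reg 12 →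
      s'.reg 10 = s.reg 10 → s'.reg 16 = s.reg 16 →
      (∀ c, c = 1 ∨ c = 2 ∨ c = 10 ∨ c = 11 →
        fld b s'.mem c = Function.update (fld b s.mem c) a 0) →
      fld b s'.mem 6 = Function.update (fld b s.mem 6) a (d + 1) →
      fld b s'.mem 7 = Function.update (Function.update (fld b s.mem 7) a 0) t v →
      fld b s'.mem 8 = Function.update (fld b s.mem 8) t (b + 16 * a) →
      fld b s'.mem 9 = Function.update (fld b s.mem 9) a (b + 16 * a) →
      (∀ c < 16, c ≤ 0 ∨ (3 ≤ c ∧ c ≤ 5) ∨ 12 ≤ c → fld b s'.mem c = fld b s.mem c) →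
      (∀ e < b, s'.mem e = s.mem e) → Q s') :
    newClass.wp B s Q := by
  subst h7
  refine wp_getF h16 (by norm_num) (by omega) (by norm_num) (by omega) ?_
  rw [hd]
  simp only [Prog.wp, State.setReg_reg]
  norm_num
  refine ⟨by omega, by omega, ?_⟩
  iterate 7
    refine wp_setF (b := b) (j := a) (by simp [h3]) (by norm_num) (by norm_num) (by omega)
      (by norm_num) (by simp [h14, h3]; omega) ?_
  iterate 2
    refine wp_setF (b := b) (j := t) (by simp [h16]) (by norm_num) (by norm_num) (by omega)
      (by norm_num) (by simp [h3]; omega) ?_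
  simp only [State.setReg_reg, State.setMem_reg]
  norm_num
  refine ⟨by omega, by rw [h3]; omega, ?_⟩
  apply hQ
  · simp [h3]; ring
  · simp
  · simp
  · simp
  · rintro c (rfl | rfl | rfl | rfl) <;>
      simp [h14, fld_update_self, fld_update_of_ne]
  · simp [fld_update_self, fld_update_of_ne]
  · simp [h14, fld_update_self, fld_update_of_ne]
  · simp [h3, fld_update_self, fld_update_of_ne]
  · simp [h3, fld_update_self, fld_update_of_ne]
  · intro c hc hcc
    have : c ≠ 1 ∧ c ≠ 2 ∧ c ≠ 6 ∧ c ≠ 7 ∧ c ≠ 8 ∧ c ≠ 9 ∧ c ≠ 10 ∧ c ≠ 11 := by omega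
    simp [fld_update_of_ne, this, hc]
  · intro e he
    simp [update_fld_raw _ _ _ _ he]

/-- A node of low degree moves to the class with the additional vertex `v`. -/
theorem Classes.move {v : Fin n} {m' : ℕ → ℕ}
    (h : Classes Δ G Y m₀ i id al P {v} C TD tid φ al' m)
    (hinj : ∀ x ∈ (layer Δ G i).verts, ∀ y ∈ (layer Δ G i).verts, id x = id y → x = y)
    {x : Node n} (hx : Low Δ G i x) (hT : insert v (C x) ∈ TD)
    (hm' : m' = Function.update m (Y.b + 16 * id x + 5) (Y.b + 16 * tid (insert v (C x)))) :
    Classes Δ G Y m₀ i id al P {v} (Function.update C x (insert v (C x))) TD tid φ al' m' := by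
  have hne : ∀ c < 16, c ≠ 5 → fld Y.b m' c = fld Y.b m c := fun c hc h5 => by
    rw [hm', fld_update_of_ne _ _ _ h5 (by norm_num) hc]
  obtain ⟨g0, g1, g2, g3, g4, g5, g6, g7, g8, g9, g10, g11, g12, g13, g14, g15, g16, g17, g18, g19,
    g20, g21⟩ := h
  refine ⟨g0, g1, g2, g3, g4, g5, g6, ?_, ?_, ?_, ?_, ?_, ?_, ?_, ?_, ?_, ?_, ?_, ?_, ?_, ?_, ?_⟩
  · rwa [hne 6 (by norm_num) (by norm_num)]
  · rwa [hne 1 (by norm_num) (by norm_num)]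
  · rwa [hne 2 (by norm_num) (by norm_num)]
  · rwa [hne 11 (by norm_num) (by norm_num)]
  · rwa [hne 9 (by norm_num) (by norm_num)]
  · rwa [hne 10 (by norm_num) (by norm_num)]
  · rwa [hne 7 (by norm_num) (by norm_num)]
  · rwa [hne 7 (by norm_num) (by norm_num), hne 8 (by norm_num) (by norm_num)]
  · intro y hy
    by_cases e : y = x
    · rw [e, Function.update_self]; exact hT
    · rw [Function.update_of_ne e]; exact g15 y hy
  · intro y hy
    rw [hm', fld_update_self]
    by_cases e : y = x
    · rw [e, Function.update_self, Function.update_self]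
    · rw [Function.update_of_ne e, Function.update_of_ne fun e' => e (hinj y hy.1 x hx.1 e'),
        g16 y hy]
  · rwa [hne 11 (by norm_num) (by norm_num)]
  · rwa [hne 11 (by norm_num) (by norm_num)]
  · intro c hc h5
    rw [hne c hc h5]
    exact g19 c hc h5
  · rw [hne 12 (by norm_num) (by norm_num), g20]
  · intro a ha
    rw [hm', update_fld_raw _ _ _ _ ha, g21 a ha]

/-- A new class. -/
theorem Classes.insert {v : Fin n} {m' : ℕ → ℕ} {T : Finset (Fin n)}
    (h : Classes Δ G Y m₀ i id al P {v} C TD tid tid al' m)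
    (hid : ∀ x ∈ (layer Δ G i).verts, id x < al)
    (hT : T ∈ TD) (hvT : v ∉ T) (hT' : insert v T ∉ TD)
    (e0 : ∀ c, c = 1 ∨ c = 2 ∨ c = 10 ∨ c = 11 →
      fld Y.b m' c = Function.update (fld Y.b m c) al' 0)
    (e6 : fld Y.b m' 6 = Function.update (fld Y.b m 6) al' (T.card + 1))
    (e7 : fld Y.b m' 7 =
      Function.update (Function.update (fld Y.b m 7) al' 0) (tid T) (Y.b + 16 * v))
    (e8 : fld Y.b m' 8 = Function.update (fld Y.b m 8) (tid T) (Y.b + 16 * al'))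
    (e9 : fld Y.b m' 9 = Function.update (fld Y.b m 9) al' (Y.b + 16 * al'))
    (e1 : ∀ c < 16, c ≤ 0 ∨ (3 ≤ c ∧ c ≤ 5) ∨ 12 ≤ c → fld Y.b m' c = fld Y.b m c)
    (er : ∀ e < Y.b, m' e = m e) :
    Classes Δ G Y m₀ i id al P {v} C (insert (insert v T) TD)
      (Function.update tid (insert v T) al') (Function.update tid (insert v T) al') (al' + 1)
      m' := by
  classical
  set T' := Insert.insert v T with hT'def
  obtain ⟨g0, g1, g2, g3, g4, g5, g6, g7, g8, g9, g10, g11, g12, g13, g14, g15, g16, g17, g18, g19,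
    g20, g21⟩ := h
  have hT'0 : T' ≠ ∅ := Finset.insert_ne_empty v T
  have hne : ∀ S ∈ TD, S ≠ T' := fun S hS e => hT' (e ▸ hS)
  have htid : ∀ S ∈ TD, Function.update tid T' al' S = tid S := fun S hS =>
    Function.update_of_ne (hne S hS) _ _
  have hal : ∀ S ∈ TD, tid S ≠ al' := fun S hS => (g5 S hS).ne
  have hcase : ∀ {p : Finset (Fin n) → ℕ → Prop}, p T' al' → (∀ S ∈ TD, p S (tid S)) →
      ∀ S ∈ Insert.insert T' TD, p S (Function.update tid T' al' S) := by
    intro p h1 h2 S hS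
    rcases Finset.mem_insert.1 hS with rfl | hS
    · rwa [Function.update_self]
    · rw [htid S hS]; exact h2 S hS
  have hzero : ∀ c, c = 1 ∨ c = 2 ∨ c = 10 ∨ c = 11 → ∀ S ∈ TD,
      fld Y.b m' c (tid S) = fld Y.b m c (tid S) := fun c hc S hS => by
    rw [e0 c hc, Function.update_of_ne (hal S hS)]
  have hzero' : ∀ c, c = 1 ∨ c = 2 ∨ c = 10 ∨ c = 11 → fld Y.b m' c al' = 0 := fun c hc => by
    rw [e0 c hc, Function.update_self]
  have hstT : ∀ S ∈ TD, S ≠ T → fld Y.b m' 7 (tid S) = fld Y.b m 7 (tid S) := by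
    intro S hS e
    rw [e7, Function.update_of_ne fun e' => e (g3 S hS T hT e'),
      Function.update_of_ne (hal S hS)]
  have hsT : fld Y.b m' 7 (tid T) = Y.b + 16 * v := by rw [e7, Function.update_self]
  refine ⟨by omega, Finset.mem_insert_of_mem g1, by rw [htid ∅ g1, g2], ?_, ?_, ?_, ?_, ?_, ?_, ?_,
    ?_, ?_, ?_, ?_, ?_, ?_, ?_, ?_, ?_, ?_, ?_, ?_⟩
  · refine hcase (p := fun S k => ∀ S' ∈ Insert.insert T' TD,
      k = Function.update tid T' al' S' → S = S') ?_ ?_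
    · refine hcase (p := fun S' k' => al' = k' → T' = S') (fun _ => rfl) ?_
      intro S hS e
      exact absurd e.symm (hal S hS)
    · intro S hS
      refine hcase (p := fun S' k' => tid S = k' → S = S') (fun e => absurd e (hal S hS)) ?_
      exact fun S' hS' e => g3 S hS S' hS' e
  · exact hcase (p := fun S k => S ≠ ∅ → al ≤ k) (fun _ => g0) g4
  · exact hcase (p := fun _ k => k < al' + 1) (by omega) fun S hS => (g5 S hS).trans (by omega)
  · intro S hS
    rcases Finset.mem_insert.1 hS with rfl | hS
    · exact Finset.insert_subset (by simp) (g6 T hT)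
    · exact g6 S hS
  · refine hcase (p := fun S k => fld Y.b m' 6 k = S.card) ?_ fun S hS => ?_
    · rw [e6, Function.update_self, Finset.card_insert_of_notMem hvT]
    · rw [e6, Function.update_of_ne (hal S hS), g7 S hS]
  · exact hcase (p := fun _ k => fld Y.b m' 1 k = 0) (hzero' 1 (by simp)) fun S hS => by
      rw [hzero 1 (by simp) S hS, g8 S hS]
  · exact hcase (p := fun _ k => fld Y.b m' 2 k = 0) (hzero' 2 (by simp)) fun S hS => by
      rw [hzero 2 (by simp) S hS, g9 S hS]
  · exact hcase (p := fun _ k => fld Y.b m' 11 k = 0) (hzero' 11 (by simp)) fun S hS => by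
      rw [hzero 11 (by simp) S hS, g10 S hS]
  · refine hcase (p := fun _ k => fld Y.b m' 9 k = Y.b + 16 * k) ?_ fun S hS => ?_
    · rw [e9, Function.update_self]
    · rw [e9, Function.update_of_ne (hal S hS), g11 S hS]
  · exact hcase (p := fun S k => S ≠ ∅ → fld Y.b m' 10 k = 0) (fun _ => hzero' 10 (by simp))
      fun S hS h0 => by rw [hzero 10 (by simp) S hS, g12 S hS h0]
  · refine hcase (p := fun _ k => fld Y.b m' 7 k = 0 ∨ ∃ w ∈ P ∪ {v},
      fld Y.b m' 7 k = Y.b + 16 * w) ?_ fun S hS => ?_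
    · left
      rw [e7, Function.update_of_ne (hal T hT).symm, Function.update_self]
    · by_cases e : S = T
      · rw [e, hsT]
        exact Or.inr ⟨v, by simp, rfl⟩
      · rw [hstT S hS e]
        exact g13 S hS
  · intro w hw S hS hwS
    obtain rfl := Finset.mem_singleton.1 hw
    rcases Finset.mem_insert.1 hS with rfl | hS
    · exact absurd (Finset.mem_insert_self w T) hwS
    rw [htid S hS]
    by_cases e : S = T
    · subst e
      refine Or.inl ⟨hsT, Finset.mem_insert_self _ _, ?_⟩
      rw [e8, Function.update_self, ← hT'def, Function.update_self]
    · have hne' : Insert.insert w S ≠ T' := by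
        intro e'
        apply e
        rw [← Finset.erase_insert hwS, e', hT'def, Finset.erase_insert hvT]
      rw [hstT S hS e, Finset.mem_insert, or_iff_right hne']
      refine (g14 w hw S hS hwS).imp_left ?_
      rintro ⟨h1, h2, h3⟩
      refine ⟨h1, h2, ?_⟩
      rw [e8, Function.update_of_ne fun e' => e (g3 S hS T hT e'), h3, htid _ h2]
  · exact fun x hx => Finset.mem_insert_of_mem (g15 x hx)
  · intro x hx
    rw [e1 5 (by norm_num) (by simp), htid _ (g15 x hx), g16 x hx]
  · intro x hx
    rw [e0 11 (by simp), Function.update_of_ne (by have := hid x hx; omega), g17 x hx]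
  · intro j hj hj'
    rw [e0 11 (by simp), Function.update_of_ne (by omega), g18 j hj hj']
  · intro c hc h5 h7 h8 h9 h11 j hj
    rw [← g19 c hc h5 h7 h8 h9 h11 j hj]
    by_cases h0 : c ≤ 0 ∨ (3 ≤ c ∧ c ≤ 5) ∨ 12 ≤ c
    · rw [e1 c hc h0]
    · by_cases h6 : c = 6
      · rw [h6, e6, Function.update_of_ne (by omega)]
      · rw [e0 c (by omega), Function.update_of_ne (by omega)]
  · rw [e1 12 (by norm_num) (by simp), g20]
  · intro a ha
    rw [er a ha, g21 a ha]

theorem card_lt (T : Finset (Fin n)) : T.card < n + 1 :=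
  Nat.lt_succ_of_le (by simpa using T.card_le_univ)

/-- The step of the refinement for one edge between a vertex `v` of high degree and a node `x` of
low degree. -/
theorem splitLow_wp {v : Fin n} {s : State} {Q : State → Prop} {x : Node n}
    (h : Classes Δ G Y m₀ i id al P {v} C TD tid tid al' s.mem)
    (hinj : ∀ x ∈ (layer Δ G i).verts, ∀ y ∈ (layer Δ G i).verts, id x = id y → x = y)
    (hid : ∀ x ∈ (layer Δ G i).verts, id x < al)
    (hx : Low Δ G i x) (hv : v ∉ C x) (hB : Y.b + 16 * al' + 16 < Y.B)
    (h3 : s.reg 3 = Y.b + 16 * al') (h7 : s.reg 7 = Y.b + 16 * v)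
    (h10 : s.reg 10 = Y.b + 16 * id x) (h14 : s.reg 14 = 0)
    (hQ : ∀ s' TD' tid' al'', al'' ≤ al' + 1 →
      Classes Δ G Y m₀ i id al P {v} (Function.update C x (insert v (C x))) TD' tid' tid' al''
        s'.mem → s'.reg 3 = Y.b + 16 * al'' → Q s') :
    (Prog.seq (.getF 16 10 5) (.seq (.getF 17 16 7) (.seq (.ifEq 17 7 .skip newClass)
        (.seq (.getF 18 16 8) (.setF 10 5 18))))).wp Y.B s Q := by
  have hle := h.le_al
  have hlab := Y.la_le
  have hbB := Y.le_B
  have hMn := Y.le_M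
  have hlaM := Y.M_le_la
  have hidx := hid x hx.1
  have hCx := h.mem x hx
  have hcls := h.cls x hx
  have htl := h.tid_lt _ hCx
  have hvn := v.2
  have hst : fld Y.b s.mem 7 (tid (C x)) < Y.B := by
    rcases h.stamp _ hCx with e | ⟨w, -, e⟩
    · omega
    · have := w.2; omega
  refine wp_getF h10 (by norm_num) (by omega) (by norm_num) (by omega) ?_
  rw [hcls]
  refine wp_getF (b := Y.b) (j := tid (C x)) (by simp) (by norm_num) (by omega) (by norm_num)
    (by simpa using hst) ?_
  simp only [State.setReg_mem]
  -- the last two instructions, in a state where the class with the additional vertex exists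
  have fin : ∀ (s₁ : State) TD' tid' al'', al'' ≤ al' + 1 →
      Classes Δ G Y m₀ i id al P {v} C TD' tid' tid' al'' s₁.mem →
      s₁.reg 3 = Y.b + 16 * al'' → s₁.reg 10 = Y.b + 16 * id x →
      s₁.reg 16 = Y.b + 16 * tid (C x) → insert v (C x) ∈ TD' →
      fld Y.b s₁.mem 8 (tid (C x)) = Y.b + 16 * tid' (insert v (C x)) →
      (Prog.seq (.getF 18 16 8) (.setF 10 5 18)).wp Y.B s₁ Q := by
    intro s₁ TD' tid' al'' hal h' r3 r10 r16 hmem h8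
    have := h'.tid_lt _ hmem
    refine wp_getF r16 (by norm_num) (by omega) (by norm_num) (by omega) ?_
    refine wp_setF (b := Y.b) (j := id x) (by simp [r10]) (by norm_num) (by norm_num) (by omega)
      (by norm_num) (by simp [h8]; omega) ?_
    refine hQ _ TD' tid' al'' hal (h'.move hinj hx hmem ?_) (by simp [r3])
    simp [h8]
  refine wp_ifEq.2 ⟨fun e => ?_, fun e => ?_⟩
  · simp [h7] at e
    rcases h.split v (by simp) _ hCx hv with ⟨-, h1, h2⟩ | ⟨h1, -⟩
    · exact fin _ TD tid al' (by omega) (by simpa using h) (by simp [h3]) (by simp [h10])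
        (by simp) h1 (by simpa using h2)
    · exact absurd e h1
  · simp [h7] at e
    rcases h.split v (by simp) _ hCx hv with ⟨h1, -⟩ | ⟨-, h1⟩
    · exact absurd h1 e
    have hc := card_lt (C x)
    refine newClass_wp (b := Y.b) (t := tid (C x)) (a := al') (d := (C x).card)
      (v := Y.b + 16 * v) (by simp [h3]) (by simp [h7]) (by simp [h14]) (by simp) hB htl
      (by omega) (by simpa using h.deg _ hCx) (by omega) ?_
    intro s' r3 _ r10 r16 e0 e6 e7 e8 e9 e1 er
    simp only [State.setReg_mem] at e0 e6 e7 e8 e9 e1 er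
    refine fin s' _ _ (al' + 1) le_rfl (h.insert hid hCx hv h1 e0 e6 e7 e8 e9 e1 er)
      r3 (by rw [r10]; simp [h10]) (by rw [r16]; simp) (Finset.mem_insert_self _ _) ?_
    rw [e8, Function.update_self, Function.update_self]

theorem Classes.start {v : Fin n} (h : Classes Δ G Y m₀ i id al P ∅ C TD tid φ al' m)
    (hb : 0 < Y.b) (hv : v ∉ P) : Classes Δ G Y m₀ i id al P {v} C TD tid φ al' m :=
  { h with
    subset := fun T hT => (h.subset T hT).trans (by simp)
    stamp := fun T hT => (h.stamp T hT).imp_right fun ⟨w, hw, e⟩ => ⟨w, by simp_all, e⟩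
    split := by
      intro u hu T hT huT
      obtain rfl := Finset.mem_singleton.1 hu
      refine Or.inr ⟨fun e => ?_, fun e => ?_⟩
      · rcases h.stamp T hT with e' | ⟨w, hw, e'⟩
        · omega
        · have : u = w := Fin.ext (by omega)
          simp_all
      · have := h.subset _ e (Finset.mem_insert_self _ _)
        simp_all }

theorem Classes.finish (h : Classes Δ G Y m₀ i id al P H C TD tid φ al' m) :
    Classes Δ G Y m₀ i id al (P ∪ H) ∅ C TD tid φ al' m :=
  { h with
    subset := fun T hT => (h.subset T hT).trans (by simp)
    stamp := fun T hT => (h.stamp T hT).imp_right fun ⟨w, hw, e⟩ => ⟨w, by simpa using hw, e⟩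
    split := by simp }

theorem Low.of_mem_L (h : LevelInv Δ G Y m₀ f i id L l al m) (hi : i ≤ height Δ G) {v : Fin n}
    (hv : v ∈ l) {x : Node n} (hx : x ∈ L v) (hl : x ∉ (layer Δ G i).high Δ) : Low Δ G i x :=
  ⟨((h.mem_L hi ((h.mem_l v).1 hv)).1 hx).1, hl, h.ne_zero_of_mem hi ((h.mem_l v).1 hv) hx⟩

theorem sum_take_succ {α : Type*} {l : List α} (g : α → ℕ) {k : ℕ} (hk : k < l.length) :
    ((l.take (k + 1)).map g).sum = ((l.take k).map g).sum + g l[k] := by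
  rw [List.take_succ_eq_append_getElem hk, List.map_append, List.sum_append]
  rw [List.map_singleton, List.sum_singleton]

theorem sum_take_le {α : Type*} (l : List α) (g : α → ℕ) (k : ℕ) :
    ((l.take k).map g).sum ≤ (l.map g).sum := by
  conv_rhs => rw [← List.take_append_drop k l, List.map_append, List.sum_append]
  exact Nat.le_add_right _ _

theorem mem_take_succ {α : Type*} {l : List α} {k : ℕ} (hk : k < l.length) {x : α} :
    x ∈ l.take (k + 1) ↔ x ∈ l.take k ∨ x = l[k] := by
  rw [List.take_succ_eq_append_getElem hk, List.mem_append, List.mem_singleton]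

theorem notMem_take {α : Type*} {l : List α} (h : l.Nodup) {k : ℕ} (hk : k < l.length) :
    l[k] ∉ l.take k := by
  intro hmem
  have := h.sublist (List.take_sublist (k + 1) l)
  rw [List.take_succ_eq_append_getElem hk, List.nodup_append] at this
  exact this.2.2 _ hmem _ (by simp) rfl

/-- The class of a node is found by partition refinement: all nodes start in the class of the empty
set, and each vertex of high degree splits the classes that it meets. -/
theorem refine_spec (h : LevelInv Δ G Y m₀ f i id L l al m) (hi : i ≤ height Δ G)
    (hB : Y.b + 16 * (al + (l.map fun v => (L v).length).sum) < Y.B) {s : State}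
    (hC : Classes Δ G Y m i id al ∅ ∅ (fun _ => ∅) {∅} (fun _ => n) (fun _ => n) al s.mem)
    (h3 : s.reg 3 = Y.b + 16 * al) (h4 : s.reg 4 = l.length) (h5 : s.reg 5 = Y.la) :
    RunsTo Y.B refine s (edgesTime bodyTime l L) fun s' => ∃ TD tid al',
      Classes Δ G Y m i id al (orig Δ G (i + 1)) ∅ (fun x => onb G x ∩ orig Δ G (i + 1))
        TD tid tid al' s'.mem ∧
      al' ≤ al + (l.map fun v => (L v).length).sum ∧ s'.reg 3 = Y.b + 16 * al' := by
  classical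
  have hlab := Y.la_le
  have hlaM := Y.M_le_la
  have hbB := Y.le_B
  have hMn := Y.le_M
  have hal := h.lt_al
  have hinj : ∀ x ∈ (layer Δ G i).verts, ∀ y ∈ (layer Δ G i).verts, id x = id y → x = y :=
    fun x hx y hy => h.id_inj x (Seen.of_mem hx) y (Seen.of_mem hy)
  have hid : ∀ x ∈ (layer Δ G i).verts, id x < al := fun x hx => h.id_lt x (Seen.of_mem hx)
  have huB : ∀ v ∈ l, ∀ u ∈ L v, Y.b + 16 * id u + 16 ≤ Y.B := fun v hv u hu => by
    have := hid u ((h.mem_L hi ((h.mem_l v).1 hv)).1 hu).1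
    omega
  -- After `k` vertices, the nodes are classified by their neighbours in `P k`. While `l[k]` is
  -- treated, the first `j` of its neighbours have already been moved to their new classes.
  let O := orig Δ G (i + 1)
  let P : ℕ → Finset (Fin n) := fun k => (l.take k).toFinset ∩ O
  let Hc : Fin n → Finset (Fin n) := fun v => {v} ∩ O
  let I : ℕ → (ℕ → ℕ) → ℕ → ℕ → Prop := fun k m' a _ => ∃ TD tid al',
    Classes Δ G Y m i id al (P k) ∅ (fun x => onb G x ∩ P k) TD tid tid al' m' ∧
    al' ≤ al + ((l.take k).map fun v => (L v).length).sum ∧ a = Y.b + 16 * al'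
  let K : ℕ → ℕ → (ℕ → ℕ) → ℕ → ℕ → Prop := fun k j m' a _ => ∃ (hk : k < l.length),
    ∃ TD tid al', Classes Δ G Y m i id al (P k) (Hc l[k])
      (fun x => onb G x ∩ P k ∪ if x ∈ (L l[k]).take j then Hc l[k] else ∅) TD tid tid al' m' ∧
    al' ≤ al + ((l.take k).map fun v => (L v).length).sum + j ∧ a = Y.b + 16 * al'
  refine (forEdges_spec Y (id := id) (l := l) (L := L) (s := s) I K
    (by rfl) h.length_le h.cap huB h4 h5 ?_ ?_ ?_ ?_ ?_ ?_).mono ?_ ?_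
  · rintro k hk m' a w ⟨TD, tid, al', hc, -, -⟩
    have := h.length_le
    have := (l[k]).2
    refine ⟨?_, ?_, ?_⟩
    · rw [hc.raw _ (by omega), h.l_array k hk]
    · rw [hc.old 3 (by norm_num) (by norm_num) (by norm_num) (by norm_num) (by norm_num)
        (by norm_num) _ (by omega), h.start]
    · rw [hc.old 4 (by norm_num) (by norm_num) (by norm_num) (by norm_num) (by norm_num)
        (by norm_num) _ (by omega), h.length]
  · rintro k hk j hj m' a w ⟨hk', TD, tid, al', hc, -, -⟩
    have e1 := Y.st_le l[k]
    have e2 := h.cap l[k]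
    rw [hc.raw _ (by omega), h.array _ j hj]
  · rintro k hk s' g1 g2 g7 g9 g11 ⟨TD, tid, al', hc, hle, ha⟩
    refine ⟨hk, TD, tid, al', ?_, by simpa using hle, ha⟩
    simp only [List.take_zero, List.not_mem_nil, if_false, Finset.union_empty]
    by_cases hO : l[k] ∈ O
    · have e : Hc l[k] = {l[k]} := Finset.inter_eq_left.2 (by simpa using hO)
      rw [e]
      refine hc.start (by omega) fun hmem => ?_
      exact notMem_take h.l_nodup hk (List.mem_toFinset.1 (Finset.mem_inter.1 hmem).1)
    · have e : Hc l[k] = ∅ := Finset.singleton_inter_of_notMem hO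
      rwa [e]
  · rintro k hk j hj s' g1 g2 g7 g10 ⟨hk', TD, tid, al', hc, hle, ha⟩
    have hlk : l[k] ∈ l := List.getElem_mem hk
    have hlo := (h.mem_l _).1 hlk
    have hxL : (L l[k])[j] ∈ L l[k] := List.getElem_mem hj
    have hxV := ((h.mem_L hi hlo).1 hxL).1
    have hvhigh : fld Y.b s'.mem 11 l[k] = if l[k] ∈ O then 1 else 0 := by
      have := hc.node_high (Sum.inl l[k]) (mem_orig.1 hlo)
      rw [h.id_inl] at this
      rw [this]
      simp only [inl_mem_high_iff, O]
    have hvn := (l[k]).2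
    refine wp_getF g7 (by norm_num) (by omega) (by norm_num)
      (by rw [hvhigh]; split_ifs <;> omega) ?_
    rw [hvhigh]
    simp only [Prog.wp, State.setReg_reg]
    norm_num
    refine ⟨by omega, fun hO => ?_, fun hO => ?_⟩
    · replace hO : l[k] ∈ O := by
        by_contra hO'
        simp [hO'] at hO
      have hH : Hc l[k] = {l[k]} := Finset.inter_eq_left.2 (by simpa using hO)
      have hxB := huB _ hlk _ hxL
      have hxhigh := hc.node_high _ hxV
      refine wp_getF (b := Y.b) (j := id (L l[k])[j]) (by simp [g10]) (by norm_num) hxB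
        (by norm_num) (by simp only [State.setReg_mem]; rw [hxhigh]; split_ifs <;> omega) ?_
      simp only [State.setReg_reg, State.setReg_mem, hxhigh]
      norm_num
      refine ⟨fun hx => ?_, fun hx => ?_⟩
      · replace hx : (L l[k])[j] ∈ (layer Δ G i).high Δ := by
          by_contra hx'
          simp [hx'] at hx
        refine ⟨hk, TD, tid, al', ?_, by omega, by simpa using ha⟩
        refine hc.congr fun y hy => ?_
        have hne : y ≠ (L l[k])[j] := fun e => hy.2.1 (e ▸ hx)
        simp only [mem_take_succ hj, hne, or_false]
      · have hlow := Low.of_mem_L h hi hlk hxL hx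
        have hnt := notMem_take (h.nodup l[k]) hj
        have hvP : l[k] ∉ P k := fun hmem =>
          notMem_take h.l_nodup hk (List.mem_toFinset.1 (Finset.mem_inter.1 hmem).1)
        have hsum := sum_take_succ (fun v => (L v).length) hk
        have hsum' := sum_take_le l (fun v => (L v).length) (k + 1)
        rw [hH] at hc
        refine splitLow_wp (C := fun x => onb G x ∩ P k ∪
          if x ∈ (L l[k]).take j then {l[k]} else ∅) (v := l[k]) (by simpa using hc) hinj hid hlow
          ?_ (by omega) (by simpa using ha) (by simp [g7]) (by simp [g10]) (by simp) ?_
        · simp only [hnt, if_false, Finset.union_empty]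
          exact fun hmem => hvP (Finset.mem_inter.1 hmem).2
        · intro s'' TD' tid' al'' hle' hc' h3'
          refine ⟨hk, TD', tid', al'', ?_, by omega, h3'⟩
          rw [hH]
          refine hc'.congr fun y hy => ?_
          by_cases e : y = (L l[k])[j]
          · rw [e, Function.update_self]
            simp only [mem_take_succ hj, hnt, if_false, Finset.union_empty, or_true, if_true]
            rw [Finset.union_comm, Finset.insert_eq]
          · rw [Function.update_of_ne e]
            simp only [mem_take_succ hj, e, or_false]
    · have hH : Hc l[k] = ∅ := Finset.singleton_inter_of_notMem hO
      refine ⟨hk, TD, tid, al', ?_, by omega, by simpa using ha⟩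
      refine hc.congr fun y _ => ?_
      rw [hH]
      simp
  · rintro k hk s' g1 g2 g7 g11 ⟨hk', TD, tid, al', hc, hle, ha⟩
    have hlk : l[k] ∈ l := List.getElem_mem hk
    have hlo := (h.mem_l _).1 hlk
    have hP : P (k + 1) = P k ∪ Hc l[k] := by
      simp only [P, Hc, List.take_succ_eq_append_getElem hk]
      rw [← Finset.union_inter_distrib_right]
      congr 1
      ext u
      simp only [List.mem_toFinset, List.mem_append, List.mem_singleton, Finset.mem_union,
        Finset.mem_singleton]
    refine ⟨TD, tid, al', ?_, by rw [sum_take_succ _ hk]; omega, ha⟩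
    rw [hP]
    refine hc.finish.congr fun y hy => ?_
    rw [Finset.inter_union_distrib_left, List.take_length]
    congr 1
    split_ifs with hmem
    · rw [Finset.inter_eq_right]
      intro u hu
      have := Finset.mem_singleton.1 (Finset.mem_inter.1 hu).1
      rw [this]
      exact ((h.mem_L hi hlo).1 hmem).2
    · ext u
      simp only [Finset.mem_inter, Finset.notMem_empty, iff_false, not_and]
      intro hu hu'
      have := Finset.mem_singleton.1 (Finset.mem_inter.1 hu').1
      rw [this] at hu
      exact hmem ((h.mem_L hi hlo).2 ⟨hy.1, hu⟩)
  · refine ⟨{∅}, fun _ => n, al, ?_, by simp, h3⟩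
    have e : P 0 = ∅ := by simp [P]
    rw [e]
    exact hC.congr fun x _ => by simp
  · simp only [edgesTime]
    gcongr
    simp [Prog.cost, Prog.setF, Prog.getF, Prog.ifEq, splitBody, newClass, bodyTime]
  · rintro s' ⟨TD, tid, al', hc, hle, ha⟩
    have e : P l.length = O := by
      simp only [P, List.take_length, Finset.inter_eq_right]
      intro v hv
      exact List.mem_toFinset.2 ((h.mem_l v).2 (orig_succ_subset i hv))
    rw [List.take_length] at hle
    rw [e] at hc
    exact ⟨TD, tid, al', hc, hle, ha⟩

end Refine

/-! ### Identification of supervertices, and pointers to the supervertices of the next graph -/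

section Link

variable {n : ℕ} {Δ : ℕ} {G : SimpleGraph (Fin n)}

open Classical in
/-- The numbers of the records when the next graph has been made: the class of `T` is a new
supervertex, with the record number `tid T`, unless the supervertex named `T` exists. -/
noncomputable def extId (Δ : ℕ) (G : SimpleGraph (Fin n)) (i : ℕ) (id : Node n → ℕ)
    (tid : Finset (Fin n) → ℕ) (x : Node n) : ℕ :=
  if Seen Δ G i x then id x else Sum.elim (fun v : Fin n => (v : ℕ)) tid x

variable {Y : Layout n} {m₀ f : ℕ → ℕ} {i : ℕ} {id : Node n → ℕ}
  {L : Fin n → List (Node n)} {l : List (Fin n)} {al al' : ℕ} {m : ℕ → ℕ}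
  {C : Node n → Finset (Fin n)} {TD : Finset (Finset (Fin n))} {tid φ : Finset (Fin n) → ℕ}

/-- The nodes that have been visited by a loop over edges. -/
def Visited (l : List (Fin n)) (L : Fin n → List (Node n)) (k j : ℕ) (x : Node n) : Prop :=
  (∃ v ∈ l.take k, x ∈ L v) ∨ ∃ hk : k < l.length, x ∈ (L l[k]).take j

theorem not_visited_zero (x : Node n) : ¬ Visited l L 0 0 x := by simp [Visited]

theorem visited_succ_right {k j : ℕ} (hk : k < l.length) (hj : j < (L l[k]).length) (x : Node n) :
    Visited l L k (j + 1) x ↔ Visited l L k j x ∨ x = (L l[k])[j] := by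
  simp only [Visited, mem_take_succ hj, hk, exists_true_left, or_assoc]

theorem visited_succ_left {k : ℕ} (hk : k < l.length) (x : Node n) :
    Visited l L (k + 1) 0 x ↔ Visited l L k (L l[k]).length x := by
  simp only [Visited, mem_take_succ hk, List.take_length, hk, List.take_zero,
    List.not_mem_nil, exists_prop, and_false, or_false, true_and]
  constructor
  · rintro ⟨v, hv | rfl, hx⟩
    · exact Or.inl ⟨v, hv, hx⟩
    · exact Or.inr hx
  · rintro (⟨v, hv, hx⟩ | hx)
    · exact ⟨v, Or.inl hv, hx⟩
    · exact ⟨_, Or.inr rfl, hx⟩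

theorem visited_length (x : Node n) : Visited l L l.length 0 x ↔ ∃ v ∈ l, x ∈ L v := by
  simp [Visited]

/-- What the loops over edges need to know about the memory. -/
theorem Classes.edge_data {P H : Finset (Fin n)} (h : LevelInv Δ G Y m₀ f i id L l al m)
    (hc : Classes Δ G Y m i id al P H C TD tid φ al' m') (k : ℕ) (hk : k < l.length) :
    (m' (Y.la + k) = Y.b + 16 * l[k] ∧
      fld Y.b m' 3 l[k] = Y.st l[k] ∧ fld Y.b m' 4 l[k] = (L l[k]).length) ∧
    ∀ j (hj : j < (L l[k]).length), m' (Y.st l[k] + j) = Y.b + 16 * id ((L l[k])[j]) := by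
  have hlab := Y.la_le
  have hal := h.lt_al
  have := h.length_le
  have := (l[k]).2
  refine ⟨⟨?_, ?_, ?_⟩, fun j hj => ?_⟩
  · rw [hc.raw _ (by omega), h.l_array k hk]
  · rw [hc.old 3 (by norm_num) (by norm_num) (by norm_num) (by norm_num) (by norm_num)
      (by norm_num) _ (by omega), h.start]
  · rw [hc.old 4 (by norm_num) (by norm_num) (by norm_num) (by norm_num) (by norm_num)
      (by norm_num) _ (by omega), h.length]
  · have e1 := Y.st_le l[k]
    have e2 := h.cap l[k]
    rw [hc.raw _ (by omega), h.array _ j hj]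

theorem Classes.setFwd {P H : Finset (Fin n)} {m' : ℕ → ℕ} {φ' : Finset (Fin n) → ℕ}
    (h : Classes Δ G Y m i id al P H C TD tid φ al' m')
    {T : Finset (Fin n)} (hT : T ∈ TD) {x : ℕ} (hφ : φ' T = x)
    (hφ' : ∀ S ∈ TD, S ≠ T → φ' S = φ S) :
    Classes Δ G Y m i id al P H C TD tid φ' al'
      (Function.update m' (Y.b + 16 * tid T + 9) (Y.b + 16 * x)) := by
  have hne : ∀ c < 16, c ≠ 9 → fld Y.b (Function.update m' (Y.b + 16 * tid T + 9) (Y.b + 16 * x)) c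
      = fld Y.b m' c := fun c hc h5 => by
    rw [fld_update_of_ne _ _ _ h5 (by norm_num) hc]
  obtain ⟨g0, g1, g2, g3, g4, g5, g6, g7, g8, g9, g10, g11, g12, g13, g14, g15, g16, g17, g18, g19,
    g20, g21⟩ := h
  refine ⟨g0, g1, g2, g3, g4, g5, g6, ?_, ?_, ?_, ?_, ?_, ?_, ?_, ?_, g15, ?_, ?_, ?_, ?_, ?_, ?_⟩
  · rwa [hne 6 (by norm_num) (by norm_num)]
  · rwa [hne 1 (by norm_num) (by norm_num)]
  · rwa [hne 2 (by norm_num) (by norm_num)]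
  · rwa [hne 11 (by norm_num) (by norm_num)]
  · intro S hS
    rw [fld_update_self]
    by_cases e : S = T
    · rw [e, Function.update_self, hφ]
    · rw [Function.update_of_ne fun e' => e (g3 S hS T hT e'), g11 S hS, hφ' S hS e]
  · rwa [hne 10 (by norm_num) (by norm_num)]
  · rwa [hne 7 (by norm_num) (by norm_num)]
  · rwa [hne 7 (by norm_num) (by norm_num), hne 8 (by norm_num) (by norm_num)]
  · rwa [hne 5 (by norm_num) (by norm_num)]
  · rwa [hne 11 (by norm_num) (by norm_num)]
  · rwa [hne 11 (by norm_num) (by norm_num)]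
  · intro c hc h5 h7 h8 h9
    rw [hne c hc h9]
    exact g19 c hc h5 h7 h8 h9
  · rw [hne 12 (by norm_num) (by norm_num), g20]
  · intro a ha
    rw [update_fld_raw _ _ _ _ ha, g21 a ha]

theorem Classes.congr_fwd {P H : Finset (Fin n)} {m' : ℕ → ℕ} {φ' : Finset (Fin n) → ℕ}
    (h : Classes Δ G Y m i id al P H C TD tid φ al' m') (hφ : ∀ S ∈ TD, φ' S = φ S) :
    Classes Δ G Y m i id al P H C TD tid φ' al' m' :=
  { h with fwd := fun S hS => by rw [hφ S hS]; exact h.fwd S hS }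

theorem Low.sv_mem {x : Node n} (hx : Low Δ G i x) :
    Sum.inr (onb G x ∩ orig Δ G (i + 1)) ∈ (layer Δ G (i + 1)).verts :=
  inr_mem_verts_succ.2 ⟨x, hx.1, hx.2.1, rfl⟩

/-- If the class of the node at the address in register `10` has the degree of this node, then they
are identified. -/
def matchBody : Prog :=
  .seq (.getF 13 10 11) (.seq (.const 14 0) (.ite 14 13 .skip
    (.seq (.getF 15 10 5) (.seq (.getF 16 15 6) (.seq (.getF 17 10 6)
      (.ifEq 16 17 (.setF 15 9 10) .skip))))))

/-- Identify classes with the supervertices that they contain, where the degrees agree. -/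
def matchSupers : Prog := forEdges .skip matchBody .skip

/-- A class that contains a supervertex of the same degree gets a pointer to the old record of this
supervertex. -/
theorem matchSupers_spec (h : LevelInv Δ G Y m₀ f i id L l al m) (hi : i ≤ height Δ G)
    (hB : Y.b + 16 * al' ≤ Y.B) (hΔ : Δ < Y.B) {s : State}
    (hC : Classes Δ G Y m i id al (orig Δ G (i + 1)) ∅ (fun x => onb G x ∩ orig Δ G (i + 1))
        TD tid tid al' s.mem)
    (h4 : s.reg 4 = l.length) (h5 : s.reg 5 = Y.la) :
    RunsTo Y.B matchSupers s (edgesTime bodyTime l L) fun s' =>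
      Classes Δ G Y m i id al (orig Δ G (i + 1)) ∅ (fun x => onb G x ∩ orig Δ G (i + 1))
        TD tid (fun T => extId Δ G i id tid (Sum.inr T)) al' s'.mem ∧ s'.reg 3 = s.reg 3 := by
  classical
  have hbB := Y.le_B
  have hal := h.lt_al
  have hle := hC.le_al
  have hid : ∀ x ∈ (layer Δ G i).verts, id x < al := fun x hx => h.id_lt x (Seen.of_mem hx)
  have huB : ∀ v ∈ l, ∀ u ∈ L v, Y.b + 16 * id u + 16 ≤ Y.B := fun v hv u hu => by
    have := hid u ((h.mem_L hi ((h.mem_l v).1 hv)).1 hu).1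
    omega
  -- Forwarded so far are the classes of the supervertices in `U`.
  let ψ : (Node n → Prop) → Finset (Fin n) → ℕ := fun U T =>
    if U (Sum.inr T) then id (Sum.inr T) else tid T
  let K : ℕ → ℕ → (ℕ → ℕ) → ℕ → ℕ → Prop := fun k j m' a _ =>
    Classes Δ G Y m i id al (orig Δ G (i + 1)) ∅ (fun x => onb G x ∩ orig Δ G (i + 1))
      TD tid (ψ (Visited l L k j)) al' m' ∧ a = s.reg 3
  refine (forEdges_spec Y (id := id) (l := l) (L := L) (s := s) (fun k => K k 0) K
    (by rfl) h.length_le h.cap huB h4 h5 ?_ ?_ ?_ ?_ ?_ ?_).mono ?_ ?_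
  · rintro k hk m' a w ⟨hc, -⟩
    exact (hc.edge_data h k hk).1
  · rintro k hk j hj m' a w ⟨hc, -⟩
    exact (hc.edge_data h k hk).2 j hj
  · rintro k hk s' - - - - - hc
    exact hc
  · rintro k hk j hj s' g1 g2 g7 g10 ⟨hc, ha⟩
    have hlk : l[k] ∈ l := List.getElem_mem hk
    have hlo := (h.mem_l _).1 hlk
    have hxL : (L l[k])[j] ∈ L l[k] := List.getElem_mem hj
    have hxV := ((h.mem_L hi hlo).1 hxL).1
    have hxB := huB _ hlk _ hxL
    have hxhigh := hc.node_high _ hxV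
    set x := (L l[k])[j] with hxdef
    have hskip : (∀ T ∈ TD, Sum.inr T ≠ x) → Classes Δ G Y m i id al (orig Δ G (i + 1)) ∅
        (fun x => onb G x ∩ orig Δ G (i + 1)) TD tid (ψ (Visited l L k (j + 1))) al' s'.mem := by
      intro hne
      refine hc.congr_fwd fun T hT => ?_
      simp only [ψ, visited_succ_right hk hj, hne T hT, or_false, ← hxdef]
    refine wp_getF g10 (by norm_num) hxB (by norm_num)
      (by rw [hxhigh]; split_ifs <;> omega) ?_
    rw [hxhigh]
    simp only [Prog.wp, State.setReg_reg]
    norm_num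
    refine ⟨by omega, fun hx => ⟨hskip ?_, ha⟩, fun hx => ?_⟩
    · replace hx : x ∈ (layer Δ G i).high Δ := by
        by_contra hx'
        simp [hx'] at hx
      intro T _ e
      exact inr_notMem_high i T (e ▸ hx)
    · have hlow := Low.of_mem_L h hi hlk hxL hx
      obtain ⟨T, hTdef⟩ : ∃ T, T = onb G x ∩ orig Δ G (i + 1) := ⟨_, rfl⟩
      have hT : T ∈ TD := by rw [hTdef]; exact hc.mem x hlow
      have hcls : fld Y.b s'.mem 5 (id x) = Y.b + 16 * tid T := by rw [hTdef]; exact hc.cls x hlow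
      have hdeg := hc.deg _ hT
      have hTlt := hc.tid_lt _ hT
      have hcard := card_lt T
      have hold := hc.old 6 (by norm_num) (by norm_num) (by norm_num) (by norm_num) (by norm_num)
        (by norm_num) _ (hid x hxV)
      -- A supervertex in the class of `T` is adjacent to all of `T`, so it has the same degree only
      -- if it is the supervertex of `T` itself. The degree stored for a vertex is
      -- `Δ`, which is too large.
      have hdx : fld Y.b s'.mem 6 (id x) < Y.B ∧
          (T.card = fld Y.b s'.mem 6 (id x) ↔ Sum.inr T = x) := by
        rw [hold]
        rcases hx' : x with v | A
        · rw [h.id_inl, h.deg_inl]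
          refine ⟨hΔ, fun e => ?_, fun e => by cases e⟩
          have := (layer_aux Δ G (i + 1) T (hTdef ▸ hlow.sv_mem)).2
          omega
        · rw [h.deg_inr A (Seen.of_mem (hx' ▸ hxV))]
          have hsub : T ⊆ A := by
            rw [hTdef, hx']; exact Finset.inter_subset_left
          refine ⟨by have := card_lt A; omega, fun e => ?_, fun e => ?_⟩
          · rw [Finset.eq_of_subset_of_card_le hsub e.ge]
          · rw [Sum.inr_injective e]
      refine wp_getF (b := Y.b) (j := id x) (by simp [g10]) (by norm_num) hxB (by norm_num)
        (by simp only [State.setReg_mem]; omega) ?_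
      simp only [State.setReg_mem, hcls]
      refine wp_getF (b := Y.b) (j := tid T) (by simp) (by norm_num) (by omega) (by norm_num)
        (by simp only [State.setReg_mem]; omega) ?_
      simp only [State.setReg_mem, hdeg]
      refine wp_getF (b := Y.b) (j := id x) (by simp [g10]) (by norm_num) hxB (by norm_num)
        (by simp only [State.setReg_mem]; omega) ?_
      simp only [State.setReg_mem]
      refine wp_ifEq.2 ⟨fun e => ?_, fun e => ?_⟩
      · simp only [State.setReg_reg] at e
        norm_num at e
        rw [hdx.2] at e
        refine wp_setF (b := Y.b) (j := tid T) (by simp) (by norm_num) (by norm_num) (by omega)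
          (by norm_num) (by simp [g10]; omega) ?_
        refine ⟨?_, by simpa using ha⟩
        have := hc.setFwd (φ' := ψ (Visited l L k (j + 1))) hT (x := id x) ?_ ?_
        · simpa [g10] using this
        · simp only [ψ, visited_succ_right hk hj, ← hxdef, e, or_true, if_true]
        · intro S hS hne
          have : (Sum.inr S : Node n) ≠ x := fun e' => hne (Sum.inr_injective (e'.trans e.symm))
          simp only [ψ, visited_succ_right hk hj, ← hxdef, this, or_false]
      · simp only [State.setReg_reg] at e
        norm_num at e
        rw [hdx.2] at e
        refine ⟨?_, by simpa using ha⟩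
        refine hskip fun S hS e' => e ?_
        rw [hTdef, ← e', onb_inr, Finset.inter_eq_left.2 (by simpa using hc.subset S hS)]
  · rintro k hk s' - - - - ⟨hc, ha⟩
    refine ⟨hc.congr_fwd fun T _ => ?_, ha⟩
    simp only [ψ, visited_succ_left hk]
  · refine ⟨hC.congr_fwd fun T _ => ?_, rfl⟩
    simp only [ψ, not_visited_zero, if_false]
  · simp only [edgesTime]
    gcongr
    simp [Prog.cost, Prog.setF, Prog.getF, Prog.ifEq, matchBody, bodyTime]
  · rintro s' ⟨hc, ha⟩
    refine ⟨hc.congr_fwd fun T hT => ?_, ha⟩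
    simp only [ψ, visited_length, extId]
    by_cases hs : Seen Δ G i (Sum.inr T)
    · rw [if_pos hs]
      by_cases h0 : T = ∅
      · subst h0
        have : id (Sum.inr ∅) = n := h.id_zero
        simp only [this, hc.tid_empty, ite_self]
      · rcases hs with e | ⟨j, hj, hs⟩
        · exact absurd (Sum.inr_injective e) h0
        have hTi : Sum.inr T ∈ (layer Δ G i).verts := by
          refine mem_verts_of_le hj hs (Or.inr ⟨T, rfl, ?_⟩)
          have := hc.subset T hT
          rw [Finset.union_empty] at this
          exact this.trans (orig_succ_subset i)
        rw [if_pos (h.exists_mem_L hi hTi fun e => h0 (Sum.inr_injective e))]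
    · rw [if_neg hs, if_neg]
      · rfl
      · rintro ⟨v, hv, hTv⟩
        exact hs (Seen.of_mem ((h.mem_L hi ((h.mem_l v).1 hv)).1 hTv).1)

/-- Put the pointer to the supervertex of the next graph into the record at the address in register
`r`, for a node of low degree. -/
def setSv (r : ℕ) : Prog :=
  .seq (.getF 13 r 11) (.seq (.const 14 0) (.ite 14 13 .skip
    (.seq (.getF 15 r 5) (.seq (.getF 16 15 9) (.setF r 0 16)))))

/-- Put the pointers to the supervertices of the next graph into the records of all nodes of low
degree. -/
def linkSupers : Prog := forEdges (setSv 7) (setSv 10) .skip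

/-- The effect of `linkSupers`. -/
structure Linked (Δ : ℕ) (G : SimpleGraph (Fin n)) (Y : Layout n) (i : ℕ) (id : Node n → ℕ)
    (φ : Finset (Fin n) → ℕ) (Done : Node n → Prop) (m m' : ℕ → ℕ) : Prop where
  sv : ∀ x, Low Δ G i x → Done x →
    fld Y.b m' 0 (id x) = Y.b + 16 * φ (onb G x ∩ orig Δ G (i + 1))
  sv_of_ne : ∀ j, (∀ x, Low Δ G i x → id x ≠ j) → fld Y.b m' 0 j = fld Y.b m 0 j
  other : ∀ c < 16, c ≠ 0 → fld Y.b m' c = fld Y.b m c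
  raw : ∀ a < Y.b, m' a = m a

theorem setSv_wp {r : ℕ} {s : State} {Q : State → Prop} {x : Node n} {Done : Node n → Prop}
    (hC : Classes Δ G Y m₀ i id al (orig Δ G (i + 1)) ∅ (fun x => onb G x ∩ orig Δ G (i + 1))
        TD tid φ al' m) (hm : Linked Δ G Y i id φ Done m s.mem)
    (hr : r ≠ 13 ∧ r ≠ 14 ∧ r ≠ 15 ∧ r ≠ 16 ∧ r ≠ 31)
    (hinj : ∀ x ∈ (layer Δ G i).verts, ∀ y ∈ (layer Δ G i).verts, id x = id y → x = y)
    (hB : Y.b + 16 * al' ≤ Y.B) (hid : ∀ x ∈ (layer Δ G i).verts, id x < al)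
    (hφ : ∀ T ∈ TD, φ T < al')
    (hx : x ∈ (layer Δ G i).verts) (hx0 : x ≠ zeroNode n) (hrx : s.reg r = Y.b + 16 * id x)
    (hQ : ∀ s', Linked Δ G Y i id φ (fun y => Done y ∨ y = x) m s'.mem →
      s'.reg 3 = s.reg 3 → s'.reg 12 = s.reg 12 → Q s') :
    (setSv r).wp Y.B s Q := by
  classical
  have hbB := Y.le_B
  have hle := hC.le_al
  have hidx := hid x hx
  have hxB : Y.b + 16 * id x + 16 ≤ Y.B := by omega
  have hxhigh := hC.node_high _ hx
  rw [← hm.other 11 (by norm_num) (by norm_num)] at hxhigh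
  refine wp_getF hrx hr.2.2.2.2 hxB (by norm_num) (by rw [hxhigh]; split_ifs <;> omega) ?_
  rw [hxhigh]
  simp only [Prog.wp, State.setReg_reg]
  norm_num
  refine ⟨by omega, fun hx' => ?_, fun hx' => ?_⟩
  · replace hx' : x ∈ (layer Δ G i).high Δ := by
      by_contra hx''
      simp [hx''] at hx'
    refine hQ _ ⟨fun y hy hd => ?_, hm.sv_of_ne, hm.other, hm.raw⟩ (by simp) (by simp)
    refine hm.sv y hy (hd.resolve_right ?_)
    rintro rfl
    exact hy.2.1 hx'
  · have hlow : Low Δ G i x := ⟨hx, hx', hx0⟩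
    obtain ⟨T, hTdef⟩ : ∃ T, T = onb G x ∩ orig Δ G (i + 1) := ⟨_, rfl⟩
    have hT : T ∈ TD := by rw [hTdef]; exact hC.mem x hlow
    have hcls : fld Y.b s.mem 5 (id x) = Y.b + 16 * tid T := by
      rw [hTdef, hm.other 5 (by norm_num) (by norm_num)]; exact hC.cls x hlow
    have hfwd := hC.fwd _ hT
    rw [← hm.other 9 (by norm_num) (by norm_num)] at hfwd
    have hTlt := hC.tid_lt _ hT
    have hφT := hφ T hT
    refine wp_getF (b := Y.b) (j := id x) (by simp [hr, hrx]) hr.2.2.2.2 hxB (by norm_num)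
      (by simp only [State.setReg_mem]; omega) ?_
    simp only [State.setReg_mem, hcls]
    refine wp_getF (b := Y.b) (j := tid T) (by simp) (by norm_num) (by omega) (by norm_num)
      (by simp only [State.setReg_mem]; omega) ?_
    simp only [State.setReg_mem, hfwd]
    refine wp_setF (b := Y.b) (j := id x) (by simp [hr, hrx]) hr.2.2.2.2 (by norm_num) (by omega)
      (by norm_num) (by simp; omega) ?_
    refine hQ _ ?_ (by simp) (by simp)
    simp only [State.setMem_mem, State.setReg_mem, State.setReg_reg]
    norm_num
    refine ⟨fun y hy hd => ?_, fun j hj => ?_, fun c hc h0 => ?_, fun a ha => ?_⟩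
    · have := fld_update_self Y.b s.mem 0 (id x) (Y.b + 16 * φ T)
      rw [add_zero] at this
      rw [this]
      by_cases e : y = x
      · rw [e, Function.update_self, hTdef]
      · rw [Function.update_of_ne fun e' => e (hinj y hy.1 x hx e')]
        exact hm.sv y hy (hd.resolve_right e)
    · have := fld_update_self Y.b s.mem 0 (id x) (Y.b + 16 * φ T)
      rw [add_zero] at this
      rw [this, Function.update_of_ne (hj x hlow).symm, hm.sv_of_ne j hj]
    · have := fld_update_of_ne (b := Y.b) s.mem (id x) (Y.b + 16 * φ T) h0 (by norm_num) hc
      rw [add_zero] at this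
      rw [this, hm.other c hc h0]
    · have := update_fld_raw (b := Y.b) s.mem 0 (id x) (Y.b + 16 * φ T) ha
      rw [add_zero] at this
      rw [this, hm.raw a ha]

theorem Linked.congr {Done Done' : Node n → Prop} {m' : ℕ → ℕ}
    (h : Linked Δ G Y i id φ Done m m') (hD : ∀ x, Low Δ G i x → Done' x → Done x) :
    Linked Δ G Y i id φ Done' m m' :=
  { h with sv := fun x hx hd => h.sv x hx (hD x hx hd) }

theorem linkSupers_spec (h : LevelInv Δ G Y m₀ f i id L l al m) (hi : i ≤ height Δ G)
    (hB : Y.b + 16 * al' ≤ Y.B) {s : State}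
    (hC : Classes Δ G Y m i id al (orig Δ G (i + 1)) ∅ (fun x => onb G x ∩ orig Δ G (i + 1))
        TD tid φ al' s.mem) (hφ : ∀ T ∈ TD, φ T < al')
    (h4 : s.reg 4 = l.length) (h5 : s.reg 5 = Y.la) :
    RunsTo Y.B linkSupers s (edgesTime bodyTime l L) fun s' =>
      Linked Δ G Y i id φ (fun _ => True) s.mem s'.mem ∧ s'.reg 3 = s.reg 3 := by
  have hbB := Y.le_B
  have hal := h.lt_al
  have hlab := Y.la_le
  have hle := hC.le_al
  have hinj : ∀ x ∈ (layer Δ G i).verts, ∀ y ∈ (layer Δ G i).verts, id x = id y → x = y :=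
    fun x hx y hy => h.id_inj x (Seen.of_mem hx) y (Seen.of_mem hy)
  have hid : ∀ x ∈ (layer Δ G i).verts, id x < al := fun x hx => h.id_lt x (Seen.of_mem hx)
  have huB : ∀ v ∈ l, ∀ u ∈ L v, Y.b + 16 * id u + 16 ≤ Y.B := fun v hv u hu => by
    have := hid u ((h.mem_L hi ((h.mem_l v).1 hv)).1 hu).1
    omega
  -- The nodes dealt with are the first `k` vertices and the neighbours `U` visited so far.
  let D : ℕ → (Node n → Prop) → Node n → Prop := fun k U x => (∃ v ∈ l.take k, x = Sum.inl v) ∨ U x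
  let J : (Node n → Prop) → (ℕ → ℕ) → ℕ → ℕ → Prop := fun U m' a _ =>
    Linked Δ G Y i id φ U s.mem m' ∧ a = s.reg 3
  have hedge : ∀ {U m' a w}, J U m' a w → ∀ (k : ℕ) (hk : k < l.length),
      (m' (Y.la + k) = Y.b + 16 * l[k] ∧
      fld Y.b m' 3 l[k] = Y.st l[k] ∧ fld Y.b m' 4 l[k] = (L l[k]).length) ∧
      ∀ j (hj : j < (L l[k]).length), m' (Y.st l[k] + j) = Y.b + 16 * id ((L l[k])[j]) := by
    rintro U m' a w ⟨hm, -⟩ k hk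
    obtain ⟨⟨e1, e2, e3⟩, e4⟩ := hC.edge_data h k hk
    have := h.length_le
    refine ⟨⟨?_, ?_, ?_⟩, fun j hj => ?_⟩
    · rw [hm.raw _ (by omega), e1]
    · rw [hm.other 3 (by norm_num) (by norm_num), e2]
    · rw [hm.other 4 (by norm_num) (by norm_num), e3]
    · have g1 := Y.st_le l[k]
      have g2 := h.cap l[k]
      rw [hm.raw _ (by omega), e4 j hj]
  refine (forEdges_spec Y (id := id) (l := l) (L := L) (s := s)
    (fun k => J (D k (Visited l L k 0))) (fun k j => J (D (k + 1) (Visited l L k j)))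
    (by rfl) h.length_le h.cap huB h4 h5 ?_ ?_ ?_ ?_ ?_ ?_).mono ?_ ?_
  · rintro k hk m' a w hJ
    exact (hedge (w := w) hJ k hk).1
  · rintro k hk j hj m' a w hJ
    exact (hedge (w := w) hJ k hk).2 j hj
  · rintro k hk s' g1 g2 g7 g9 g11 ⟨hm, ha⟩
    have hlo := (h.mem_l _).1 (List.getElem_mem hk)
    refine setSv_wp hC hm (by norm_num) hinj hB hid hφ (mem_orig.1 hlo)
      (by simp [zeroNode]) (by rw [g7, h.id_inl]) fun s'' hm' r3 r12 => ?_
    refine ⟨hm'.congr fun x _ hx => ?_, r3.trans ha⟩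
    rcases hx with ⟨v, hv, rfl⟩ | hx
    · rcases (mem_take_succ hk).1 hv with hv | rfl
      · exact Or.inl (Or.inl ⟨v, hv, rfl⟩)
      · exact Or.inr rfl
    · exact Or.inl (Or.inr hx)
  · rintro k hk j hj s' g1 g2 g7 g10 ⟨hm, ha⟩
    have hlk : l[k] ∈ l := List.getElem_mem hk
    have hlo := (h.mem_l _).1 hlk
    have hxL : (L l[k])[j] ∈ L l[k] := List.getElem_mem hj
    refine setSv_wp hC hm (by norm_num) hinj hB hid hφ ((h.mem_L hi hlo).1 hxL).1
      (h.ne_zero_of_mem hi hlo hxL) g10 fun s'' hm' r3 r12 => ?_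
    refine ⟨hm'.congr fun x _ hx => ?_, r3.trans ha⟩
    rcases hx with hx | hx
    · exact Or.inl (Or.inl hx)
    · exact ((visited_succ_right hk hj x).1 hx).imp_left Or.inr
  · rintro k hk s' - - - - ⟨hm, ha⟩
    exact ⟨hm.congr fun x _ hx => hx.imp_right (visited_succ_left hk x).1, ha⟩
  · refine ⟨⟨?_, fun _ _ => rfl, fun _ _ _ => rfl, fun _ _ => rfl⟩, rfl⟩
    rintro x - (⟨v, hv, -⟩ | hx)
    · simp at hv
    · exact absurd hx (not_visited_zero x)
  · simp only [edgesTime]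
    gcongr
    simp [Prog.cost, Prog.setF, Prog.getF, setSv, bodyTime]
  · rintro s' ⟨hm, ha⟩
    refine ⟨hm.congr fun x hx _ => ?_, ha⟩
    rcases x with v | A
    · refine Or.inl ⟨v, ?_, rfl⟩
      rw [List.take_length]
      exact (h.mem_l v).2 (mem_orig.2 hx.1)
    · exact Or.inr ((visited_length _).2 (h.exists_mem_L hi hx.1 hx.2.2))

end Link

/-! ### The lists of neighbours in the next graph -/

section Rebuild

variable {n : ℕ} (Δ : ℕ) (G : SimpleGraph (Fin n))

open Classical in
/-- The vertex of `Gᵢ₊₁` that corresponds to the vertex `x` of `Gᵢ`. -/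
noncomputable def nextNode (i : ℕ) (x : Node n) : Node n :=
  if x ∈ (layer Δ G i).high Δ then x else Sum.inr (onb G x ∩ orig Δ G (i + 1))

/-- The lists `L'` are those of the next graph for the vertices of high degree among the first `k`
vertices of `l`, and the lists `L` for the other ones. The memory `m'` holds these lists, except for
the arrays of the vertices in `exc`; apart from this, it agrees with `m`. -/
structure Lists (Y : Layout n) (i : ℕ) (id' : Node n → ℕ) (l : List (Fin n))
    (TD : Finset (Finset (Fin n))) (tid : Finset (Fin n) → ℕ)
    (L : Fin n → List (Node n)) (k : ℕ) (exc : Fin n → Prop) (L' : Fin n → List (Node n))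
    (m m' : ℕ → ℕ) : Prop where
  length : ∀ v : Fin n, fld Y.b m' 4 v = (L' v).length
  nodup : ∀ v, (L' v).Nodup
  mem : ∀ v ∈ l.take k, v ∈ orig Δ G (i + 1) → ∀ y, y ∈ L' v ↔ ∃ x ∈ L v, nextNode Δ G i x = y
  eq : ∀ v, v ∉ l.take k ∨ v ∉ orig Δ G (i + 1) → L' v = L v
  le : ∀ v, (L' v).length ≤ (L v).length
  array : ∀ v, ¬ exc v → ∀ (k : ℕ) (hk : k < (L' v).length),
    m' (Y.st v + k) = Y.b + 16 * id' ((L' v)[k])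
  mark : ∀ T ∈ TD, T ≠ ∅ → fld Y.b m' 10 (tid T) = 0 ∨
    ∃ u : Fin n, (u ∈ l.take k ∨ exc u) ∧ fld Y.b m' 10 (tid T) = Y.b + 16 * u
  other : ∀ c < 16, c ≠ 4 → c ≠ 10 → fld Y.b m' c = fld Y.b m c
  raw : ∀ a < Y.M, m' a = m a
  la : ∀ a, Y.la ≤ a → a < Y.b → m' a = m a

/-- The list `R` of neighbours of `v` in the next graph, which is made while the first `j` members
of the list `N` of neighbours of `v` are dealt with. It takes the first cells of the array of `v`,
before the cell `w`. -/
structure Rebuilding (Y : Layout n) (i : ℕ) (id' : Node n → ℕ) (TD : Finset (Finset (Fin n)))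
    (tid : Finset (Fin n) → ℕ) (v : Fin n) (N : List (Node n)) (j : ℕ) (R : List (Node n))
    (m : ℕ → ℕ) (w : ℕ) : Prop where
  nodup : R.Nodup
  mem : ∀ y, y ∈ R ↔ ∃ x ∈ N.take j, nextNode Δ G i x = y
  le : R.length ≤ j
  addr : w = Y.st v + R.length
  array : ∀ (k : ℕ) (hk : k < R.length), m (Y.st v + k) = Y.b + 16 * id' R[k]
  rest : ∀ (k : ℕ) (hk : k < N.length), j ≤ k → m (Y.st v + k) = Y.b + 16 * id' N[k]
  mark : ∀ T ∈ TD, T ≠ ∅ → (fld Y.b m 10 (tid T) = Y.b + 16 * v ↔ Sum.inr T ∈ R)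

variable {Δ G} {Y : Layout n} {m₀ f : ℕ → ℕ} {i : ℕ} {id id' : Node n → ℕ}
  {L L' : Fin n → List (Node n)} {l : List (Fin n)} {al al' : ℕ} {m m' : ℕ → ℕ}
  {TD : Finset (Finset (Fin n))} {tid φ : Finset (Fin n) → ℕ}

theorem nextNode_of_mem {x : Node n} (hx : x ∈ (layer Δ G i).high Δ) : nextNode Δ G i x = x :=
  if_pos hx

theorem nextNode_of_notMem {x : Node n} (hx : x ∉ (layer Δ G i).high Δ) :
    nextNode Δ G i x = Sum.inr (onb G x ∩ orig Δ G (i + 1)) :=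
  if_neg hx

section Append

variable {k j w : ℕ} {v : Fin n} {N R : List (Node n)} {y : Node n}

/-- A new member of the list. -/
theorem Rebuilding.append (h : Rebuilding Δ G Y i id' TD tid v N j R m w)
    (hj : j < N.length) (hy : nextNode Δ G i N[j] = y) (hyR : y ∉ R)
    (hcap : N.length ≤ Y.cap v) {m' : ℕ → ℕ}
    (hm : ∀ a < Y.b, m' a = Function.update m w (Y.b + 16 * id' y) a)
    (hmark : ∀ T ∈ TD, T ≠ ∅ →
      (fld Y.b m' 10 (tid T) = Y.b + 16 * v ↔ Sum.inr T ∈ R ∨ Sum.inr T = y)) :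
    Rebuilding Δ G Y i id' TD tid v N (j + 1) (R ++ [y]) m' (w + 1) := by
  obtain ⟨g1, g2, g3, g4, g5, g6, g7⟩ := h
  have hst := Y.st_le v
  have hlab := Y.la_le
  refine ⟨?_, ?_, by simp; omega, by simp [g4]; ring, ?_, ?_, ?_⟩
  · rw [List.nodup_append]
    refine ⟨g1, by simp, ?_⟩
    intro a ha b hb
    rw [List.mem_singleton] at hb
    rintro rfl
    exact hyR (hb ▸ ha)
  · intro z
    rw [List.mem_append, g2, List.mem_singleton]
    constructor
    · rintro (⟨x, hx, hz⟩ | rfl)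
      · exact ⟨x, (mem_take_succ hj).2 (Or.inl hx), hz⟩
      · exact ⟨_, (mem_take_succ hj).2 (Or.inr rfl), hy⟩
    · rintro ⟨x, hx, hz⟩
      rcases (mem_take_succ hj).1 hx with hx | rfl
      · exact Or.inl ⟨x, hx, hz⟩
      · exact Or.inr (hz.symm.trans hy)
  · intro k hk
    rw [List.length_append, List.length_singleton] at hk
    rw [hm _ (by omega), g4]
    by_cases e : k = R.length
    · subst e
      simp
    · rw [Function.update_of_ne (by omega), List.getElem_append_left (by omega), g5]
  · intro k hk hjk
    rw [hm _ (by omega), Function.update_of_ne (by omega), g6 k hk (by omega)]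
  · intro T hT h0
    rw [hmark T hT h0, List.mem_append, List.mem_singleton]

/-- A neighbour whose class is in the list. -/
theorem Rebuilding.skip (h : Rebuilding Δ G Y i id' TD tid v N j R m w)
    (hj : j < N.length) (hy : nextNode Δ G i N[j] ∈ R) :
    Rebuilding Δ G Y i id' TD tid v N (j + 1) R m w := by
  obtain ⟨g1, g2, g3, g4, g5, g6, g7⟩ := h
  refine ⟨g1, fun z => ?_, by omega, g4, g5, fun k hk hjk => g6 k hk (by omega), g7⟩
  constructor
  · intro hz
    obtain ⟨x, hx, hz⟩ := (g2 z).1 hz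
    exact ⟨x, (mem_take_succ hj).2 (Or.inl hx), hz⟩
  · rintro ⟨x, hx, hz⟩
    rcases (mem_take_succ hj).1 hx with hx | rfl
    · exact (g2 z).2 ⟨x, hx, hz⟩
    · exact hz ▸ hy

/-- A change of the marks and of one array. -/
theorem Lists.frame {exc : Fin n → Prop}
    (h : Lists Δ G Y i id' l TD tid L k exc L' m m') (hv : exc v)
    (hcap : ∀ v, (L v).length ≤ Y.cap v)
    {m'' : ℕ → ℕ} {a : ℕ} (ha : Y.st v ≤ a) (ha' : a < Y.st v + Y.cap v)
    (hm : ∀ e < Y.b, e ≠ a → m'' e = m' e)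
    (hf : ∀ c < 16, c ≠ 10 → fld Y.b m'' c = fld Y.b m' c)
    (hmark : ∀ T ∈ TD, T ≠ ∅ → fld Y.b m'' 10 (tid T) = Y.b + 16 * v ∨
      fld Y.b m'' 10 (tid T) = fld Y.b m' 10 (tid T)) :
    Lists Δ G Y i id' l TD tid L k exc L' m m'' := by
  obtain ⟨g1, g2, g3, g4, g5, g6, g7, g8, g9, g10⟩ := h
  have hst := Y.st_le v
  have hlab := Y.la_le
  have hM := Y.M_le_st v
  have hMla := Y.M_le_la
  refine ⟨?_, g2, g3, g4, g5, ?_, ?_, ?_, ?_, ?_⟩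
  · rwa [hf 4 (by norm_num) (by norm_num)]
  · intro u hu k hk
    have h1 := Y.st_le u
    have h2 := hcap u
    have h3 := g5 u
    have h4 := Y.disj u v fun e => hu (e ▸ hv)
    rw [hm _ (by omega) (by omega), g6 u hu k hk]
  · intro T hT h0
    rcases hmark T hT h0 with e | e
    · exact Or.inr ⟨v, Or.inr hv, e⟩
    · rw [e]; exact g7 T hT h0
  · intro c hc h4 h10
    rw [hf c hc h10, g8 c hc h4 h10]
  · intro e he
    rw [hm _ (by omega) (by omega), g9 e he]
  · intro e he he'
    rw [hm _ (by omega) (by omega), g10 e he he']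

end Append

/-- Append a member to the list of the vertex at the address in register `7`: the neighbour at the
address in register `10`, if it has high degree, or its class, unless it is in the list. -/
def rebuildBody : Prog :=
  .seq (.getF 13 7 11) (.seq (.const 14 0) (.ite 14 13
    (.seq (.getF 15 10 11) (.ite 14 15
      (.seq (.store 12 10) (.seq (.const 16 1) (.add 12 12 16)))
      (.seq (.getF 17 10 5) (.seq (.getF 18 17 10) (.ifEq 18 7 .skip
        (.seq (.setF 17 10 7) (.seq (.getF 19 17 9) (.seq (.store 12 19)
          (.seq (.const 16 1) (.add 12 12 16))))))))))
    .skip))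

/-- Store the length of the new list. -/
def rebuildPost : Prog :=
  .seq (.getF 13 7 11) (.seq (.const 14 0) (.ite 14 13
    (.seq (.sub 15 12 11) (.setF 7 4 15)) .skip))

/-- Make the lists of neighbours in the next graph. -/
def rebuild : Prog := forEdges (.move 12 11) rebuildBody rebuildPost

/-- What the construction of the lists needs to know about the memory. -/
structure Ready (Δ : ℕ) (G : SimpleGraph (Fin n)) (Y : Layout n) (i : ℕ) (id id' : Node n → ℕ)
    (al al' : ℕ) (TD : Finset (Finset (Fin n))) (tid : Finset (Fin n) → ℕ) (m : ℕ → ℕ) : Prop where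
  le_al : al ≤ al'
  inj : ∀ T ∈ TD, ∀ T' ∈ TD, tid T = tid T' → T = T'
  tid_lt : ∀ T ∈ TD, tid T < al'
  id_lt : ∀ T ∈ TD, id' (Sum.inr T) < al'
  fwd : ∀ T ∈ TD, fld Y.b m 9 (tid T) = Y.b + 16 * id' (Sum.inr T)
  mem : ∀ x, Low Δ G i x → onb G x ∩ orig Δ G (i + 1) ∈ TD
  cls : ∀ x, Low Δ G i x → fld Y.b m 5 (id x) = Y.b + 16 * tid (onb G x ∩ orig Δ G (i + 1))
  node_high : ∀ x ∈ (layer Δ G i).verts, fld Y.b m 11 (id x) = open Classical in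
    if x ∈ (layer Δ G i).high Δ then 1 else 0
  id_eq : ∀ x, Seen Δ G i x → id' x = id x

theorem rebuildBody_wp {k j : ℕ} {v : Fin n} {exc : Fin n → Prop} {N R : List (Node n)}
    (hr : Ready Δ G Y i id id' al al' TD tid m) (hB : Y.b + 16 * al' ≤ Y.B)
    (hcap : ∀ v, (L v).length ≤ Y.cap v)
    {s : State} {Q : State → Prop} {x : Node n}
    (hL : Lists Δ G Y i id' l TD tid L k exc L' m s.mem) (hexc : exc v)
    (hR : Rebuilding Δ G Y i id' TD tid v N j R s.mem (s.reg 12)) (hN : N.Nodup)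
    (hNcap : N.length ≤ Y.cap v)
    (hNV : ∀ x ∈ N, x ∈ (layer Δ G i).verts ∧ v ∈ onb G x ∧ x ≠ zeroNode n)
    (hv : v ∈ orig Δ G i) (hv' : v ∈ orig Δ G (i + 1)) (hidx : id x < al)
    (hid : id (Sum.inl v) = v)
    (hj : j < N.length) (hx : N[j] = x) (h7 : s.reg 7 = Y.b + 16 * v)
    (h10 : s.reg 10 = Y.b + 16 * id x)
    (hQ : ∀ s' R', s'.reg 3 = s.reg 3 → Lists Δ G Y i id' l TD tid L k exc L' m s'.mem →
      Rebuilding Δ G Y i id' TD tid v N (j + 1) R' s'.mem (s'.reg 12) → Q s') :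
    rebuildBody.wp Y.B s Q := by
  classical
  have hbB := Y.le_B
  have hle := hr.le_al
  have hvn := v.2
  have hlab := Y.la_le
  have hst := Y.st_le v
  have hRle := hR.le
  have hw := hR.addr
  obtain ⟨hxV, hvx, hx0⟩ := hNV _ (List.getElem_mem hj)
  rw [hx] at hxV hvx hx0
  have hxhigh := hr.node_high _ hxV
  rw [← hL.other 11 (by norm_num) (by norm_num) (by norm_num)] at hxhigh
  have hvhigh := hr.node_high (Sum.inl v) (mem_orig.1 hv)
  rw [← hL.other 11 (by norm_num) (by norm_num) (by norm_num), if_pos (inl_mem_high_iff.2 hv'),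
    hid] at hvhigh
  refine wp_getF h7 (by norm_num) (by omega) (by norm_num) (by omega) ?_
  rw [hvhigh]
  simp only [Prog.wp, State.setReg_reg]
  norm_num
  refine ⟨by omega, ?_⟩
  refine wp_getF (b := Y.b) (j := id x) (by simp [h10]) (by norm_num) (by omega) (by norm_num)
    (by simp only [State.setReg_mem]; rw [hxhigh]; split_ifs <;> omega) ?_
  simp only [State.setReg_reg, State.setReg_mem, hxhigh]
  norm_num
  refine ⟨fun hx' => ?_, fun hx' => ?_⟩
  · replace hx' : x ∈ (layer Δ G i).high Δ := by
      by_contra hx''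
      simp [hx''] at hx'
    have hnext : nextNode Δ G i N[j] = x := by rw [hx, nextNode_of_mem hx']
    -- A vertex of high degree can enter the new list only as itself, and the old list has
    -- no duplicates.
    have hxR : x ∉ R := by
      intro hxR
      obtain ⟨y, hy, e⟩ := (hR.mem x).1 hxR
      by_cases hyh : y ∈ (layer Δ G i).high Δ
      · rw [nextNode_of_mem hyh] at e
        exact notMem_take hN hj (hx ▸ e ▸ hy)
      · rw [nextNode_of_notMem hyh] at e
        exact inr_notMem_high i _ (e ▸ hx')
    refine ⟨by omega, by rw [h10]; omega, by omega, by omega, ?_⟩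
    have hseen := hr.id_eq x (Seen.of_mem hxV)
    refine hQ _ (R ++ [x]) (by simp)
      (hL.frame hexc hcap (a := s.reg 12) (by omega) (by omega) ?_ ?_ ?_) ?_
    · intro e _ he
      simp [Function.update_of_ne he]
    · intro c _ _
      simp only [State.setMem_mem, State.setReg_mem]
      rw [fld_update_raw _ _ _ (by omega)]
    · intro T _ _
      right
      simp only [State.setMem_mem, State.setReg_mem]
      rw [fld_update_raw _ _ _ (by omega)]
    · simp only [State.setMem_mem, State.setReg_mem, State.setReg_reg]
      norm_num
      refine hR.append hj hnext hxR hNcap (fun a _ => by rw [hseen, h10]) fun T hT h0 => ?_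
      rw [fld_update_raw _ _ _ (by omega), hR.mark T hT h0, or_iff_left]
      intro e
      exact inr_notMem_high i T (e ▸ hx')
  · have hlow : Low Δ G i x := ⟨hxV, hx', hx0⟩
    obtain ⟨T, hTdef⟩ : ∃ T, T = onb G x ∩ orig Δ G (i + 1) := ⟨_, rfl⟩
    have hnext : nextNode Δ G i N[j] = Sum.inr T := by rw [hx, nextNode_of_notMem hx', hTdef]
    have hT : T ∈ TD := by rw [hTdef]; exact hr.mem x hlow
    have hT0 : T ≠ ∅ := by
      intro e
      have : v ∈ T := by rw [hTdef]; exact Finset.mem_inter.2 ⟨hvx, hv'⟩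
      simp [e] at this
    have hcls : fld Y.b s.mem 5 (id x) = Y.b + 16 * tid T := by
      rw [hTdef, hL.other 5 (by norm_num) (by norm_num) (by norm_num)]; exact hr.cls x hlow
    have hfwd := hr.fwd T hT
    rw [← hL.other 9 (by norm_num) (by norm_num) (by norm_num)] at hfwd
    have hTlt := hr.tid_lt _ hT
    have hφT := hr.id_lt T hT
    have hmark : fld Y.b s.mem 10 (tid T) < Y.B := by
      rcases hL.mark T hT hT0 with e | ⟨u, -, e⟩
      · omega
      · have := u.2; omega
    refine wp_getF (b := Y.b) (j := id x) (by simp [h10]) (by norm_num) (by omega) (by norm_num)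
      (by simp only [State.setReg_mem]; omega) ?_
    simp only [State.setReg_mem, hcls]
    refine wp_getF (b := Y.b) (j := tid T) (by simp) (by norm_num) (by omega) (by norm_num)
      (by simp only [State.setReg_mem]; omega) ?_
    simp only [State.setReg_mem]
    refine wp_ifEq.2 ⟨fun e => ?_, fun e => ?_⟩
    · simp [h7] at e
      exact hQ _ R (by simp) (by simpa using hL) (by
        simpa using hR.skip hj (by rw [hnext]; exact (hR.mark T hT hT0).1 e))
    · simp [h7] at e
      have hTR : Sum.inr T ∉ R := fun hTR => e ((hR.mark T hT hT0).2 hTR)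
      refine wp_setF (b := Y.b) (j := tid T) (by simp) (by norm_num) (by norm_num) (by omega)
        (by norm_num) (by simp [h7]; omega) ?_
      have hfwd' : fld Y.b (Function.update s.mem (Y.b + 16 * tid T + 10) (Y.b + 16 * v)) 9 (tid T)
          = Y.b + 16 * id' (Sum.inr T) := by
        rw [fld_update_of_ne _ _ _ (by norm_num) (by norm_num) (by norm_num), hfwd]
      refine wp_getF (b := Y.b) (j := tid T) (by simp) (by norm_num) (by omega) (by norm_num)
        (by simp [h7, hfwd']; omega) ?_
      simp only [Prog.wp, State.setReg_reg, State.setReg_mem, State.setMem_mem, State.setMem_reg]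
      norm_num
      rw [h7, hfwd']
      refine ⟨by omega, by omega, by omega, by omega, ?_⟩
      have hfr : ∀ (c : ℕ) x, fld Y.b (Function.update (Function.update s.mem
          (Y.b + 16 * tid T + 10) (Y.b + 16 * v)) (s.reg 12) x) c =
          fld Y.b (Function.update s.mem (Y.b + 16 * tid T + 10) (Y.b + 16 * v)) c := fun c x => by
        rw [fld_update_raw _ _ _ (by omega)]
      refine hQ _ (R ++ [Sum.inr T]) (by simp)
        (hL.frame hexc hcap (a := s.reg 12) (by omega) (by omega) ?_ ?_ ?_) ?_
      · intro e he hne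
        simp only [State.setMem_mem, State.setReg_mem]
        rw [Function.update_of_ne hne, update_fld_raw _ _ _ _ he]
      · intro c hc h10
        simp only [State.setMem_mem, State.setReg_mem]
        rw [hfr, fld_update_of_ne _ _ _ h10 (by norm_num) hc]
      · intro S hS _
        simp only [State.setMem_mem, State.setReg_mem]
        rw [hfr, fld_update_self]
        by_cases e : S = T
        · left; rw [e, Function.update_self]
        · right; rw [Function.update_of_ne fun e' => e (hr.inj S hS T hT e')]
      · simp only [State.setMem_mem, State.setReg_mem, State.setReg_reg]
        norm_num
        refine hR.append hj hnext hTR hNcap ?_ ?_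
        · intro a ha
          by_cases e : a = s.reg 12
          · rw [e, Function.update_self, Function.update_self]
          · rw [Function.update_of_ne e, Function.update_of_ne e, update_fld_raw _ _ _ _ ha]
        · intro S hS hS0
          rw [hfr, fld_update_self]
          by_cases e : S = T
          · rw [e, Function.update_self]; simp
          · rw [Function.update_of_ne fun e' => e (hr.inj S hS T hT e'), hR.mark S hS hS0,
              or_iff_left fun e' => e (Sum.inr_injective e')]

theorem extId_of_seen {x : Node n} (hx : Seen Δ G i x) : extId Δ G i id tid x = id x := if_pos hx

theorem extId_inr_lt (h : LevelInv Δ G Y m₀ f i id L l al m) {m₂ : ℕ → ℕ} {P H : Finset (Fin n)}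
    {C : Node n → Finset (Fin n)} (hC : Classes Δ G Y m i id al P H C TD tid φ al' m₂)
    {T : Finset (Fin n)} (hT : T ∈ TD) : extId Δ G i id tid (Sum.inr T) < al' := by
  rw [extId]
  split_ifs with hs
  · exact (h.id_lt _ hs).trans_le hC.le_al
  · exact hC.tid_lt T hT

theorem Ready.of_linked (h : LevelInv Δ G Y m₀ f i id L l al m) {m₂ m₃ : ℕ → ℕ}
    {Done : Node n → Prop}
    (hC : Classes Δ G Y m i id al (orig Δ G (i + 1)) ∅ (fun x => onb G x ∩ orig Δ G (i + 1))
      TD tid (fun T => extId Δ G i id tid (Sum.inr T)) al' m₂)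
    (hl : Linked Δ G Y i id φ Done m₂ m₃) :
    Ready Δ G Y i id (extId Δ G i id tid) al al' TD tid m₃ := by
  refine ⟨hC.le_al, hC.inj, hC.tid_lt, fun T hT => extId_inr_lt h hC hT, fun T hT => ?_, hC.mem,
    fun x hx => ?_, fun x hx => ?_, fun x hx => extId_of_seen hx⟩
  · rw [hl.other 9 (by norm_num) (by norm_num), hC.fwd T hT]
  · rw [hl.other 5 (by norm_num) (by norm_num), hC.cls x hx]
  · rw [hl.other 11 (by norm_num) (by norm_num), hC.node_high x hx]

theorem LevelInv.seen_of_mem (h : LevelInv Δ G Y m₀ f i id L l al m) {v : Fin n} {x : Node n}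
    (hx : x ∈ L v) : Seen Δ G i x := by
  have := (h.mem_list v x).1 hx
  simp only [Layer.nbrs, Finset.mem_filter] at this
  exact Or.inr ⟨_, Nat.min_le_left _ _, this.1⟩

/-- The lists of the vertices of high degree are replaced by lists of their neighbours in the next
graph. Several old neighbours can belong to one class, so a stamp on each record of a class keeps it
from being entered twice. The list never outgrows the old one, so it can be written over it. -/
theorem rebuild_spec (h : LevelInv Δ G Y m₀ f i id L l al m) (hi : i ≤ height Δ G)
    (hB : Y.b + 16 * al' ≤ Y.B) {m₂ : ℕ → ℕ} {s : State}
    (hC : Classes Δ G Y m i id al (orig Δ G (i + 1)) ∅ (fun x => onb G x ∩ orig Δ G (i + 1))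
      TD tid (fun T => extId Δ G i id tid (Sum.inr T)) al' m₂)
    (hl : Linked Δ G Y i id φ (fun _ => True) m₂ s.mem)
    (h4 : s.reg 4 = l.length) (h5 : s.reg 5 = Y.la) :
    RunsTo Y.B rebuild s (edgesTime bodyTime l L) fun s' => (∃ L',
      Lists Δ G Y i (extId Δ G i id tid) l TD tid L l.length (fun _ => False) L' s.mem s'.mem) ∧
      s'.reg 3 = s.reg 3 := by
  classical
  have hbB := Y.le_B
  have hal := h.lt_al
  have hlab := Y.la_le
  have hle := hC.le_al
  have hR := Ready.of_linked h hC hl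
  have huB : ∀ v ∈ l, ∀ u ∈ L v, Y.b + 16 * id u + 16 ≤ Y.B := fun v hv u hu => by
    have := h.id_lt u (h.seen_of_mem hu)
    omega
  let J : ℕ → (Fin n → Prop) → (Fin n → List (Node n)) → (ℕ → ℕ) → Prop := fun k exc L' m' =>
    Lists Δ G Y i (extId Δ G i id tid) l TD tid L k exc L' s.mem m'
  refine (forEdges_spec Y (id := id) (l := l) (L := L) (s := s)
    (fun k m' a _ => a = s.reg 3 ∧ ∃ L', J k (fun _ => False) L' m')
    (fun k j m' a w => a = s.reg 3 ∧ ∃ hk : k < l.length, ∃ L',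
      J k (fun u => u = l[k] ∧ u ∈ orig Δ G (i + 1)) L' m' ∧
      (l[k] ∈ orig Δ G (i + 1) → ∃ R,
        Rebuilding Δ G Y i (extId Δ G i id tid) TD tid l[k] (L l[k]) j R m' w))
    (by rfl) h.length_le h.cap huB h4 h5 ?_ ?_ ?_ ?_ ?_ ?_).mono ?_ ?_
  · rintro k hk m' a w ⟨-, L', hJ⟩
    obtain ⟨⟨e1, e2, e3⟩, e4⟩ := hC.edge_data h k hk
    have := h.length_le
    refine ⟨?_, ?_, ?_⟩
    · rw [hJ.la _ (by omega) (by omega), hl.raw _ (by omega), e1]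
    · rw [hJ.other 3 (by norm_num) (by norm_num) (by norm_num),
        hl.other 3 (by norm_num) (by norm_num), e2]
    · rw [hJ.length, hJ.eq _ (Or.inl (notMem_take h.l_nodup hk))]
  · rintro k hk j hj m' a w ⟨-, hk', L', hJ, hR⟩
    have hseen := h.seen_of_mem (List.getElem_mem hj)
    by_cases hO : l[k] ∈ orig Δ G (i + 1)
    · obtain ⟨R, hR⟩ := hR hO
      rw [hR.rest j hj le_rfl, extId_of_seen hseen]
    · have e := hJ.eq l[k] (Or.inr hO)
      have := hJ.array l[k] (fun h => hO h.2) j (by rw [e]; exact hj)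
      rw [this]
      simp only [e, extId_of_seen hseen]
  · rintro k hk s' g1 g2 g7 g9 g11 ⟨ha, L', hJ⟩
    have e1 := Y.st_le l[k]
    have hnt := notMem_take h.l_nodup hk
    refine ⟨by rw [g11]; omega, by simpa using ha, hk, L', ?_, fun hO => ⟨[], ?_⟩⟩
    · refine ⟨hJ.length, hJ.nodup, hJ.mem, hJ.eq, hJ.le, fun v _ => hJ.array v (by simp), ?_,
        hJ.other, hJ.raw, hJ.la⟩
      intro T hT h0
      exact (hJ.mark T hT h0).imp_right fun ⟨u, hu, e⟩ =>
        ⟨u, Or.inl (hu.resolve_right (by simp)), e⟩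
    · refine ⟨by simp, by simp, by simp, by simp [g11], by simp, fun k' hk' _ => ?_, ?_⟩
      · have e := hJ.eq l[k] (Or.inl hnt)
        have := hJ.array l[k] (by simp) k' (by rw [e]; exact hk')
        simpa [e] using this
      · intro T hT h0
        simp only [State.setReg_mem, List.not_mem_nil, iff_false]
        intro e
        rcases hJ.mark T hT h0 with e' | ⟨u, hu, e'⟩
        · omega
        · have : u = l[k] := Fin.ext (by omega)
          exact hnt (this ▸ hu.resolve_right (by simp))
  · rintro k hk j hj s' g1 g2 g7 g10 ⟨ha, hk', L', hJ, hRb⟩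
    have hlk : l[k] ∈ l := List.getElem_mem hk
    have hlo := (h.mem_l _).1 hlk
    by_cases hO : l[k] ∈ orig Δ G (i + 1)
    · obtain ⟨R, hRb⟩ := hRb hO
      refine (rebuildBody_wp hR hB h.cap hJ ⟨rfl, hO⟩ hRb (h.nodup _) (h.cap _)
        (fun x hx => ⟨((h.mem_L hi hlo).1 hx).1, ((h.mem_L hi hlo).1 hx).2,
          h.ne_zero_of_mem hi hlo hx⟩) hlo hO
        (h.id_lt _ (h.seen_of_mem (List.getElem_mem hj))) (h.id_inl _) hj rfl g7 g10
        (Q := fun s'' => s''.reg 3 = s.reg 3 ∧ ∃ hk : k < l.length, ∃ L',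
          J k (fun u => u = l[k] ∧ u ∈ orig Δ G (i + 1)) L' s''.mem ∧
          (l[k] ∈ orig Δ G (i + 1) → ∃ R, Rebuilding Δ G Y i (extId Δ G i id tid) TD tid l[k]
            (L l[k]) (j + 1) R s''.mem (s''.reg 12))) ?_)
      intro s'' R' h3 hJ' hR'
      exact ⟨h3.trans ha, hk, L', hJ', fun _ => ⟨R', hR'⟩⟩
    · have hvhigh := hR.node_high (Sum.inl l[k]) (mem_orig.1 hlo)
      rw [← hJ.other 11 (by norm_num) (by norm_num) (by norm_num),
        if_neg (by rwa [inl_mem_high_iff]), h.id_inl] at hvhigh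
      have hvn := (l[k]).2
      refine wp_getF g7 (by norm_num) (by omega) (by norm_num) (by omega) ?_
      rw [hvhigh]
      simp only [Prog.wp, State.setReg_reg]
      norm_num [-mem_orig]
      exact ⟨by omega, ha, hk, ⟨L', hJ⟩, fun h => absurd h hO⟩
  · rintro k hk s' g1 g2 g7 g11 ⟨ha, hk', L', hJ, hRb⟩
    have hlk : l[k] ∈ l := List.getElem_mem hk
    have hlo := (h.mem_l _).1 hlk
    have hnt := notMem_take h.l_nodup hk
    have hvn := (l[k]).2
    have hvhigh := hR.node_high (Sum.inl l[k]) (mem_orig.1 hlo)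
    rw [← hJ.other 11 (by norm_num) (by norm_num) (by norm_num), h.id_inl] at hvhigh
    refine wp_getF g7 (by norm_num) (by omega) (by norm_num)
      (by rw [hvhigh]; split_ifs <;> omega) ?_
    rw [hvhigh]
    simp only [Prog.wp, State.setReg_reg, inl_mem_high_iff]
    norm_num [-mem_orig]
    refine ⟨by omega, fun hO => ?_, fun hO => ?_⟩
    · replace hO : l[k] ∈ orig Δ G (i + 1) := by
        by_contra hO'
        simp [hO'] at hO
      obtain ⟨R, hRb⟩ := hRb hO
      have hRle := hRb.le
      have hcap := h.cap l[k]
      have hst := Y.st_le l[k]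
      have hlen : s'.reg 12 - s'.reg 11 = R.length := by rw [hRb.addr, g11]; omega
      refine ⟨by omega, ?_⟩
      refine wp_setF (b := Y.b) (j := l[k]) (by simp [g7]) (by norm_num) (by norm_num) (by omega)
        (by norm_num) (by simp [hlen]; omega) ?_
      refine ⟨by simpa using ha, Function.update L' l[k] R, ?_⟩
      simp only [State.setMem_mem, State.setReg_mem, State.setReg_reg]
      norm_num
      rw [hlen]
      have hR' : ∀ u, u ≠ l[k] → Function.update L' l[k] R u = L' u := fun u hu =>
        Function.update_of_ne hu _ _
      refine ⟨?_, ?_, ?_, ?_, ?_, ?_, ?_, ?_, ?_, ?_⟩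
      · intro u
        rw [fld_update_self]
        by_cases e : u = l[k]
        · rw [e, Function.update_self, Function.update_self]
        · rw [Function.update_of_ne fun e' => e (Fin.ext e'), hR' u e, hJ.length]
      · intro u
        by_cases e : u = l[k]
        · rw [e, Function.update_self]; exact hRb.nodup
        · rw [hR' u e]; exact hJ.nodup u
      · intro u hu huO y
        by_cases e : u = l[k]
        · rw [e, Function.update_self, hRb.mem, List.take_length]
        · rw [hR' u e]
          exact hJ.mem u (((mem_take_succ hk).1 hu).resolve_right e) huO y
      · intro u hu
        have e : u ≠ l[k] := by
          rintro rfl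
          exact hu.elim (fun h => h ((mem_take_succ hk).2 (Or.inr rfl))) fun h => h hO
        rw [hR' u e]
        exact hJ.eq u (hu.imp_left fun h h' => h ((mem_take_succ hk).2 (Or.inl h')))
      · intro u
        by_cases e : u = l[k]
        · rw [e, Function.update_self]; exact hRle
        · rw [hR' u e]; exact hJ.le u
      · intro u _ k' hk'
        by_cases e : u = l[k]
        · subst e
          simp only [Function.update_self] at hk' ⊢
          rw [update_fld_raw _ _ _ _ (by omega), hRb.array k' hk']
        · simp only [hR' u e] at hk' ⊢
          have := hJ.le u
          have := h.cap u
          have := Y.st_le u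
          rw [update_fld_raw _ _ _ _ (by omega), hJ.array u (fun h => e h.1) k' hk']
      · intro T hT h0
        rw [fld_update_of_ne _ _ _ (by norm_num) (by norm_num) (by norm_num)]
        refine (hJ.mark T hT h0).imp_right ?_
        rintro ⟨u, hu, e⟩
        exact ⟨u, Or.inl ((mem_take_succ hk).2 (hu.imp_right fun h => h.1)), e⟩
      · intro c hc h4 h10
        rw [fld_update_of_ne _ _ _ h4 (by norm_num) hc, hJ.other c hc h4 h10]
      · intro a ha
        have := Y.M_le_la
        rw [update_fld_raw _ _ _ _ (by omega), hJ.raw a ha]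
      · intro a ha ha'
        rw [update_fld_raw _ _ _ _ ha', hJ.la a ha ha']
    · refine ⟨ha, L', hJ.length, hJ.nodup, ?_, ?_, hJ.le, fun v _ => ?_, ?_,
        hJ.other, hJ.raw, hJ.la⟩
      · intro u hu huO
        refine hJ.mem u (((mem_take_succ hk).1 hu).resolve_right ?_) huO
        rintro rfl
        exact hO huO
      · intro u hu
        exact hJ.eq u (hu.imp_left fun h h' => h ((mem_take_succ hk).2 (Or.inl h')))
      · exact hJ.array v fun h => hO (h.1 ▸ h.2)
      · intro T hT h0
        refine (hJ.mark T hT h0).imp_right ?_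
        rintro ⟨u, hu, e⟩
        exact ⟨u, Or.inl ((mem_take_succ hk).2 (hu.imp_right fun h => h.1)), e⟩
  · refine ⟨rfl, L, ?_, h.nodup, by simp, fun _ _ => rfl, fun _ => le_rfl, ?_, ?_,
      fun _ _ _ _ => rfl, fun _ _ => rfl, fun _ _ _ => rfl⟩
    · intro v
      have := v.2
      rw [hl.other 4 (by norm_num) (by norm_num), hC.old 4 (by norm_num) (by norm_num)
        (by norm_num) (by norm_num) (by norm_num) (by norm_num) _ (by omega), h.length]
    · intro v _ k hk
      have e1 := Y.st_le v
      have e2 := h.cap v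
      rw [hl.raw _ (by omega), hC.raw _ (by omega), h.array v k hk,
        extId_of_seen (h.seen_of_mem (List.getElem_mem hk))]
    · intro T hT h0
      rw [hl.other 10 (by norm_num) (by norm_num)]
      exact Or.inl (hC.mark T hT h0)
  · simp only [edgesTime]
    gcongr
    simp [Prog.cost, Prog.setF, Prog.getF, Prog.ifEq, rebuildBody, rebuildPost, bodyTime]
  · rintro s' ⟨ha, L', hJ⟩
    exact ⟨⟨L', hJ⟩, ha⟩

end Rebuild

/-! ### From one level to the next -/

section LevelStep

variable {n : ℕ} {Δ D : ℕ} {G : SimpleGraph (Fin n)} {Y : Layout n} {m₀ f : ℕ → ℕ} {i : ℕ}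
  {id : Node n → ℕ} {L L' : Fin n → List (Node n)} {l : List (Fin n)} {al al' : ℕ} {m : ℕ → ℕ}
  {TD : Finset (Finset (Fin n))} {tid φ : Finset (Fin n) → ℕ}

/-- Keep the marked vertices in the list of vertices. -/
def filterBody : Prog :=
  .seq (.add 28 5 6) (.seq (.load 7 28) (.seq (.getF 13 7 11) (.seq (.const 14 0) (.ite 14 13
    (.seq (.add 15 5 12) (.seq (.store 15 7) (.seq (.const 16 1) (.add 12 12 16)))) .skip))))

/-- Keep the marked vertices in the list of vertices. -/
def filterList : Prog := .seq (.const 12 0) (.seq (.for 6 4 filterBody) (.move 4 12))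

theorem filterList_spec {p : Fin n → Prop} [DecidablePred p] {s : State} (hl : l.length ≤ n)
    (harr : ∀ k (hk : k < l.length), s.mem (Y.la + k) = Y.b + 16 * l[k])
    (hhigh : ∀ v ∈ l, fld Y.b s.mem 11 (v : Fin n) = if p v then 1 else 0)
    (h4 : s.reg 4 = l.length) (h5 : s.reg 5 = Y.la) :
    RunsTo Y.B filterList s (30 * l.length + 4) fun s' =>
      s'.reg 4 = (l.filter p).length ∧ s'.reg 3 = s.reg 3 ∧
      (∀ k (hk : k < (l.filter p).length), s'.mem (Y.la + k) = Y.b + 16 * (l.filter p)[k]) ∧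
      ∀ a, a < Y.la ∨ Y.b ≤ a → s'.mem a = s.mem a := by
  have hlab := Y.la_le
  have hbB := Y.le_B
  let F : ℕ → List (Fin n) := fun k => (l.take k).filter p
  have hFlen : ∀ k, (F k).length ≤ k := fun k =>
    (List.length_filter_le _ _).trans (List.length_take_le _ _)
  have hF : ∀ k (hk : k < l.length), F (k + 1) = F k ++ if p l[k] then [l[k]] else [] := by
    intro k hk
    simp only [F]
    rw [List.take_succ_eq_append_getElem hk, List.filter_append, List.filter_singleton]
    simp
  let I : ℕ → (ℕ → ℕ) → ℕ → ℕ → Prop := fun k m' a w => w = (F k).length ∧ a = s.reg 3 ∧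
    (∀ k' (hk' : k' < (F k).length), m' (Y.la + k') = Y.b + 16 * (F k)[k']) ∧
    (∀ k' (hk' : k' < l.length), k ≤ k' → m' (Y.la + k') = Y.b + 16 * l[k']) ∧
    ∀ a, a < Y.la ∨ Y.b ≤ a → m' a = s.mem a
  have hinit : RunsTo Y.B (.const 12 0) s 1 fun s' => s' = s.setReg 12 0 :=
    RunsTo.of_wp (p := .const 12 0) ⟨by omega, rfl⟩
  refine (hinit.seq (T' := 30 * l.length + 3) fun s₁ hs₁ => ?_).mono (by omega) fun _ h => h
  subst hs₁
  have hloop : RunsTo Y.B (.for 6 4 filterBody) (s.setReg 12 0)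
      (∑ k ∈ Finset.range l.length, (20 + 3) + 2)
      fun s' => I l.length s'.mem (s'.reg 3) (s'.reg 12) := by
    refine RunsTo.for (N := l.length) (c := fun _ => 20) I ⟨by norm_num, by norm_num, by norm_num,
      by norm_num, by norm_num, by rfl, by rfl⟩ (by simp [h4]) (by omega) (by omega) ?_ ?_
    · refine ⟨by simp [F], by simp, by simp [F], fun k hk _ => harr k hk, fun _ _ => rfl⟩
    · rintro k hk s' hreg h6 ⟨j1, j2, j3, j4, j5⟩
      have r5 : s'.reg 5 = Y.la := (hreg 5 (by rfl)).trans (by simp [h5])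
      have hle := hFlen k
      have hvn := (l[k]).2
      have hfl : fld Y.b s'.mem 11 l[k] = if p l[k] then 1 else 0 := by
        rw [← hhigh _ (List.getElem_mem hk)]
        exact j5 _ (Or.inr (by omega))
      refine (RunsTo.of_wp (p := filterBody) ?_).mono
        (by simp [filterBody, Prog.cost, Prog.getF]) fun _ h => h
      simp only [filterBody, Prog.wp, State.setReg_reg, State.setReg_mem, r5, h6, if_true,
        j4 k hk le_rfl]
      refine ⟨by omega, by omega, by omega, ?_⟩
      refine wp_getF (b := Y.b) (j := l[k]) (by simp) (by norm_num) (by omega) (by norm_num)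
        (by simp only [State.setReg_mem]; rw [hfl]; split_ifs <;> omega) ?_
      simp only [State.setReg_mem, hfl, State.setReg_reg]
      norm_num
      refine ⟨by omega, fun hp => ?_, fun hp => ?_⟩
      · replace hp : p l[k] := by
          by_contra hp'
          simp [hp'] at hp
        have hw : s'.reg 12 = (F k).length := j1
        rw [r5, hw]
        refine ⟨by omega, by omega, by omega, by omega, ?_⟩
        have e := hF k hk
        rw [if_pos hp] at e
        refine ⟨by rw [e]; simp, j2, ?_, ?_, ?_⟩
        · intro k' hk'
          simp only [e] at hk' ⊢
          rw [List.length_append, List.length_singleton] at hk'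
          by_cases e' : k' = (F k).length
          · subst e'
            simp
          · rw [Function.update_of_ne (by omega), List.getElem_append_left (by omega), j3]
        · intro k' hk' hkk'
          rw [Function.update_of_ne (by omega), j4 k' hk' (by omega)]
        · intro a ha
          rw [Function.update_of_ne (by omega), j5 a ha]
      · have e := hF k hk
        rw [if_neg hp, List.append_nil] at e
        simp only [I, e]
        exact ⟨j1, j2, j3, fun k' hk' hkk' => j4 k' hk' (by omega), j5⟩
  refine (hloop.seq (T' := 1) fun s' hs' => ?_).mono ?_ fun _ h => h
  · obtain ⟨j1, j2, j3, -, j5⟩ := hs'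
    have e : F l.length = l.filter p := by simp [F]
    rw [e] at j1
    simp only [e] at j3
    have := List.length_filter_le (fun x => decide (p x)) l
    refine RunsTo.of_wp (p := .move 4 12) ⟨by omega, ?_, ?_, ?_, ?_⟩
    · simpa using j1
    · simpa using j2
    · exact j3
    · exact j5
  · simp only [Finset.sum_const, Finset.card_range, smul_eq_mul]
    omega

theorem LevelInv.le_id_inr (h : LevelInv Δ G Y m₀ f i id L l al m) {A : Finset (Fin n)}
    (hA : Seen Δ G i (Sum.inr A)) : n ≤ id (Sum.inr A) := by
  by_contra! hlt
  have := h.id_inj _ hA _ (Seen.inl i ⟨_, hlt⟩) (h.id_inl ⟨_, hlt⟩).symm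
  cases this

/-- The nodes that appear in the next graph are classes. -/
theorem Classes.exists_of_not_seen {m₂ : ℕ → ℕ} {P H : Finset (Fin n)}
    (hC : Classes Δ G Y m i id al P H (fun x => onb G x ∩ orig Δ G (i + 1)) TD tid φ al' m₂)
    {x : Node n} (hx : x ∈ (layer Δ G (i + 1)).verts) (hs : ¬ Seen Δ G i x) :
    ∃ T ∈ TD, T ≠ ∅ ∧ x = Sum.inr T := by
  rcases x with v | A
  · exact absurd (Seen.inl i v) hs
  · have hA : A ≠ ∅ := by
      rintro rfl
      exact hs (Seen.zero i)
    obtain ⟨y, hy, hyh, rfl⟩ := inr_mem_verts_succ.1 hx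
    refine ⟨_, hC.mem y ⟨hy, hyh, ?_⟩, hA, rfl⟩
    rintro rfl
    exact hA (by simp [zeroNode])

theorem extId_eq_tid {T : Finset (Fin n)} (hs : ¬ Seen Δ G i (Sum.inr T)) :
    extId Δ G i id tid (Sum.inr T) = tid T := if_neg hs

/-- The invariant for the next level, from the effects of the passes over the edges. -/
theorem LevelInv.succ (hG : Sparse Δ D G) (h : LevelInv Δ G Y m₀ f i id L l al m)
    (hi : i < height Δ G) {m₂ m₃ m₄ m₅ : ℕ → ℕ}
    (hC : Classes Δ G Y m i id al (orig Δ G (i + 1)) ∅ (fun x => onb G x ∩ orig Δ G (i + 1))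
      TD tid (fun T => extId Δ G i id tid (Sum.inr T)) al' m₂)
    (hl : Linked Δ G Y i id (fun T => extId Δ G i id tid (Sum.inr T)) (fun _ => True) m₂ m₃)
    (hL : Lists Δ G Y i (extId Δ G i id tid) l TD tid L l.length (fun _ => False) L' m₃ m₄)
    {p : Fin n → Prop} [DecidablePred p] (hp : ∀ v, p v ↔ v ∈ orig Δ G (i + 1))
    (harr : ∀ k (hk : k < (l.filter p).length), m₅ (Y.la + k) = Y.b + 16 * (l.filter p)[k])
    (hm : ∀ a, a < Y.la ∨ Y.b ≤ a → m₅ a = m₄ a) :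
    LevelInv Δ G Y m₀ f (i + 1) (extId Δ G i id tid) L' (l.filter p) al' m₅ := by
  have hal := h.lt_al
  have hle := hC.le_al
  have hlab := Y.la_le
  have hMla := Y.M_le_la
  have hf5 : ∀ c, fld Y.b m₅ c = fld Y.b m₄ c := fun c => by
    funext j
    exact hm _ (Or.inr (by omega))
  have hf3 : ∀ c < 16, c ≠ 4 → c ≠ 10 → fld Y.b m₅ c = fld Y.b m₃ c := fun c hc h4 h10 => by
    rw [hf5, hL.other c hc h4 h10]
  have hf2 : ∀ c < 16, c ≠ 0 → c ≠ 4 → c ≠ 10 → fld Y.b m₅ c = fld Y.b m₂ c :=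
    fun c hc h0 h4 h10 => by rw [hf3 c hc h4 h10, hl.other c hc h0]
  have hold : ∀ c < 16, c ≠ 0 → c ≠ 4 → c ≠ 10 → c ≠ 5 → c ≠ 7 → c ≠ 8 → c ≠ 9 → c ≠ 11 →
      ∀ j < al, fld Y.b m₅ c j = fld Y.b m c j := fun c hc h0 h4 h10 h5 h7 h8 h9 h11 j hj => by
    rw [hf2 c hc h0 h4 h10, hC.old c hc h5 h7 h8 h9 h11 j hj]
  have hcase : ∀ {P : Node n → ℕ → Prop}, (∀ x, Seen Δ G i x → P x (id x)) →
      (∀ T ∈ TD, T ≠ ∅ → ¬ Seen Δ G i (Sum.inr T) → P (Sum.inr T) (tid T)) →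
      ∀ x, Seen Δ G (i + 1) x → P x (extId Δ G i id tid x) := by
    intro P h1 h2 x hx
    by_cases hs : Seen Δ G i x
    · rw [extId_of_seen hs]
      exact h1 x hs
    · obtain ⟨T, hT, h0, rfl⟩ := hC.exists_of_not_seen ((Seen.succ_iff.1 hx).resolve_left hs) hs
      rw [extId_eq_tid hs]
      exact h2 T hT h0 hs
  have hzlow : ∀ x, Low Δ G i x → id x ≠ n := fun x hx e =>
    hx.2.2 (h.id_inj x (Seen.of_mem hx.1) _ (Seen.zero i) (e.trans h.id_zero.symm))
  have hmem_node : ∀ {x}, Seen Δ G i x → x ∈ nodes Δ G := by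
    rintro x (rfl | ⟨j, hj, hx⟩)
    · exact hG.zeroNode_mem_nodes
    · exact Sparse.mem_nodes.2 ⟨j, by omega, hx⟩
  refine ⟨fun v => ?_, ?_, ?_, ?_, by omega, ?_, fun v => ?_, fun v => ?_, hL.nodup, ?_, ?_,
    fun v => (hL.le v).trans (h.cap v), h.l_nodup.filter _, fun v => ?_, harr, fun v => ?_,
    fun A hA => ?_, fun A hA => ?_, ?_, ?_, ?_, ?_, ?_, ?_⟩
  · rw [extId_of_seen (Seen.inl i v), h.id_inl]
  · rw [extId_of_seen (Seen.zero i), h.id_zero]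
  · refine hcase (P := fun x k => ∀ y, Seen Δ G (i + 1) y → k = extId Δ G i id tid y → x = y) ?_ ?_
    · intro x hx
      refine hcase (P := fun y k => id x = k → x = y) (fun y hy e => h.id_inj x hx y hy e) ?_
      intro T hT h0 _ e
      have h1 := h.id_lt x hx
      have h2 := hC.le_tid T hT h0
      omega
    · intro T hT h0 _
      refine hcase (P := fun y k => tid T = k → Sum.inr T = y) ?_ ?_
      · intro y hy e
        have h1 := h.id_lt y hy
        have h2 := hC.le_tid T hT h0
        omega
      · intro T' hT' _ _ e
        rw [hC.inj T hT T' hT' e]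
  · exact hcase (P := fun _ k => k < al') (fun x hx => (h.id_lt x hx).trans_le hle)
      fun T hT _ _ => hC.tid_lt T hT
  · intro x hx hx0 hxV
    have hs := (Seen.succ_iff.1 hx).resolve_right hxV
    have hxN := hmem_node hs
    rw [hf3 0 (by norm_num) (by norm_num) (by norm_num), extId_of_seen hs]
    by_cases hxi : x ∈ (layer Δ G i).verts
    · have hlow : Low Δ G i x := by
        refine ⟨hxi, fun hh => ?_, hx0⟩
        obtain ⟨v, hv, rfl⟩ := mem_high_iff.1 hh
        exact hxV (mem_orig.1 hv)
      rw [hl.sv x hlow trivial, Sparse.sv_eq hxN, Sparse.level_eq hi hxi hxV]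
    · rw [hl.sv_of_ne _ fun y hy e => hxi (h.id_inj y (Seen.of_mem hy.1) x hs e ▸ hy.1),
        hC.old 0 (by norm_num) (by norm_num) (by norm_num) (by norm_num) (by norm_num)
        (by norm_num) _ (h.id_lt x hs), h.sv x hs hx0 hxi]
      have hlev : level Δ G x + 1 ≤ i := by
        by_contra! hlt
        rcases hs with e | ⟨j, hj, hxj⟩
        · exact hx0 e
        · exact hxi (mem_verts_of_between hj (by omega) hxj (Sparse.mem_verts_level hxN))
      rw [extId_of_seen (Or.inr ⟨_, hlev, hG.sv_mem_verts hxN hx0⟩)]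
  · rw [hold 3 (by norm_num) (by norm_num) (by norm_num) (by norm_num) (by norm_num) (by norm_num)
      (by norm_num) (by norm_num) (by norm_num) _ (by omega), h.start]
  · rw [hf5, hL.length]
  · intro v y
    by_cases hv : v ∈ orig Δ G (i + 1)
    · have hvi := orig_succ_subset i hv
      rw [hL.mem v (by rw [List.take_length]; exact (h.mem_l v).2 hvi) hv,
        Nat.min_eq_left ((Sparse.mem_orig_iff hi).1 hv), mem_nbrs hv]
      constructor
      · rintro ⟨x, hx, rfl⟩
        obtain ⟨hxV, hvx⟩ := (h.mem_L hi.le hvi).1 hx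
        by_cases hxh : x ∈ (layer Δ G i).high Δ
        · rw [nextNode_of_mem hxh]
          obtain ⟨u, hu, rfl⟩ := mem_high_iff.1 hxh
          exact ⟨mem_orig.1 hu, hvx⟩
        · rw [nextNode_of_notMem hxh]
          exact ⟨inr_mem_verts_succ.2 ⟨x, hxV, hxh, rfl⟩, Finset.mem_inter.2 ⟨hvx, hv⟩⟩
      · rintro ⟨hy, hvy⟩
        rcases y with u | A
        · have hu := mem_orig.2 hy
          refine ⟨Sum.inl u, (h.mem_L hi.le hvi).2 ⟨mem_orig.1 (orig_succ_subset i hu), hvy⟩, ?_⟩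
          rw [nextNode_of_mem (inl_mem_high_iff.2 hu)]
        · obtain ⟨x, hxV, hxh, rfl⟩ := inr_mem_verts_succ.1 hy
          refine ⟨x, (h.mem_L hi.le hvi).2 ⟨hxV, (Finset.mem_inter.1 hvy).1⟩, ?_⟩
          rw [nextNode_of_notMem hxh]
    · have hlt : level Δ G (Sum.inl v) < i + 1 := by
        rw [Sparse.mem_orig_iff hi] at hv
        omega
      rw [hL.eq v (Or.inr hv), h.mem_list, Nat.min_eq_right (by omega), Nat.min_eq_right (by omega)]
  · intro v k hk
    have h1 := Y.st_le v
    have h2 := h.cap v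
    have h3 := hL.le v
    rw [hm _ (by omega), hL.array v (by simp) k hk]
  · rw [List.mem_filter, h.mem_l, decide_eq_true_iff, hp]
    exact ⟨fun h => h.2, fun hv => ⟨orig_succ_subset i hv, hv⟩⟩
  · rw [hold 6 (by norm_num) (by norm_num) (by norm_num) (by norm_num) (by norm_num) (by norm_num)
      (by norm_num) (by norm_num) (by norm_num) _ (by omega), h.deg_inl]
  · refine hcase (P := fun x k => ∀ A, x = Sum.inr A → fld Y.b m₅ 6 k = A.card) ?_ ?_ _ hA A rfl
    · rintro x hx A rfl
      rw [hold 6 (by norm_num) (by norm_num) (by norm_num) (by norm_num) (by norm_num)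
        (by norm_num) (by norm_num) (by norm_num) (by norm_num) _ (h.id_lt _ hx), h.deg_inr A hx]
    · rintro T hT - - A e
      rw [hf2 6 (by norm_num) (by norm_num) (by norm_num) (by norm_num), hC.deg T hT,
        Sum.inr_injective e]
  · refine hcase (P := fun x k => ∀ A, x = Sum.inr A → fld Y.b m₅ 11 k = 0) ?_ ?_ _ hA A rfl
    · rintro x hx A rfl
      rw [hf2 11 (by norm_num) (by norm_num) (by norm_num) (by norm_num),
        hC.high_of_le _ (h.le_id_inr hx) (h.id_lt _ hx), h.high A hx]
    · rintro T hT - - A e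
      rw [hf2 11 (by norm_num) (by norm_num) (by norm_num) (by norm_num), hC.high T hT]
  · refine hcase (P := fun x k => fld Y.b m₅ 1 k = 0) ?_ ?_
    · rintro x hx
      rw [hold 1 (by norm_num) (by norm_num) (by norm_num) (by norm_num) (by norm_num)
        (by norm_num) (by norm_num) (by norm_num) (by norm_num) _ (h.id_lt _ hx), h.nadj x hx]
    · rintro T hT - -
      rw [hf2 1 (by norm_num) (by norm_num) (by norm_num) (by norm_num), hC.nadj T hT]
  · refine hcase (P := fun x k => fld Y.b m₅ 2 k = 0) ?_ ?_
    · rintro x hx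
      rw [hold 2 (by norm_num) (by norm_num) (by norm_num) (by norm_num) (by norm_num)
        (by norm_num) (by norm_num) (by norm_num) (by norm_num) _ (h.id_lt _ hx), h.undom x hx]
    · rintro T hT - -
      rw [hf2 2 (by norm_num) (by norm_num) (by norm_num) (by norm_num), hC.undom T hT]
  · rw [hf3 0 (by norm_num) (by norm_num) (by norm_num), hl.sv_of_ne _ hzlow,
      hC.old 0 (by norm_num) (by norm_num) (by norm_num) (by norm_num) (by norm_num)
      (by norm_num) _ hal, h.sv_zero]
  · have e := hC.fwd ∅ hC.empty_mem
    have e' : extId Δ G i id tid (Sum.inr ∅) = n :=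
      (extId_of_seen (Seen.zero i)).trans h.id_zero
    rw [hC.tid_empty, e'] at e
    rw [hf2 9 (by norm_num) (by norm_num) (by norm_num) (by norm_num), e]
  · rw [hf2 12 (by norm_num) (by norm_num) (by norm_num) (by norm_num), hC.bits, h.bits]
  · intro a ha
    rw [hm a (by omega), hL.raw a ha, hl.raw a (by omega), hC.raw a (by omega), h.raw a ha]

/-- The construction of the next graph. -/
def levelStep (Δ : ℕ) : Prog :=
  .seq (markHigh Δ) (.seq refine (.seq matchSupers (.seq linkSupers (.seq rebuild filterList))))

/-- A bound for the time of `levelStep`, per vertex. -/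
def levelTime (D : ℕ) : ℕ := 1200 * (1 + D)

theorem edgesTime_le (hG : Sparse Δ D G) (h : LevelInv Δ G Y m₀ f i id L l al m)
    (hi : i ≤ height Δ G) :
    l.length = (orig Δ G i).card ∧
    (l.map fun v => (L v).length).sum ≤ D * (orig Δ G i).card ∧
    edgesTime bodyTime l L ≤ 230 * (1 + D) * (orig Δ G i).card + 2 := by
  have e : l.toFinset = orig Δ G i := by
    ext v
    rw [List.mem_toFinset, h.mem_l]
  have h1 : l.length = (orig Δ G i).card := by
    rw [← e, List.toFinset_card_of_nodup h.l_nodup]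
  have h2 : (l.map fun v => (L v).length).sum ≤ D * (orig Δ G i).card := by
    refine le_trans (le_of_eq ?_) (hG.sum_le i)
    rw [← List.sum_toFinset _ h.l_nodup, e]
    exact Finset.sum_congr rfl fun v hv => h.length_eq_card hi hv
  refine ⟨h1, h2, ?_⟩
  rw [edgesTime, h1]
  have : bodyTime + 30 = 230 := rfl
  rw [this]
  nlinarith

theorem levelStep_keeps {r : ℕ} (hr : r = 1 ∨ r = 2 ∨ r = 5 ∨ r = 30) :
    (levelStep Δ).keeps r = true := by
  rcases hr with rfl | rfl | rfl | rfl <;> rfl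

/-- One graph of the hierarchy is computed from the one before in time linear in the number of
vertices of `G` in the latter, which bounds the sum of the lengths of the lists by sparsity. -/
theorem levelStep_spec (hG : Sparse Δ D G) {s : State}
    (h : LevelInv Δ G Y m₀ f i id L l al s.mem) (hi : i < height Δ G) (hΔ : Δ < Y.B)
    (hB : Y.b + 16 * (al + D * (orig Δ G i).card) < Y.B) (h1 : s.reg 1 = Y.b)
    (h2 : s.reg 2 = Y.b + 16 * n) (h3 : s.reg 3 = Y.b + 16 * al) (h4 : s.reg 4 = l.length)
    (h5 : s.reg 5 = Y.la) :
    RunsTo Y.B (levelStep Δ) s (levelTime D * (orig Δ G i).card) fun s' => ∃ id' L' l' al',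
      LevelInv Δ G Y m₀ f (i + 1) id' L' l' al' s'.mem ∧
      al' ≤ al + D * (orig Δ G i).card ∧ s'.reg 3 = Y.b + 16 * al' ∧ s'.reg 4 = l'.length := by
  classical
  obtain ⟨hlen, hsum, hT⟩ := edgesTime_le hG h hi.le
  have hpos : 1 ≤ (orig Δ G i).card := (hG.orig_nonempty hi).card_pos
  have hlab := Y.la_le
  have hMla := Y.M_le_la
  have hal := h.lt_al
  have step1 := (markHigh_spec h hi.le (by omega) hΔ rfl h1 h2 h4 h5).frame
  refine (step1.seq (T' := 4 * edgesTime bodyTime l L + (30 * l.length + 4))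
    fun s₁ ⟨⟨hm₁, r3⟩, hk⟩ => ?_).mono ?_ fun _ h => h
  · have r4 : s₁.reg 4 = l.length := (hk 4 (by rfl)).trans h4
    have r5 : s₁.reg 5 = Y.la := (hk 5 (by rfl)).trans h5
    rw [h3] at r3
    clear hk step1
    refine ((refine_spec h hi.le (by omega) (Classes.of_marked h hm₁) r3 r4 r5).frame.seq
      (T' := 3 * edgesTime bodyTime l L + (30 * l.length + 4))
      fun s₂ ⟨⟨TD, tid, al', hC, hal', r3'⟩, hk⟩ => ?_).mono (by omega) fun _ h => h
    replace r4 : s₂.reg 4 = l.length := (hk 4 (by rfl)).trans r4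
    replace r5 : s₂.reg 5 = Y.la := (hk 5 (by rfl)).trans r5
    have hB' : Y.b + 16 * al' ≤ Y.B := by omega
    clear hk r3
    refine ((matchSupers_spec h hi.le hB' hΔ hC r4 r5).frame.seq
      (T' := 2 * edgesTime bodyTime l L + (30 * l.length + 4))
      fun s₃ ⟨⟨hC', r3⟩, hk⟩ => ?_).mono (by omega) fun _ h => h
    replace r4 : s₃.reg 4 = l.length := (hk 4 (by rfl)).trans r4
    replace r5 : s₃.reg 5 = Y.la := (hk 5 (by rfl)).trans r5
    rw [r3'] at r3
    clear hk r3'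
    refine ((linkSupers_spec h hi.le hB' hC' (fun T hT => extId_inr_lt h hC' hT) r4 r5).frame.seq
      (T' := edgesTime bodyTime l L + (30 * l.length + 4))
      fun s₄ ⟨⟨hl, r3'⟩, hk⟩ => ?_).mono (by omega) fun _ h => h
    replace r4 : s₄.reg 4 = l.length := (hk 4 (by rfl)).trans r4
    replace r5 : s₄.reg 5 = Y.la := (hk 5 (by rfl)).trans r5
    rw [r3] at r3'
    clear hk r3
    refine ((rebuild_spec h hi.le hB' hC' hl r4 r5).frame.seq (T' := 30 * l.length + 4)
      fun s₅ ⟨⟨⟨L', hL⟩, r3⟩, hk⟩ => ?_).mono (by omega) fun _ h => h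
    replace r4 : s₅.reg 4 = l.length := (hk 4 (by rfl)).trans r4
    replace r5 : s₅.reg 5 = Y.la := (hk 5 (by rfl)).trans r5
    rw [r3'] at r3
    clear hk r3'
    refine (filterList_spec (Y := Y) (p := fun v => v ∈ orig Δ G (i + 1)) h.length_le ?_ ?_ r4
      r5).mono le_rfl fun s₆ ⟨r4', r3', harr, hm⟩ => ?_
    · intro k hk
      have := h.length_le
      rw [hL.la _ (by omega) (by omega), hl.raw _ (by omega)]
      exact ((hC'.edge_data h k hk).1).1
    · intro v hv
      have hvo := mem_orig.1 ((h.mem_l v).1 hv)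
      have := hC'.node_high _ hvo
      rw [h.id_inl] at this
      rw [hL.other 11 (by norm_num) (by norm_num) (by norm_num),
        hl.other 11 (by norm_num) (by norm_num), this]
      simp only [inl_mem_high_iff]
    · exact ⟨_, _, _, al', h.succ hG hi hC' hl hL (fun _ => Iff.rfl) harr hm, by omega,
        r3'.trans r3, r4'⟩
  · rw [hlen, levelTime]
    nlinarith

/-- The construction of all graphs of the hierarchy. -/
def levels (Δ : ℕ) : Prog := .seq (.const 30 0) (.loop 30 4 (levelStep Δ))

/-- The loop over the levels takes linear time, because the numbers of vertices of `G` in the graphs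
of the hierarchy decrease geometrically and have sum at most `2 * n`. -/
theorem levels_spec (hG : Sparse Δ D G) {s : State}
    (h : LevelInv Δ G Y m₀ f 0 id L l (n + 1) s.mem) (hΔ : Δ < Y.B)
    (hB : Y.b + 16 * (n + 1 + D * (2 * n)) < Y.B) (h1 : s.reg 1 = Y.b)
    (h2 : s.reg 2 = Y.b + 16 * n) (h3 : s.reg 3 = Y.b + 16 * (n + 1)) (h4 : s.reg 4 = l.length)
    (h5 : s.reg 5 = Y.la) :
    RunsTo Y.B (levels Δ) s ((levelTime D + 1) * (2 * n) + 2) fun s' => ∃ id L l al,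
      LevelInv Δ G Y m₀ f (height Δ G) id L l al s'.mem ∧ al ≤ n + 1 + D * (2 * n) ∧
      s'.reg 1 = Y.b ∧ s'.reg 2 = Y.b + 16 * n ∧ s'.reg 5 = Y.la := by
  have hinit : RunsTo Y.B (.const 30 0) s 1 fun s' => s' = s.setReg 30 0 :=
    RunsTo.of_wp (p := .const 30 0) ⟨by omega, rfl⟩
  let I : ℕ → State → Prop := fun i s => ∃ id L l al, i ≤ height Δ G ∧
    LevelInv Δ G Y m₀ f i id L l al s.mem ∧
    al ≤ n + 1 + D * ∑ j ∈ Finset.range i, (orig Δ G j).card ∧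
    s.reg 1 = Y.b ∧ s.reg 2 = Y.b + 16 * n ∧ s.reg 3 = Y.b + 16 * al ∧ s.reg 4 = l.length ∧
    s.reg 5 = Y.la ∧ s.reg 30 = 0
  have hsum : ∀ i, ∑ j ∈ Finset.range i, (orig Δ G j).card ≤ 2 * n := fun i => by
    have := hG.sum_card_orig_le i
    omega
  refine (hinit.seq (T' := (levelTime D + 1) * (2 * n) + 1) fun s₁ hs₁ => ?_).mono (by omega)
    fun _ h => h
  subst hs₁
  refine (RunsTo.loop (N := height Δ G) (c := fun i => levelTime D * (orig Δ G i).card) I ?_ ?_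
    ?_).mono ?_ ?_
  · rintro i hi s ⟨id, L, l, al, -, h, -, -, -, -, h4, -, h30⟩
    rw [h30, h4, (edgesTime_le hG h hi).1, Finset.card_pos]
    constructor
    · intro hne
      refine lt_of_le_of_ne hi ?_
      rintro rfl
      rw [hG.orig_height] at hne
      exact Finset.not_nonempty_empty hne
    · exact fun hi => hG.orig_nonempty hi
  · rintro i hi s ⟨id, L, l, al, -, h, hal, h1, h2, h3, h4, h5, h30⟩
    have hs := Nat.mul_le_mul_left D (hsum (i + 1))
    rw [Finset.sum_range_succ, Nat.mul_add] at hs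
    refine (levelStep_spec hG h hi hΔ (by omega) h1 h2 h3 h4 h5).frame.mono le_rfl ?_
    rintro s' ⟨⟨id', L', l', al', h', hal', h3', h4'⟩, hk⟩
    refine ⟨id', L', l', al', hi, h', ?_, (hk 1 (levelStep_keeps (by simp))).trans h1,
      (hk 2 (levelStep_keeps (by simp))).trans h2, h3', h4',
      (hk 5 (levelStep_keeps (by simp))).trans h5, (hk 30 (levelStep_keeps (by simp))).trans h30⟩
    rw [Finset.sum_range_succ, Nat.mul_add]
    omega
  · refine ⟨id, L, l, n + 1, Nat.zero_le _, by simpa using h, by simp, ?_⟩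
    simp [h1, h2, h3, h4, h5]
  · have h1 : ∀ i ∈ Finset.range (height Δ G), levelTime D * (orig Δ G i).card + 1 ≤
        (levelTime D + 1) * (orig Δ G i).card := by
      intro i hi
      have := (hG.orig_nonempty (Finset.mem_range.1 hi)).card_pos
      nlinarith
    have h2 := Finset.sum_le_sum h1
    rw [← Finset.mul_sum] at h2
    have h3 := Nat.mul_le_mul_left (levelTime D + 1) (hsum (height Δ G))
    omega
  · rintro s' ⟨id, L, l, al, -, h, hal, h1, h2, -, -, h5, -⟩
    have hs := Nat.mul_le_mul_left D (hsum (height Δ G))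
    exact ⟨id, L, l, al, h, by omega, h1, h2, h5⟩

end LevelStep

/-! ### The numbers for the given set -/

section Start

variable {n : ℕ} {Δ D : ℕ} {G : SimpleGraph (Fin n)} {Y : Layout n} {m₀ f : ℕ → ℕ}
  {id : Node n → ℕ} {L : Fin n → List (Node n)} {l : List (Fin n)} {al : ℕ} {m : ℕ → ℕ}

theorem seen_height_iff (hG : Sparse Δ D G) {x : Node n} :
    Seen Δ G (height Δ G) x ↔ x ∈ nodes Δ G := by
  rw [Sparse.mem_nodes]
  refine ⟨?_, Or.inr⟩
  rintro (rfl | h)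
  · exact Sparse.mem_nodes.1 hG.zeroNode_mem_nodes
  · exact h

theorem LevelInv.static (hG : Sparse Δ D G) (h : LevelInv Δ G Y m₀ f (height Δ G) id L l al m)
    (hB : Y.b + 16 * al ≤ Y.B) {m' : ℕ → ℕ} (hm : ∀ a, a < Y.la ∨ Y.b ≤ a → m' a = m a) :
    Static Δ G Y.B Y.b id Y.st L m' := by
  have hf : ∀ c, fld Y.b m' c = fld Y.b m c := fun c => by
    funext j
    exact hm _ (Or.inr (by omega))
  have hlab := Y.la_le
  have hMla := Y.M_le_la
  have hMn := Y.le_M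
  have hseen : ∀ {x}, x ∈ nodes Δ G → Seen Δ G (height Δ G) x := (seen_height_iff hG).2
  refine ⟨by omega, h.id_inl, h.id_zero, fun x hx y hy => h.id_inj x (hseen hx) y (hseen hy),
    fun x hx => ?_, fun x hx h0 => ?_, by rw [hf, h.sv_zero], fun v => by rw [hf, h.start],
    fun v => by rw [hf, h.length], h.nodup, fun v y => ?_, fun v k hk => ?_, fun v => ?_,
    fun v => ?_⟩
  · have := h.id_lt x (hseen hx)
    omega
  · rw [hf]
    refine h.sv x (hseen hx) h0 ?_
    rwa [hG.verts_height, Finset.mem_singleton]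
  · rw [h.mem_list, Nat.min_eq_right (Sparse.level_le _), nbr]
  · have := Y.st_le v
    have := h.cap v
    rw [hm _ (by omega), h.array v k hk]
  · have := Y.M_le_st v
    omega
  · have := Y.st_le v
    have := h.cap v
    omega

/-- Write the list of all vertices to the cells from the address in register `5` on. -/
def listAll : Prog :=
  .seq (.seq (.const 28 0) (.seq (.load 4 28) (.move 12 1)))
    (.for 6 4 (.seq (.add 28 5 6) (.seq (.store 28 12) (.seq (.const 16 16) (.add 12 12 16)))))

theorem listAll_spec {s : State} (h0 : s.mem 0 = n) (h1 : s.reg 1 = Y.b) (h5 : s.reg 5 = Y.la) :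
    RunsTo Y.B listAll s (7 * n + 5) fun s' => s'.reg 4 = n ∧
      (∀ k < n, s'.mem (Y.la + k) = Y.b + 16 * k) ∧
      ∀ a, a < Y.la ∨ Y.b ≤ a → s'.mem a = s.mem a := by
  have hlab := Y.la_le
  have hbB := Y.le_B
  have hinit : RunsTo Y.B (.seq (.const 28 0) (.seq (.load 4 28) (.move 12 1))) s 3 fun s' =>
      s'.mem = s.mem ∧ s'.reg 4 = n ∧ s'.reg 5 = Y.la ∧ s'.reg 12 = Y.b := by
    refine RunsTo.of_wp (p := .seq (.const 28 0) (.seq (.load 4 28) (.move 12 1))) ?_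
    simp only [Prog.wp, State.setReg_reg, State.setReg_mem]
    norm_num
    rw [h0, h1, h5]
    exact ⟨by omega, by omega, by omega, rfl, rfl, rfl⟩
  refine (hinit.seq (T' := 7 * n + 2) fun s₁ hs₁ => ?_).mono (by omega) fun _ h => h
  obtain ⟨hm, r4, r5, r12⟩ := hs₁
  let I : ℕ → (ℕ → ℕ) → ℕ → ℕ → Prop := fun k m' _ w => w = Y.b + 16 * k ∧
    (∀ k' < k, m' (Y.la + k') = Y.b + 16 * k') ∧ ∀ a, a < Y.la ∨ Y.b ≤ a → m' a = s.mem a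
  refine (RunsTo.for (N := n) (c := fun _ => 4) I ⟨by norm_num, by norm_num, by norm_num,
    by norm_num, by norm_num, by rfl, by rfl⟩ r4 (by omega) (by omega) ?_ ?_).frame.mono ?_ ?_
  · exact ⟨by simpa using r12, by simp, fun a _ => by rw [hm]⟩
  · rintro k hk s' hreg h6 ⟨j1, j2, j3⟩
    have g5 : s'.reg 5 = Y.la := (hreg 5 (by rfl)).trans r5
    refine RunsTo.of_wp (p := .seq (.add 28 5 6) (.seq (.store 28 12) (.seq (.const 16 16)
      (.add 12 12 16)))) ?_
    simp only [Prog.wp, State.setReg_reg, State.setReg_mem, State.setMem_reg, State.setMem_mem]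
    norm_num
    rw [g5, h6, j1]
    refine ⟨by omega, by omega, by omega, by omega, by ring, fun k' hk' => ?_, fun a ha => ?_⟩
    · by_cases e : k' = k
      · rw [e, Function.update_self]
      · rw [Function.update_of_ne (by omega), j2 k' (by omega)]
    · rw [Function.update_of_ne (by omega), j3 a ha]
  · simp only [Finset.sum_const, Finset.card_range, smul_eq_mul]
    omega
  · rintro s' ⟨⟨-, j2, j3⟩, hk⟩
    exact ⟨(hk 4 (by rfl)).trans r4, j2, j3⟩

/-- Compute the numbers `nadj` for the set of all vertices. -/
def countNadj : Prog :=
  forEdges .skip (.seq (.getF 13 10 1) (.seq (.const 14 1) (.seq (.add 13 13 14)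
    (.setF 10 1 13)))) .skip

theorem countNadj_spec {s : State} (hs : Static Δ G Y.B Y.b id Y.st L s.mem)
    (hcap : ∀ v, (L v).length ≤ Y.cap v) (h4 : s.reg 4 = n) (h5 : s.reg 5 = Y.la)
    (hla : ∀ k < n, s.mem (Y.la + k) = Y.b + 16 * k)
    (hN : ∀ x ∈ nodes Δ G, fld Y.b s.mem 1 (id x) = 0)
    (hU : ∀ x ∈ nodes Δ G, fld Y.b s.mem 2 (id x) = 0)
    (hS : Indicates (Finset.univ : Finset (Fin n)) s.mem) :
    RunsTo Y.B countNadj s (edgesTime bodyTime (List.finRange n) L) fun s' =>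
      Current Δ G Y.b id s.mem Finset.univ s'.mem := by
  classical
  have hlab := Y.la_le
  have hMla := Y.M_le_la
  have hMn := Y.le_M
  have hbB := Y.le_B
  obtain ⟨l, hl⟩ : ∃ l, l = List.finRange n := ⟨_, rfl⟩
  have hget : ∀ k (hk : k < l.length), (l[k] : ℕ) = k := by subst hl; simp
  have hlen : l.length = n := by rw [hl, List.length_finRange]
  have hnd : l.Nodup := by rw [hl]; exact List.nodup_finRange n
  rw [← hl]
  have hmemL : ∀ {v y}, y ∈ L v → y ∈ nodes Δ G := fun hy =>
    Sparse.nbr_subset_nodes ((hs.mem_list _ _).1 hy)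
  -- The number of lists in which `y` has been met so far.
  let cnt : ℕ → ℕ → Node n → ℕ := fun k j y =>
    ((l.take k).toFinset.filter fun u => y ∈ L u).card +
    if ∃ hk : k < l.length, y ∈ (L l[k]).take j then 1 else 0
  let K : ℕ → ℕ → (ℕ → ℕ) → ℕ → ℕ → Prop := fun k j m' _ _ =>
    (∀ y ∈ nodes Δ G, fld Y.b m' 1 (id y) = cnt k j y) ∧
    (∀ c < 16, c ≠ 1 → fld Y.b m' c = fld Y.b s.mem c) ∧ ∀ a < Y.b, m' a = s.mem a
  have hcnt : ∀ k j y, cnt k j y ≤ n + 1 := fun k j y => by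
    have h1 := Finset.card_le_univ ((l.take k).toFinset.filter fun u => y ∈ L u)
    rw [Fintype.card_fin] at h1
    simp only [cnt]
    split_ifs <;> omega
  refine (forEdges_spec Y (id := id) (l := l) (L := L) (s := s) (fun k => K k 0) K
    (by rfl) hlen.le hcap (fun v _ u hu => hs.id_le u (hmemL hu)) (by rw [h4, hlen]) h5
    ?_ ?_ ?_ ?_ ?_ ?_).mono ?_ ?_
  · rintro k hk m' a w ⟨j1, j2, j3⟩
    have hk' : k < n := by omega
    refine ⟨?_, ?_, ?_⟩
    · rw [j3 _ (by omega), hla k hk', hget]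
    · rw [j2 3 (by norm_num) (by norm_num), hs.start_eq]
    · rw [j2 4 (by norm_num) (by norm_num), hs.length_eq]
  · rintro k hk j hj m' a w ⟨j1, j2, j3⟩
    have := hs.start_le l[k]
    rw [j3 _ (by omega), hs.array _ j hj]
  · rintro k hk s' - - - - - h
    exact h
  · rintro k hk j hj s' g1 g2 g7 g10 ⟨j1, j2, j3⟩
    have hx := hmemL (List.getElem_mem hj)
    have hxB := hs.id_le _ hx
    have hb := hcnt k j (L l[k])[j]
    refine wp_getF g10 (by norm_num) hxB (by norm_num) (by rw [j1 _ hx]; omega) ?_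
    rw [j1 _ hx]
    simp only [Prog.wp, State.setReg_reg]
    norm_num
    refine ⟨by omega, by omega, ?_⟩
    refine wp_setF (b := Y.b) (j := id (L l[k])[j]) (by simp [g10]) (by norm_num)
      (by norm_num) hxB (by norm_num) (by simp; omega) ?_
    simp only [State.setMem_mem, State.setReg_mem, State.setReg_reg]
    norm_num
    refine ⟨fun y hy => ?_, fun c hc h1 => ?_, fun a ha => ?_⟩
    · rw [fld_update_self]
      have hnt := notMem_take (hs.nodup l[k]) hj
      by_cases e : y = (L l[k])[j]
      · rw [e, Function.update_self]
        simp only [cnt, mem_take_succ hj, hnt, hk, exists_true_left, if_false, or_true, if_true]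
      · rw [Function.update_of_ne fun e' => e (hs.id_inj y hy _ hx e'), j1 y hy]
        simp only [cnt, mem_take_succ hj, e, or_false]
    · rw [fld_update_of_ne _ _ _ h1 (by norm_num) hc, j2 c hc h1]
    · rw [update_fld_raw _ _ _ _ ha, j3 a ha]
  · rintro k hk s' - - - - ⟨j1, j2, j3⟩
    refine ⟨fun y hy => ?_, j2, j3⟩
    rw [j1 y hy]
    have hnt := notMem_take (hnd) hk
    have e : (l.take (k + 1)).toFinset =
        insert l[k] (l.take k).toFinset := by
      ext u
      rw [List.mem_toFinset, mem_take_succ hk, Finset.mem_insert, List.mem_toFinset, or_comm]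
    simp only [cnt, List.take_length, List.take_zero, List.not_mem_nil, exists_false, if_false,
      exists_prop, hk, true_and]
    rw [e, Finset.filter_insert]
    split_ifs with hy'
    · rw [Finset.card_insert_of_notMem fun h =>
        hnt (List.mem_toFinset.1 (Finset.mem_filter.1 h).1)]
    · rfl
  · refine ⟨fun y hy => ?_, fun _ _ _ => rfl, fun _ _ => rfl⟩
    rw [hN y hy]
    simp [cnt]
  · simp only [edgesTime]
    gcongr
    simp [Prog.cost, Prog.setF, Prog.getF, bodyTime]
  · rintro s' ⟨j1, j2, j3⟩
    have hall : ∀ x ∈ nodes Δ G, cnt l.length 0 x = nadj Δ G Finset.univ x := by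
      intro x hx
      rw [Sparse.nadj_eq _ hx]
      simp only [cnt, List.take_length, List.take_zero, List.not_mem_nil, exists_false, if_false,
        add_zero, hs.mem_list]
      congr 1
      ext u
      simp [hl]
    refine ⟨nadj Δ G Finset.univ, fun _ => 0, fun _ _ => rfl, ⟨fun x hx => ?_, fun x hx => ?_,
      fun c hc h1 _ => j2 c hc h1, fun a ha _ => j3 a ha⟩, fun v => ?_, fun v => by simp,
      fun A _ => by simp⟩
    · rw [j1 x hx, hall x hx]
    · rw [j2 2 (by norm_num) (by norm_num), hU x hx]
    · rw [j3 _ (by omega), hS v]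

theorem RunsTo.ite {B a b T : ℕ} {p q : Prog} {s : State} {P : State → Prop}
    (h1 : s.reg a < s.reg b → RunsTo B p s T P) (h2 : ¬ s.reg a < s.reg b → RunsTo B q s T P) :
    RunsTo B (.ite a b p q) s (T + 1) P := by
  by_cases hc : s.reg a < s.reg b
  · obtain ⟨t, s', ht, he, hs⟩ := h1 hc
    exact ⟨t + 1, s', by omega, .ite_true hc he, hs⟩
  · obtain ⟨t, s', ht, he, hs⟩ := h2 hc
    exact ⟨t + 1, s', by omega, .ite_false hc he, hs⟩

/-- Delete the vertices outside the given set, according to the bits in the records. -/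
def deleteOthers : Prog :=
  .for 6 4 (.seq (.seq (.move 0 6) (.seq (.add 13 6 6) (.seq (.add 13 13 13) (.seq (.add 13 13 13)
    (.seq (.add 13 13 13) (.seq (.add 13 1 13) (.seq (.getF 14 13 12) (.const 15 1))))))))
    (.ite 14 15 deleteProg .skip))

theorem deleteOthers_spec {m₁ : ℕ → ℕ} (hs : Static Δ G Y.B Y.b id Y.st L m₁)
    (hG : Sparse Δ D G) {S : Finset (Fin n)}
    (hbits : ∀ v : Fin n, fld Y.b m₁ 12 v = if v ∈ S then 1 else 0) {s : State}
    (h : Current Δ G Y.b id m₁ Finset.univ s.mem) (h1 : s.reg 1 = Y.b) (h4 : s.reg 4 = n) :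
    RunsTo Y.B deleteOthers s ((23 + flipTime Δ) * n + 2) fun s' =>
      Current Δ G Y.b id m₁ S s'.mem := by
  classical
  have hbB := Y.le_B
  have hb := hs.lt_b
  -- The vertices below `k` that are not in `S` have been deleted.
  let I : ℕ → (ℕ → ℕ) → ℕ → ℕ → Prop := fun k m' _ _ =>
    Current Δ G Y.b id m₁ (Finset.univ.filter fun v => v ∈ S ∨ k ≤ v) m'
  refine (RunsTo.for (N := n) (c := fun _ => 20 + flipTime Δ) I ⟨by norm_num, by norm_num,
    by norm_num, by norm_num, by norm_num, by rfl, by rfl⟩ h4 (by omega) (by omega) ?_ ?_).mono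
    ?_ ?_
  · simpa [I] using h
  · intro k hk s' hreg h6 hI
    have g1 : s'.reg 1 = Y.b := (hreg 1 (by rfl)).trans h1
    have hbit : fld Y.b s'.mem 12 k = if (⟨k, hk⟩ : Fin n) ∈ S then 1 else 0 := by
      obtain ⟨N, U, -, hH, -⟩ := hI
      rw [hH.other 12 (by norm_num) (by norm_num) (by norm_num), ← hbits]
    have hpre : RunsTo Y.B (.seq (.move 0 6) (.seq (.add 13 6 6) (.seq (.add 13 13 13)
        (.seq (.add 13 13 13) (.seq (.add 13 13 13) (.seq (.add 13 1 13) (.seq (.getF 14 13 12)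
        (.const 15 1)))))))) s' 10 fun s'' => s''.mem = s'.mem ∧ s''.reg 0 = k ∧
        s''.reg 1 = Y.b ∧ s''.reg 14 = (if (⟨k, hk⟩ : Fin n) ∈ S then 1 else 0) ∧
        s''.reg 15 = 1 := by
      refine RunsTo.of_wp (p := .seq (.move 0 6) (.seq (.add 13 6 6) (.seq (.add 13 13 13)
        (.seq (.add 13 13 13) (.seq (.add 13 13 13) (.seq (.add 13 1 13) (.seq (.getF 14 13 12)
        (.const 15 1)))))))) ?_
      simp only [Prog.wp, State.setReg_reg, State.setReg_mem]
      norm_num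
      rw [h6, g1]
      refine ⟨by omega, by omega, by omega, by omega, by omega, by omega, ?_⟩
      refine wp_getF (b := Y.b) (j := k) (by simp; ring) (by norm_num) (by omega) (by norm_num)
        (by simp only [State.setReg_mem]; rw [hbit]; split_ifs <;> omega) ?_
      simp only [State.setReg_reg, State.setReg_mem, hbit]
      norm_num
      exact ⟨by omega, g1⟩
    refine (hpre.seq (T' := 9 + flipTime Δ + 1) fun s'' ⟨hm, r0, r1, r14, r15⟩ => ?_).mono
      (by omega) fun _ h => h
    have hI' : Current Δ G Y.b id m₁ (Finset.univ.filter fun v => v ∈ S ∨ k ≤ v) s''.mem := by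
      rw [hm]; exact hI
    refine RunsTo.ite (fun hlt => ?_) fun hge => ?_
    · rw [r14, r15] at hlt
      have hkS : (⟨k, hk⟩ : Fin n) ∉ S := fun hkS => by simp [hkS] at hlt
      refine (deleteProg_spec hs hG hI' (v := ⟨k, hk⟩) r0 r1).mono le_rfl fun s₃ h₃ => ?_
      convert h₃ using 1
      ext v
      simp only [Finset.mem_filter, Finset.mem_univ, true_and, Finset.mem_erase, ne_eq,
        Fin.ext_iff]
      constructor
      · rintro (hv | hv)
        · refine ⟨fun e => hkS ?_, Or.inl hv⟩
          rwa [show (⟨k, hk⟩ : Fin n) = v from Fin.ext e.symm]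
        · exact ⟨by omega, Or.inr (by omega)⟩
      · rintro ⟨hne, hv | hv⟩
        · exact Or.inl hv
        · exact Or.inr (by omega)
    · rw [r14, r15] at hge
      have hkS : (⟨k, hk⟩ : Fin n) ∈ S := by
        by_contra hkS
        simp [hkS] at hge
      refine ⟨1, s'', by omega, .skip s'', ?_⟩
      have : (Finset.univ.filter fun v : Fin n => v ∈ S ∨ k + 1 ≤ v) =
          Finset.univ.filter fun v : Fin n => v ∈ S ∨ k ≤ v := by
        ext v
        simp only [Finset.mem_filter, Finset.mem_univ, true_and]
        constructor
        · rintro (hv | hv)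
          · exact Or.inl hv
          · exact Or.inr (by omega)
        · rintro (hv | hv)
          · exact Or.inl hv
          · by_cases e : (v : ℕ) = k
            · left
              rwa [show v = ⟨k, hk⟩ from Fin.ext e]
            · exact Or.inr (by omega)
      simp only [I]
      rw [this]
      exact hI'
  · simp only [Finset.sum_const, Finset.card_range, smul_eq_mul]
    have : 20 + flipTime Δ + 3 = 23 + flipTime Δ := by omega
    rw [this, mul_comm]
  · intro s' hI
    have e : (Finset.univ.filter fun v : Fin n => v ∈ S ∨ n ≤ v) = S := by
      ext v
      have := v.2
      simp only [Finset.mem_filter, Finset.mem_univ, true_and]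
      exact or_iff_left (by omega)
    simp only [I] at hI
    rwa [e] at hI

/-- Compute the numbers `nadj` and `undom` for the given set. -/
def finish : Prog := .seq listAll (.seq countNadj deleteOthers)

/-- A bound for the time of `finish`, per vertex. -/
def finishTime (Δ : ℕ) : ℕ := 300 + 230 * Δ + flipTime Δ

theorem finish_spec (hG : Sparse Δ D G) {S : Finset (Fin n)} {s : State}
    (h : LevelInv Δ G Y m₀ f (height Δ G) id L l al s.mem) (hB : Y.b + 16 * al ≤ Y.B)
    (h0 : m₀ 0 = n) (hbit : ∀ v : Fin n, m₀ (1 + v) = 1)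
    (hf : ∀ v : Fin n, f v = if v ∈ S then 1 else 0)
    (h1 : s.reg 1 = Y.b) (h5 : s.reg 5 = Y.la) :
    RunsTo Y.B finish s (finishTime Δ * n) fun s' => ∃ m₁,
      Static Δ G Y.B Y.b id Y.st L m₁ ∧ Current Δ G Y.b id m₁ S s'.mem ∧
      ∀ a < Y.M, m₁ a = m₀ a := by
  have hMn := Y.le_M
  have hMla := Y.M_le_la
  have hn := hG.pos
  have hseen : ∀ {x}, x ∈ nodes Δ G → Seen Δ G (height Δ G) x := (seen_height_iff hG).2
  refine ((listAll_spec (by rw [h.raw 0 (by omega), h0]) h1 h5).frame.seq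
    (T' := (230 * (n + Δ * n) + 2) + ((23 + flipTime Δ) * n + 2))
    fun s₁ ⟨⟨r4, hla, hm⟩, hk⟩ => ?_).mono ?_ fun _ h => h
  · have r1 : s₁.reg 1 = Y.b := (hk 1 (by rfl)).trans h1
    have r5 : s₁.reg 5 = Y.la := (hk 5 (by rfl)).trans h5
    clear hk
    have hs := h.static hG hB hm
    have hfld : ∀ c, fld Y.b s₁.mem c = fld Y.b s.mem c := fun c => by
      funext j
      have := Y.la_le
      exact hm _ (Or.inr (by omega))
    have hraw : ∀ a < Y.M, s₁.mem a = m₀ a := fun a ha => by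
      rw [hm a (Or.inl (by omega)), h.raw a ha]
    have hT : edgesTime bodyTime (List.finRange n) L ≤ 230 * (n + Δ * n) + 2 := by
      have e : bodyTime + 30 = 230 := rfl
      have hsum : ((List.finRange n).map fun v => (L v).length).sum ≤ Δ * n := by
        rw [← List.sum_toFinset _ (List.nodup_finRange n)]
        refine (Finset.sum_le_card_nsmul _ _ Δ fun v _ => ?_).trans ?_
        · rw [← List.toFinset_card_of_nodup (hs.nodup v)]
          refine le_trans (le_of_eq ?_) (hG.card_nbr_lt v).le
          congr 1
          ext y
          rw [List.mem_toFinset, hs.mem_list]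
        · rw [smul_eq_mul, mul_comm]
          refine Nat.mul_le_mul_left _ ?_
          simp
      rw [edgesTime, e, List.length_finRange]
      gcongr
    refine ((countNadj_spec hs h.cap r4 r5 hla ?_ ?_ ?_).frame.mono hT fun _ h => h).seq
      fun s₂ ⟨hc, hk⟩ => ?_
    · intro x hx
      rw [hfld, h.nadj x (hseen hx)]
    · intro x hx
      rw [hfld, h.undom x (hseen hx)]
    · intro v
      have := v.2
      rw [hraw _ (by omega), hbit, if_pos (Finset.mem_univ v)]
    · refine (deleteOthers_spec hs hG (S := S) (fun v => by rw [hfld, h.bits, hf]) hc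
        ((hk 1 (by rfl)).trans r1) ((hk 4 (by rfl)).trans r4)).mono le_rfl fun s₃ h₃ => ?_
      exact ⟨s₁.mem, hs, h₃, hraw⟩
  · simp only [finishTime]
    nlinarith

end Start

/-! ### Initialization -/

section Prepare

variable {n : ℕ} {Δ D : ℕ} {G : SimpleGraph (Fin n)} {Y : Layout n}

/-- Put the sizes and addresses of the parts of the memory into registers. -/
def setup : Prog :=
  .seq (.const 28 0) (.seq (.load 4 28) (.seq (.add 28 4 4) (.seq (.const 29 1)
  (.seq (.add 28 28 29) (.seq (.load 20 28) (.seq (.add 5 20 20) (.seq (.add 21 5 20)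
  (.seq (.add 1 21 21) (.seq (.add 1 1 1) (.seq (.add 1 1 1) (.seq (.add 1 1 1)
  (.seq (.add 2 4 4) (.seq (.add 2 2 2) (.seq (.add 2 2 2) (.seq (.add 2 2 2) (.seq (.add 2 1 2)
  (.seq (.const 28 16) (.seq (.add 3 2 28) (.seq (.const 28 2) (.seq (.add 23 4 4)
  (.seq (.add 23 23 28) (.seq (.sub 22 20 23) (.move 12 1)))))))))))))))))))))))

theorem setup_wp {B M : ℕ} {s : State} (h0 : s.mem 0 = n) (hM : s.mem (2 * n + 1) = M)
    (hn : 2 * n + 2 ≤ M) (hB : 48 * M + 16 * n + 16 < B) :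
    RunsTo B setup s 24 fun s' => s'.mem = s.mem ∧ s'.reg 1 = 48 * M ∧
      s'.reg 2 = 48 * M + 16 * n ∧ s'.reg 3 = 48 * M + 16 * (n + 1) ∧ s'.reg 4 = n ∧
      s'.reg 5 = 2 * M ∧ s'.reg 12 = 48 * M ∧ s'.reg 20 = M ∧ s'.reg 22 = M - (2 * n + 2) ∧
      s'.reg 23 = 2 * n + 2 := by
  refine RunsTo.of_wp (p := setup) ?_
  simp only [setup, Prog.wp, State.setReg_reg, State.setReg_mem]
  norm_num
  rw [h0, show n + n + 1 = 2 * n + 1 by ring, hM]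
  and_intros <;> omega

/-- Replace the entries of the arrays of neighbours by pointers to their records, in copies of the
arrays. -/
def copyArrays : Prog :=
  .for 6 22 (.seq (.add 24 23 6) (.seq (.load 25 24) (.seq (.add 25 25 25) (.seq (.add 25 25 25)
    (.seq (.add 25 25 25) (.seq (.add 25 25 25) (.seq (.add 25 25 1) (.seq (.add 24 24 20)
    (.store 24 25)))))))))

theorem copyArrays_spec {B M : ℕ} {s : State}
    (hn : 2 * n + 2 ≤ M) (hB : 48 * M + 16 * n + 16 < B)
    (hent : ∀ a, 2 * n + 2 ≤ a → a < M → s.mem a < n) (h1 : s.reg 1 = 48 * M)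
    (h20 : s.reg 20 = M) (h22 : s.reg 22 = M - (2 * n + 2)) (h23 : s.reg 23 = 2 * n + 2) :
    RunsTo B copyArrays s (12 * M + 2) fun s' => s'.reg 3 = s.reg 3 ∧ s'.reg 12 = s.reg 12 ∧
      (∀ a < M, s'.mem a = s.mem a) ∧
      ∀ a, 2 * n + 2 ≤ a → a < M → s'.mem (a + M) = 48 * M + 16 * s.mem a := by
  let I : ℕ → (ℕ → ℕ) → ℕ → ℕ → Prop := fun k m' a w => a = s.reg 3 ∧ w = s.reg 12 ∧
    (∀ a < M, m' a = s.mem a) ∧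
    ∀ a, 2 * n + 2 ≤ a → a < 2 * n + 2 + k → m' (a + M) = 48 * M + 16 * s.mem a
  refine (RunsTo.for (N := M - (2 * n + 2)) (c := fun _ => 9) I ⟨by norm_num, by norm_num,
    by norm_num, by norm_num, by norm_num, by rfl, by rfl⟩ h22 (by omega) (by omega) ?_ ?_).mono
    ?_ ?_
  · exact ⟨rfl, rfl, fun _ _ => rfl, fun a h h' => by omega⟩
  · rintro k hk s' hreg h6 ⟨j1, j2, j3, j4⟩
    have g1 : s'.reg 1 = 48 * M := (hreg 1 (by rfl)).trans h1
    have g20 : s'.reg 20 = M := (hreg 20 (by rfl)).trans h20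
    have g23 : s'.reg 23 = 2 * n + 2 := (hreg 23 (by rfl)).trans h23
    have he := hent (2 * n + 2 + k) (by omega) (by omega)
    have hb : (Prog.seq (.add 24 23 6) (.seq (.load 25 24) (.seq (.add 25 25 25)
        (.seq (.add 25 25 25) (.seq (.add 25 25 25) (.seq (.add 25 25 25) (.seq (.add 25 25 1)
        (.seq (.add 24 24 20) (.store 24 25))))))))).wp B s'
        fun s'' => I (k + 1) s''.mem (s''.reg 3) (s''.reg 12) := by
      simp only [Prog.wp, State.setReg_reg, State.setReg_mem, State.setMem_reg, State.setMem_mem]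
      norm_num
      rw [g1, g20, g23, h6, j3 _ (by omega)]
      refine ⟨by omega, by omega, by omega, by omega, by omega, by omega, by omega, by omega,
        by omega, j1, j2, fun a ha => ?_, fun a ha ha' => ?_⟩
      · rw [Function.update_of_ne (by omega), j3 a ha]
      · by_cases e : a = 2 * n + 2 + k
        · rw [e, Function.update_self]
          ring
        · rw [Function.update_of_ne (by omega), j4 a ha (by omega)]
    exact RunsTo.of_wp hb
  · simp only [Finset.sum_const, Finset.card_range, smul_eq_mul]
    omega
  · rintro s' ⟨j1, j2, j3, j4⟩
    exact ⟨j1, j2, j3, fun a ha ha' => j4 a ha (by omega)⟩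

/-- Make the record of one vertex, at the address in register `12`. -/
def initRecord (Δ : ℕ) : Prog :=
  .seq (.add 24 4 6) (.seq (.const 25 1) (.seq (.add 24 24 25) (.seq (.load 26 24)
  (.seq (.add 24 24 25) (.seq (.load 27 24) (.seq (.sub 27 27 26) (.seq (.add 26 26 20)
  (.seq (.const 14 0) (.seq (.const 15 Δ) (.seq (.setF 12 1 14) (.seq (.setF 12 2 14)
  (.seq (.setF 12 3 26) (.seq (.setF 12 4 27) (.seq (.setF 12 6 15) (.seq (.add 24 25 6)
  (.seq (.load 26 24) (.seq (.setF 12 12 26) (.seq (.store 24 25) (.seq (.add 24 5 6)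
  (.seq (.store 24 12) (.seq (.const 25 16) (.add 12 12 25))))))))))))))))))))))

theorem initRecord_wp {B b M la k o len β : ℕ} {s : State} {Q : State → Prop}
    (h4 : s.reg 4 = n) (h5 : s.reg 5 = la) (h6 : s.reg 6 = k) (h20 : s.reg 20 = M)
    (h12 : s.reg 12 = b + 16 * k) (hk : k < n) (hB : b + 16 * n + 16 < B) (hΔ : Δ < B)
    (hla : la + n ≤ b) (hnla : 2 * n + 2 ≤ la) (hMla : o + len + M ≤ la)
    (ho : s.mem (n + 1 + k) = o) (hlen : s.mem (n + 2 + k) = o + len) (hβ : s.mem (1 + k) = β)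
    (hβB : β < B)
    (hQ : ∀ s' : State, s'.reg 3 = s.reg 3 → s'.reg 12 = b + 16 * (k + 1) →
      fld b s'.mem 1 = Function.update (fld b s.mem 1) k 0 →
      fld b s'.mem 2 = Function.update (fld b s.mem 2) k 0 →
      fld b s'.mem 3 = Function.update (fld b s.mem 3) k (o + M) →
      fld b s'.mem 4 = Function.update (fld b s.mem 4) k len →
      fld b s'.mem 6 = Function.update (fld b s.mem 6) k Δ →
      fld b s'.mem 12 = Function.update (fld b s.mem 12) k β →
      (∀ a < b, s'.mem a = Function.update (Function.update s.mem (1 + k) 1) (la + k)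
        (b + 16 * k) a) → Q s') :
    (initRecord Δ).wp B s Q := by
  simp only [initRecord, Prog.wp, State.setReg_reg, State.setReg_mem]
  norm_num
  rw [h4, h6, h20, show n + k + 1 = n + 1 + k by ring, show n + 1 + k + 1 = n + 2 + k by ring, ho,
    hlen]
  refine ⟨by omega, by omega, by omega, by omega, by omega, by omega, by omega, by omega,
    by omega, by omega, ?_⟩
  iterate 5
    refine wp_setF (b := b) (j := k) (by simp [h12]) (by norm_num) (by norm_num) (by omega)
      (by norm_num) (by simp; omega) ?_
  simp only [State.setReg_reg, State.setReg_mem, State.setMem_reg, State.setMem_mem]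
  norm_num
  rw [h6, update_fld_raw _ _ _ _ (by omega), update_fld_raw _ _ _ _ (by omega),
    update_fld_raw _ _ _ _ (by omega), update_fld_raw _ _ _ _ (by omega),
    update_fld_raw _ _ _ _ (by omega), hβ]
  refine ⟨by omega, hβB, ?_⟩
  refine wp_setF (b := b) (j := k) (by simp [h12]) (by norm_num) (by norm_num) (by omega)
    (by norm_num) (by simp; omega) ?_
  simp only [State.setReg_reg, State.setMem_reg]
  norm_num
  rw [h5, h6, h12]
  refine ⟨by omega, by omega, by omega, by omega, by omega, by omega, ?_⟩
  have hraw : ∀ (m : ℕ → ℕ) (x y c : ℕ), fld b (Function.update (Function.update m (1 + k) x)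
      (la + k) y) c = fld b m c := fun m x y c => by
    rw [fld_update_raw _ _ _ (by omega), fld_update_raw _ _ _ (by omega)]
  apply hQ
  · simp
  · simp; ring
  iterate 6 simp [hraw, fld_update_self, fld_update_of_ne]
  · intro a ha
    simp only [State.setReg_mem, State.setMem_mem]
    by_cases e : a = la + k
    · rw [e, Function.update_self, Function.update_self]
    · rw [Function.update_of_ne e, Function.update_of_ne e]
      by_cases e : a = 1 + k
      · rw [e, Function.update_self, Function.update_self]
      · rw [Function.update_of_ne e, Function.update_of_ne e]
        iterate 6 rw [update_fld_raw _ _ _ _ ha]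

/-- Make the records and the list of all vertices. The indicator array of the given set is moved to
the records and replaced by the one of the set of all vertices. -/
def initRecords (Δ : ℕ) : Prog := .for 6 4 (initRecord Δ)

theorem initRecords_spec {s : State} {o len : Fin n → ℕ} (hΔ : Δ < Y.B)
    (ho : ∀ v : Fin n, s.mem (n + 1 + v) = o v) (hst : ∀ v, Y.st v = o v + Y.M)
    (hlen : ∀ v : Fin n, s.mem (n + 2 + v) = o v + len v) (hcap : ∀ v, len v = Y.cap v)
    (hbit : ∀ v : Fin n, s.mem (1 + v) < Y.B) (hB : Y.b + 16 * (n + 1) < Y.B)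
    (h4 : s.reg 4 = n) (h5 : s.reg 5 = Y.la) (h12 : s.reg 12 = Y.b) (h20 : s.reg 20 = Y.M) :
    RunsTo Y.B (initRecords Δ) s (38 * n + 2) fun s' => s'.reg 3 = s.reg 3 ∧
      (∀ v : Fin n, fld Y.b s'.mem 1 v = 0 ∧ fld Y.b s'.mem 2 v = 0 ∧
        fld Y.b s'.mem 3 v = Y.st v ∧ fld Y.b s'.mem 4 v = Y.cap v ∧ fld Y.b s'.mem 6 v = Δ ∧
        fld Y.b s'.mem 12 v = s.mem (1 + v) ∧ s'.mem (1 + v) = 1 ∧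
        s'.mem (Y.la + v) = Y.b + 16 * v) ∧
      ∀ a < Y.la, ¬(1 ≤ a ∧ a ≤ n) → s'.mem a = s.mem a := by
  have hlab := Y.la_le
  have hMla := Y.M_le_la
  have hMn := Y.le_M
  let I : ℕ → (ℕ → ℕ) → ℕ → ℕ → Prop := fun k m' a w => a = s.reg 3 ∧ w = Y.b + 16 * k ∧
    (∀ v : Fin n, (v : ℕ) < k → fld Y.b m' 1 v = 0 ∧ fld Y.b m' 2 v = 0 ∧
      fld Y.b m' 3 v = Y.st v ∧ fld Y.b m' 4 v = Y.cap v ∧ fld Y.b m' 6 v = Δ ∧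
      fld Y.b m' 12 v = s.mem (1 + v) ∧ m' (1 + v) = 1 ∧ m' (Y.la + v) = Y.b + 16 * v) ∧
    ∀ a < Y.la, ¬(1 ≤ a ∧ a ≤ k) → m' a = s.mem a
  refine (RunsTo.for (N := n) (c := fun _ => 35) I ⟨by norm_num, by norm_num, by norm_num,
    by norm_num, by norm_num, by rfl, by rfl⟩ h4 (by omega) (by omega) ?_ ?_).mono ?_ ?_
  · exact ⟨rfl, by rw [h12]; rfl, fun v hv => by omega, fun a _ _ => rfl⟩
  · rintro k hk s' hreg h6 ⟨j1, j2, j3, j4⟩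
    have g4 : s'.reg 4 = n := (hreg 4 (by rfl)).trans h4
    have g5 : s'.reg 5 = Y.la := (hreg 5 (by rfl)).trans h5
    have g20 : s'.reg 20 = Y.M := (hreg 20 (by rfl)).trans h20
    obtain ⟨x, rfl⟩ : ∃ x : Fin n, (x : ℕ) = k := ⟨⟨k, hk⟩, rfl⟩
    have hx := Y.st_le x
    have e1 := hcap x
    have e2 := hst x
    refine RunsTo.of_wp (p := initRecord Δ) (initRecord_wp (b := Y.b) (k := x) (o := o x)
      (len := len x) (β := s.mem (1 + x)) g4 g5 h6 g20 j2 hk (by omega) hΔ hlab (by omega)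
      (by omega) ?_ ?_ ?_ (hbit x) ?_)
    · rw [j4 _ (by omega) (by omega), ho]
    · rw [j4 _ (by omega) (by omega), hlen]
    · rw [j4 _ (by omega) (by omega)]
    · intro s'' r3 r12 f1 f2 f3 f4 f6 f12 hr
      refine ⟨r3.trans j1, r12, fun v hv => ?_, fun a ha ha' => ?_⟩
      · rw [f1, f2, f3, f4, f6, f12, hr _ (by omega), hr _ (by omega)]
        by_cases e : v = x
        · subst e
          refine ⟨?_, ?_, ?_, ?_, ?_, ?_, ?_, ?_⟩
          iterate 6 simp [hst, hcap]
          · rw [Function.update_of_ne (by omega), Function.update_self]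
          · rw [Function.update_self]
        · have e' : (v : ℕ) ≠ x := fun h => e (Fin.ext h)
          iterate 6 rw [Function.update_of_ne e']
          rw [Function.update_of_ne (a := 1 + (v : ℕ)) (by omega),
            Function.update_of_ne (a := 1 + (v : ℕ)) (by omega),
            Function.update_of_ne (a := Y.la + (v : ℕ)) (by omega),
            Function.update_of_ne (a := Y.la + (v : ℕ)) (by omega)]
          exact j3 v (by omega)
      · rw [hr a (by omega), Function.update_of_ne (by omega), Function.update_of_ne (by omega),
          j4 a ha (by omega)]
  · simp only [Finset.sum_const, Finset.card_range, smul_eq_mul]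
    omega
  · rintro s' ⟨j1, -, j3, j4⟩
    exact ⟨j1, fun v => j3 v v.2, j4⟩

/-- Make the record of the supervertex of degree zero. -/
def initZero : Prog :=
  .seq (.const 14 0) (.seq (.setF 2 0 14) (.seq (.setF 2 1 14) (.seq (.setF 2 2 14)
    (.seq (.setF 2 6 14) (.seq (.setF 2 11 14) (.setF 2 9 2))))))

theorem initZero_spec {B b : ℕ} {s : State} (hB : b + 16 * (n + 1) < B)
    (h2 : s.reg 2 = b + 16 * n) :
    RunsTo B initZero s 19 fun s' => s'.reg 3 = s.reg 3 ∧
      (∀ c, c = 0 ∨ c = 1 ∨ c = 2 ∨ c = 6 ∨ c = 11 →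
        fld b s'.mem c = Function.update (fld b s.mem c) n 0) ∧
      fld b s'.mem 9 = Function.update (fld b s.mem 9) n (b + 16 * n) ∧
      (∀ c, c = 3 ∨ c = 4 ∨ c = 12 → fld b s'.mem c = fld b s.mem c) ∧
      ∀ a < b, s'.mem a = s.mem a := by
  refine RunsTo.of_wp (p := initZero) ?_
  simp only [initZero]
  rw [Prog.wp]
  refine ⟨by omega, ?_⟩
  iterate 6
    refine wp_setF (b := b) (j := n) (by simp [h2]) (by norm_num) (by norm_num) (by omega)
      (by norm_num) (by simp [h2]; omega) ?_
  have z0 : fld b (Function.update s.mem (b + 16 * n) 0) 0 =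
      Function.update (fld b s.mem 0) n 0 := fld_update_self b s.mem 0 n 0
  have z : ∀ c, c ≠ 0 → c < 16 → fld b (Function.update s.mem (b + 16 * n) 0) c =
      fld b s.mem c := fun c h h' => fld_update_of_ne s.mem n 0 h (by norm_num) h'
  refine ⟨by simp, ?_, ?_, ?_, ?_⟩
  · rintro c (rfl | rfl | rfl | rfl | rfl) <;> simp [fld_update_self, fld_update_of_ne, z0, z]
  · simp [h2, fld_update_self, fld_update_of_ne, z]
  · rintro c (rfl | rfl | rfl) <;> simp [fld_update_of_ne, z]
  · intro a ha
    simp only [State.setReg_mem, State.setMem_mem]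
    iterate 6 rw [update_fld_raw _ _ _ _ ha]

end Prepare

/-! ### The input -/

section Input

variable {n : ℕ} {Δ D : ℕ} {G : SimpleGraph (Fin n)} {adj : Fin n → List (Fin n)} {m : ℕ → ℕ}

/-- The memory holds the graph `G`, where `adj v` lists the neighbours of `v` in the order of the
array for `v`. -/
structure Arrays (G : SimpleGraph (Fin n)) (adj : Fin n → List (Fin n)) (m : ℕ → ℕ) : Prop where
  zero : m 0 = n
  first : m (n + 1) = 2 * n + 2
  nodup : ∀ v, (adj v).Nodup
  mem_adj : ∀ v u, u ∈ adj v ↔ G.Adj v u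
  next : ∀ v : Fin n, m (n + 2 + v) = m (n + 1 + v) + (adj v).length
  entry : ∀ (v : Fin n) (k : ℕ) (hk : k < (adj v).length),
    m (m (n + 1 + v) + k) = ((adj v)[k] : Fin n)

namespace Arrays

theorem offset_mono (h : Arrays G adj m) {j k : ℕ} (hjk : j ≤ k) (hk : k ≤ n) :
    m (n + 1 + j) ≤ m (n + 1 + k) := by
  induction k, hjk using Nat.le_induction with
  | base => exact le_rfl
  | succ k hjk ih =>
    have := h.next ⟨k, hk⟩
    simp only [show n + 2 + k = n + 1 + (k + 1) by ring] at this
    exact (ih (by omega)).trans (by omega)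

theorem le_offset (h : Arrays G adj m) {k : ℕ} (hk : k ≤ n) : 2 * n + 2 ≤ m (n + 1 + k) := by
  rw [← h.first]
  exact h.offset_mono (Nat.zero_le k) hk

/-- The end of the arrays. -/
theorem offset_last (h : Arrays G adj m) :
    m (2 * n + 1) = 2 * n + 2 + ∑ v, (adj v).length := by
  have key : ∀ k ≤ n, m (n + 1 + k) =
      2 * n + 2 + ∑ j ∈ Finset.range k, if hj : j < n then (adj ⟨j, hj⟩).length else 0 := by
    intro k hk
    induction k with
    | zero => simpa using h.first
    | succ k ih =>
      have := h.next ⟨k, hk⟩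
      simp only [show n + 2 + k = n + 1 + (k + 1) by ring] at this
      rw [this, ih (by omega), Finset.sum_range_succ, dif_pos (by omega), add_assoc]
  rw [show 2 * n + 1 = n + 1 + n by ring, key n le_rfl, Finset.sum_fin_eq_sum_range]

theorem offset_add_length_le (h : Arrays G adj m) (v : Fin n) :
    m (n + 1 + v) + (adj v).length ≤ m (2 * n + 1) := by
  rw [← h.next, show 2 * n + 1 = n + 1 + n by ring, show n + 2 + (v : ℕ) = n + 1 + (v + 1) by ring]
  exact h.offset_mono (by omega) le_rfl

theorem offset_disjoint (h : Arrays G adj m) {u v : Fin n} (huv : (u : ℕ) < v) :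
    m (n + 1 + u) + (adj u).length ≤ m (n + 1 + v) := by
  rw [← h.next, show n + 2 + (u : ℕ) = n + 1 + (u + 1) by ring]
  exact h.offset_mono (by omega) (by omega)

theorem entry_lt (h : Arrays G adj m) {a : ℕ} (ha : 2 * n + 2 ≤ a) (ha' : a < m (2 * n + 1)) :
    m a < n := by
  have key : ∀ k ≤ n, a < m (n + 1 + k) → m a < n := by
    intro k hk
    induction k with
    | zero =>
      intro hlt
      have := h.first
      rw [add_zero] at hlt
      omega
    | succ k ih =>
      intro hlt
      by_cases hlt' : a < m (n + 1 + k)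
      · exact ih (by omega) hlt'
      · have hn := h.next ⟨k, hk⟩
        simp only [show n + 2 + k = n + 1 + (k + 1) by ring] at hn
        have he := h.entry ⟨k, hk⟩ (a - m (n + 1 + k)) (by omega)
        simp only [show m (n + 1 + k) + (a - m (n + 1 + k)) = a by omega] at he
        omega
  exact key n le_rfl (by rwa [show n + 1 + n = 2 * n + 1 by ring])

/-- The division of the memory for the given input. -/
def layout (h : Arrays G adj m) (B : ℕ) (hB : 48 * m (2 * n + 1) + 16 * (n + 1) ≤ B) :
    Layout n where
  B := B
  b := 48 * m (2 * n + 1)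
  M := m (2 * n + 1)
  la := 2 * m (2 * n + 1)
  st v := m (n + 1 + v) + m (2 * n + 1)
  cap v := (adj v).length
  le_M := by rw [h.offset_last]; omega
  M_le_st v := by omega
  st_le v := by have := h.offset_add_length_le v; omega
  disj u v huv := by
    rcases lt_or_gt_of_ne (Fin.val_ne_of_ne huv) with h' | h'
    · have := h.offset_disjoint h'
      omega
    · have := h.offset_disjoint h'
      omega
  M_le_la := by omega
  la_le := by rw [h.offset_last]; omega
  le_B := hB

/-- The neighbours of the original vertices in `G₀`. -/
theorem mem_map_iff (h : Arrays G adj m) (v : Fin n) (y : Node n) :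
    y ∈ (adj v).map Sum.inl ↔ y ∈ (layer Δ G 0).nbrs (Sum.inl v) := by
  rw [mem_nbrs (by rw [orig_zero]; exact Finset.mem_univ v), List.mem_map]
  rcases y with u | A
  · simp [layer, h.mem_adj, SimpleGraph.adj_comm]
  · simp [layer]

theorem sum_length_le (h : Arrays G adj m) (hG : Sparse Δ D G) :
    ∑ v, (adj v).length ≤ D * n := by
  classical
  have h0 := hG.sum_le 0
  rw [orig_zero, Finset.card_univ, Fintype.card_fin] at h0
  refine (Finset.sum_le_sum fun v _ => ?_).trans h0
  rw [← List.length_map (f := (Sum.inl : Fin n → Node n)),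
    ← List.toFinset_card_of_nodup ((h.nodup v).map Sum.inl_injective)]
  refine Finset.card_le_card fun y hy => ?_
  rwa [List.mem_toFinset, h.mem_map_iff (Δ := Δ)] at hy

/-- The encoding of `G` is kept by programs that write to the indicator array and behind the
encoding only. -/
theorem congr (h : Arrays G adj m) {m' : ℕ → ℕ}
    (hm : ∀ a < m (2 * n + 1), a = 0 ∨ n < a → m' a = m a) : Arrays G adj m' := by
  have hM := h.offset_last
  have ho : ∀ k ≤ n, m' (n + 1 + k) = m (n + 1 + k) := fun k hk => hm _ (by omega) (by omega)
  refine ⟨by rw [hm _ (by omega) (by omega), h.zero], by rw [← h.first]; exact ho 0 (by omega),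
    h.nodup, h.mem_adj, fun v => ?_, fun v k hk => ?_⟩
  · rw [ho v (by omega), hm _ (by omega) (by omega), h.next]
  · have h1 := h.le_offset v.2.le
    have h2 := h.offset_add_length_le v
    rw [ho v (by omega), hm _ (by omega) (by omega), h.entry]

end Arrays

theorem encodes_iff {S : Finset (Fin n)} :
    Encodes G S m ↔ Indicates S m ∧ ∃ adj, Arrays G adj m := by
  constructor
  · rintro ⟨h0, h1, h2, adj, h3, h4, h5⟩
    exact ⟨h1, adj, h0, h2, fun v => (h3 v).1, fun v => (h3 v).2, h4, h5⟩
  · rintro ⟨h1, adj, h⟩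
    exact ⟨h.zero, h1, h.first, adj, fun v => ⟨h.nodup v, h.mem_adj v⟩, h.next, h.entry⟩

/-- Prepare the memory for the construction of the hierarchy. -/
def prepare (Δ : ℕ) : Prog := .seq setup (.seq copyArrays (.seq (initRecords Δ) initZero))

/-- The numbers of the records of the vertices of `G₀` and of the supervertex of degree zero. -/
def firstId : Node n → ℕ := Sum.elim (fun v => v) fun _ => n

theorem prepare_spec {S : Finset (Fin n)} {s : State} (hA : Arrays G adj s.mem)
    (hS : Indicates S s.mem) {B : ℕ} (hB : 48 * s.mem (2 * n + 1) + 16 * (n + 1) < B)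
    (hΔ : Δ < B) :
    RunsTo B (prepare Δ) s (12 * s.mem (2 * n + 1) + 38 * n + 47) fun s' => ∃ f : ℕ → ℕ,
      (∀ v : Fin n, f v = if v ∈ S then 1 else 0) ∧
      LevelInv Δ G (hA.layout B hB.le) (fun a => if 1 ≤ a ∧ a ≤ n then 1 else s.mem a) f 0 firstId
        (fun v => (adj v).map Sum.inl) (List.finRange n) (n + 1) s'.mem ∧
      s'.reg 1 = 48 * s.mem (2 * n + 1) ∧ s'.reg 2 = 48 * s.mem (2 * n + 1) + 16 * n ∧
      s'.reg 3 = 48 * s.mem (2 * n + 1) + 16 * (n + 1) ∧ s'.reg 4 = n ∧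
      s'.reg 5 = 2 * s.mem (2 * n + 1) := by
  obtain ⟨M, hM⟩ : ∃ M, M = s.mem (2 * n + 1) := ⟨_, rfl⟩
  have hMn : 2 * n + 2 ≤ M := by rw [hM, hA.offset_last]; omega
  obtain ⟨Y, hY⟩ : ∃ Y, Y = hA.layout B hB.le := ⟨_, rfl⟩
  have hYB : Y.B = B := by rw [hY]; rfl
  have hYb : Y.b = 48 * M := by rw [hY, hM]; rfl
  have hYM : Y.M = M := by rw [hY, hM]; rfl
  have hYla : Y.la = 2 * M := by rw [hY, hM]; rfl
  have hYst : ∀ v : Fin n, Y.st v = s.mem (n + 1 + v) + M := fun v => by rw [hY, hM]; rfl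
  have hYcap : ∀ v : Fin n, Y.cap v = (adj v).length := fun v => by rw [hY]; rfl
  rw [← hY, ← hM, ← hYB]
  rw [← hM, ← hYB] at hB
  rw [← hYB] at hΔ
  have hle : ∀ v : Fin n, s.mem (n + 1 + v) + (adj v).length ≤ M := fun v => by
    rw [hM]; exact hA.offset_add_length_le v
  have hge : ∀ v : Fin n, 2 * n + 2 ≤ s.mem (n + 1 + v) := fun v => hA.le_offset v.2.le
  refine ((setup_wp (B := Y.B) hA.zero hM.symm hMn (by omega)).seq
    (T' := 12 * M + 2 + (38 * n + 2 + 19)) fun s₁ hs₁ => ?_).mono (by omega) fun _ h => h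
  obtain ⟨m1, r1, r2, r3, r4, r5, r12, r20, r22, r23⟩ := hs₁
  refine (copyArrays_spec (n := n) (M := M) hMn (by omega) (fun a ha ha' => ?_) r1 r20 r22
    r23).frame.seq (T' := 38 * n + 2 + 19) fun s₂ ⟨⟨g3, g12, g, gM⟩, k₂⟩ => ?_
  · rw [m1]
    exact hA.entry_lt ha (hM ▸ ha')
  rw [m1] at g gM
  refine (initRecords_spec (Y := Y) (o := fun v => s.mem (n + 1 + v))
      (len := fun v => (adj v).length) hΔ (fun v => ?_) (fun v => by rw [hYst, hYM]) (fun v => ?_)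
      (fun v => (hYcap v).symm) (fun v => ?_) (by omega) ((k₂ 4 (by rfl)).trans r4)
      (((k₂ 5 (by rfl)).trans r5).trans hYla.symm) ((g12.trans r12).trans hYb.symm)
      (((k₂ 20 (by rfl)).trans r20).trans hYM.symm)).frame.seq (T' := 19)
      fun s₃ ⟨⟨l3, lv, lr⟩, k₃⟩ => ?_
  · exact g _ (by omega)
  · rw [g _ (by omega), hA.next]
  · rw [g _ (by omega), hS v]
    split_ifs <;> omega
  refine (initZero_spec (n := n) (b := Y.b) (B := Y.B) (by omega) ?_).frame.mono le_rfl
    fun s₄ ⟨⟨z3, z0, z9, zc, zr⟩, k₄⟩ => ?_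
  · rw [k₃ 2 (by rfl), k₂ 2 (by rfl), r2, hYb]
  have hv : ∀ (v : Fin n) x (g : ℕ → ℕ), Function.update g n x v = g v := fun v x g =>
    Function.update_of_ne (by omega) _ _
  refine ⟨fld Y.b s₄.mem 12, fun v => ?_, ?_, ?_, ?_, ?_, ?_, ?_⟩
  · rw [zc 12 (by simp), (lv v).2.2.2.2.2.1, g _ (by omega), hS]
  · have hx : ∀ x, Seen Δ G 0 x → x = zeroNode n ∨ ∃ v, x = Sum.inl v := by
      rintro x (rfl | ⟨j, hj, h⟩)
      · exact Or.inl rfl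
      · obtain rfl := Nat.le_zero.1 hj
        rcases x with v | A
        · exact Or.inr ⟨v, rfl⟩
        · exact absurd h (inr_notMem_verts_zero A)
    have hinr : ∀ A, Seen Δ G 0 (Sum.inr A : Node n) → A = ∅ := fun A h => by
      rcases hx _ h with e | ⟨v, e⟩
      · exact Sum.inr_injective e
      · simp at e
    have hz : ∀ c, c = 0 ∨ c = 1 ∨ c = 2 ∨ c = 6 ∨ c = 11 → fld Y.b s₄.mem c n = 0 :=
      fun c hc => by rw [z0 c hc, Function.update_self]
    refine ⟨fun _ => rfl, rfl, ?_, ?_, by omega, ?_, ?_, ?_, ?_, ?_, ?_, ?_, ?_, ?_, ?_, ?_, ?_,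
      ?_, ?_, ?_, hz 0 (by simp), by rw [z9, Function.update_self], rfl, ?_⟩
    · intro x h x' h' e
      rcases hx x h with rfl | ⟨v, rfl⟩ <;> rcases hx x' h' with rfl | ⟨v', rfl⟩
      · rfl
      · have : n = (v' : ℕ) := e
        omega
      · have : (v : ℕ) = n := e
        omega
      · rw [Fin.ext e]
    · intro x h
      rcases hx x h with rfl | ⟨v, rfl⟩
      · exact Nat.lt_succ_self n
      · exact v.2.trans (Nat.lt_succ_self n)
    · intro x h hne hnot
      rcases hx x h with rfl | ⟨v, rfl⟩
      · exact absurd rfl hne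
      · exact absurd (by simp [layer]) hnot
    · intro v
      rw [zc 3 (by simp), (lv v).2.2.1]
    · intro v
      rw [zc 4 (by simp), (lv v).2.2.2.1, hYcap, List.length_map]
    · exact fun v => (hA.nodup v).map Sum.inl_injective
    · intro v y
      rw [Nat.zero_min, hA.mem_map_iff]
    · intro v k hk
      rw [List.length_map] at hk
      have h1 := hge v
      have h2 := hle v
      rw [hYst, zr _ (by omega), lr _ (by omega) (by omega),
        show s.mem (n + 1 + v) + M + k = s.mem (n + 1 + v) + k + M by ring, gM _ (by omega)
        (by omega), hA.entry v k hk, List.getElem_map, hYb]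
      rfl
    · intro v
      rw [List.length_map, hYcap]
    · exact List.nodup_finRange n
    · intro v
      rw [orig_zero]
      simp
    · intro k hk
      rw [List.length_finRange] at hk
      have := (lv ⟨k, hk⟩).2.2.2.2.2.2.2
      rw [zr _ (by omega), List.getElem_finRange]
      exact this
    · intro v
      rw [z0 6 (by simp), hv, (lv v).2.2.2.2.1]
    · intro A h
      obtain rfl := hinr A h
      exact hz 6 (by simp)
    · intro A h
      obtain rfl := hinr A h
      exact hz 11 (by simp)
    · intro x h
      rcases hx x h with rfl | ⟨v, rfl⟩
      · exact hz 1 (by simp)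
      · exact (congrFun (z0 1 (by simp)) v).trans ((hv v _ _).trans (lv v).1)
    · intro x h
      rcases hx x h with rfl | ⟨v, rfl⟩
      · exact hz 2 (by simp)
      · exact (congrFun (z0 2 (by simp)) v).trans ((hv v _ _).trans (lv v).2.1)
    · intro a ha
      rw [zr a (by omega)]
      by_cases e : 1 ≤ a ∧ a ≤ n
      · have := (lv ⟨a - 1, by omega⟩).2.2.2.2.2.2.1
        simp only [show 1 + (a - 1) = a by omega] at this
        rw [if_pos e, this]
      · rw [if_neg e, lr a (by omega) e, g a (by omega)]
  · rw [k₄ 1 (by rfl), k₃ 1 (by rfl), k₂ 1 (by rfl), r1]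
  · rw [k₄ 2 (by rfl), k₃ 2 (by rfl), k₂ 2 (by rfl), r2]
  · rw [z3, l3, g3, r3]
  · rw [k₄ 4 (by rfl), k₃ 4 (by rfl), k₂ 4 (by rfl), r4]
  · rw [k₄ 5 (by rfl), k₃ 5 (by rfl), k₂ 5 (by rfl), r5]

end Input

/-! ### The data structure -/

section Main

variable {n : ℕ} {Δ D : ℕ} {G : SimpleGraph (Fin n)} {B : ℕ} {S : Finset (Fin n)} {s : State}

/-- The states in which the memory holds the data structure for `S`, and the registers `1` and `2`
hold the address of the records and the one of the record of the supervertex of degree zero. -/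
def Maintains (Δ : ℕ) (G : SimpleGraph (Fin n)) (B : ℕ) (S : Finset (Fin n)) (s : State) : Prop :=
  ∃ (b : ℕ) (id : Node n → ℕ) (start : Fin n → ℕ) (L : Fin n → List (Node n)) (m₀ : ℕ → ℕ)
    (adj : Fin n → List (Fin n)),
    s.reg 1 = b ∧ s.reg 2 = b + 16 * n ∧ Static Δ G B b id start L m₀ ∧ Arrays G adj m₀ ∧
    m₀ (2 * n + 1) ≤ b ∧ (∀ v, m₀ (2 * n + 1) ≤ start v) ∧
    (∀ u v, u ≠ v → start u + (L u).length ≤ start v ∨ start v + (L v).length ≤ start u) ∧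
    Current Δ G b id m₀ S s.mem

theorem Maintains.stores (h : Maintains Δ G B S s) : Stores Δ G S B s.mem := by
  obtain ⟨b, id, start, L, m₀, adj, -, -, hs, hA, hMb, hMst, hdisj, N, U, hN, hH, hI, hU⟩ := h
  have hlast := hA.offset_last
  have hM : s.mem (2 * n + 1) = m₀ (2 * n + 1) := hH.raw _ (by omega) (Or.inr (by omega))
  have hfld : ∀ c < 16, c ≠ 1 → c ≠ 2 → ∀ j, s.mem (b + 16 * j + c) = fld b m₀ c j :=
    fun c h h1 h2 j => congrFun (hH.other c h h1 h2) j
  refine ⟨encodes_iff.2 ⟨hI, adj, hA.congr fun a ha => hH.raw a (by omega)⟩,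
    fun x => b + 16 * id x, start, L, fun x hx h0 => ?_, fun x hx => ?_, ?_, fun v =>
    ⟨hs.nodup v, hs.mem_list v, ?_, ?_, fun k hk => ?_⟩, fun x hx => ?_, fun v => ?_,
    fun x hx y hy hxy => ?_, fun u v huv => ?_, fun x hx v => ?_⟩
  · exact (hfld 0 (by norm_num) (by norm_num) (by norm_num) _).trans (hs.sv x hx h0)
  · exact (hH.nadj x hx).trans (hN x hx)
  · exact (isUndom_iff _ _).2 (hU.congr (fun x hx => (hN x hx).symm) fun x hx => hH.undom x hx)
  · rw [hfld 3 (by norm_num) (by norm_num) (by norm_num), hs.id_inl, hs.start_eq]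
  · rw [hfld 4 (by norm_num) (by norm_num) (by norm_num), hs.id_inl, hs.length_eq]
  · have h1 := hs.start_le v
    have h2 := hs.lt_start v
    rw [hH.raw _ (by omega) (Or.inr (by omega)), hs.array v k hk]
  · have := hs.id_le x hx
    change _ ≤ b + 16 * id x ∧ b + 16 * id x + 5 ≤ B
    omega
  · have h1 := hs.start_le v
    have h2 := hs.id_le _ (Sparse.inl_mem_nodes v)
    have h3 := hMst v
    omega
  · have hne : id x ≠ id y := fun e => hxy (hs.id_inj x hx y hy e)
    rw [Finset.disjoint_left]
    intro a ha ha'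
    simp only [Finset.mem_Ico] at ha ha'
    omega
  · have := hdisj u v huv
    rw [Finset.disjoint_left]
    intro a ha ha'
    simp only [Finset.mem_Ico] at ha ha'
    omega
  · have := hs.start_le v
    rw [Finset.disjoint_left]
    intro a ha ha'
    simp only [Finset.mem_Ico] at ha ha'
    omega

theorem Maintains.insert (hG : Sparse Δ D G) (h : Maintains Δ G B S s) (v : Fin n) :
    RunsTo B insertProg (s.setReg 0 v) (9 + flipTime Δ) (Maintains Δ G B (insert v S)) := by
  obtain ⟨b, id, start, L, m₀, adj, h1, h2, hs, hA, hMb, hMst, hdisj, hC⟩ := h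
  refine (insertProg_spec hs hG (v := v) (s := s.setReg 0 v) hC (by simp)
    (by simp [h1])).frame.mono le_rfl fun s' ⟨hC', hk⟩ =>
    ⟨b, id, start, L, m₀, adj, ?_, ?_, hs, hA, hMb, hMst, hdisj, hC'⟩
  · rw [hk 1 (by rfl)]; simpa using h1
  · rw [hk 2 (by rfl)]; simpa using h2

theorem Maintains.erase (hG : Sparse Δ D G) (h : Maintains Δ G B S s) (v : Fin n) :
    RunsTo B deleteProg (s.setReg 0 v) (9 + flipTime Δ) (Maintains Δ G B (S.erase v)) := by
  obtain ⟨b, id, start, L, m₀, adj, h1, h2, hs, hA, hMb, hMst, hdisj, hC⟩ := h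
  refine (deleteProg_spec hs hG (v := v) (s := s.setReg 0 v) hC (by simp)
    (by simp [h1])).frame.mono le_rfl fun s' ⟨hC', hk⟩ =>
    ⟨b, id, start, L, m₀, adj, ?_, ?_, hs, hA, hMb, hMst, hdisj, hC'⟩
  · rw [hk 1 (by rfl)]; simpa using h1
  · rw [hk 2 (by rfl)]; simpa using h2

theorem Maintains.query (hG : Sparse Δ D G) (h : Maintains Δ G B S s) :
    RunsTo B queryProg s 3 fun s' => s'.reg 0 = (undominated G S).card ∧ Maintains Δ G B S s' := by
  obtain ⟨b, id, start, L, m₀, adj, h1, h2, hs, hA, hMb, hMst, hdisj, hC⟩ := h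
  refine (queryProg_spec hs hG hC h2).frame.mono le_rfl fun s' ⟨⟨h0, hm⟩, hk⟩ => ⟨h0,
    b, id, start, L, m₀, adj, ?_, ?_, hs, hA, hMb, hMst, hdisj, by rwa [hm]⟩
  · rw [hk 1 (by rfl), h1]
  · rw [hk 2 (by rfl), h2]

/-- Construct the data structure. -/
def construct (Δ : ℕ) : Prog := .seq (prepare Δ) (.seq (levels Δ) finish)

theorem construct_spec (hG : Sparse Δ D G) (h : Encodes G S s.mem) {C : ℕ}
    (hC : 500 + 100 * D + Δ + 2 * levelTime D + finishTime Δ ≤ C) :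
    RunsTo (C * n) (construct Δ) s (C * n) (Maintains Δ G (C * n) S) := by
  obtain ⟨hS, adj, hA⟩ := encodes_iff.1 h
  have hn := hG.pos
  have hlen := hA.sum_length_le hG
  have hlast := hA.offset_last
  have hCn := Nat.mul_le_mul_right n hC
  have hΔn : Δ ≤ Δ * n := Nat.le_mul_of_pos_right Δ hn
  have hexp : (500 + 100 * D + Δ + 2 * levelTime D + finishTime Δ) * n = 500 * n + 100 * (D * n) +
    Δ * n + 2 * (levelTime D * n) + finishTime Δ * n := by ring
  have hD2 : D * (2 * n) = 2 * (D * n) := by ring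
  have hT : (levelTime D + 1) * (2 * n) = 2 * (levelTime D * n) + 2 * n := by ring
  have hB : 48 * s.mem (2 * n + 1) + 16 * (n + 1 + D * (2 * n)) < C * n := by omega
  refine ((prepare_spec (Δ := Δ) hA hS (B := C * n) (by omega) (by omega)).seq
    (T' := (levelTime D + 1) * (2 * n) + 2 + finishTime Δ * n) fun s₁ hs₁ => ?_).mono (by omega)
    fun _ h => h
  obtain ⟨f, hf, hinv, r1, r2, r3, r4, r5⟩ := hs₁
  refine (levels_spec hG hinv (show Δ < C * n by omega) hB r1 r2 r3
    (by rw [r4, List.length_finRange]) r5).seq (T' := finishTime Δ * n) fun s₂ hs₂ => ?_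
  obtain ⟨id, L, l, al, hinv', hal, g1, g2, g5⟩ := hs₂
  have hYb : (hA.layout (C * n) (by omega)).b = 48 * s.mem (2 * n + 1) := rfl
  refine (finish_spec hG hinv' ?_ ?_ (fun v => ?_) hf g1 g5).frame.mono le_rfl
    fun s₃ ⟨⟨m₁, hst, hcur, hm₁⟩, hk⟩ => ?_
  · change 48 * s.mem (2 * n + 1) + 16 * al ≤ C * n
    omega
  · simpa using hA.zero
  · rw [if_pos (by omega)]
  have hM : m₁ (2 * n + 1) = s.mem (2 * n + 1) := by
    rw [hm₁ _ (show 2 * n + 1 < s.mem (2 * n + 1) by omega), if_neg (by omega)]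
  refine ⟨_, id, _, L, m₁, adj, (hk 1 (by rfl)).trans g1, (hk 2 (by rfl)).trans g2, hst,
    hA.congr fun a ha h0 => ?_, ?_, fun v => ?_, fun u v huv => ?_, hcur⟩
  · rw [hm₁ a ha, if_neg (by omega)]
  · rw [hM, hYb]
    omega
  · rw [hM]
    exact (hA.layout (C * n) (by omega)).M_le_st v
  · have h1 := (hA.layout (C * n) (by omega)).disj u v huv
    have h2 := hinv'.cap u
    have h3 := hinv'.cap v
    omega

/-- The members of a proper minor-closed family exclude a common complete graph as a minor. -/
theorem exists_not_isMinor_top {F : GraphFamily} (hF : MinorClosed F) (hproper : Proper F) :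
    ∃ t : ℕ, ∀ (n : ℕ) (G : SimpleGraph (Fin n)), G ∈ F n →
      ¬ IsMinor (⊤ : SimpleGraph (Fin t)) G := by
  obtain ⟨t, H, hH⟩ := hproper
  exact ⟨t, fun n G hG h => hH (hF t t H ⊤ (hF t n ⊤ G hG h)
    (.of_injective _root_.id Function.injective_id fun _ _ hw => hw.ne))⟩

end Main

end DynDom

open DynDom
/-- The constants `Δ`, `C` and the four programs depend on the family only. All computations use
`C * n` memory cells and words less than `C * n`. For every graph `G` in the family with `n ≥ 1`
vertices, the hierarchy ends with a single supervertex of degree zero, and there is a class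
`Valid S` of states, for each set `S` of vertices, such that: `build` takes every memory that holds
`G` and `S` to a state in `Valid S` in time `C * n`; each state in `Valid S` stores the supervertex
data structure for `S`; and from each such state, with the argument in register `0`, insertion and
deletion of a vertex lead in time `C` to a valid state for the new set, and a query leaves in time
`C` the number of undominated vertices in register `0` of a state that is valid for `S`. -/
theorem mainTheorem1 (F : GraphFamily) (hF : MinorClosed F) (hproper : Proper F) :
    ∃ (Δ C : ℕ) (build ins del query : Prog),
      ∀ (n : ℕ) (_ : 1 ≤ n) (G : SimpleGraph (Fin n)) (_ : G ∈ F n),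
        (layer Δ G (height Δ G)).verts = {zeroNode n} ∧
        ∃ Valid : Finset (Fin n) → State → Prop,
          (∀ (S : Finset (Fin n)) (s : State), Encodes G S s.mem →
            RunsTo (C * n) build s (C * n) (Valid S)) ∧
          (∀ (S : Finset (Fin n)) (s : State), Valid S s →
            Stores Δ G S (C * n) s.mem ∧
            (∀ v : Fin n, RunsTo (C * n) ins (s.setReg 0 v) C (Valid (insert v S))) ∧
            (∀ v : Fin n, RunsTo (C * n) del (s.setReg 0 v) C (Valid (S.erase v))) ∧
            RunsTo (C * n) query s C
              (fun s' => s'.reg 0 = (undominated G S).card ∧ Valid S s')) := by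
  obtain ⟨t, ht⟩ := exists_not_isMinor_top hF hproper
  obtain ⟨D, hD⟩ : ∃ D, D = degreeBound t := ⟨_, rfl⟩
  obtain ⟨Δ, hΔ⟩ : ∃ Δ, Δ = 2 * D + 1 := ⟨_, rfl⟩
  obtain ⟨C, hC⟩ : ∃ C, C = 500 + 100 * D + Δ + 2 * levelTime D + finishTime Δ + flipTime Δ :=
    ⟨_, rfl⟩
  refine ⟨Δ, C, construct Δ, insertProg, deleteProg, queryProg, fun n hn G hG => ?_⟩
  have hs : Sparse Δ D G :=
    ⟨hn, hΔ.ge, fun i => by rw [hD]; exact sum_card_nbrs_le (ht n G hG) i⟩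
  exact ⟨hs.verts_height, Maintains Δ G (C * n), fun S s h => construct_spec hs h (by omega),
    fun S s h => ⟨h.stores, fun v => (h.insert hs v).mono (by omega) fun _ h => h,
      fun v => (h.erase hs v).mono (by omega) fun _ h => h,
      (h.query hs).mono (by omega) fun _ h => h⟩⟩
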